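/- Let $\alpha\in(0,1)$ and let $(C,D)$ be an admissible pair, i.e. $C,D\in M_2(\mathbb C)$, $CD^*$ is self-adjoint and $\det(CC^*+DD^*)\neq 0$. **The operator.** Let $A_\alpha(x,y)=-\alpha\big(\frac{-y}{x^2+y^2},\frac{x}{x^2+y^2}\big)$ and let $H_\alpha=(-i\nabla-A_\alpha)^2$ in $L^2(\mathbb R^2)$ with domain $C_c^\infty(\mathbb R^2\setminus\{0\})$. For $f$ in the domain of the adjoint $H_\alpha^*$ let $\Phi_0(f),\Psi_0(f),\Phi_{-1}(f),\Psi_{-1}(f)$ be the numbers with $$2\pi f(r\cos\theta,r\sin\theta)=\Phi_0(f)r^{-\alpha}+\Psi_0(f)r^{\alpha}+e^{-i\theta}\big(\Phi_{-1}(f)r^{\alpha-1}+\Psi_{-1}(f)r^{1-\alpha}\big)+O(r)\qquad(r\to0+).$$ $H_\alpha^{CD}$ is the restriction of $H_\alpha^*$ to the $f$ with $C\binom{\Phi_0(f)}{\Phi_{-1}(f)}=2D\binom{\alpha\Psi_0(f)}{(1-\alpha)\Psi_{-1}(f)}$. **The scattering functions.** For $x\in\mathbb R$, $m\in\{0,-1\}$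 and $\delta_m^\alpha=\frac\pi2(|m|-|m+\alpha|)$ set $$\varphi_m^-(x)=e^{i\delta_m^\alpha}\frac{\Gamma(\frac12(|m|+1+ix))}{\Gamma(\frac12(|m|+1-ix))}\,\frac{\Gamma(\frac12(|m+\alpha|+1-ix))}{\Gamma(\frac12(|m+\alpha|+1+ix))},$$ $$\tilde\varphi_m(x)=\frac1{2\pi}e^{-i\pi|m|/2}e^{\pi x/2}\frac{\Gamma(\frac12(|m|+1+ix))}{\Gamma(\frac12(|m|+1-ix))}\,\Gamma\big(\tfrac12(1+|m+\alpha|-ix)\big)\,\Gamma\big(\tfrac12(1-|m+\alpha|-ix)\big).$$ For $\kappa>0$ let $b_1=\frac{\Gamma(1-\alpha)e^{-i\pi\alpha/2}}{2^\alpha}\kappa^\alpha$, $b_2=\frac{\Gamma(\alpha)e^{-i\pi(1-\alpha)/2}}{2^{1-\alpha}}\kappa^{1-\alpha}$, $$\widetilde S(\kappa)=2i\sin(\pi\alpha)\begin{pmatrix}b_1&0\\0&b_2\end{pmatrix}\Big(D\begin{pmatrix}b_1^2&0\\0&b_2^2\end{pmatrix}+\tfrac{\pi}{2\sin(\pi\alpha)}C\Big)^{-1}D\begin{pmatrix}b_1&0\\0&-b_2\end{pmatrix},$$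 and let $S(\kappa)=\mathrm{diag}(e^{-i\pi\alpha},e^{i\pi\alpha})+\widetilde S(\kappa)$ be the scattering matrix. **The function $\Gamma$.** The limits $\widetilde S(0)$ and $\widetilde S(+\infty)$ of $\widetilde S(\kappa)$ as $\kappa\to0+$ and $\kappa\to+\infty$ exist, and there is a (unique) continuous function $\Gamma(C,D,\alpha,\cdot):\square\to U(2)$ on the boundary $\square$ of the square $[0,\infty]\times[-\infty,\infty]$ such that for $x\in\mathbb R$ and $\kappa\in(0,\infty)$ its value is $\mathrm{diag}(\varphi_0^-(x),\varphi_{-1}^-(x))+\mathrm{diag}(\tilde\varphi_0(x),\tilde\varphi_{-1}(x))\,\widetilde S(0)$ at $(0,x)$; $S(\kappa)$ at $(\kappa,+\infty)$; $\mathrm{diag}(\varphi_0^-(x),\varphi_{-1}^-(x))+\mathrm{diag}(\tilde\varphi_0(x),\tilde\varphi_{-1}(x))\,\widetilde S(+\infty)$ at $(+\infty,x)$; and $1$ at $(\kappa,-\infty)$. **Theorem.** Let $\mathrm{wind}[\Gamma(C,D,\alpha,\cdot)]$ be the winding number of $\square\ni\zeta\mapsto\det\Gamma(C,D,\alpha,\zeta)\in\mathbb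 T$, where $\square$ is oriented clockwise (the first coordinate being horizontal, so that the side $\{0\}\times[-\infty,\infty]$ is traversed from $-\infty$ to $+\infty$). Then $$\mathrm{wind}[\Gamma(C,D,\alpha,\cdot)]=-\#\sigma_p(H_\alpha^{CD})=-\#\{\text{negative eigenvalues of }CD^*\},$$ where $\sigma_p$ denotes the set of eigenvalues, and eigenvalues are counted with multiplicity in both places. -/

import Mathlib

open MeasureTheory Filter Topology Asymptotics Set
open scoped ContDiff ENNReal Matrix

noncomputable section

namespace AharonovBohm

/-! ### The Aharonov-Bohm operator on test functions -/

/-- The plane `ℝ²`. -/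
abbrev Plane : Type := EuclideanSpace ℝ (Fin 2)

/-- The Hilbert space `L²(ℝ²)`. -/
abbrev L2Plane : Type := Lp ℂ 2 (volume : Measure Plane)

/-- The space `C_c^∞(ℝ² ∖ {0})`, its elements being extended by zero to `ℝ²`. -/
def testSpace : Submodule ℂ (Plane → ℂ) where
  carrier := {u | ContDiff ℝ ∞ u ∧ HasCompactSupport u ∧ (0 : Plane) ∉ tsupport u}
  zero_mem' := by
    refine ⟨contDiff_const, HasCompactSupport.zero, ?_⟩
    simp [tsupport]
  add_mem' := by
    rintro u v ⟨hu, hu', hu0⟩ ⟨hv, hv', hv0⟩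
    exact ⟨hu.add hv, hu'.add hv', fun h => (tsupport_add u v h).elim hu0 hv0⟩
  smul_mem' := by
    rintro c u ⟨hu, hu', hu0⟩
    refine ⟨contDiff_const.smul hu, hu'.smul_left (f := fun _ => c), fun h => hu0 ?_⟩
    exact closure_mono (Function.support_const_smul_subset c u) h

/-- The vector potential `A_α(x, y) = -α (-y / (x² + y²), x / (x² + y²))`. -/
def vectorPotential (α : ℝ) (x : Plane) : Fin 2 → ℝ :=
  ![-α * (-x 1 / (x 0 ^ 2 + x 1 ^ 2)), -α * (x 0 / (x 0 ^ 2 + x 1 ^ 2))]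

/-- The `j`-th component of `(-i∇ - A_α) u`. -/
def momentumFun (α : ℝ) (j : Fin 2) (u : Plane → ℂ) (x : Plane) : ℂ :=
  -Complex.I * fderiv ℝ u x (EuclideanSpace.single j 1) - (vectorPotential α x j : ℂ) * u x

theorem contDiffAt_vectorPotential (α : ℝ) (j : Fin 2) {x : Plane} (hx : x ≠ 0) :
    ContDiffAt ℝ ∞ (fun y : Plane => vectorPotential α y j) x := by
  have h : x 0 ^ 2 + x 1 ^ 2 ≠ 0 := by
    intro h
    apply hx
    have h0 : x 0 = 0 := by nlinarith [sq_nonneg (x 0), sq_nonneg (x 1)]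
    have h1 : x 1 = 0 := by nlinarith [sq_nonneg (x 0), sq_nonneg (x 1)]
    ext i
    fin_cases i
    · simpa using h0
    · simpa using h1
  have c (i : Fin 2) : ContDiffAt ℝ ∞ (fun y : Plane => y i) x := by fun_prop
  have d : ContDiffAt ℝ ∞ (fun y : Plane => y 0 ^ 2 + y 1 ^ 2) x :=
    ((c 0).pow 2).add ((c 1).pow 2)
  fin_cases j
  · exact contDiffAt_const.mul ((c 1).neg.div d h)
  · exact contDiffAt_const.mul ((c 0).div d h)

theorem momentumFun_mem (α : ℝ) (j : Fin 2) {u : Plane → ℂ} (hu : u ∈ testSpace) :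
    momentumFun α j u ∈ testSpace := by
  obtain ⟨hs, hc, h0⟩ := hu
  have hz : ∀ x, x ∉ tsupport u → momentumFun α j u x = 0 := by
    intro x hx
    have h1 : fderiv ℝ u x = 0 := by
      by_contra h
      exact hx (support_fderiv_subset ℝ h)
    simp [momentumFun, h1, image_eq_zero_of_notMem_tsupport hx]
  have hsub : tsupport (momentumFun α j u) ⊆ tsupport u :=
    closure_minimal (fun x hx => by by_contra h; exact hx (hz x h)) (isClosed_tsupport u)
  refine ⟨?_, hc.mono' (subset_closure.trans hsub), fun h => h0 (hsub h)⟩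
  rw [contDiff_iff_contDiffAt]
  intro x
  by_cases hx : x = 0
  · subst hx
    have : momentumFun α j u =ᶠ[𝓝 0] fun _ => 0 := by
      filter_upwards [(isClosed_tsupport u).isOpen_compl.mem_nhds h0] with y hy
      exact hz y hy
    exact contDiffAt_const.congr_of_eventuallyEq this
  · have e1 : ContDiff ℝ ∞ (fun y => fderiv ℝ u y (EuclideanSpace.single j 1)) :=
      (hs.fderiv_right (m := ∞) (by simp)).clm_apply contDiff_const
    have e2 : ContDiffAt ℝ ∞ (fun y : Plane => (vectorPotential α y j : ℂ)) x :=
      Complex.ofRealCLM.contDiff.contDiffAt.comp x (contDiffAt_vectorPotential α j hx)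
    exact (contDiffAt_const.mul e1.contDiffAt).sub (e2.mul hs.contDiffAt)

/-- The `j`-th component of `-i∇ - A_α`, acting on `C_c^∞(ℝ² ∖ {0})`. -/
def momentum (α : ℝ) (j : Fin 2) : testSpace →ₗ[ℂ] testSpace where
  toFun u := ⟨momentumFun α j u, momentumFun_mem α j u.2⟩
  map_add' := by
    rintro ⟨u, hu⟩ ⟨v, hv⟩
    ext x
    have h1 : DifferentiableAt ℝ u x := (hu.1.differentiable (by simp)) x
    have h2 : DifferentiableAt ℝ v x := (hv.1.differentiable (by simp)) x
    simp only [momentumFun, AddMemClass.mk_add_mk, Pi.add_apply]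
    rw [fderiv_add h1 h2]
    simp only [_root_.add_apply]
    ring
  map_smul' := by
    rintro c ⟨u, hu⟩
    ext x
    have h1 : DifferentiableAt ℝ u x := (hu.1.differentiable (by simp)) x
    simp only [momentumFun, SetLike.mk_smul_mk, Pi.smul_apply, RingHom.id_apply]
    rw [fderiv_const_smul h1]
    simp only [_root_.smul_apply, smul_eq_mul]
    ring

/-- `(-i∇ - A_α)²` on `C_c^∞(ℝ² ∖ {0})`. -/
def magneticLaplacian (α : ℝ) : testSpace →ₗ[ℂ] testSpace :=
  ∑ j : Fin 2, momentum α j ∘ₗ momentum α j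

theorem memLp_of_mem_testSpace (u : testSpace) :
    MemLp (u : Plane → ℂ) 2 (volume : Measure Plane) :=
  u.2.1.continuous.memLp_of_hasCompactSupport u.2.2.1

/-- The embedding of `C_c^∞(ℝ² ∖ {0})` into `L²(ℝ²)`. -/
def testToL2 : testSpace →ₗ[ℂ] L2Plane where
  toFun u := (memLp_of_mem_testSpace u).toLp u
  map_add' _ _ := rfl
  map_smul' _ _ := rfl

theorem testToL2_injective : Function.Injective testToL2 := by
  intro u v h
  have h1 : (u : Plane → ℂ) =ᵐ[volume] v :=
    (MemLp.toLp_eq_toLp_iff (memLp_of_mem_testSpace u) (memLp_of_mem_testSpace v)).1 h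
  exact Subtype.ext ((u.2.1.continuous.ae_eq_iff_eq volume v.2.1.continuous).1 h1)

/-- The operator `H_α = (-i∇ - A_α)²` in `L²(ℝ²)` with domain `C_c^∞(ℝ² ∖ {0})`. (It has the
same adjoint as its closure.) -/
def minimalOperator (α : ℝ) : L2Plane →ₗ.[ℂ] L2Plane where
  domain := LinearMap.range testToL2
  toFun := testToL2 ∘ₗ magneticLaplacian α ∘ₗ
    (LinearEquiv.ofInjective testToL2 testToL2_injective).symm.toLinearMap

/-! ### Self-adjoint extensions -/

/-- Admissible pairs `(C, D)`: `C D*` is self-adjoint and `det (C C* + D D*) ≠ 0`. -/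
structure Admissible (C D : Matrix (Fin 2) (Fin 2) ℂ) : Prop where
  isHermitian : (C * Dᴴ).IsHermitian
  det_ne_zero : (C * Cᴴ + D * Dᴴ).det ≠ 0

/-- `e^{-iθ}` at the point `x = (r cos θ, r sin θ)`. -/
def expNegAngle (x : Plane) : ℂ := ((x 0 : ℂ) - Complex.I * (x 1 : ℂ)) / (‖x‖ : ℂ)

/-- The singular expansion
`Φ₀ r^{-α} + Ψ₀ r^α + e^{-iθ} (Φ₋₁ r^{α-1} + Ψ₋₁ r^{1-α})`;
the index `0` of `Fin 2` stands for `0` and the index `1` for `-1`. -/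
def singularPart (α : ℝ) (Φ Ψ : Fin 2 → ℂ) (x : Plane) : ℂ :=
  Φ 0 * ((‖x‖ ^ (-α) : ℝ) : ℂ) + Ψ 0 * ((‖x‖ ^ α : ℝ) : ℂ) +
    expNegAngle x * (Φ 1 * ((‖x‖ ^ (α - 1) : ℝ) : ℂ) + Ψ 1 * ((‖x‖ ^ (1 - α) : ℝ) : ℂ))

/-- `Φ` and `Ψ` are the boundary values of `f` at the origin:
`2π f = Φ₀ r^{-α} + Ψ₀ r^α + e^{-iθ} (Φ₋₁ r^{α-1} + Ψ₋₁ r^{1-α}) + O(r)` as `r → 0+`, where `f`,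
being a class of functions, is evaluated almost everywhere. -/
def HasBoundaryValues (α : ℝ) (f : L2Plane) (Φ Ψ : Fin 2 → ℂ) : Prop :=
  (fun x : Plane => 2 * (Real.pi : ℂ) * f x - singularPart α Φ Ψ x)
    =O[ae (volume : Measure Plane) ⊓ 𝓝 0] fun x => ‖x‖

/-- The functions whose boundary values at the origin satisfy
`C (Φ₀, Φ₋₁) = 2 D (α Ψ₀, (1 - α) Ψ₋₁)`. -/
def boundaryCondition (α : ℝ) (C D : Matrix (Fin 2) (Fin 2) ℂ) : Submodule ℂ L2Plane where
  carrier := {f | ∃ Φ Ψ : Fin 2 → ℂ, HasBoundaryValues α f Φ Ψ ∧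
    C *ᵥ Φ = (2 : ℂ) • (D *ᵥ ![(α : ℂ) * Ψ 0, (1 - (α : ℂ)) * Ψ 1])}
  zero_mem' := by
    refine ⟨0, 0, ?_, ?_⟩
    · have h : (fun x : Plane => 2 * (Real.pi : ℂ) * (0 : L2Plane) x - singularPart α 0 0 x)
          =ᶠ[ae (volume : Measure Plane) ⊓ 𝓝 0] fun _ => 0 := by
        filter_upwards with x
        simp [singularPart]
      exact h.trans_isBigO (isBigO_zero _ _)
    · have : ![(α : ℂ) * (0 : Fin 2 → ℂ) 0, (1 - (α : ℂ)) * (0 : Fin 2 → ℂ) 1] = 0 := by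
        ext i; fin_cases i <;> simp
      rw [this]; simp
  add_mem' := by
    rintro f g ⟨Φ, Ψ, h, hb⟩ ⟨Φ', Ψ', h', hb'⟩
    refine ⟨Φ + Φ', Ψ + Ψ', ?_, ?_⟩
    · refine IsBigO.congr' (h.add h') ?_ EventuallyEq.rfl
      filter_upwards [(Lp.coeFn_add f g).filter_mono inf_le_left] with x hx
      rw [hx]
      simp only [singularPart, Pi.add_apply]
      ring
    · have : ![(α : ℂ) * (Ψ + Ψ') 0, (1 - (α : ℂ)) * (Ψ + Ψ') 1] =
          ![(α : ℂ) * Ψ 0, (1 - (α : ℂ)) * Ψ 1] + ![(α : ℂ) * Ψ' 0, (1 - (α : ℂ)) * Ψ' 1] := by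
        ext i; fin_cases i <;> simp [mul_add]
      rw [this, Matrix.mulVec_add, Matrix.mulVec_add, hb, hb', smul_add]
  smul_mem' := by
    rintro c f ⟨Φ, Ψ, h, hb⟩
    refine ⟨c • Φ, c • Ψ, ?_, ?_⟩
    · refine IsBigO.congr' (h.const_mul_left c) ?_ EventuallyEq.rfl
      filter_upwards [(Lp.coeFn_smul c f).filter_mono inf_le_left] with x hx
      rw [hx]
      simp only [singularPart, Pi.smul_apply, smul_eq_mul]
      ring
    · have : ![(α : ℂ) * (c • Ψ) 0, (1 - (α : ℂ)) * (c • Ψ) 1] =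
          c • ![(α : ℂ) * Ψ 0, (1 - (α : ℂ)) * Ψ 1] := by
        ext i; fin_cases i <;> simp [mul_left_comm]
      rw [this, Matrix.mulVec_smul, Matrix.mulVec_smul, hb, smul_comm]

/-- The operator `H_α^{CD}`: the restriction of the adjoint `H_α^*` to the functions that satisfy
the boundary condition given by `(C, D)`. -/
def hamiltonian (α : ℝ) (C D : Matrix (Fin 2) (Fin 2) ℂ) : L2Plane →ₗ.[ℂ] L2Plane :=
  (minimalOperator α).adjoint.domRestrict (boundaryCondition α C D)

/-! ### Eigenvalues -/

/-- The eigenspace `ker (T - z)` of an unbounded operator. -/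
def eigenspace {E : Type*} [AddCommGroup E] [Module ℂ E] (T : E →ₗ.[ℂ] E) (z : ℂ) :
    Submodule ℂ E :=
  (LinearMap.ker (T.toFun - z • T.domain.subtype)).map T.domain.subtype

/-- The number `#σ_p(T)` of eigenvalues of `T`, counted with multiplicity, that is
`∑_z dim ker (T - z)`; the terms for which `z` is not an eigenvalue vanish. -/
def eigenvalueCount {E : Type*} [AddCommGroup E] [Module ℂ E] (T : E →ₗ.[ℂ] E) : ℕ∞ :=
  ∑' z : ℂ, Cardinal.toENat (Module.rank ℂ (eigenspace T z))

/-- The number of negative eigenvalues, counted with multiplicity, of a Hermitian matrix. -/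
def negEigenvalueCount {A : Matrix (Fin 2) (Fin 2) ℂ} (hA : A.IsHermitian) : ℕ :=
  (Finset.univ.filter fun i => hA.eigenvalues i < 0).card

/-! ### Wave and scattering operators -/

/-- `δ_m^α = π (|m| - |m + α|) / 2`. -/
def phaseShift (α : ℝ) (m : ℤ) : ℝ := Real.pi / 2 * (|(m : ℝ)| - |(m : ℝ) + α|)

/-- The function `φ_m^-`. -/
def phiMinus (α : ℝ) (m : ℤ) (x : ℝ) : ℂ :=
  Complex.exp (Complex.I * (phaseShift α m : ℂ)) *
    (Complex.Gamma (1 / 2 * (((|(m : ℝ)| : ℝ) : ℂ) + 1 + Complex.I * x)) /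
      Complex.Gamma (1 / 2 * (((|(m : ℝ)| : ℝ) : ℂ) + 1 - Complex.I * x))) *
    (Complex.Gamma (1 / 2 * (((|(m : ℝ) + α| : ℝ) : ℂ) + 1 - Complex.I * x)) /
      Complex.Gamma (1 / 2 * (((|(m : ℝ) + α| : ℝ) : ℂ) + 1 + Complex.I * x)))

/-- The function `φ̃_m`, for `m ∈ {0, -1}`. -/
def phiTilde (α : ℝ) (m : ℤ) (x : ℝ) : ℂ :=
  1 / (2 * (Real.pi : ℂ)) *
    Complex.exp (-Complex.I * (Real.pi : ℂ) * ((|(m : ℝ)| : ℝ) : ℂ) / 2) *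
    Complex.exp ((Real.pi : ℂ) * x / 2) *
    (Complex.Gamma (1 / 2 * (((|(m : ℝ)| : ℝ) : ℂ) + 1 + Complex.I * x)) /
      Complex.Gamma (1 / 2 * (((|(m : ℝ)| : ℝ) : ℂ) + 1 - Complex.I * x))) *
    Complex.Gamma (1 / 2 * (1 + ((|(m : ℝ) + α| : ℝ) : ℂ) - Complex.I * x)) *
    Complex.Gamma (1 / 2 * (1 - ((|(m : ℝ) + α| : ℝ) : ℂ) - Complex.I * x))

/-- `Γ(1-α) e^{-iπα/2} κ^α / 2^α`. -/
def channelZero (α κ : ℝ) : ℂ :=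
  ((Real.Gamma (1 - α) / 2 ^ α * κ ^ α : ℝ) : ℂ) *
    Complex.exp (-Complex.I * (Real.pi : ℂ) * (α : ℂ) / 2)

/-- `Γ(α) e^{-iπ(1-α)/2} κ^{1-α} / 2^{1-α}`. -/
def channelNegOne (α κ : ℝ) : ℂ :=
  ((Real.Gamma α / 2 ^ (1 - α) * κ ^ (1 - α) : ℝ) : ℂ) *
    Complex.exp (-Complex.I * (Real.pi : ℂ) * (1 - (α : ℂ)) / 2)

/-- The function `S̃_α^{CD}` on `(0, ∞)`. The entries of the diagonal matrix multiplied by `D` inside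
the inverse, namely `Γ(1-α)² e^{-iπα} κ^{2α} / 4^α` and
`Γ(α)² e^{-iπ(1-α)} κ^{2(1-α)} / 4^{1-α}`, are written as squares. -/
def sTilde (α : ℝ) (C D : Matrix (Fin 2) (Fin 2) ℂ) (κ : ℝ) : Matrix (Fin 2) (Fin 2) ℂ :=
  (2 * Complex.I * (Real.sin (Real.pi * α) : ℂ)) •
    (Matrix.diagonal ![channelZero α κ, channelNegOne α κ] *
      (D * Matrix.diagonal ![channelZero α κ ^ 2, channelNegOne α κ ^ 2] +
        ((Real.pi / (2 * Real.sin (Real.pi * α)) : ℝ) : ℂ) • C)⁻¹ * D *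
      Matrix.diagonal ![channelZero α κ, -channelNegOne α κ])

/-- The scattering matrix `S_α^{CD}(κ)`, `κ > 0`. -/
def scatteringMatrix (α : ℝ) (C D : Matrix (Fin 2) (Fin 2) ℂ) (κ : ℝ) :
    Matrix (Fin 2) (Fin 2) ℂ :=
  Matrix.diagonal ![Complex.exp (-Complex.I * (Real.pi : ℂ) * (α : ℂ)),
    Complex.exp (Complex.I * (Real.pi : ℂ) * (α : ℂ))] + sTilde α C D κ

/-- The restriction of the wave operator at an energy where `S̃_α^{CD}` takes the value `S`:
`diag(φ_0^-(x), φ_{-1}^-(x)) + diag(φ̃_0(x), φ̃_{-1}(x)) S`. -/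
def waveRestriction (α : ℝ) (S : Matrix (Fin 2) (Fin 2) ℂ) (x : ℝ) :
    Matrix (Fin 2) (Fin 2) ℂ :=
  Matrix.diagonal ![phiMinus α 0 x, phiMinus α (-1) x] +
    Matrix.diagonal ![phiTilde α 0 x, phiTilde α (-1) x] * S

/-! ### The function `Γ` on the boundary of the square and its winding number -/

/-- The boundary `□` of the square `[0, ∞] × [-∞, ∞]`. -/
def squareBoundary : Set (ℝ≥0∞ × EReal) :=
  {p | p.1 = 0 ∨ p.1 = ⊤ ∨ p.2 = ⊥ ∨ p.2 = ⊤}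

/-- The point `(0, x)` of the left side. -/
def leftSide (x : EReal) : squareBoundary := ⟨(0, x), Or.inl rfl⟩

/-- The point `(κ, +∞)` of the upper side. -/
def topSide (κ : ℝ≥0∞) : squareBoundary := ⟨(κ, ⊤), Or.inr (Or.inr (Or.inr rfl))⟩

/-- The point `(+∞, x)` of the right side. -/
def rightSide (x : EReal) : squareBoundary := ⟨(⊤, x), Or.inr (Or.inl rfl)⟩

/-- The point `(κ, -∞)` of the lower side. -/
def bottomSide (κ : ℝ≥0∞) : squareBoundary := ⟨(κ, ⊥), Or.inr (Or.inr (Or.inl rfl))⟩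

/-- `G` is the function `Γ(C, D, α, ·) ∈ C(□, U(2))` with the sides `Γ₁`, `Γ₂`, `Γ₃`, `Γ₄`, where
`S̃(0)` and `S̃(+∞)` are the limits of `S̃_α^{CD}`. The values of `G` at the corners are determined
by continuity. -/
structure IsLevinsonLoop (α : ℝ) (C D : Matrix (Fin 2) (Fin 2) ℂ)
    (G : C(squareBoundary, Matrix.unitaryGroup (Fin 2) ℂ)) : Prop where
  left : ∃ S₀, Tendsto (sTilde α C D) (𝓝[>] 0) (𝓝 S₀) ∧
    ∀ x : ℝ, (G (leftSide x) : Matrix (Fin 2) (Fin 2) ℂ) = waveRestriction α S₀ x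
  top : ∀ κ : ℝ, 0 < κ →
    (G (topSide (ENNReal.ofReal κ)) : Matrix (Fin 2) (Fin 2) ℂ) = scatteringMatrix α C D κ
  right : ∃ S₁, Tendsto (sTilde α C D) atTop (𝓝 S₁) ∧
    ∀ x : ℝ, (G (rightSide x) : Matrix (Fin 2) (Fin 2) ℂ) = waveRestriction α S₁ x
  bottom : ∀ κ : ℝ, 0 < κ →
    (G (bottomSide (ENNReal.ofReal κ)) : Matrix (Fin 2) (Fin 2) ℂ) = 1

/-- `n` is the winding number of `f : □ → 𝕋`, with `□` oriented clockwise (energy on the horizontal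
axis): along the left side from `-∞` to `+∞`, the upper side from `0` to `+∞`, the right side from
`+∞` to `-∞`, and the lower side from `+∞` to `0`. The total increment of a continuous argument of
`f` along the four sides is `2π n`. -/
def HasWindingNumber (f : squareBoundary → ℂ) (n : ℤ) : Prop :=
  ∃ (θ₁ : EReal → ℝ) (θ₂ : ℝ≥0∞ → ℝ) (θ₃ : EReal → ℝ) (θ₄ : ℝ≥0∞ → ℝ),
    Continuous θ₁ ∧ Continuous θ₂ ∧ Continuous θ₃ ∧ Continuous θ₄ ∧
    (∀ x, f (leftSide x) = Complex.exp (Complex.I * θ₁ x)) ∧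
    (∀ κ, f (topSide κ) = Complex.exp (Complex.I * θ₂ κ)) ∧
    (∀ x, f (rightSide x) = Complex.exp (Complex.I * θ₃ x)) ∧
    (∀ κ, f (bottomSide κ) = Complex.exp (Complex.I * θ₄ κ)) ∧
    (θ₁ ⊤ - θ₁ ⊥) + (θ₂ ⊤ - θ₂ 0) + (θ₃ ⊥ - θ₃ ⊤) + (θ₄ 0 - θ₄ ⊤) = 2 * Real.pi * n

end AharonovBohm

end

noncomputable section

namespace AharonovBohm

/-! ### Square integrable solutions of the radial equation -/

/-! Both numbers in the theorem are compared with the signature of `C D*`; no direct link between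
bound states and scattering is used.

Bound states. Separation in angular momentum turns `H_α^* f = z f` into one radial equation for each
`m`, with index `|m + α|`. For an index above `1` there is no square integrable solution, so only `m
= 0` (index `α`) and `m = -1` (index `1 - α`) survive (`exists_modes`). In these two channels
energies `z ≥ 0` are impossible channel by channel, and non-real `z` is impossible because an
admissible boundary condition makes the total flux at the origin vanish (`eigenspace_eq_bot`). For
`z = -4t < 0` each channel has one decaying solution up to scalars, a modified Bessel function given
by `besselIntegral`. The quotient of its two coefficients at the origin is, up to a constant, a
positive power of `t`, the Weyl factor `X(t)` or `Y(t)`. The boundary condition then says that the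
eigenspace is a copy of the kernel of `C + D diag(X, Y)` (`eigenspace_eq_map`).

Algebra of the pair. The Cayley transform of `(C, D)` is unitary, and `U(2) = U(1) · SU(2)`. This
gives a phase `u` and coordinates with `det C = uc`, `det D = ud`, `adj(C) D = u` times a Hermitian
matrix with diagonal `a, b` and off-diagonal entry `e`, and `ab - cd = |e|²`
(`exists_pairCoordinates`). Hence `det (C + D diag(X, Y)) = uF` with `F = c + aX + bY + dXY`. Up to
the sign of `u` there are three patterns: `a, b ≥ 0` not both zero, where `C D*` has `[c < 0] + [d <
0]` negative eigenvalues; `ab < 0` with `c > 0 > d`, where it has one; and `a = b = 0`. For `d < 0`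
the equation `F = 0` reads `(dX + b)(dY + a) = |e|²`, and monotonicity of the two factors counts its
roots; in the remaining patterns `F` is strictly increasing or free of zeros. The total dimension of
the kernels is the number of negative eigenvalues of `C D*` (`hasKernelCount`).

Winding. At the energy `κ²` the Weyl factors become `X = ω̄x` and `Y = -ωy` with `ω = e^{iπα}` and
`x, y > 0`, and `det S = F̄/F` (`scatteringMatrix_mul`). A constant rotation `σ` brings `F` into the
slit plane, so `arg (σF)` is a continuous argument along the upper side. On a vertical side the
reflection formula gives `φ̃` as an elementary multiple of `φ^-`, and the limit of `S̃` is `(ω - ω̄)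
diag(1, -1) P` with an orthogonal projection `P` that commutes with the diagonal matrix `V` of
channel phases. The side is then `diag(φ_0^-, φ_{-1}^-)(1 + (V - 1)P)` (`waveRestriction_eq`). The
factor `φ_0^- φ_{-1}^-` occurs on both vertical sides, traversed in opposite directions, and
cancels. The rest has increment `0`, `2πα`, `2π(1 - α)`, `π` or `2π` according to `P`. Added to
twice the limits of `arg (σF)`, it becomes a table in the signs of `c` and `d`, whose total is `-2π`
times the number of negative eigenvalues (`exists_hasEnd`). -/

/-- In the variable `t = log r` the radial equation is `u'' = (ν² - z e^{2t}) u`; here `v = u'`. -/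
structure RadialSolution (ν : ℝ) (z : ℂ) (u v : ℝ → ℂ) : Prop where
  deriv_fst : ∀ t, HasDerivAt u (v t) t
  deriv_snd : ∀ t, HasDerivAt v (((ν : ℂ) ^ 2 - z * (Real.exp (2 * t) : ℂ)) * u t) t

/-- Square integrability with respect to `r dr`. -/
def RadialL2 (u : ℝ → ℂ) : Prop :=
  Integrable (fun t : ℝ => ‖u t‖ ^ 2 * Real.exp (2 * t))

/-- A positive value would remain a lower bound on a half-line of infinite measure. Square
integrability at infinity enters through this: fluxes and energies are monotone and integrable. -/
theorem nonpos_of_monotone_of_integrableOn {f : ℝ → ℝ} (hf : Monotone f)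
    (hi : IntegrableOn f (Ioi 0)) (t : ℝ) : f t ≤ 0 := by
  by_contra! h
  have h1 : IntegrableOn (fun _ : ℝ => f t) (Ioi (max t 0)) := by
    refine Integrable.mono' (hi.mono_set (Ioi_subset_Ioi (le_max_right t 0)))
      aestronglyMeasurable_const ?_
    refine (ae_restrict_iff' measurableSet_Ioi).2 (Eventually.of_forall fun s hs => ?_)
    rw [Real.norm_of_nonneg h.le]
    exact hf ((le_max_left t 0).trans (le_of_lt hs))
  rw [integrableOn_const_iff] at h1
  rcases h1 with h1 | h1
  · exact h.ne' (by simpa using h1)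
  · simp at h1

/-! ### Energy and flux identities; behaviour at infinity. -/

namespace RadialSolution

variable {ν : ℝ} {z : ℂ} {u v : ℝ → ℂ}

theorem continuous_fst (h : RadialSolution ν z u v) : Continuous u :=
  continuous_iff_continuousAt.2 fun t => (h.deriv_fst t).continuousAt

theorem continuous_snd (h : RadialSolution ν z u v) : Continuous v :=
  continuous_iff_continuousAt.2 fun t => (h.deriv_snd t).continuousAt

/-- Uniqueness for a linear first order system: on a bounded interval around both points the
coefficients are bounded, so the vector field is uniformly Lipschitz. -/
theorem eq_zero_of_eq_zero (h : RadialSolution ν z u v) {t₀ : ℝ} (hu : u t₀ = 0) (hv : v t₀ = 0) :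
    u = 0 := by
  funext t
  set a := min t t₀ - 1
  set b := max t t₀ + 1
  let F : ℝ → ℂ × ℂ → ℂ × ℂ :=
    fun s p => (p.2, ((ν : ℂ) ^ 2 - z * (Real.exp (2 * s) : ℂ)) * p.1)
  have hc : Continuous fun s : ℝ => ‖(ν : ℂ) ^ 2 - z * (Real.exp (2 * s) : ℂ)‖ := by fun_prop
  obtain ⟨M, hM⟩ := (isCompact_Icc (a := a) (b := b)).bddAbove_image hc.continuousOn
  have hM' : ∀ s ∈ Ioo a b, ‖(ν : ℂ) ^ 2 - z * (Real.exp (2 * s) : ℂ)‖ ≤ M := fun s hs =>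
    hM ⟨s, Ioo_subset_Icc_self hs, rfl⟩
  have ht₀ : t₀ ∈ Ioo a b := ⟨by grind, by grind⟩
  have ht : t ∈ Ioo a b := ⟨by grind, by grind⟩
  have hL : ∀ s ∈ Ioo a b, LipschitzOnWith (Real.toNNReal (max M 1)) (F s) univ := by
    intro s hs
    refine LipschitzOnWith.of_dist_le_mul fun p _ q _ => ?_
    rw [Real.coe_toNNReal _ (le_trans zero_le_one (le_max_right _ _)), Prod.dist_eq]
    have e1 : dist p.1 q.1 ≤ dist p q := le_max_left _ _
    have e2 : dist p.2 q.2 ≤ dist p q := le_max_right _ _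
    refine max_le ?_ ?_
    · calc dist p.2 q.2 ≤ 1 * dist p q := by simpa using e2
        _ ≤ _ := by gcongr; exact le_max_right _ _
    · simp only [F, dist_eq_norm, ← mul_sub, norm_mul]
      exact mul_le_mul ((hM' s hs).trans (le_max_left _ _)) (by simpa [dist_eq_norm] using e1)
        (norm_nonneg _) (by positivity)
  have key := ODE_solution_unique_of_mem_Ioo (v := F) (s := fun _ => univ)
    (f := fun s => (u s, v s)) (g := fun _ => (0, 0)) hL ht₀
    (fun s _ => ⟨(h.deriv_fst s).prodMk (h.deriv_snd s), mem_univ _⟩)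
    (fun s _ => ⟨(hasDerivAt_const s ((0 : ℂ), (0 : ℂ))).congr_deriv (by simp [F, Prod.ext_iff]), mem_univ _⟩)
    (by simp [hu, hv])
  exact congrArg Prod.fst (key ht)

/-- `Re (ū u')`. -/
theorem hasDerivAt_re (h : RadialSolution ν z u v) (t : ℝ) :
    HasDerivAt (fun s => (star (u s) * v s).re)
      (‖v t‖ ^ 2 + (ν ^ 2 - z.re * Real.exp (2 * t)) * ‖u t‖ ^ 2) t := by
  have h1 := ((h.deriv_fst t).star.mul (h.deriv_snd t))
  have h2 := Complex.reCLM.hasFDerivAt.comp_hasDerivAt t h1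
  refine h2.congr_deriv ?_
  simp only [Complex.reCLM_apply, Complex.star_def]
  rw [← Complex.normSq_eq_norm_sq, ← Complex.normSq_eq_norm_sq]
  simp [Complex.normSq_apply, pow_two, -Complex.ofReal_exp]
  ring

/-- `Im (ū u')`. -/
theorem hasDerivAt_im (h : RadialSolution ν z u v) (t : ℝ) :
    HasDerivAt (fun s => (star (u s) * v s).im) (-z.im * (‖u t‖ ^ 2 * Real.exp (2 * t))) t := by
  have h1 := ((h.deriv_fst t).star.mul (h.deriv_snd t))
  have h2 := Complex.imCLM.hasFDerivAt.comp_hasDerivAt t h1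
  refine h2.congr_deriv ?_
  simp only [Complex.imCLM_apply, Complex.star_def]
  rw [← Complex.normSq_eq_norm_sq]
  simp [Complex.normSq_apply, pow_two, -Complex.ofReal_exp]
  ring

theorem hasDerivAt_normSq (h : RadialSolution ν z u v) (t : ℝ) :
    HasDerivAt (fun s => ‖u s‖ ^ 2) (2 * (star (u t) * v t).re) t := by
  have h1 := ((h.deriv_fst t).star.mul (h.deriv_fst t))
  have h2 := Complex.reCLM.hasFDerivAt.comp_hasDerivAt t h1
  have e : (fun s => ‖u s‖ ^ 2) = Complex.reCLM ∘ (star u * u) := by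
    funext s
    simp [← Complex.normSq_eq_norm_sq, Complex.normSq_apply]
  rw [e]
  refine h2.congr_deriv ?_
  simp
  ring

theorem hasDerivAt_normSq_snd (h : RadialSolution ν z u v) (t : ℝ) :
    HasDerivAt (fun s => ‖v s‖ ^ 2)
      (2 * (star (v t) * (((ν : ℂ) ^ 2 - z * (Real.exp (2 * t) : ℂ)) * u t)).re) t := by
  have h1 := ((h.deriv_snd t).star.mul (h.deriv_snd t))
  have h2 := Complex.reCLM.hasFDerivAt.comp_hasDerivAt t h1
  have e : (fun s => ‖v s‖ ^ 2) = Complex.reCLM ∘ (star v * v) := by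
    funext s
    simp [← Complex.normSq_eq_norm_sq, Complex.normSq_apply]
  rw [e]
  refine h2.congr_deriv ?_
  simp [-Complex.ofReal_exp, pow_two]
  ring

theorem integrableOn_normSq (hL : RadialL2 u) (h : Continuous u) :
    IntegrableOn (fun t => ‖u t‖ ^ 2) (Ioi 0) := by
  refine Integrable.mono' hL.integrableOn (by fun_prop) ?_
  refine (ae_restrict_iff' measurableSet_Ioi).2 (Eventually.of_forall fun s hs => ?_)
  rw [Real.norm_of_nonneg (by positivity)]
  have : 1 ≤ Real.exp (2 * s) := Real.one_le_exp (by have : 0 < s := hs; linarith)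
  nlinarith [sq_nonneg ‖u s‖]

/-- A nonzero value would bound `‖u‖²` from below on a half-line where the weight `e^{2t}` is at
least one. -/
theorem eq_zero_of_monotoneOn (hL : RadialL2 u)
    {t₁ : ℝ} (hm : ∀ s t, t₁ ≤ s → s ≤ t → ‖u s‖ ^ 2 ≤ ‖u t‖ ^ 2) {t : ℝ} (ht : t₁ ≤ t) :
    u t = 0 := by
  by_contra hne
  have hp : 0 < ‖u t‖ ^ 2 := by positivity
  have h1 : IntegrableOn (fun _ : ℝ => ‖u t‖ ^ 2) (Ioi (max t 0)) := by
    refine Integrable.mono' hL.integrableOn aestronglyMeasurable_const ?_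
    refine (ae_restrict_iff' measurableSet_Ioi).2 (Eventually.of_forall fun s hs => ?_)
    rw [Real.norm_of_nonneg hp.le]
    have h2 := hm t s ht ((le_max_left t 0).trans (le_of_lt hs))
    have : 1 ≤ Real.exp (2 * s) :=
      Real.one_le_exp (by have := (le_max_right t 0).trans (le_of_lt hs); linarith)
    nlinarith [sq_nonneg ‖u s‖]
  rw [integrableOn_const_iff] at h1
  rcases h1 with h1 | h1
  · exact hne (by simpa using h1)
  · simp at h1

/-- Integrating the derivative of `Re (ū v)` shows that it dominates `∫ ‖v‖²` up to a bounded error.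
If that integral were unbounded, `‖u‖²` would eventually increase, so `u` would vanish at a point
where `Re (ū v)` is positive. This makes Wronskians and fluxes integrable at `+∞`. -/
theorem integrableOn_normSq_snd (h : RadialSolution ν z u v) (hL : RadialL2 u) :
    IntegrableOn (fun t => ‖v t‖ ^ 2) (Ioi 0) := by
  have hcu := h.continuous_fst
  have hcv := h.continuous_snd
  set M := 1 + |(star (u 0) * v 0).re| + |z.re| * ∫ t, ‖u t‖ ^ 2 * Real.exp (2 * t) with hM
  have hint : ∀ a b, IntervalIntegrable (fun t => ‖v t‖ ^ 2) volume a b :=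
    fun a b => (by fun_prop : Continuous fun t => ‖v t‖ ^ 2).intervalIntegrable a b
  have low : ∀ t, 0 ≤ t → (∫ s in (0 : ℝ)..t, ‖v s‖ ^ 2) - (M - 1) ≤ (star (u t) * v t).re := by
    intro t ht
    have e := intervalIntegral.integral_eq_sub_of_hasDerivAt (a := 0) (b := t)
      (fun s _ => h.hasDerivAt_re s) (Continuous.intervalIntegrable (by fun_prop) _ _)
    have e2 : (∫ s in (0 : ℝ)..t, (‖v s‖ ^ 2 + (ν ^ 2 - z.re * Real.exp (2 * s)) * ‖u s‖ ^ 2))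
        = (∫ s in (0 : ℝ)..t, ‖v s‖ ^ 2) + (∫ s in (0 : ℝ)..t, ν ^ 2 * ‖u s‖ ^ 2)
          - z.re * ∫ s in (0 : ℝ)..t, ‖u s‖ ^ 2 * Real.exp (2 * s) := by
      rw [← intervalIntegral.integral_const_mul, ← intervalIntegral.integral_add (hint _ _)
        (Continuous.intervalIntegrable (by fun_prop) _ _),
        ← intervalIntegral.integral_sub (Continuous.intervalIntegrable (by fun_prop) _ _)
        (Continuous.intervalIntegrable (by fun_prop) _ _)]
      congr 1
      funext s
      ring
    have e3 : 0 ≤ ∫ s in (0 : ℝ)..t, ν ^ 2 * ‖u s‖ ^ 2 :=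
      intervalIntegral.integral_nonneg ht fun s _ => by positivity
    have e4 : 0 ≤ ∫ s in (0 : ℝ)..t, ‖u s‖ ^ 2 * Real.exp (2 * s) :=
      intervalIntegral.integral_nonneg ht fun s _ => by positivity
    have e5 : (∫ s in (0 : ℝ)..t, ‖u s‖ ^ 2 * Real.exp (2 * s)) ≤
        ∫ t, ‖u t‖ ^ 2 * Real.exp (2 * t) := by
      rw [intervalIntegral.integral_of_le ht]
      exact setIntegral_le_integral hL (Eventually.of_forall fun s => by positivity)
    have e6 : z.re * (∫ s in (0 : ℝ)..t, ‖u s‖ ^ 2 * Real.exp (2 * s)) ≤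
        |z.re| * ∫ t, ‖u t‖ ^ 2 * Real.exp (2 * t) := by
      calc _ ≤ |z.re| * (∫ s in (0 : ℝ)..t, ‖u s‖ ^ 2 * Real.exp (2 * s)) := by
            gcongr; exact le_abs_self _
        _ ≤ _ := by gcongr
    have e7 := neg_abs_le (star (u 0) * v 0).re
    linarith
  have bound : ∀ t, 0 ≤ t → (∫ s in (0 : ℝ)..t, ‖v s‖ ^ 2) ≤ M := by
    by_contra! hcon
    obtain ⟨t₁, ht₁, hlt⟩ := hcon
    have hp : ∀ t, t₁ ≤ t → 0 < (star (u t) * v t).re := by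
      intro t ht
      have h1 := low t (ht₁.trans ht)
      have h2 : (∫ s in (0 : ℝ)..t₁, ‖v s‖ ^ 2) ≤ ∫ s in (0 : ℝ)..t, ‖v s‖ ^ 2 :=
        intervalIntegral.integral_mono_interval le_rfl ht₁ ht
          (Eventually.of_forall fun s => by positivity) (hint _ _)
      linarith
    have hmono : MonotoneOn (fun s => ‖u s‖ ^ 2) (Ici t₁) := by
      refine monotoneOn_of_deriv_nonneg (convex_Ici _) (by fun_prop)
        (fun s _ => (h.hasDerivAt_normSq s).differentiableAt.differentiableWithinAt) fun s hs => ?_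
      rw [(h.hasDerivAt_normSq s).deriv]
      rw [interior_Ici] at hs
      linarith [hp s hs.le]
    have h0 := eq_zero_of_monotoneOn hL (t₁ := t₁)
      (fun s t hs hst => hmono hs (hs.trans hst) hst) le_rfl
    have := hp t₁ le_rfl
    simp [h0] at this
  refine integrableOn_Ioi_of_intervalIntegral_norm_bounded M 0 (b := id) (l := atTop)
    (fun t => (by fun_prop : Continuous fun t => ‖v t‖ ^ 2).integrableOn_Ioc) tendsto_id ?_
  filter_upwards [eventually_ge_atTop 0] with t ht
  simpa using bound t ht

theorem integrableOn_mul {ν₁ ν₂ : ℝ} {z₁ z₂ : ℂ} {u₁ v₁ u₂ v₂ : ℝ → ℂ}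
    (h₁ : RadialSolution ν₁ z₁ u₁ v₁) (h₂ : RadialSolution ν₂ z₂ u₂ v₂) (hL₁ : RadialL2 u₁)
    (hL₂ : RadialL2 u₂) : IntegrableOn (fun t => u₁ t * v₂ t) (Ioi 0) := by
  have a := integrableOn_normSq hL₁ h₁.continuous_fst
  have b := h₂.integrableOn_normSq_snd hL₂
  have := h₁.continuous_fst
  have := h₂.continuous_snd
  refine Integrable.mono' (a.add b) (by fun_prop) (Eventually.of_forall fun t => ?_)
  simp only [norm_mul, Pi.add_apply]
  nlinarith [sq_nonneg (‖u₁ t‖ - ‖v₂ t‖), sq_nonneg (‖u₁ t‖), sq_nonneg ‖v₂ t‖]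

theorem conj (h : RadialSolution ν z u v) :
    RadialSolution ν (star z) (fun t => star (u t)) (fun t => star (v t)) where
  deriv_fst t := (h.deriv_fst t).star
  deriv_snd t := by
    refine (h.deriv_snd t).star.congr_deriv ?_
    simp [-Complex.ofReal_exp]

theorem _root_.AharonovBohm.RadialL2.conj (h : RadialL2 u) : RadialL2 fun t => star (u t) := by
  simpa [RadialL2] using h

/-- Two solutions that are square integrable are proportional. -/
theorem wronskian_eq_zero {u₂ v₂ : ℝ → ℂ} (h : RadialSolution ν z u v)
    (h₂ : RadialSolution ν z u₂ v₂) (hL : RadialL2 u) (hL₂ : RadialL2 u₂) (t : ℝ) :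
    u t * v₂ t = u₂ t * v t := by
  have hd : ∀ s, HasDerivAt (fun s => u s * v₂ s - u₂ s * v s) 0 s := fun s => by
    refine (((h.deriv_fst s).mul (h₂.deriv_snd s)).sub
      ((h₂.deriv_fst s).mul (h.deriv_snd s))).congr_deriv ?_
    ring
  have hc : ∀ s, u s * v₂ s - u₂ s * v s = u t * v₂ t - u₂ t * v t := fun s =>
    is_const_of_deriv_eq_zero (fun s => (hd s).differentiableAt) (fun s => (hd s).deriv) s t
  -- The Wronskian is constant and integrable on a half-line, hence zero.
  have hi : IntegrableOn (fun s => u s * v₂ s - u₂ s * v s) (Ioi 0) :=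
    (h.integrableOn_mul h₂ hL hL₂).sub (h₂.integrableOn_mul h hL₂ hL)
  simp only [hc] at hi
  rw [integrableOn_const_iff] at hi
  rcases hi with hi | hi
  · exact sub_eq_zero.1 (by simpa using hi)
  · simp at hi

theorem integrableOn_im (h : RadialSolution ν z u v) (hL : RadialL2 u) :
    IntegrableOn (fun t => (star (u t) * v t).im) (Ioi 0) :=
  (h.conj.integrableOn_mul h hL.conj hL).im

/-- There are no square integrable solutions if `z > 0`. -/
theorem eq_zero_of_pos {x : ℝ} (hx : 0 < x) (h : RadialSolution ν x u v) (hL : RadialL2 u) :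
    u = 0 := by
  -- An oscillator energy with nonnegative derivative `2x‖u‖² e^{2t}`; being integrable at `+∞` it
  -- is nonpositive. For large `t` the term `x e^{2t}` exceeds `ν²`, and `E ≤ 0` forces `u = v = 0`.
  let E : ℝ → ℝ := fun t => ‖v t‖ ^ 2 - ν ^ 2 * ‖u t‖ ^ 2 + x * (‖u t‖ ^ 2 * Real.exp (2 * t))
  have hE : ∀ t, HasDerivAt E (2 * x * (‖u t‖ ^ 2 * Real.exp (2 * t))) t := by
    intro t
    have e : HasDerivAt (fun s : ℝ => Real.exp (2 * s)) (2 * Real.exp (2 * t)) t := by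
      simpa [mul_comm] using ((hasDerivAt_id t).const_mul 2).exp
    refine (((h.hasDerivAt_normSq_snd t).sub ((h.hasDerivAt_normSq t).const_mul (ν ^ 2))).add
      (((h.hasDerivAt_normSq t).mul e).const_mul x)).congr_deriv ?_
    simp [pow_two, -Complex.ofReal_exp]
    ring
  have hmono : Monotone E := monotone_of_hasDerivAt_nonneg hE fun t => by positivity
  have hint : IntegrableOn E (Ioi 0) :=
    ((h.integrableOn_normSq_snd hL).sub
      ((integrableOn_normSq hL h.continuous_fst).const_mul _)).add (hL.integrableOn.const_mul x)
  have hnonpos := nonpos_of_monotone_of_integrableOn hmono hint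
  obtain ⟨T, hT⟩ : ∃ T : ℝ, ∀ t, T ≤ t → ν ^ 2 + 1 ≤ x * Real.exp (2 * t) := by
    have : Tendsto (fun t : ℝ => x * Real.exp (2 * t)) atTop atTop :=
      (Real.tendsto_exp_atTop.comp (tendsto_id.const_mul_atTop two_pos)).const_mul_atTop hx
    exact eventually_atTop.1 (this.eventually_ge_atTop _)
  have hz : ∀ t, T ≤ t → u t = 0 ∧ v t = 0 := by
    intro t ht
    have h1 := hnonpos t
    have h2 := hT t ht
    have h3 : ‖v t‖ ^ 2 + ‖u t‖ ^ 2 ≤ E t := by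
      simp only [E]; nlinarith [sq_nonneg ‖u t‖]
    have h4 : ‖v t‖ ^ 2 = 0 := by nlinarith [sq_nonneg ‖u t‖, sq_nonneg ‖v t‖]
    have h5 : ‖u t‖ ^ 2 = 0 := by nlinarith [sq_nonneg ‖u t‖, sq_nonneg ‖v t‖]
    exact ⟨by simpa using h5, by simpa using h4⟩
  exact h.eq_zero_of_eq_zero (hz T le_rfl).1 (hz T le_rfl).2

end RadialSolution

/-! ### Behaviour of solutions at the origin, `t → -∞`. -/

namespace RadialSolution

variable {ν : ℝ} {z : ℂ} {u v : ℝ → ℂ}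

/-- The coefficient of the growing exponential at `-∞`. -/
def lower (ν : ℝ) (u v : ℝ → ℂ) (t : ℝ) : ℂ := (Real.exp (ν * t) : ℂ) * (v t - ν * u t)

/-- The coefficient of the decaying exponential at `-∞`. -/
def upper (ν : ℝ) (u v : ℝ → ℂ) (t : ℝ) : ℂ := (Real.exp (-ν * t) : ℂ) * (v t + ν * u t)

theorem hasDerivAt_ofReal_exp (a t : ℝ) :
    HasDerivAt (fun s : ℝ => (Real.exp (a * s) : ℂ)) (a * (Real.exp (a * t) : ℂ)) t := by
  have : HasDerivAt (fun s : ℝ => Real.exp (a * s)) (a * Real.exp (a * t)) t := by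
    simpa [mul_comm] using ((hasDerivAt_id t).const_mul a).exp
  simpa [-Complex.ofReal_exp] using this.ofReal_comp

/-- Variation of constants: `d²/dt² - ν²` factors into first order operators, so only the term `z
e^{2t} u` drives the coefficient. -/
theorem hasDerivAt_lower (h : RadialSolution ν z u v) (t : ℝ) :
    HasDerivAt (lower ν u v) (-z * (Real.exp ((2 + ν) * t) : ℂ) * u t) t := by
  refine ((hasDerivAt_ofReal_exp ν t).mul
    ((h.deriv_snd t).sub ((h.deriv_fst t).const_mul (ν : ℂ)))).congr_deriv ?_
  have : (Real.exp ((2 + ν) * t) : ℂ) = (Real.exp (ν * t) : ℂ) * (Real.exp (2 * t) : ℂ) := by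
    rw [← Complex.ofReal_mul, ← Real.exp_add]; ring_nf
  rw [this]
  simp only [Pi.sub_apply]
  ring

theorem hasDerivAt_upper (h : RadialSolution ν z u v) (t : ℝ) :
    HasDerivAt (upper ν u v) (-z * (Real.exp ((2 - ν) * t) : ℂ) * u t) t := by
  refine ((hasDerivAt_ofReal_exp (-ν) t).mul
    ((h.deriv_snd t).add ((h.deriv_fst t).const_mul (ν : ℂ)))).congr_deriv ?_
  have : (Real.exp ((2 - ν) * t) : ℂ) = (Real.exp (-ν * t) : ℂ) * (Real.exp (2 * t) : ℂ) := by
    rw [← Complex.ofReal_mul, ← Real.exp_add]; ring_nf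
  rw [this]
  push_cast
  simp only [Pi.add_apply]
  ring

theorem fst_eq (hν : ν ≠ 0) (t : ℝ) :
    u t = ((Real.exp (ν * t) : ℂ) * upper ν u v t - (Real.exp (-ν * t) : ℂ) * lower ν u v t)
      / (2 * ν) := by
  have e : (Real.exp (ν * t) : ℂ) * (Real.exp (-ν * t) : ℂ) = 1 := by
    rw [← Complex.ofReal_mul, ← Real.exp_add]; simp
  have hν' : (ν : ℂ) ≠ 0 := by exact_mod_cast hν
  rw [upper, lower, ← mul_assoc, ← mul_assoc, e, mul_comm (Real.exp (-ν * t) : ℂ), e]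
  field_simp
  ring

theorem snd_eq (t : ℝ) :
    v t = ((Real.exp (ν * t) : ℂ) * upper ν u v t + (Real.exp (-ν * t) : ℂ) * lower ν u v t)
      / 2 := by
  have e : (Real.exp (ν * t) : ℂ) * (Real.exp (-ν * t) : ℂ) = 1 := by
    rw [← Complex.ofReal_mul, ← Real.exp_add]; simp
  rw [upper, lower, ← mul_assoc, ← mul_assoc, e, mul_comm (Real.exp (-ν * t) : ℂ), e]
  ring

/-- The exponentials in `upper` and `lower` are inverse to each other, so the flux is expressed
through the two coefficients alone, whose limits at the origin are accessible. -/
theorem im_eq (hν : ν ≠ 0) (t : ℝ) :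
    (star (u t) * v t).im = (star (upper ν u v t) * lower ν u v t).im / (2 * ν) := by
  have e : (Real.exp (-ν * t) : ℂ) * (Real.exp (ν * t) : ℂ) = 1 := by
    rw [← Complex.ofReal_mul, ← Real.exp_add]; simp
  have e2 : star (upper ν u v t) * lower ν u v t
      = star (v t + ν * u t) * (v t - ν * u t) := by
    rw [upper, lower]
    simp only [star_mul', Complex.star_def, Complex.conj_ofReal]
    linear_combination ((starRingEnd ℂ) (v t + ν * u t) * (v t - ν * u t)) * e
  rw [e2, eq_div_iff (by positivity)]
  simp
  ring

/-- Young's inequality for `‖u‖ e^s` times `e^{(a-1)s - bt}`. With `b = a - 1` the last exponential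
has an integral independent of `t`, so the whole rate sits in `e^{bt}`. -/
theorem norm_mul_exp_le (u : ℝ → ℂ) (a b s t : ℝ) :
    ‖u s‖ * Real.exp (a * s) ≤ Real.exp (b * t) * ((‖u s‖ ^ 2 * Real.exp (2 * s) +
      Real.exp (2 * ((a - 1) * s - b * t))) / 2) := by
  have e1 : Real.exp (a * s) = Real.exp (b * t) * (Real.exp s * Real.exp ((a - 1) * s - b * t)) := by
    rw [← Real.exp_add, ← Real.exp_add]; ring_nf
  have e2 : Real.exp (2 * s) = Real.exp s ^ 2 := by rw [← Real.exp_nat_mul]; norm_num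
  have e3 : Real.exp (2 * ((a - 1) * s - b * t)) = Real.exp ((a - 1) * s - b * t) ^ 2 := by
    rw [← Real.exp_nat_mul]; norm_num
  rw [e1, e2, e3]
  have := sq_nonneg (‖u s‖ * Real.exp s - Real.exp ((a - 1) * s - b * t))
  calc _ = Real.exp (b * t) * (‖u s‖ * Real.exp s * Real.exp ((a - 1) * s - b * t)) := by ring
    _ ≤ _ := by gcongr; nlinarith

/-- A square integrable solution with `ν > 1` vanishes at the origin, together with its
derivative. -/
theorem tendsto_atBot (hν : 1 < ν) (h : RadialSolution ν z u v) (hL : RadialL2 u) :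
    Tendsto u atBot (𝓝 0) ∧ Tendsto v atBot (𝓝 0) := by
  have hcu := h.continuous_fst
  have hν0 : ν ≠ 0 := by linarith
  set N := ∫ t, ‖u t‖ ^ 2 * Real.exp (2 * t) with hN
  have hNle : ∀ s : Set ℝ, ∫ t in s, ‖u t‖ ^ 2 * Real.exp (2 * t) ≤ N := fun s =>
    setIntegral_le_integral hL (Eventually.of_forall fun s => by positivity)
  have hexp : ∀ a : ℝ, 0 < a → Tendsto (fun t : ℝ => Real.exp (a * t)) atBot (𝓝 0) := fun a ha =>
    Real.tendsto_exp_atBot.comp (tendsto_id.const_mul_atBot ha)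
  -- the growing coefficient
  have key : ∀ t, IntegrableOn (fun s => -z * (Real.exp ((2 + ν) * s) : ℂ) * u s) (Iic t) ∧
      ∫ s in Iic t, ‖-z * (Real.exp ((2 + ν) * s) : ℂ) * u s‖ ≤
        ‖z‖ * (Real.exp ((1 + ν) * t) * ((N + 1 / (2 * (1 + ν))) / 2)) := by
    intro t
    have i1 : IntegrableOn (fun s => Real.exp (2 * ((2 + ν - 1) * s - (1 + ν) * t))) (Iic t) := by
      have := (integrableOn_exp_mul_Iic (a := 2 * (1 + ν)) (by linarith) t).mul_const
        (Real.exp (-2 * ((1 + ν) * t)))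
      refine this.congr (Eventually.of_forall fun s => ?_)
      simp only []
      rw [← Real.exp_add]; ring_nf
    have i2 : IntegrableOn (fun s => ‖z‖ * (Real.exp ((1 + ν) * t) * ((‖u s‖ ^ 2 * Real.exp (2 * s) +
        Real.exp (2 * ((2 + ν - 1) * s - (1 + ν) * t))) / 2))) (Iic t) :=
      (((hL.integrableOn.add i1).div_const 2).const_mul _).const_mul _
    have b : ∀ s, ‖-z * (Real.exp ((2 + ν) * s) : ℂ) * u s‖ ≤ ‖z‖ * (Real.exp ((1 + ν) * t) *
        ((‖u s‖ ^ 2 * Real.exp (2 * s) +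
          Real.exp (2 * ((2 + ν - 1) * s - (1 + ν) * t))) / 2)) := by
      intro s
      rw [norm_mul, norm_mul, norm_neg, Complex.norm_real, Real.norm_of_nonneg (Real.exp_pos _).le,
        mul_assoc]
      refine mul_le_mul_of_nonneg_left ?_ (norm_nonneg _)
      rw [mul_comm]
      exact norm_mul_exp_le u (2 + ν) (1 + ν) s t
    have i3 : IntegrableOn (fun s => -z * (Real.exp ((2 + ν) * s) : ℂ) * u s) (Iic t) :=
      Integrable.mono' i2 (by fun_prop) (Eventually.of_forall b)
    refine ⟨i3, ?_⟩
    calc _ ≤ _ := integral_mono i3.norm i2 b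
      _ = ‖z‖ * (Real.exp ((1 + ν) * t) * (((∫ s in Iic t, ‖u s‖ ^ 2 * Real.exp (2 * s)) +
          ∫ s in Iic t, Real.exp (2 * ((2 + ν - 1) * s - (1 + ν) * t))) / 2)) := by
        rw [integral_const_mul, integral_const_mul, integral_div, integral_add hL.integrableOn i1]
      _ ≤ _ := by
        have : ∫ s in Iic t, Real.exp (2 * ((2 + ν - 1) * s - (1 + ν) * t))
            = 1 / (2 * (1 + ν)) := by
          have e : ∀ s, Real.exp (2 * ((2 + ν - 1) * s - (1 + ν) * t)) =
              Real.exp (2 * (1 + ν) * s) * Real.exp (-2 * ((1 + ν) * t)) := fun s => by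
            rw [← Real.exp_add]; ring_nf
          simp only [e]
          rw [integral_mul_const, integral_exp_mul_Iic (by linarith), div_mul_eq_mul_div,
            ← Real.exp_add]
          ring_nf
          simp
        rw [this]
        gcongr
        exact hNle _
  have hZlim := tendsto_limUnder_of_hasDerivAt_of_integrableOn_Iic (a := 0)
    (fun t _ => h.hasDerivAt_lower t) (key 0).1
  set Z₀ := limUnder atBot (lower ν u v) with hZ₀
  have hZ : ∀ t, ‖lower ν u v t - Z₀‖ ≤
      ‖z‖ * (Real.exp ((1 + ν) * t) * ((N + 1 / (2 * (1 + ν))) / 2)) := by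
    intro t
    rw [← integral_Iic_of_hasDerivAt_of_tendsto' (fun s _ => h.hasDerivAt_lower s) (key t).1 hZlim]
    exact (norm_integral_le_integral_norm _).trans (key t).2
  have hZt : Tendsto (fun t => (Real.exp (-ν * t) : ℂ) * (lower ν u v t - Z₀)) atBot (𝓝 0) := by
    have hb : Tendsto (fun t : ℝ => ‖z‖ * (((N + 1 / (2 * (1 + ν))) / 2)) * Real.exp (1 * t))
        atBot (𝓝 0) := by simpa using (hexp 1 one_pos).const_mul (‖z‖ * ((N + 1 / (2 * (1 + ν))) / 2))
    refine squeeze_zero_norm (fun t => ?_) hb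
    rw [norm_mul, Complex.norm_real, Real.norm_of_nonneg (Real.exp_pos _).le]
    calc _ ≤ Real.exp (-ν * t) *
          (‖z‖ * (Real.exp ((1 + ν) * t) * ((N + 1 / (2 * (1 + ν))) / 2))) := by
            gcongr; exact hZ t
      _ = ‖z‖ * (((N + 1 / (2 * (1 + ν))) / 2)) * (Real.exp (-ν * t) * Real.exp ((1 + ν) * t)) := by
          ring
      _ = _ := by rw [← Real.exp_add]; ring_nf
  -- the decaying coefficient
  have hYt : Tendsto (fun t => (Real.exp (ν * t) : ℂ) * upper ν u v t) atBot (𝓝 0) := by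
    have hb : Tendsto (fun t : ℝ => ‖upper ν u v 0‖ * Real.exp (ν * t) +
        ‖z‖ * (((N + 1 / (2 * (ν - 1))) / 2)) * Real.exp (1 * t)) atBot (𝓝 0) := by
      simpa using ((hexp ν (by linarith)).const_mul (‖upper ν u v 0‖)).add
        ((hexp 1 one_pos).const_mul (‖z‖ * ((N + 1 / (2 * (ν - 1))) / 2)))
    refine squeeze_zero_norm' ?_ hb
    filter_upwards [eventually_le_atBot 0] with t ht
    have e1 := intervalIntegral.integral_eq_sub_of_hasDerivAt (a := t) (b := 0)
      (fun s _ => h.hasDerivAt_upper s) (Continuous.intervalIntegrable (by fun_prop) _ _)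
    have i1 : IntegrableOn (fun s => Real.exp (2 * ((2 - ν - 1) * s - (1 - ν) * t))) (Ioi t) := by
      have := (integrableOn_exp_mul_Ioi (a := 2 * (1 - ν)) (by linarith) t).mul_const
        (Real.exp (-2 * ((1 - ν) * t)))
      refine this.congr (Eventually.of_forall fun s => ?_)
      simp only []
      rw [← Real.exp_add]; ring_nf
    have e2 : ‖∫ s in t..0, -z * (Real.exp ((2 - ν) * s) : ℂ) * u s‖ ≤
        ‖z‖ * (Real.exp ((1 - ν) * t) * ((N + 1 / (2 * (ν - 1))) / 2)) := by
      calc _ ≤ ∫ s in t..0, ‖-z * (Real.exp ((2 - ν) * s) : ℂ) * u s‖ :=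
            intervalIntegral.norm_integral_le_integral_norm ht
        _ ≤ ∫ s in t..0, ‖z‖ * (Real.exp ((1 - ν) * t) * ((‖u s‖ ^ 2 * Real.exp (2 * s) +
            Real.exp (2 * ((2 - ν - 1) * s - (1 - ν) * t))) / 2)) := by
            refine intervalIntegral.integral_mono ht (Continuous.intervalIntegrable (by fun_prop) _ _)
              (Continuous.intervalIntegrable (by fun_prop) _ _) fun s => ?_
            simp only []
            rw [norm_mul, norm_mul, norm_neg, Complex.norm_real,
              Real.norm_of_nonneg (Real.exp_pos _).le, mul_assoc]
            refine mul_le_mul_of_nonneg_left ?_ (norm_nonneg _)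
            rw [mul_comm]
            exact norm_mul_exp_le u (2 - ν) (1 - ν) s t
        _ = ‖z‖ * (Real.exp ((1 - ν) * t) * (((∫ s in t..0, ‖u s‖ ^ 2 * Real.exp (2 * s)) +
            ∫ s in t..0, Real.exp (2 * ((2 - ν - 1) * s - (1 - ν) * t))) / 2)) := by
            rw [intervalIntegral.integral_const_mul, intervalIntegral.integral_const_mul,
              intervalIntegral.integral_div, intervalIntegral.integral_add
                (Continuous.intervalIntegrable (by fun_prop) _ _)
                (Continuous.intervalIntegrable (by fun_prop) _ _)]
        _ ≤ _ := by
            have h1 : (∫ s in t..0, ‖u s‖ ^ 2 * Real.exp (2 * s)) ≤ N := by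
              rw [intervalIntegral.integral_of_le ht]; exact hNle _
            have h2 : (∫ s in t..0, Real.exp (2 * ((2 - ν - 1) * s - (1 - ν) * t))) ≤
                1 / (2 * (ν - 1)) := by
              rw [intervalIntegral.integral_of_le ht]
              refine (setIntegral_mono_set i1 (Eventually.of_forall fun s => by positivity)
                (LE.le.eventuallyLE Ioc_subset_Ioi_self)).trans_eq ?_
              have e : ∀ s, Real.exp (2 * ((2 - ν - 1) * s - (1 - ν) * t)) =
                  Real.exp (2 * (1 - ν) * s) * Real.exp (-2 * ((1 - ν) * t)) := fun s => by
                rw [← Real.exp_add]; ring_nf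
              simp only [e]
              rw [integral_mul_const, integral_exp_mul_Ioi (by linarith),
                div_mul_eq_mul_div, neg_mul, ← Real.exp_add]
              rw [div_eq_div_iff (by linarith) (by linarith)]
              ring_nf
              simp
              ring
            gcongr
    have e3 : upper ν u v t = upper ν u v 0 -
        ∫ s in t..0, -z * (Real.exp ((2 - ν) * s) : ℂ) * u s := by rw [e1]; ring
    rw [norm_mul, Complex.norm_real, Real.norm_of_nonneg (Real.exp_pos _).le]
    calc _ ≤ Real.exp (ν * t) * (‖upper ν u v 0‖ +
          ‖z‖ * (Real.exp ((1 - ν) * t) * ((N + 1 / (2 * (ν - 1))) / 2))) := by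
            gcongr
            rw [e3]
            exact (norm_sub_le _ _).trans (by gcongr)
      _ = ‖upper ν u v 0‖ * Real.exp (ν * t) + ‖z‖ * (((N + 1 / (2 * (ν - 1))) / 2)) *
          (Real.exp (ν * t) * Real.exp ((1 - ν) * t)) := by ring
      _ = _ := by rw [← Real.exp_add]; ring_nf
  -- square integrability excludes the growing exponential
  have hZ0 : Z₀ = 0 := by
    by_contra hne
    have hu : Tendsto (fun t => (Real.exp (ν * t) : ℂ) * u t) atBot (𝓝 (-Z₀ / (2 * ν))) := by
      have e : ∀ t, (Real.exp (ν * t) : ℂ) * u t =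
          ((Real.exp (ν * t) : ℂ) * ((Real.exp (ν * t) : ℂ) * upper ν u v t) - lower ν u v t)
            / (2 * ν) := by
        intro t
        have e : (Real.exp (ν * t) : ℂ) * (Real.exp (-ν * t) : ℂ) = 1 := by
          rw [← Complex.ofReal_mul, ← Real.exp_add]; simp
        rw [fst_eq (u := u) (v := v) hν0 t]
        rw [mul_div_assoc', mul_sub, ← mul_assoc _ (Real.exp (-ν * t) : ℂ), e, one_mul]
      simp only [e]
      have e0 : Tendsto (fun t : ℝ => (Real.exp (ν * t) : ℂ)) atBot (𝓝 ((0 : ℝ) : ℂ)) :=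
        (Complex.continuous_ofReal.tendsto _).comp (hexp ν (by linarith))
      simpa using (((e0.mul hYt).sub hZlim).div_const (2 * (ν : ℂ)))
    have hpos : 0 < ‖-Z₀ / (2 * ν)‖ := by
      have : (ν : ℂ) ≠ 0 := by exact_mod_cast hν0
      exact norm_pos_iff.2 (div_ne_zero (neg_ne_zero.2 hne) (by simpa using this))
    set c := ‖-Z₀ / (2 * ν)‖ / 2 with hc
    have hc0 : 0 < c := by positivity
    -- A limit `Z₀ ≠ 0` would give `‖u‖ ≥ c e^{-νs}`, and then `‖u‖² e^{2s} ≥ c²` for `s ≤ 0`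
    -- because `ν > 1`.
    obtain ⟨t₁, ht₁⟩ := eventually_atBot.1 (hu.norm.eventually_const_lt (half_lt_self hpos))
    have h1 : IntegrableOn (fun _ : ℝ => c ^ 2) (Iic (min t₁ 0)) := by
      refine Integrable.mono' hL.integrableOn aestronglyMeasurable_const ?_
      refine (ae_restrict_iff' measurableSet_Iic).2 (Eventually.of_forall fun s hs => ?_)
      rw [Real.norm_of_nonneg (by positivity)]
      have h2 := ht₁ s (le_trans hs (min_le_left _ _))
      have hs0 : s ≤ 0 := le_trans hs (min_le_right _ _)
      rw [norm_mul, Complex.norm_real, Real.norm_of_nonneg (Real.exp_pos _).le] at h2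
      have h3 : Real.exp (ν * s) ≤ Real.exp s := Real.exp_le_exp.2 (by nlinarith)
      have h4 : c ≤ Real.exp s * ‖u s‖ := h2.le.trans (by gcongr)
      have e2 : Real.exp (2 * s) = Real.exp s ^ 2 := by rw [← Real.exp_nat_mul]; norm_num
      calc c ^ 2 ≤ (Real.exp s * ‖u s‖) ^ 2 := by gcongr
        _ = _ := by rw [e2]; ring
    rw [integrableOn_const_iff] at h1
    rcases h1 with h1 | h1
    · exact hc0.ne' (by simpa using h1)
    · simp at h1
  rw [hZ0] at hZt
  simp only [sub_zero] at hZt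
  constructor
  · have : u = fun t => ((Real.exp (ν * t) : ℂ) * upper ν u v t -
        (Real.exp (-ν * t) : ℂ) * lower ν u v t) / (2 * ν) := funext fun t => fst_eq hν0 t
    rw [this]
    simpa using (hYt.sub hZt).div_const (2 * (ν : ℂ))
  · have : v = fun t => ((Real.exp (ν * t) : ℂ) * upper ν u v t +
        (Real.exp (-ν * t) : ℂ) * lower ν u v t) / 2 := funext fun t => snd_eq t
    rw [this]
    simpa using (hYt.add hZt).div_const 2

end RadialSolution

theorem nonneg_of_monotone_of_tendsto_atBot {f : ℝ → ℝ} {a : ℝ} (hf : Monotone f)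
    (hl : Tendsto f atBot (𝓝 a)) (t : ℝ) : a ≤ f t :=
  hf.le_of_tendsto hl t

/-! ### Exclusion of square integrable solutions; the flux at the origin. -/

namespace RadialSolution

variable {ν : ℝ} {z : ℂ} {u v : ℝ → ℂ}

/-- No square integrable solutions with `ν > 1` if `z ≤ 0`. -/
theorem eq_zero_of_nonpos {x : ℝ} (hx : x ≤ 0) (hν : 1 < ν) (h : RadialSolution ν x u v)
    (hL : RadialL2 u) : u = 0 := by
  obtain ⟨hu, hv⟩ := h.tendsto_atBot hν hL
  -- For a real energy `≤ 0` the quantity `Re (ū v)` increases from its limit `0` at the origin, so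
  -- `‖u‖²` increases as well, against square integrability.
  have hmono : Monotone fun s => (star (u s) * v s).re := by
    refine monotone_of_hasDerivAt_nonneg h.hasDerivAt_re fun t => ?_
    have : 0 ≤ ν ^ 2 - x * Real.exp (2 * t) := by nlinarith [Real.exp_pos (2 * t)]
    simp only [Complex.ofReal_re]
    positivity
  have hl : Tendsto (fun s => (star (u s) * v s).re) atBot (𝓝 0) := by
    have := (Complex.continuous_re.tendsto _).comp (hu.star.mul hv)
    simpa [Function.comp_def] using this
  have hp := nonneg_of_monotone_of_tendsto_atBot hmono hl
  have hq : Monotone fun s => ‖u s‖ ^ 2 :=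
    monotone_of_hasDerivAt_nonneg h.hasDerivAt_normSq fun t => mul_nonneg zero_le_two (hp t)
  funext t
  exact eq_zero_of_monotoneOn hL (t₁ := t) (fun s t _ hst => hq hst) le_rfl

/-- The combined flux of two square integrable solutions vanishes for non-real `z`. -/
theorem eq_zero_of_im_ne_zero {ν' : ℝ} {u' v' : ℝ → ℂ} (hz : z.im ≠ 0)
    (h : RadialSolution ν z u v) (hL : RadialL2 u) (h' : RadialSolution ν' z u' v')
    (hL' : RadialL2 u')
    (hlim : Tendsto (fun t => (star (u t) * v t).im + (star (u' t) * v' t).im) atBot (𝓝 0)) :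
    u = 0 ∧ u' = 0 := by
  -- The factor `-Im z` makes the total flux increasing for either sign of `Im z`. It is nonpositive
  -- by integrability at `+∞` and nonnegative by its limit at `-∞`; so it vanishes, and with it its
  -- derivative, a sum of nonnegative terms.
  set w := fun t => -z.im * ((star (u t) * v t).im + (star (u' t) * v' t).im) with hw
  have hd : ∀ t, HasDerivAt w (z.im ^ 2 * (‖u t‖ ^ 2 * Real.exp (2 * t)) +
      z.im ^ 2 * (‖u' t‖ ^ 2 * Real.exp (2 * t))) t := fun t => by
    refine (((h.hasDerivAt_im t).add (h'.hasDerivAt_im t)).const_mul (-z.im)).congr_deriv ?_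
    ring
  have hmono : Monotone w := monotone_of_hasDerivAt_nonneg hd fun t => by positivity
  have hint : IntegrableOn w (Ioi 0) :=
    ((h.integrableOn_im hL).add (h'.integrableOn_im hL')).const_mul _
  have hle := nonpos_of_monotone_of_integrableOn hmono hint
  have hge := nonneg_of_monotone_of_tendsto_atBot hmono (a := 0) (by
    have := hlim.const_mul (-z.im)
    rwa [mul_zero] at this)
  have h0 : w = fun _ => 0 := funext fun t => le_antisymm (hle t) (hge t)
  have hzero : ∀ t, z.im ^ 2 * (‖u t‖ ^ 2 * Real.exp (2 * t)) +
      z.im ^ 2 * (‖u' t‖ ^ 2 * Real.exp (2 * t)) = 0 := fun t => by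
    have h1 := hd t
    rw [h0] at h1
    exact h1.unique (hasDerivAt_const t 0)
  have hz2 : 0 < z.im ^ 2 := by positivity
  constructor <;> funext t <;> by_contra hne <;> have hne' := norm_pos_iff.2 hne <;>
    have := hzero t <;> have h3 := Real.exp_pos (2 * t)
  · have : 0 < z.im ^ 2 * (‖u t‖ ^ 2 * Real.exp (2 * t)) := by positivity
    have : 0 ≤ z.im ^ 2 * (‖u' t‖ ^ 2 * Real.exp (2 * t)) := by positivity
    linarith
  · have : 0 < z.im ^ 2 * (‖u' t‖ ^ 2 * Real.exp (2 * t)) := by positivity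
    have : 0 ≤ z.im ^ 2 * (‖u t‖ ^ 2 * Real.exp (2 * t)) := by positivity
    linarith

theorem zero (ν : ℝ) (z : ℂ) : RadialSolution ν z 0 0 where
  deriv_fst t := hasDerivAt_const t (0 : ℂ) |>.congr_deriv (by simp)
  deriv_snd t := hasDerivAt_const t (0 : ℂ) |>.congr_deriv (by simp)

theorem _root_.AharonovBohm.RadialL2.zero : RadialL2 0 := by simp [RadialL2]

/-- No square integrable solutions with `ν > 1`. -/
theorem eq_zero_of_one_lt (hν : 1 < ν) (h : RadialSolution ν z u v) (hL : RadialL2 u) :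
    u = 0 := by
  by_cases hz : z.im = 0
  · have e : z = (z.re : ℂ) := Complex.ext (by simp) (by simp [hz])
    rw [e] at h
    rcases le_or_gt z.re 0 with h0 | h0
    · exact h.eq_zero_of_nonpos h0 hν hL
    · exact h.eq_zero_of_pos h0 hL
  · obtain ⟨hu, hv⟩ := h.tendsto_atBot hν hL
    refine (h.eq_zero_of_im_ne_zero hz hL (zero ν z) .zero ?_).1
    have := (Complex.continuous_im.tendsto _).comp (hu.star.mul hv)
    simpa [Function.comp_def] using this

theorem const_of_hasDerivAt_zero {f : ℝ → ℂ} (h : ∀ t, HasDerivAt f 0 t) (t : ℝ) : f t = f 0 :=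
  is_const_of_deriv_eq_zero (fun s => (h s).differentiableAt) (fun s => (h s).deriv) t 0

theorem eq_zero_of_integrableOn_exp {a : ℝ} (ha : 0 ≤ a) {c : ℂ}
    (h : IntegrableOn (fun t : ℝ => ‖c‖ ^ 2 * Real.exp (a * t)) (Ioi 0)) : c = 0 := by
  by_contra hne
  have h1 : IntegrableOn (fun _ : ℝ => ‖c‖ ^ 2) (Ioi 0) := by
    refine Integrable.mono' h aestronglyMeasurable_const ?_
    refine (ae_restrict_iff' measurableSet_Ioi).2 (Eventually.of_forall fun s hs => ?_)
    rw [Real.norm_of_nonneg (by positivity)]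
    have : 1 ≤ Real.exp (a * s) := Real.one_le_exp (mul_nonneg ha (le_of_lt hs))
    nlinarith [sq_nonneg ‖c‖]
  rw [integrableOn_const_iff] at h1
  rcases h1 with h1 | h1
  · exact hne (by simpa using h1)
  · simp at h1

/-- No square integrable solutions for `z = 0`, `0 < ν < 1`. -/
theorem eq_zero_of_zero (h0 : 0 < ν) (h1 : ν < 1) (h : RadialSolution ν 0 u v)
    (hL : RadialL2 u) : u = 0 := by
  have hu := integrableOn_normSq hL h.continuous_fst
  have hv := h.integrableOn_normSq_snd hL
  have := h.continuous_fst
  have := h.continuous_snd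
  -- For `z = 0` both coefficients are constant. The one of `e^{νt}` is excluded since `v + νu` is
  -- square integrable at `+∞`; the one of `e^{-νt}` is excluded by the weight `e^{2t}`, as `ν < 1`.
  have hY := const_of_hasDerivAt_zero (f := upper ν u v)
    fun t => (h.hasDerivAt_upper t).congr_deriv (by simp)
  have hZ := const_of_hasDerivAt_zero (f := lower ν u v)
    fun t => (h.hasDerivAt_lower t).congr_deriv (by simp)
  have e : ∀ t, (Real.exp (ν * t) : ℂ) * (Real.exp (-ν * t) : ℂ) = 1 := fun t => by
    rw [← Complex.ofReal_mul, ← Real.exp_add]; simp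
  have hY0 : upper ν u v 0 = 0 := by
    refine eq_zero_of_integrableOn_exp (a := 2 * ν) (by linarith) ?_
    have h2 : ∀ t, ‖upper ν u v 0‖ ^ 2 * Real.exp (2 * ν * t) = ‖v t + ν * u t‖ ^ 2 := fun t => by
      have h3 : v t + ν * u t = (Real.exp (ν * t) : ℂ) * upper ν u v t := by
        rw [upper, ← mul_assoc, e, one_mul]
      rw [h3, hY t, norm_mul, Complex.norm_real, Real.norm_of_nonneg (Real.exp_pos _).le, mul_pow,
        ← Real.exp_nat_mul]
      push_cast
      ring_nf
    simp only [h2]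
    refine Integrable.mono' ((hv.const_mul 2).add (hu.const_mul (2 * ν ^ 2))) (by fun_prop)
      (Eventually.of_forall fun t => ?_)
    rw [Real.norm_of_nonneg (by positivity)]
    have h4 : ‖v t + ν * u t‖ ≤ ‖v t‖ + ν * ‖u t‖ := by
      refine (norm_add_le _ _).trans ?_
      rw [norm_mul, Complex.norm_real, Real.norm_of_nonneg h0.le]
    have : ‖v t + ν * u t‖ ^ 2 ≤ (‖v t‖ + ν * ‖u t‖) ^ 2 := by gcongr
    simp only [Pi.add_apply]
    nlinarith [sq_nonneg (‖v t‖ - ν * ‖u t‖)]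
  have hu' : ∀ t, u t = -((Real.exp (-ν * t) : ℂ) * lower ν u v 0) / (2 * ν) := fun t => by
    rw [fst_eq (u := u) (v := v) h0.ne' t, hY, hZ, hY0]; simp
  have hZ0 : lower ν u v 0 / (2 * ν) = 0 := by
    refine eq_zero_of_integrableOn_exp (a := 2 * (1 - ν)) (by linarith) ?_
    refine hL.integrableOn.congr (Eventually.of_forall fun t => ?_)
    simp only []
    rw [hu' t, norm_div, norm_neg, norm_mul, Complex.norm_real,
      Real.norm_of_nonneg (Real.exp_pos _).le, norm_div, div_pow, mul_pow, div_pow,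
      ← Real.exp_nat_mul, mul_div_assoc, mul_comm (Real.exp _), mul_assoc, ← Real.exp_add]
    push_cast
    ring_nf
  funext t
  rw [hu' t, neg_div, mul_div_assoc, hZ0]
  simp

theorem norm_integral_Iic_exp_le {a C t : ℝ} (ha : 0 < a) {f : ℝ → ℂ} (hc : Continuous f)
    (hf : ∀ s ≤ t, ‖f s‖ ≤ C * Real.exp (a * s)) :
    IntegrableOn f (Iic t) ∧ ‖∫ s in Iic t, f s‖ ≤ C / a * Real.exp (a * t) := by
  have i := (integrableOn_exp_mul_Iic ha t).const_mul C
  have b : ∀ᵐ s ∂volume.restrict (Iic t), ‖f s‖ ≤ C * Real.exp (a * s) :=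
    (ae_restrict_iff' measurableSet_Iic).2 (Eventually.of_forall hf)
  refine ⟨Integrable.mono' i (by fun_prop) b, ?_⟩
  refine (norm_integral_le_of_norm_le i b).trans_eq ?_
  rw [integral_const_mul, integral_exp_mul_Iic ha]
  ring

/-- The flux at the origin in terms of the boundary values. -/
theorem tendsto_im_atBot (h0 : 0 < ν) (h1 : ν < 1) (h : RadialSolution ν z u v) {A B : ℂ}
    (hAB : (fun t => u t - (A * (Real.exp (-ν * t) : ℂ) + B * (Real.exp (ν * t) : ℂ)))
      =O[atBot] fun t => Real.exp t) :
    Tendsto (fun t => (star (u t) * v t).im) atBot (𝓝 (2 * ν * (star A * B).im)) := by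
  have hcu := h.continuous_fst
  have hexp : ∀ a : ℝ, 0 < a → Tendsto (fun t : ℝ => Real.exp (a * t)) atBot (𝓝 0) := fun a ha =>
    Real.tendsto_exp_atBot.comp (tendsto_id.const_mul_atBot ha)
  have hexpC : ∀ a : ℝ, 0 < a → Tendsto (fun t : ℝ => (Real.exp (a * t) : ℂ)) atBot (𝓝 0) := by
    intro a ha
    simpa [Function.comp_def, -Complex.ofReal_exp] using
      (Complex.continuous_ofReal.tendsto _).comp (hexp a ha)
  obtain ⟨C, hC⟩ := hAB.bound
  obtain ⟨t₀, ht₀⟩ := eventually_atBot.1 hC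
  set t₁ := min t₀ 0
  have ht₁ : t₁ ≤ 0 := min_le_right _ _
  have hexpadd : ∀ a b : ℝ, Real.exp a * Real.exp b = Real.exp (a + b) :=
    fun a b => (Real.exp_add a b).symm
  have hub : ∀ s ≤ t₁, ‖u s‖ ≤ (|C| + ‖A‖ + ‖B‖) * Real.exp (-ν * s) := by
    intro s hs
    have h2 := ht₀ s (hs.trans (min_le_left _ _))
    have hs0 : s ≤ 0 := hs.trans ht₁
    rw [Real.norm_of_nonneg (Real.exp_pos _).le] at h2
    have e1 : Real.exp s ≤ Real.exp (-ν * s) := Real.exp_le_exp.2 (by nlinarith)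
    have e2 : Real.exp (ν * s) ≤ Real.exp (-ν * s) := Real.exp_le_exp.2 (by nlinarith)
    calc ‖u s‖ = ‖(u s - (A * (Real.exp (-ν * s) : ℂ) + B * (Real.exp (ν * s) : ℂ))) +
          (A * (Real.exp (-ν * s) : ℂ) + B * (Real.exp (ν * s) : ℂ))‖ := by congr 1; ring
      _ ≤ C * Real.exp s + (‖A‖ * Real.exp (-ν * s) + ‖B‖ * Real.exp (ν * s)) := by
          refine (norm_add_le _ _).trans (add_le_add h2 ((norm_add_le _ _).trans_eq ?_))
          rw [norm_mul, norm_mul, Complex.norm_real, Complex.norm_real,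
            Real.norm_of_nonneg (Real.exp_pos _).le, Real.norm_of_nonneg (Real.exp_pos _).le]
      _ ≤ |C| * Real.exp (-ν * s) + (‖A‖ * Real.exp (-ν * s) + ‖B‖ * Real.exp (-ν * s)) := by
          gcongr
          exact le_abs_self C
      _ = _ := by ring
  set K := |C| + ‖A‖ + ‖B‖
  have hbound : ∀ a s, s ≤ t₁ → ‖-z * (Real.exp (a * s) : ℂ) * u s‖ ≤
      (‖z‖ * K) * Real.exp ((a - ν) * s) := by
    intro a s hs
    rw [norm_mul, norm_mul, norm_neg, Complex.norm_real, Real.norm_of_nonneg (Real.exp_pos _).le]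
    calc _ ≤ ‖z‖ * Real.exp (a * s) * (K * Real.exp (-ν * s)) := by gcongr; exact hub s hs
      _ = ‖z‖ * K * (Real.exp (a * s) * Real.exp (-ν * s)) := by ring
      _ = _ := by rw [hexpadd]; ring_nf
  -- limits of the two coefficients
  have hYi := (norm_integral_Iic_exp_le (a := 2 - ν - ν) (by linarith)
    (by fun_prop : Continuous fun s => -z * (Real.exp ((2 - ν) * s) : ℂ) * u s)
    (fun s hs => hbound (2 - ν) s hs)).1
  have hYlim := tendsto_limUnder_of_hasDerivAt_of_integrableOn_Iic (a := t₁)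
    (fun t _ => h.hasDerivAt_upper t) hYi
  set Y₀ := limUnder atBot (upper ν u v)
  have hZi := fun t (ht : t ≤ t₁) => norm_integral_Iic_exp_le (a := 2 + ν - ν) (by linarith)
    (by fun_prop : Continuous fun s => -z * (Real.exp ((2 + ν) * s) : ℂ) * u s)
    (fun s hs => hbound (2 + ν) s (hs.trans ht))
  have hZlim := tendsto_limUnder_of_hasDerivAt_of_integrableOn_Iic (a := t₁)
    (fun t _ => h.hasDerivAt_lower t) (hZi t₁ le_rfl).1
  set Z₀ := limUnder atBot (lower ν u v)
  -- To isolate the coefficient `B` of `e^{νt}`, the convergence of `lower` must survive the factor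
  -- `e^{-2νt}`. Its rate `e^{2t}` allows this because `ν < 1`.
  have hZrate : Tendsto (fun t => (Real.exp (-(2 * ν) * t) : ℂ) * (lower ν u v t - Z₀)) atBot
      (𝓝 0) := by
    have hb : Tendsto (fun t : ℝ => (‖z‖ * K / (2 + ν - ν)) * Real.exp ((2 - 2 * ν) * t)) atBot
        (𝓝 0) := by simpa using (hexp (2 - 2 * ν) (by linarith)).const_mul (‖z‖ * K / (2 + ν - ν))
    refine squeeze_zero_norm' ?_ hb
    filter_upwards [eventually_le_atBot t₁] with t ht
    have h2 := (hZi t ht).2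
    rw [integral_Iic_of_hasDerivAt_of_tendsto' (fun s _ => h.hasDerivAt_lower s) (hZi t ht).1 hZlim]
      at h2
    rw [norm_mul, Complex.norm_real, Real.norm_of_nonneg (Real.exp_pos _).le]
    calc _ ≤ Real.exp (-(2 * ν) * t) * (‖z‖ * K / (2 + ν - ν) * Real.exp ((2 + ν - ν) * t)) := by
          gcongr
      _ = ‖z‖ * K / (2 + ν - ν) * (Real.exp (-(2 * ν) * t) * Real.exp ((2 + ν - ν) * t)) := by ring
      _ = _ := by rw [hexpadd]; ring_nf
  -- identification of the limits
  have hmulC : ∀ a b : ℝ, (Real.exp a : ℂ) * (Real.exp b : ℂ) = (Real.exp (a + b) : ℂ) :=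
    fun a b => by rw [← Complex.ofReal_mul, hexpadd]
  have hscaled : ∀ a : ℝ, 0 < 1 + a → Tendsto (fun t => (Real.exp (a * t) : ℂ) *
      (u t - (A * (Real.exp (-ν * t) : ℂ) + B * (Real.exp (ν * t) : ℂ)))) atBot (𝓝 0) := by
    intro a ha
    have hb : Tendsto (fun t : ℝ => C * Real.exp ((1 + a) * t)) atBot (𝓝 0) := by
      simpa using (hexp (1 + a) ha).const_mul C
    refine squeeze_zero_norm' ?_ hb
    filter_upwards [hC] with t ht
    rw [Real.norm_of_nonneg (Real.exp_pos _).le] at ht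
    rw [norm_mul, Complex.norm_real, Real.norm_of_nonneg (Real.exp_pos _).le]
    calc _ ≤ Real.exp (a * t) * (C * Real.exp t) := by gcongr
      _ = C * (Real.exp (a * t) * Real.exp t) := by ring
      _ = _ := by rw [hexpadd]; ring_nf
  have hν0 : (ν : ℂ) ≠ 0 := by exact_mod_cast h0.ne'
  have hA : Z₀ = -(2 * ν * A) := by
    have l1 : Tendsto (fun t => (Real.exp (ν * t) : ℂ) * u t) atBot (𝓝 A) := by
      have := ((hscaled ν (by linarith)).add_const A).add
        ((hexpC (2 * ν) (by linarith)).const_mul B)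
      simp only [mul_zero, add_zero, zero_add] at this
      refine this.congr fun t => ?_
      have e1 := hmulC (ν * t) (-ν * t)
      have e2 := hmulC (ν * t) (ν * t)
      rw [show ν * t + -ν * t = 0 by ring, Real.exp_zero, Complex.ofReal_one] at e1
      rw [show ν * t + ν * t = 2 * ν * t by ring] at e2
      linear_combination (-A) * e1 + (-B) * e2
    have l2 : Tendsto (fun t => (Real.exp (ν * t) : ℂ) * u t) atBot (𝓝 ((0 * Y₀ - Z₀) / (2 * ν))) := by
      refine ((((hexpC (2 * ν) (by linarith)).mul hYlim).sub hZlim).div_const (2 * (ν : ℂ))).congr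
        fun t => ?_
      have e1 := hmulC (ν * t) (-ν * t)
      have e2 := hmulC (ν * t) (ν * t)
      rw [show ν * t + -ν * t = 0 by ring, Real.exp_zero, Complex.ofReal_one] at e1
      rw [show ν * t + ν * t = 2 * ν * t by ring] at e2
      rw [fst_eq (u := u) (v := v) h0.ne' t]
      generalize (Real.exp (ν * t) : ℂ) = a at *
      generalize (Real.exp (-ν * t) : ℂ) = b at *
      generalize (Real.exp (2 * ν * t) : ℂ) = c at *
      field_simp
      linear_combination (lower ν u v t) * e1 - (upper ν u v t) * e2
    have := tendsto_nhds_unique l1 l2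
    rw [this]
    field_simp
    ring
  have hB : Y₀ = 2 * ν * B := by
    have l1 : Tendsto (fun t => (Real.exp (-ν * t) : ℂ) * (u t - A * (Real.exp (-ν * t) : ℂ)))
        atBot (𝓝 B) := by
      have := (hscaled (-ν) (by linarith)).add_const B
      simp only [zero_add] at this
      refine this.congr fun t => ?_
      have e1 := hmulC (-ν * t) (ν * t)
      rw [show -ν * t + ν * t = 0 by ring, Real.exp_zero, Complex.ofReal_one] at e1
      linear_combination (-B) * e1
    have l2 : Tendsto (fun t => (Real.exp (-ν * t) : ℂ) * (u t - A * (Real.exp (-ν * t) : ℂ)))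
        atBot (𝓝 ((Y₀ - 0) / (2 * ν))) := by
      refine ((hYlim.sub hZrate).div_const (2 * (ν : ℂ))).congr fun t => ?_
      have e1 := hmulC (-ν * t) (ν * t)
      have e2 := hmulC (-ν * t) (-ν * t)
      rw [show -ν * t + ν * t = 0 by ring, Real.exp_zero, Complex.ofReal_one] at e1
      rw [show -ν * t + -ν * t = -(2 * ν) * t by ring] at e2
      rw [fst_eq (u := u) (v := v) h0.ne' t, hA]
      generalize (Real.exp (ν * t) : ℂ) = a at *
      generalize (Real.exp (-ν * t) : ℂ) = b at *
      generalize (Real.exp (-(2 * ν) * t) : ℂ) = c at *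
      field_simp
      linear_combination (lower ν u v t + 2 * ν * A) * e2 - (upper ν u v t) * e1
    have := tendsto_nhds_unique l1 l2
    rw [this]
    field_simp
    ring
  have hlim : Tendsto (fun t => (star (upper ν u v t) * lower ν u v t).im / (2 * ν)) atBot
      (𝓝 ((star Y₀ * Z₀).im / (2 * ν))) :=
    ((Complex.continuous_im.tendsto _).comp (hYlim.star.mul hZlim)).div_const _
  have : (star Y₀ * Z₀).im / (2 * ν) = 2 * ν * (star A * B).im := by
    rw [hA, hB]
    field_simp
    simp
    ring
  rw [← this]
  exact hlim.congr fun t => (im_eq h0.ne' t).symm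

end RadialSolution

/-! ### Weak solutions of the radial equation -/

theorem exists_tsupport_subset_Icc {ψ : ℝ → ℝ} (hc : HasCompactSupport ψ) :
    ∃ R : ℝ, 0 < R ∧ ∀ t, t ∉ Ioo (-R) R → ψ t = 0 := by
  obtain ⟨R, hR⟩ := hc.isCompact.isBounded.subset_closedBall 0
  refine ⟨max R 0 + 1, by positivity, fun t ht => ?_⟩
  refine image_eq_zero_of_notMem_tsupport fun h => ht ?_
  have h1 := hR h
  rw [Metric.mem_closedBall, dist_zero_right, Real.norm_eq_abs, abs_le] at h1
  constructor <;> linarith [le_max_left R 0, h1.1, h1.2]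

theorem integral_eq_intervalIntegral {f : ℝ → ℝ} {R : ℝ} (hR : 0 < R)
    (h : ∀ t, t ∉ Ioo (-R) R → f t = 0) : ∫ t, f t = ∫ t in (-R)..R, f t := by
  rw [intervalIntegral.integral_of_le (by linarith), setIntegral_eq_integral_of_forall_compl_eq_zero]
  intro t ht
  exact h t fun h' => ht (Ioo_subset_Ioc_self h')

/-- Integrate from the left of the support; vanishing total integral makes the primitive vanish to
the right of it as well. -/
theorem exists_primitive {ψ : ℝ → ℝ} (hψ : ContDiff ℝ ∞ ψ) (hc : HasCompactSupport ψ)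
    (h0 : ∫ t, ψ t = 0) :
    ∃ Ψ : ℝ → ℝ, ContDiff ℝ ∞ Ψ ∧ HasCompactSupport Ψ ∧ ∀ t, HasDerivAt Ψ (ψ t) t := by
  obtain ⟨R, hR, hz⟩ := exists_tsupport_subset_Icc hc
  have hcont := hψ.continuous
  have hd : ∀ t, HasDerivAt (fun t => ∫ s in (-R)..t, ψ s) (ψ t) t := fun t =>
    intervalIntegral.integral_hasDerivAt_right (hcont.intervalIntegrable _ _)
      hcont.stronglyMeasurable.stronglyMeasurableAtFilter hcont.continuousAt
  refine ⟨_, ?_, ?_, hd⟩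
  · rw [contDiff_infty_iff_deriv]
    refine ⟨fun t => (hd t).differentiableAt, ?_⟩
    rw [show deriv (fun t => ∫ s in (-R)..t, ψ s) = ψ from funext fun t => (hd t).deriv]
    exact hψ
  · refine HasCompactSupport.intro (isCompact_Icc (a := -R) (b := R)) fun t ht => ?_
    rcases lt_or_ge t (-R) with h | h
    · rw [intervalIntegral.integral_symm, neg_eq_zero]
      refine intervalIntegral.integral_zero_ae (Eventually.of_forall fun s hs => hz s fun h' => ?_)
      rw [uIoc_of_le h.le] at hs
      exact absurd h'.1 (not_lt.2 hs.2)
    · have h1 : R < t := by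
        by_contra! h2
        exact ht ⟨h, h2⟩
      rw [← intervalIntegral.integral_add_adjacent_intervals (b := R)
        (hcont.intervalIntegrable _ _) (hcont.intervalIntegrable _ _),
        ← integral_eq_intervalIntegral hR hz, h0, zero_add]
      refine intervalIntegral.integral_zero_ae (Eventually.of_forall fun s hs => hz s fun h' => ?_)
      rw [uIoc_of_le h1.le] at hs
      exact absurd h'.2 (not_lt.2 hs.1.le)

/-- A locally integrable function with vanishing second weak derivative is affine. -/
theorem ae_eq_affine {g : ℝ → ℝ} (hg : LocallyIntegrable g)
    (h : ∀ η η₁ η₂ : ℝ → ℝ, ContDiff ℝ ∞ η → HasCompactSupport η → (∀ t, HasDerivAt η (η₁ t) t) →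
      (∀ t, HasDerivAt η₁ (η₂ t) t) → ∫ t, η₂ t * g t = 0) :
    ∃ a b : ℝ, g =ᵐ[volume] fun t => a + b * t := by
  -- With a bump `f` of integral one, every test function is `p f + q f' + η''` for a test function
  -- `η`: subtract a multiple of `f`, integrate, and repeat. As `g` annihilates `η''`, only `∫ f g`
  -- and `∫ f' g` matter.
  let ρ : ContDiffBump (0 : ℝ) := default
  let f : ℝ → ℝ := ρ.normed volume
  have hf : ContDiff ℝ ∞ f := ρ.contDiff_normed
  have hfc : HasCompactSupport f := ρ.hasCompactSupport_normed
  have hf1 : ∫ t, f t = 1 := ρ.integral_normed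
  have hfd : ∀ t, HasDerivAt f (deriv f t) t := fun t =>
    (hf.differentiable (by simp) t).hasDerivAt
  have hf' : ContDiff ℝ ∞ (deriv f) := (contDiff_infty_iff_deriv.1 hf).2
  have hfc' : HasCompactSupport (deriv f) := hfc.deriv
  have hint : ∀ ψ : ℝ → ℝ, ContDiff ℝ ∞ ψ → HasCompactSupport ψ →
      Integrable fun t => ψ t * g t := fun ψ hψ hc => by
    simpa using hg.integrable_smul_left_of_hasCompactSupport hψ.continuous hc
  set m := ∫ t, t * f t
  set a := ∫ t, f t * g t
  set b := ∫ t, deriv f t * g t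
  refine ⟨a + m * b, -b, ?_⟩
  refine ae_eq_of_integral_contDiff_smul_eq hg
    (by fun_prop : Continuous fun t => a + m * b + -b * t).locallyIntegrable fun ψ hψ hc => ?_
  simp only [smul_eq_mul]
  set p := ∫ t, ψ t
  have hψi : Integrable ψ := hψ.continuous.integrable_of_hasCompactSupport hc
  have hfi : Integrable f := hf.continuous.integrable_of_hasCompactSupport hfc
  have c1 : HasCompactSupport fun t => ψ t - p * f t :=
    hc.sub (hfc.smul_left (f := fun _ => p))
  obtain ⟨Ψ, hΨ, hΨc, hΨd⟩ := exists_primitive (ψ := fun t => ψ t - p * f t)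
    (hψ.sub (contDiff_const.mul hf)) c1
    (by rw [integral_sub hψi (hfi.const_mul p), integral_const_mul, hf1]; simp [p])
  set q := ∫ t, Ψ t
  have hΨi : Integrable Ψ := hΨ.continuous.integrable_of_hasCompactSupport hΨc
  -- The second constant is a first moment, by parts against `t`; this produces the linear term of
  -- the affine function.
  have hq : q = -(∫ t, t * ψ t) + p * m := by
    have i1 : Integrable fun t => t * ψ t :=
      (continuous_id.mul hψ.continuous).integrable_of_hasCompactSupport hc.mul_left
    have i2 : Integrable fun t => t * f t :=
      (continuous_id.mul hf.continuous).integrable_of_hasCompactSupport hfc.mul_left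
    have i3 : Integrable fun t => t * (ψ t - p * f t) := by
      refine (i1.sub (i2.const_mul p)).congr (Eventually.of_forall fun t => ?_)
      simp only [Pi.sub_apply]
      ring
    have i4 : Integrable fun t => t * Ψ t :=
      (continuous_id.mul hΨ.continuous).integrable_of_hasCompactSupport hΨc.mul_left
    have := integral_mul_deriv_eq_deriv_mul_of_integrable (u := fun t : ℝ => t) (v := Ψ)
      (u' := fun _ => 1) (fun t _ => hasDerivAt_id t) (fun t _ => hΨd t) i3 (by simpa [Pi.mul_def] using hΨi) i4
    simp only [one_mul] at this
    have e : ∫ t, t * (ψ t - p * f t) = (∫ t, t * ψ t) - p * m := by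
      rw [← integral_const_mul, ← integral_sub i1 (i2.const_mul p)]
      congr 1
      funext t
      ring
    rw [e] at this
    simp only [q]
    linarith
  have c2 : HasCompactSupport fun t => Ψ t - q * f t :=
    hΨc.sub (hfc.smul_left (f := fun _ => q))
  obtain ⟨η, hη, hηc, hηd⟩ := exists_primitive (ψ := fun t => Ψ t - q * f t)
    (hΨ.sub (contDiff_const.mul hf)) c2
    (by rw [integral_sub hΨi (hfi.const_mul q), integral_const_mul, hf1]; simp [q])
  have key := h η _ (fun t => (ψ t - p * f t) - q * deriv f t) hη hηc hηd
    (fun t => (hΨd t).sub ((hfd t).const_mul q))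
  have e1 : ∫ t, ((ψ t - p * f t) - q * deriv f t) * g t = (∫ t, ψ t * g t) - p * a - q * b := by
    simp only [a, b]
    rw [← integral_const_mul, ← integral_const_mul, ← integral_sub (hint ψ hψ hc)
      ((hint f hf hfc).const_mul p), ← integral_sub _ ((hint _ hf' hfc').const_mul q)]
    · congr 1
      funext t
      ring
    · exact (hint ψ hψ hc).sub ((hint f hf hfc).const_mul p)
  have e2 : ∫ t, ψ t * (a + m * b + -b * t) = (a + m * b) * p - b * ∫ t, t * ψ t := by
    have i1 : Integrable fun t => t * ψ t :=
      (continuous_id.mul hψ.continuous).integrable_of_hasCompactSupport hc.mul_left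
    have e3 : (a + m * b) * p = ∫ t, (a + m * b) * ψ t := (integral_const_mul _ _).symm
    have e4 : b * (∫ t, t * ψ t) = ∫ t, b * (t * ψ t) := (integral_const_mul _ _).symm
    rw [e3, e4, ← integral_sub (hψi.const_mul _) (i1.const_mul _)]
    congr 1
    funext t
    ring
  rw [e2]
  rw [e1, hq] at key
  linarith

/-- A weak solution of `F'' = G` is a.e. a twofold primitive of `G`. -/
theorem ae_eq_of_weak_second_deriv {F G : ℝ → ℝ} (hF : LocallyIntegrable F)
    (hG : LocallyIntegrable G)
    (h : ∀ η η₁ η₂ : ℝ → ℝ, ContDiff ℝ ∞ η → HasCompactSupport η → (∀ t, HasDerivAt η (η₁ t) t) →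
      (∀ t, HasDerivAt η₁ (η₂ t) t) → ∫ t, η₂ t * F t = ∫ t, η t * G t) :
    ∃ a b : ℝ, F =ᵐ[volume] fun t => a + b * t + ∫ s in (0 : ℝ)..t, ∫ r in (0 : ℝ)..s, G r := by
  have hGi : ∀ a b, IntervalIntegrable G volume a b := fun a b => intervalIntegrable_iff.mpr
    ((hG.integrableOn_isCompact isCompact_uIcc).mono_set uIoc_subset_uIcc)
  set V₁ : ℝ → ℝ := fun s => ∫ r in (0 : ℝ)..s, G r with hV₁
  have hV₁c : Continuous V₁ := intervalIntegral.continuous_primitive hGi 0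
  -- The twofold primitive of `G` has `G` as its second weak derivative, so `F - V` falls under
  -- `ae_eq_affine`.
  set V : ℝ → ℝ := fun t => ∫ s in (0 : ℝ)..t, V₁ s with hV
  have hVd : ∀ t, HasDerivAt V (V₁ t) t := fun t =>
    intervalIntegral.integral_hasDerivAt_right (hV₁c.intervalIntegrable _ _)
      hV₁c.stronglyMeasurable.stronglyMeasurableAtFilter hV₁c.continuousAt
  have hVc : Continuous V := continuous_iff_continuousAt.2 fun t => (hVd t).continuousAt
  have key : ∀ η η₁ η₂ : ℝ → ℝ, ContDiff ℝ ∞ η → HasCompactSupport η →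
      (∀ t, HasDerivAt η (η₁ t) t) → (∀ t, HasDerivAt η₁ (η₂ t) t) →
      ∫ t, η₂ t * (F t - V t) = 0 := by
    intro η η₁ η₂ hη hc h1 h2
    have e1 : η₁ = deriv η := funext fun t => (h1 t).deriv.symm
    have e2 : η₂ = deriv η₁ := funext fun t => (h2 t).deriv.symm
    have hη₁ : ContDiff ℝ ∞ η₁ := e1 ▸ (contDiff_infty_iff_deriv.1 hη).2
    have hc₁ : HasCompactSupport η₁ := e1 ▸ hc.deriv
    have hη₂ : ContDiff ℝ ∞ η₂ := e2 ▸ (contDiff_infty_iff_deriv.1 hη₁).2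
    have hc₂ : HasCompactSupport η₂ := e2 ▸ hc₁.deriv
    have i1 : Integrable fun t => η₂ t * F t := by
      simpa using hF.integrable_smul_left_of_hasCompactSupport hη₂.continuous hc₂
    have i2 : Integrable fun t => η₂ t * V t :=
      (hη₂.continuous.mul hVc).integrable_of_hasCompactSupport hc₂.mul_right
    have i3 : Integrable fun t => η₁ t * V t :=
      (hη₁.continuous.mul hVc).integrable_of_hasCompactSupport hc₁.mul_right
    have i4 : Integrable fun t => η₁ t * V₁ t :=
      (hη₁.continuous.mul hV₁c).integrable_of_hasCompactSupport hc₁.mul_right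
    have p1 : ∫ t, V t * η₂ t = -∫ t, V₁ t * η₁ t :=
      integral_mul_deriv_eq_deriv_mul_of_integrable (fun t _ => hVd t) (fun t _ => h2 t)
        (by simpa [Pi.mul_def, mul_comm] using i2) (by simpa [Pi.mul_def, mul_comm] using i4)
        (by simpa [Pi.mul_def, mul_comm] using i3)
    have p2 : ∫ t, V₁ t * η₁ t = -∫ t, η t * G t := by
      obtain ⟨R, hR, hz⟩ := exists_tsupport_subset_Icc hc
      obtain ⟨R', hR', hz'⟩ := exists_tsupport_subset_Icc hc₁
      set M := max R R'
      have hM : 0 < M := lt_max_of_lt_left hR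
      have z1 : ∀ t, t ∉ Ioo (-M) M → η t = 0 := fun t ht => hz t fun h' =>
        ht (Ioo_subset_Ioo (neg_le_neg (le_max_left _ _)) (le_max_left _ _) h')
      have z2 : ∀ t, t ∉ Ioo (-M) M → η₁ t = 0 := fun t ht => hz' t fun h' =>
        ht (Ioo_subset_Ioo (neg_le_neg (le_max_right _ _)) (le_max_right _ _) h')
      rw [integral_eq_intervalIntegral hM (fun t ht => by rw [z2 t ht, mul_zero]),
        integral_eq_intervalIntegral hM (fun t ht => by rw [z1 t ht, zero_mul])]
      -- `G` is only locally integrable, so `V₁` is differentiable merely almost everywhere;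
      -- absolute continuity justifies the integration by parts.
      have a1 : AbsolutelyContinuousOnInterval V₁ (-M) M :=
        (hGi (-M) M).absolutelyContinuousOnInterval_intervalIntegral (c := 0)
          (by rw [uIcc_of_le (by linarith)]; constructor <;> linarith)
      have a2 : AbsolutelyContinuousOnInterval η (-M) M :=
        ContDiffOn.absolutelyContinuousOnInterval (hη.of_le (by simp)).contDiffOn
      have := a1.integral_mul_deriv_eq_deriv_mul a2
      rw [e1, this, z1 M (by simp), z1 (-M) (by simp)]
      simp only [mul_zero, sub_self, zero_sub]
      congr 1
      refine intervalIntegral.integral_congr_ae ?_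
      filter_upwards [LocallyIntegrable.ae_hasDerivAt_integral hG] with t ht _
      rw [(ht 0).deriv, mul_comm]
    have p3 := h η η₁ η₂ hη hc h1 h2
    simp only [mul_sub]
    rw [integral_sub i1 i2, p3]
    have : ∫ t, η₂ t * V t = ∫ t, V t * η₂ t := by congr 1; funext t; ring
    rw [this, p1, p2]
    ring
  obtain ⟨a, b, hab⟩ := ae_eq_affine (hF.sub hVc.locallyIntegrable) key
  refine ⟨a, b, ?_⟩
  filter_upwards [hab] with t ht
  simp only [Pi.sub_apply] at ht
  linarith

/-- Weak solutions of the radial equation are classical solutions. -/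
theorem exists_radialSolution {ν : ℝ} {z : ℂ} {F : ℝ → ℂ} (hF : LocallyIntegrable F)
    (h : ∀ η η₁ η₂ : ℝ → ℝ, ContDiff ℝ ∞ η → HasCompactSupport η → (∀ t, HasDerivAt η (η₁ t) t) →
      (∀ t, HasDerivAt η₁ (η₂ t) t) →
      ∫ t, (η₂ t : ℂ) * F t = ∫ t, (η t : ℂ) * (((ν : ℂ) ^ 2 - z * (Real.exp (2 * t) : ℂ)) * F t)) :
    ∃ u v : ℝ → ℂ, RadialSolution ν z u v ∧ F =ᵐ[volume] u := by
  set Q : ℝ → ℂ := fun t => (ν : ℂ) ^ 2 - z * (Real.exp (2 * t) : ℂ) with hQ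
  have hQc : Continuous Q := by fun_prop
  have hG : LocallyIntegrable fun t => Q t * F t := by
    rw [locallyIntegrable_iff] at hF ⊢
    intro k hk
    exact (hF k hk).continuousOn_mul hQc.continuousOn hk
  have hre : ∀ {f : ℝ → ℂ}, LocallyIntegrable f → LocallyIntegrable fun t => (f t).re :=
    fun {f} hf => by
      rw [locallyIntegrable_iff] at hf ⊢
      exact fun k hk => (hf k hk).re
  have him : ∀ {f : ℝ → ℂ}, LocallyIntegrable f → LocallyIntegrable fun t => (f t).im :=
    fun {f} hf => by
      rw [locallyIntegrable_iff] at hf ⊢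
      exact fun k hk => (hf k hk).im
  have hint : ∀ {η : ℝ → ℝ} {f : ℝ → ℂ}, Continuous η → HasCompactSupport η →
      LocallyIntegrable f → Integrable fun t => (η t : ℂ) * f t := fun {η f} hη hc hf => by
    simpa using hf.integrable_smul_left_of_hasCompactSupport hη hc
  have hcont : ∀ {η η₁ η₂ : ℝ → ℝ}, ContDiff ℝ ∞ η → HasCompactSupport η →
      (∀ t, HasDerivAt η (η₁ t) t) → (∀ t, HasDerivAt η₁ (η₂ t) t) →
      Continuous η₂ ∧ HasCompactSupport η₂ := fun {η η₁ η₂} hη hc h1 h2 => by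
    have e1 : η₁ = deriv η := funext fun t => (h1 t).deriv.symm
    have e2 : η₂ = deriv η₁ := funext fun t => (h2 t).deriv.symm
    have hη₁ : ContDiff ℝ ∞ η₁ := e1 ▸ (contDiff_infty_iff_deriv.1 hη).2
    exact ⟨(e2 ▸ (contDiff_infty_iff_deriv.1 hη₁).2 : ContDiff ℝ ∞ η₂).continuous,
      e2 ▸ (e1 ▸ hc.deriv : HasCompactSupport η₁).deriv⟩
  obtain ⟨a, b, hab⟩ := ae_eq_of_weak_second_deriv (hre hF) (hre hG)
    fun η η₁ η₂ hη hc h1 h2 => by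
      have key := congrArg Complex.re (h η η₁ η₂ hη hc h1 h2)
      have l := integral_re (hint (hcont hη hc h1 h2).1 (hcont hη hc h1 h2).2 hF)
      have r := integral_re (hint hη.continuous hc hG)
      simp only [RCLike.re_eq_complex_re] at l r
      rw [← l, ← r] at key
      simpa using key
  obtain ⟨a', b', hab'⟩ := ae_eq_of_weak_second_deriv (him hF) (him hG)
    fun η η₁ η₂ hη hc h1 h2 => by
      have key := congrArg Complex.im (h η η₁ η₂ hη hc h1 h2)
      have l := integral_im (hint (hcont hη hc h1 h2).1 (hcont hη hc h1 h2).2 hF)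
      have r := integral_im (hint hη.continuous hc hG)
      simp only [RCLike.im_eq_complex_im] at l r
      rw [← l, ← r] at key
      simpa using key
  have hGi : ∀ a b, IntervalIntegrable (fun t => Q t * F t) volume a b :=
    fun a b => intervalIntegrable_iff.mpr
    ((hG.integrableOn_isCompact isCompact_uIcc).mono_set uIoc_subset_uIcc)
  set V₁ : ℝ → ℂ := fun s => ∫ r in (0 : ℝ)..s, Q r * F r with hV₁
  have hV₁c : Continuous V₁ := intervalIntegral.continuous_primitive hGi 0
  set u : ℝ → ℂ := fun t => (a + a' * Complex.I) + (b + b' * Complex.I) * t +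
    ∫ s in (0 : ℝ)..t, V₁ s with hu
  have hV₁re : ∀ s, (V₁ s).re = ∫ r in (0 : ℝ)..s, (Q r * F r).re := fun s =>
    (Complex.reCLM.intervalIntegral_comp_comm (hGi 0 s)).symm
  have hV₁im : ∀ s, (V₁ s).im = ∫ r in (0 : ℝ)..s, (Q r * F r).im := fun s =>
    (Complex.imCLM.intervalIntegral_comp_comm (hGi 0 s)).symm
  have hFu : F =ᵐ[volume] u := by
    filter_upwards [hab, hab'] with t ht ht'
    have e1 := Complex.reCLM.intervalIntegral_comp_comm (hV₁c.intervalIntegrable (μ := volume) 0 t)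
    have e2 := Complex.imCLM.intervalIntegral_comp_comm (hV₁c.intervalIntegrable (μ := volume) 0 t)
    simp only [Complex.reCLM_apply, Complex.imCLM_apply, hV₁re, hV₁im] at e1 e2
    refine Complex.ext ?_ ?_
    · rw [ht, e1]; simp [hu]
    · rw [ht', e2]; simp [hu]
  have hVd : ∀ t, HasDerivAt (fun t => ∫ s in (0 : ℝ)..t, V₁ s) (V₁ t) t := fun t =>
    intervalIntegral.integral_hasDerivAt_right (hV₁c.intervalIntegrable _ _)
      hV₁c.stronglyMeasurable.stronglyMeasurableAtFilter hV₁c.continuousAt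
  have hud : ∀ t, HasDerivAt u ((b + b' * Complex.I) + V₁ t) t := fun t => by
    have := (((Complex.ofRealCLM.hasDerivAt (x := t)).const_mul (b + b' * Complex.I)).const_add
      (a + a' * Complex.I)).add (hVd t)
    simpa [hu, Pi.add_def] using this
  have huc : Continuous u := continuous_iff_continuousAt.2 fun t => (hud t).continuousAt
  -- Bootstrap: `F` may be replaced under the integral by its continuous representative `u`. The
  -- integrand is then continuous and `V₁` differentiable everywhere.
  have hV₁' : V₁ = fun s => ∫ r in (0 : ℝ)..s, Q r * u r := by
    funext s
    refine intervalIntegral.integral_congr_ae ?_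
    filter_upwards [hFu] with r hr _
    rw [hr]
  have hQu : Continuous fun r => Q r * u r := hQc.mul huc
  refine ⟨u, fun t => (b + b' * Complex.I) + V₁ t, ⟨hud, fun t => ?_⟩, hFu⟩
  rw [hV₁']
  exact (intervalIntegral.integral_hasDerivAt_right (hQu.intervalIntegrable _ _)
      hQu.stronglyMeasurable.stronglyMeasurableAtFilter hQu.continuousAt).const_add _

/-! ### Functions of one angular momentum -/

/-- The complex coordinate of the plane. -/
def planeCoord (x : Plane) : ℂ := (x 0 : ℂ) + Complex.I * (x 1 : ℂ)

/-- The angular factor `e^{imθ}`. -/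
def angular (m : ℤ) (x : Plane) : ℂ := (planeCoord x / (‖x‖ : ℂ)) ^ m

open scoped Classical in
/-- The function `η(log r) e^{imθ}`. -/
def modeFun (m : ℤ) (η : ℝ → ℂ) (x : Plane) : ℂ :=
  if x = 0 then 0 else η (Real.log ‖x‖) * angular m x

theorem modeFun_of_ne {m : ℤ} {η : ℝ → ℂ} {x : Plane} (hx : x ≠ 0) :
    modeFun m η x = η (Real.log ‖x‖) * angular m x := if_neg hx

theorem norm_sq_eq (x : Plane) : ‖x‖ ^ 2 = x 0 ^ 2 + x 1 ^ 2 := by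
  rw [EuclideanSpace.norm_sq_eq]; simp

theorem norm_planeCoord (x : Plane) : ‖planeCoord x‖ = ‖x‖ := by
  rw [← sq_eq_sq₀ (norm_nonneg _) (norm_nonneg _), norm_sq_eq, ← Complex.normSq_eq_norm_sq,
    Complex.normSq_apply]
  simp [planeCoord]
  ring

theorem planeCoord_ne_zero {x : Plane} (hx : x ≠ 0) : planeCoord x ≠ 0 := by
  rw [← norm_pos_iff, norm_planeCoord]; exact norm_pos_iff.2 hx

theorem norm_angular {x : Plane} (hx : x ≠ 0) (m : ℤ) : ‖angular m x‖ = 1 := by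
  have : ‖x‖ ≠ 0 := norm_ne_zero_iff.2 hx
  simp [angular, norm_planeCoord, this]

theorem expNegAngle_eq (x : Plane) : expNegAngle x = angular (-1) x := by
  by_cases hx : x = 0
  · simp [hx, expNegAngle, angular, planeCoord]
  have h0 := planeCoord_ne_zero hx
  have h1 : (‖x‖ : ℂ) ≠ 0 := by exact_mod_cast norm_ne_zero_iff.2 hx
  have h2 : (‖x‖ : ℂ) ^ 2 = (x 0 : ℂ) ^ 2 + (x 1 : ℂ) ^ 2 := by exact_mod_cast norm_sq_eq x
  rw [angular, zpow_neg, zpow_one, inv_div, expNegAngle, div_eq_div_iff h1 h0, planeCoord]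
  linear_combination -h2 - (x 1 : ℂ) ^ 2 * Complex.I_sq

theorem contDiff_planeCoord : ContDiff ℝ ∞ planeCoord := by
  unfold planeCoord
  have c (i : Fin 2) : ContDiff ℝ ∞ (fun y : Plane => (y i : ℂ)) :=
    Complex.ofRealCLM.contDiff.comp (by fun_prop)
  exact (c 0).add (contDiff_const.mul (c 1))

theorem contDiffAt_angular (m : ℤ) {x : Plane} (hx : x ≠ 0) : ContDiffAt ℝ ∞ (angular m) x := by
  have h1 : ContDiffAt ℝ ∞ (fun y : Plane => (‖y‖ : ℂ)) x :=
    Complex.ofRealCLM.contDiff.contDiffAt.comp x (contDiffAt_norm ℝ hx)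
  have hn : (‖x‖ : ℂ) ≠ 0 := by exact_mod_cast norm_ne_zero_iff.2 hx
  have h2 : ContDiffAt ℝ ∞ (fun y : Plane => planeCoord y / (‖y‖ : ℂ)) x := by
    simp only [div_eq_mul_inv]
    exact contDiff_planeCoord.contDiffAt.mul (h1.inv hn)
  have h3 : planeCoord x / (‖x‖ : ℂ) ≠ 0 := div_ne_zero (planeCoord_ne_zero hx) hn
  cases m with
  | ofNat n =>
    refine (h2.pow n).congr_of_eventuallyEq (Eventually.of_forall fun y => ?_)
    simp [angular]
  | negSucc n =>
    have := (h2.pow (n + 1)).inv (pow_ne_zero _ h3)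
    refine this.congr_of_eventuallyEq (Eventually.of_forall fun y => ?_)
    simp only [angular, zpow_negSucc, Pi.inv_apply]

theorem contDiffAt_log_norm {x : Plane} (hx : x ≠ 0) :
    ContDiffAt ℝ ∞ (fun y : Plane => Real.log ‖y‖) x :=
  (contDiffAt_norm ℝ hx).log (norm_ne_zero_iff.2 hx)

theorem modeFun_eventuallyEq (m : ℤ) (η : ℝ → ℂ) {x : Plane} (hx : x ≠ 0) :
    modeFun m η =ᶠ[𝓝 x] fun y => η (Real.log ‖y‖) * angular m y := by
  filter_upwards [isOpen_ne.mem_nhds hx] with y hy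
  exact modeFun_of_ne hy

theorem contDiffAt_modeFun (m : ℤ) {η : ℝ → ℂ} (hη : ContDiff ℝ ∞ η) {x : Plane} (hx : x ≠ 0) :
    ContDiffAt ℝ ∞ (modeFun m η) x :=
  ((hη.contDiffAt.comp x (contDiffAt_log_norm hx)).mul
    (contDiffAt_angular m hx)).congr_of_eventuallyEq (modeFun_eventuallyEq m η hx)

/-- Compact support in `log r` means support in a closed annulus, away from the origin. -/
theorem modeFun_mem_testSpace (m : ℤ) {η : ℝ → ℂ} (hη : ContDiff ℝ ∞ η)
    (hc : HasCompactSupport η) : modeFun m η ∈ testSpace := by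
  obtain ⟨R, hR⟩ := hc.isCompact.isBounded.subset_closedBall 0
  have hz : ∀ x : Plane, ‖x‖ < Real.exp (-R) ∨ Real.exp R < ‖x‖ → modeFun m η x = 0 := by
    intro x hx
    by_cases h0 : x = 0
    · simp [modeFun, h0]
    rw [modeFun_of_ne h0, image_eq_zero_of_notMem_tsupport (f := η), zero_mul]
    intro h
    have h1 := hR h
    rw [Metric.mem_closedBall, dist_zero_right, Real.norm_eq_abs, abs_le] at h1
    have hp : 0 < ‖x‖ := norm_pos_iff.2 h0
    rcases hx with hx | hx
    · have := (Real.log_lt_iff_lt_exp hp).2 hx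
      linarith [h1.1]
    · have := (Real.lt_log_iff_exp_lt hp).2 hx
      linarith [h1.2]
  have hsub : tsupport (modeFun m η) ⊆ {x : Plane | Real.exp (-R) ≤ ‖x‖ ∧ ‖x‖ ≤ Real.exp R} := by
    refine closure_minimal (fun x hx => ?_) ((isClosed_le continuous_const continuous_norm).inter
      (isClosed_le continuous_norm continuous_const))
    by_contra hcon
    refine hx (hz x ?_)
    simp only [mem_ofPred_eq, not_and_or, not_le] at hcon
    exact hcon
  have h00 : (0 : Plane) ∉ tsupport (modeFun m η) := fun h => by
    have := (hsub h).1
    simp only [norm_zero] at this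
    exact absurd (Real.exp_pos (-R)) (not_lt.2 this)
  refine ⟨?_, ?_, h00⟩
  · rw [contDiff_iff_contDiffAt]
    intro x
    by_cases hx : x = 0
    · subst hx
      have : modeFun m η =ᶠ[𝓝 0] fun _ => 0 := by
        filter_upwards [(isClosed_tsupport (modeFun m η)).isOpen_compl.mem_nhds h00] with y hy
        exact image_eq_zero_of_notMem_tsupport hy
      exact contDiffAt_const.congr_of_eventuallyEq this
    · exact contDiffAt_modeFun m hη hx
  · refine HasCompactSupport.of_support_subset_isCompact (isCompact_closedBall (0 : Plane) (Real.exp R))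
      fun x hx => ?_
    rw [Metric.mem_closedBall, dist_zero_right]
    exact (hsub (subset_closure hx)).2

/-- The `j`-th component of `r² ∇θ`. -/
def angularDir (x : Plane) : Fin 2 → ℝ := ![-x 1, x 0]

theorem vectorPotential_eq (α : ℝ) (x : Plane) (j : Fin 2) :
    vectorPotential α x j = -α * (angularDir x j / ‖x‖ ^ 2) := by
  rw [norm_sq_eq]
  fin_cases j <;> simp [vectorPotential, angularDir]

/-! ### Derivatives along coordinate lines. -/

section directional

variable {x : Plane} (j : Fin 2)

/-- The line through `x` in the direction `j`. -/
def coordLine (x : Plane) (j : Fin 2) (s : ℝ) : Plane := x + s • EuclideanSpace.single j (1 : ℝ)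

@[simp] theorem coordLine_zero (x : Plane) (j : Fin 2) : coordLine x j 0 = x := by simp [coordLine]

theorem continuous_coordLine (x : Plane) (j : Fin 2) : Continuous (coordLine x j) := by
  unfold coordLine; fun_prop

theorem fderiv_eq_of_hasDerivAt {u : Plane → ℂ} (hu : DifferentiableAt ℝ u x) {j : Fin 2} {u' : ℂ}
    (h : HasDerivAt (fun s => u (coordLine x j s)) u' 0) :
    fderiv ℝ u x (EuclideanSpace.single j 1) = u' := by
  rw [← hu.lineDeriv_eq_fderiv]
  exact HasLineDerivAt.lineDeriv h

theorem hasDerivAt_coord (i : Fin 2) :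
    HasDerivAt (fun s => coordLine x j s i) (if i = j then 1 else 0) 0 := by
  have : (fun s => coordLine x j s i) = fun s => x i + s * (if i = j then 1 else 0) := by
    funext s
    simp [coordLine, PiLp.single_apply]
  rw [this]
  simpa using ((hasDerivAt_id (0 : ℝ)).mul_const (if i = j then (1 : ℝ) else 0)).const_add (x i)

theorem hasDerivAt_normSq : HasDerivAt (fun s => ‖coordLine x j s‖ ^ 2) (2 * x j) 0 := by
  simp only [norm_sq_eq]
  refine (((hasDerivAt_coord j 0).pow 2).add ((hasDerivAt_coord j 1).pow 2)).congr_deriv ?_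
  fin_cases j <;> simp

theorem hasDerivAt_norm (hx : x ≠ 0) : HasDerivAt (fun s => ‖coordLine x j s‖) (x j / ‖x‖) 0 := by
  have hn : ‖x‖ ≠ 0 := norm_ne_zero_iff.2 hx
  have h := (hasDerivAt_normSq (x := x) j).sqrt (by simpa using hn)
  simp only [Real.sqrt_sq (norm_nonneg _), coordLine_zero] at h
  refine h.congr_deriv ?_
  field_simp

theorem hasDerivAt_log_norm (hx : x ≠ 0) :
    HasDerivAt (fun s => Real.log ‖coordLine x j s‖) (x j / ‖x‖ ^ 2) 0 := by
  have hn : ‖x‖ ≠ 0 := norm_ne_zero_iff.2 hx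
  refine ((hasDerivAt_norm j hx).log (by simpa using hn)).congr_deriv ?_
  simp only [coordLine_zero]
  field_simp

theorem hasDerivAt_planeCoord :
    HasDerivAt (fun s => planeCoord (coordLine x j s)) (if j = 0 then 1 else Complex.I) 0 := by
  unfold planeCoord
  refine ((hasDerivAt_coord j 0).ofReal_comp.add
    ((hasDerivAt_coord j 1).ofReal_comp.const_mul Complex.I)).congr_deriv ?_
  fin_cases j <;> simp

/-- The logarithmic derivative of `e^{iθ}` is `i∇θ`, with `∇θ = angularDir / r²`; the power rule
gives the factor `m`. -/
theorem hasDerivAt_angular (hx : x ≠ 0) (m : ℤ) :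
    HasDerivAt (fun s => angular m (coordLine x j s))
      (m * (Complex.I * (angularDir x j : ℂ) / (‖x‖ : ℂ) ^ 2) * angular m x) 0 := by
  have hn : (‖x‖ : ℂ) ≠ 0 := by exact_mod_cast norm_ne_zero_iff.2 hx
  have h3 : planeCoord x / (‖x‖ : ℂ) ≠ 0 := div_ne_zero (planeCoord_ne_zero hx) hn
  have h1 := (hasDerivAt_planeCoord (x := x) j).div (hasDerivAt_norm j hx).ofReal_comp
    (by simpa using norm_ne_zero_iff.2 hx)
  have h2 := HasDerivAt.comp (0 : ℝ) (hasDerivAt_zpow m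
    (planeCoord (coordLine x j 0) / (‖coordLine x j 0‖ : ℂ)) (Or.inl (by simpa using h3))) h1
  refine h2.congr_deriv ?_
  simp only [coordLine_zero]
  rw [zpow_sub_one₀ h3, ← angular]
  have h0 := planeCoord_ne_zero hx
  have hsq : (‖x‖ : ℂ) ^ 2 = (x 0 : ℂ) ^ 2 + (x 1 : ℂ) ^ 2 := by exact_mod_cast norm_sq_eq x
  have hI := Complex.I_sq
  have key : (planeCoord x / (‖x‖ : ℂ))⁻¹ * (((if j = 0 then 1 else Complex.I) * (‖x‖ : ℂ) -
      planeCoord x * ((x j / ‖x‖ : ℝ) : ℂ)) / (‖x‖ : ℂ) ^ 2) =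
      Complex.I * (angularDir x j : ℂ) / (‖x‖ : ℂ) ^ 2 := by
    rw [inv_div]
    push_cast
    field_simp
    fin_cases j
    · simp [angularDir]
      rw [hsq, planeCoord]
      linear_combination (x 1 : ℂ) ^ 2 * hI
    · simp [angularDir]
      rw [hsq, planeCoord]
      linear_combination (-(x 0 : ℂ) * (x 1 : ℂ)) * hI
  rw [mul_assoc (m : ℂ), mul_assoc (m : ℂ), mul_assoc (angular m x), key]
  ring

theorem hasDerivAt_radial (hx : x ≠ 0) {η η₁ : ℝ → ℂ} (h : ∀ t, HasDerivAt η (η₁ t) t) :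
    HasDerivAt (fun s => η (Real.log ‖coordLine x j s‖))
      (η₁ (Real.log ‖x‖) * (x j : ℂ) / (‖x‖ : ℂ) ^ 2) 0 := by
  have h1 := (h (Real.log ‖coordLine x j 0‖)).scomp (0 : ℝ) (hasDerivAt_log_norm j hx)
  refine h1.congr_deriv ?_
  simp
  ring

end directional

theorem momentumFun_congr {α : ℝ} {j : Fin 2} {u w : Plane → ℂ} {x : Plane} (h : u =ᶠ[𝓝 x] w) :
    momentumFun α j u x = momentumFun α j w x := by
  simp only [momentumFun, h.fderiv_eq, h.self_of_nhds]

/-- `(-i∇ - A_α)_j` applied to `η(log r) e^{imθ}`. -/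
def modeMomentum (α : ℝ) (m : ℤ) (η η₁ : ℝ → ℂ) (j : Fin 2) (x : Plane) : ℂ :=
  (-Complex.I * η₁ (Real.log ‖x‖) * (x j : ℂ) +
    ((m : ℂ) + α) * (angularDir x j : ℂ) * η (Real.log ‖x‖)) / (‖x‖ : ℂ) ^ 2 * angular m x

/-! ### The magnetic Laplacian at fixed angular momentum. -/

section modes

variable {α : ℝ} {m : ℤ} {η η₁ η₂ : ℝ → ℂ} {x : Plane}

/-- Since `A_α = -α∇θ`, the potential merely shifts `m` to `m + α` in the angular component. -/
theorem momentumFun_modeFun (hη : ContDiff ℝ ∞ η) (h1 : ∀ t, HasDerivAt η (η₁ t) t)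
    (j : Fin 2) (hx : x ≠ 0) :
    momentumFun α j (modeFun m η) x = modeMomentum α m η η₁ j x := by
  have hn : (‖x‖ : ℂ) ≠ 0 := by exact_mod_cast norm_ne_zero_iff.2 hx
  have hd : HasDerivAt (fun s => modeFun m η (coordLine x j s))
      (η₁ (Real.log ‖x‖) * (x j : ℂ) / (‖x‖ : ℂ) ^ 2 * angular m x + η (Real.log ‖x‖) *
        (m * (Complex.I * (angularDir x j : ℂ) / (‖x‖ : ℂ) ^ 2) * angular m x)) 0 := by
    have h2 := (hasDerivAt_radial j hx h1).mul (hasDerivAt_angular j hx m)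
    simp only [coordLine_zero] at h2
    refine h2.congr_of_eventuallyEq ?_
    have hc : Tendsto (coordLine x j) (𝓝 0) (𝓝 x) := by
      simpa using (continuous_coordLine x j).tendsto 0
    exact hc.eventually (modeFun_eventuallyEq m η hx)
  rw [momentumFun, fderiv_eq_of_hasDerivAt ((contDiffAt_modeFun m hη hx).differentiableAt (by simp))
    hd, modeFun_of_ne hx, vectorPotential_eq, modeMomentum]
  push_cast
  field_simp
  linear_combination (-(m : ℂ) * angularDir x j * η (Real.log ‖x‖) * angular m x) * Complex.I_sq

theorem contDiffAt_modeMomentum (hη : ContDiff ℝ ∞ η) (hη₁ : ContDiff ℝ ∞ η₁) (j : Fin 2)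
    (hx : x ≠ 0) : ContDiffAt ℝ ∞ (modeMomentum α m η η₁ j) x := by
  have hn : (‖x‖ : ℂ) ≠ 0 := by exact_mod_cast norm_ne_zero_iff.2 hx
  have c (i : Fin 2) : ContDiffAt ℝ ∞ (fun y : Plane => (y i : ℂ)) x :=
    (Complex.ofRealCLM.contDiff.comp (by fun_prop : ContDiff ℝ ∞ fun y : Plane => y i)).contDiffAt
  have d : ContDiffAt ℝ ∞ (fun y : Plane => (angularDir y j : ℂ)) x := by
    fin_cases j
    · simpa [angularDir] using (c 1).neg
    · simpa [angularDir] using c 0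
  have e : ContDiffAt ℝ ∞ (fun y : Plane => η (Real.log ‖y‖)) x :=
    hη.contDiffAt.comp x (contDiffAt_log_norm hx)
  have e₁ : ContDiffAt ℝ ∞ (fun y : Plane => η₁ (Real.log ‖y‖)) x :=
    hη₁.contDiffAt.comp x (contDiffAt_log_norm hx)
  have h1 : ContDiffAt ℝ ∞ (fun y : Plane => (‖y‖ : ℂ)) x :=
    Complex.ofRealCLM.contDiff.contDiffAt.comp x (contDiffAt_norm ℝ hx)
  unfold modeMomentum
  simp only [div_eq_mul_inv]
  exact ((((contDiffAt_const.mul e₁).mul (c j)).add ((contDiffAt_const.mul d).mul e)).mul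
    ((h1.pow 2).inv (pow_ne_zero 2 hn))).mul (contDiffAt_angular m hx)

/-- The magnetic Laplacian on a function of one angular momentum. -/
theorem sum_momentumFun_modeFun (hη : ContDiff ℝ ∞ η) (hη₁ : ContDiff ℝ ∞ η₁)
    (h1 : ∀ t, HasDerivAt η (η₁ t) t) (h2 : ∀ t, HasDerivAt η₁ (η₂ t) t) (hx : x ≠ 0) :
    ∑ j, momentumFun α j (momentumFun α j (modeFun m η)) x =
      (-η₂ (Real.log ‖x‖) + ((m : ℂ) + α) ^ 2 * η (Real.log ‖x‖)) / (‖x‖ : ℂ) ^ 2 *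
        angular m x := by
  have hn : (‖x‖ : ℂ) ≠ 0 := by exact_mod_cast norm_ne_zero_iff.2 hx
  have hsq : (‖x‖ : ℂ) ^ 2 = (x 0 : ℂ) ^ 2 + (x 1 : ℂ) ^ 2 := by exact_mod_cast norm_sq_eq x
  have step : ∀ j, momentumFun α j (momentumFun α j (modeFun m η)) x =
      ((-Complex.I * (-Complex.I * η₂ (Real.log ‖x‖) * (x j : ℂ) ^ 2 / (‖x‖ : ℂ) ^ 2 -
        Complex.I * η₁ (Real.log ‖x‖) + ((m : ℂ) + α) * (angularDir x j : ℂ) *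
        (η₁ (Real.log ‖x‖) * (x j : ℂ) / (‖x‖ : ℂ) ^ 2)) / (‖x‖ : ℂ) ^ 2) +
      (Complex.I * (2 * (x j : ℂ)) + ((m : ℂ) + α) * (angularDir x j : ℂ)) *
        (-Complex.I * η₁ (Real.log ‖x‖) * (x j : ℂ) +
        ((m : ℂ) + α) * (angularDir x j : ℂ) * η (Real.log ‖x‖)) / (‖x‖ : ℂ) ^ 4)
        * angular m x := by
    intro j
    have he : momentumFun α j (modeFun m η) =ᶠ[𝓝 x] modeMomentum α m η η₁ j := by
      filter_upwards [isOpen_ne.mem_nhds hx] with y hy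
      exact momentumFun_modeFun hη h1 j hy
    have hc : HasDerivAt (fun s => ((coordLine x j s) j : ℂ)) 1 0 := by
      simpa using (hasDerivAt_coord (x := x) j j).ofReal_comp
    have ha : HasDerivAt (fun s => (angularDir (coordLine x j s) j : ℂ)) 0 0 := by
      fin_cases j
      · simpa [angularDir, Pi.neg_def] using (hasDerivAt_coord (x := x) 0 1).ofReal_comp.neg
      · simpa [angularDir] using (hasDerivAt_coord (x := x) 1 0).ofReal_comp
    have hr : HasDerivAt (fun s => (‖coordLine x j s‖ : ℂ) ^ 2) (2 * (x j : ℂ)) 0 := by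
      simpa using (hasDerivAt_normSq (x := x) j).ofReal_comp
    have hd := ((((hasDerivAt_radial j hx h2).const_mul (-Complex.I)).mul hc).add
      ((ha.const_mul ((m : ℂ) + α)).mul (hasDerivAt_radial j hx h1))).div hr
      (by simpa using norm_ne_zero_iff.2 hx) |>.mul (hasDerivAt_angular j hx m)
    rw [momentumFun_congr he, momentumFun, fderiv_eq_of_hasDerivAt
      ((contDiffAt_modeMomentum hη hη₁ j hx).differentiableAt (by simp)) hd, vectorPotential_eq,
      modeMomentum]
    simp only [coordLine_zero, Pi.add_apply, Pi.mul_apply, Pi.div_apply]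
    push_cast
    field_simp
    generalize angular m x = e
    generalize η (Real.log ‖x‖) = a
    generalize η₁ (Real.log ‖x‖) = b
    generalize η₂ (Real.log ‖x‖) = c
    generalize (‖x‖ : ℂ) = r
    generalize (angularDir x j : ℂ) = d
    generalize (x j : ℂ) = y
    have hI := Complex.I_sq
    generalize Complex.I = I at *
    linear_combination (-(m : ℂ) * d * e * (-I * b * y + (m + α) * d * a)) * hI
  rw [Fin.sum_univ_two, step 0, step 1]
  simp only [angularDir, Matrix.cons_val_zero, Matrix.cons_val_one]
  push_cast
  have h4 : (‖x‖ : ℂ) ^ 4 = (‖x‖ : ℂ) ^ 2 * (‖x‖ : ℂ) ^ 2 := by ring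
  have hne : (x 0 : ℂ) ^ 2 + (x 1 : ℂ) ^ 2 ≠ 0 := hsq ▸ pow_ne_zero 2 hn
  rw [h4, hsq]
  field_simp
  generalize angular m x = e
  generalize η (Real.log ‖x‖) = a
  generalize η₁ (Real.log ‖x‖) = b
  generalize η₂ (Real.log ‖x‖) = c
  generalize (x 0 : ℂ) = y₀ at *
  generalize (x 1 : ℂ) = y₁ at *
  have hI := Complex.I_sq
  generalize Complex.I = I at *
  linear_combination e * (c * (y₀ ^ 2 + y₁ ^ 2)) * hI

end modes

theorem magneticLaplacian_apply (α : ℝ) (u : testSpace) (x : Plane) :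
    (magneticLaplacian α u : Plane → ℂ) x =
      ∑ j, momentumFun α j (momentumFun α j (u : Plane → ℂ)) x := by
  simp [magneticLaplacian, momentum]

/-! ### The adjoint operator -/

/-- A test function vanishes near the origin, so a singularity of `f` there does no harm. -/
theorem continuous_mul_test {f : Plane → ℂ} (hf : ∀ x ≠ 0, ContinuousAt f x) {u : Plane → ℂ}
    (hu : u ∈ testSpace) : Continuous fun x => f x * u x := by
  rw [continuous_iff_continuousAt]
  intro x
  by_cases hx : x ∈ tsupport u
  · have h0 : x ≠ 0 := fun h => hu.2.2 (h ▸ hx)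
    exact (hf x h0).mul hu.1.continuous.continuousAt
  · have : (fun x => f x * u x) =ᶠ[𝓝 x] fun _ => 0 := by
      filter_upwards [(isClosed_tsupport u).isOpen_compl.mem_nhds hx] with y hy
      rw [image_eq_zero_of_notMem_tsupport hy, mul_zero]
    exact continuousAt_const.congr this.symm

theorem integrable_mul_test {f : Plane → ℂ} (hf : ∀ x ≠ 0, ContinuousAt f x) {u : Plane → ℂ}
    (hu : u ∈ testSpace) : Integrable fun x => f x * u x :=
  (continuous_mul_test hf hu).integrable_of_hasCompactSupport hu.2.1.mul_left

theorem fderiv_mem_testSpace {u : Plane → ℂ} (hu : u ∈ testSpace) (v : Plane) :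
    (fun x => fderiv ℝ u x v) ∈ testSpace := by
  have hsub : tsupport (fun x => fderiv ℝ u x v) ⊆ tsupport u := tsupport_fderiv_apply_subset ℝ v
  exact ⟨(hu.1.fderiv_right (m := ∞) (by simp)).clm_apply contDiff_const,
    hu.2.1.mono' (subset_closure.trans hsub), fun h => hu.2.2 (hsub h)⟩

theorem contDiffAt_star {f : Plane → ℂ} {x : Plane} (h : ContDiffAt ℝ ∞ f x) :
    ContDiffAt ℝ ∞ (fun y => star (f y)) x :=
  Complex.conjCLE.contDiff.contDiffAt.comp x h

/-- Integration by parts for `-i∂_j`, while the potential is real. No boundary term arises at the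
origin, where `ψ` may be singular, because `u` is supported away from it. -/
theorem integral_star_mul_momentumFun (α : ℝ) (j : Fin 2) {ψ : Plane → ℂ}
    (hψ : ∀ x ≠ 0, ContDiffAt ℝ ∞ ψ x) {u : Plane → ℂ} (hu : u ∈ testSpace) :
    ∫ x, star (ψ x) * momentumFun α j u x = ∫ x, star (momentumFun α j ψ x) * u x := by
  set e : Plane := EuclideanSpace.single j (1 : ℝ)
  have c0 : ∀ x ≠ 0, ContinuousAt (fun x => star (ψ x)) x := fun x hx =>
    (hψ x hx).continuousAt.star
  have c1 : ∀ x ≠ 0, ContinuousAt (fun x => fderiv ℝ (fun y => star (ψ y)) x e) x := fun x hx =>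
    (((contDiffAt_star (hψ x hx)).fderiv_right (m := 0) (by simp)).clm_apply contDiffAt_const).continuousAt
  have c2 : ∀ x ≠ 0, ContinuousAt (fun x => star (ψ x) * (vectorPotential α x j : ℂ)) x :=
    fun x hx => (c0 x hx).mul (Complex.continuous_ofReal.continuousAt.comp
      (contDiffAt_vectorPotential α j hx).continuousAt)
  have ibp : ∫ x, star (ψ x) * fderiv ℝ u x e = -∫ x, fderiv ℝ (fun y => star (ψ y)) x e * u x :=
    integral_mul_fderiv_eq_neg_fderiv_mul_of_integrable (integrable_mul_test c1 hu)
      (integrable_mul_test c0 (fderiv_mem_testSpace hu e)) (integrable_mul_test c0 hu)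
      (fun x hx => (contDiffAt_star (hψ x fun h => hu.2.2 (h ▸ hx))).differentiableAt (by simp))
      (fun x _ => hu.1.differentiable (by simp) x)
  have l : ∫ x, star (ψ x) * momentumFun α j u x = -Complex.I * (∫ x, star (ψ x) * fderiv ℝ u x e)
      - ∫ x, (star (ψ x) * (vectorPotential α x j : ℂ)) * u x := by
    rw [← integral_const_mul, ← integral_sub
      ((integrable_mul_test c0 (fderiv_mem_testSpace hu e)).const_mul _) (integrable_mul_test c2 hu)]
    congr 1
    funext x
    simp only [momentumFun, e]
    ring
  have r : ∫ x, star (momentumFun α j ψ x) * u x =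
      Complex.I * (∫ x, fderiv ℝ (fun y => star (ψ y)) x e * u x)
      - ∫ x, (star (ψ x) * (vectorPotential α x j : ℂ)) * u x := by
    rw [← integral_const_mul, ← integral_sub ((integrable_mul_test c1 hu).const_mul _)
      (integrable_mul_test c2 hu)]
    congr 1
    funext x
    simp only [momentumFun, fderiv_star, e]
    simp
    ring
  rw [l, r, ibp]
  ring

/-- The functional `u ↦ ∫ f̄ u`. -/
def pairing (f u : Plane → ℂ) : ℂ := ∫ x, star (f x) * u x

theorem inner_testToL2 (f : L2Plane) (u : testSpace) :
    inner ℂ f (testToL2 u) = pairing f u := by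
  rw [L2.inner_def]
  refine integral_congr_ae ?_
  filter_upwards [(memLp_of_mem_testSpace u).coeFn_toLp] with x hx
  have hx' : (testToL2 u : L2Plane) x = (u : Plane → ℂ) x := hx
  rw [hx', RCLike.inner_apply']
  rfl

theorem pairing_congr {f g u : Plane → ℂ} (h : f =ᵐ[volume] g) : pairing f u = pairing g u := by
  refine integral_congr_ae ?_
  filter_upwards [h] with x hx
  rw [hx]

/-- A vector orthogonal to all test functions vanishes almost everywhere off the origin, which is a
null set. Density is what makes the adjoint determined by its pairing with test functions. -/
theorem dense_domain (α : ℝ) : Dense ((minimalOperator α).domain : Set L2Plane) := by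
  rw [Submodule.dense_iff_topologicalClosure_eq_top, Submodule.topologicalClosure_eq_top_iff,
    Submodule.eq_bot_iff]
  intro f hf
  have h1 : ∀ᵐ x ∂(volume : Measure Plane), x ∈ ({0}ᶜ : Set Plane) → star (f x) = 0 := by
    refine IsOpen.ae_eq_zero_of_integral_contDiff_smul_eq_zero isOpen_compl_singleton ?_ ?_
    · exact ((Lp.memLp f).star.locallyIntegrable (by norm_num)).locallyIntegrableOn _
    · intro g hg hc hs
      have hg' : (fun x => (g x : ℂ)) ∈ testSpace := by
        have hsub : tsupport (fun x => (g x : ℂ)) ⊆ tsupport g :=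
          closure_mono fun x hx => by simpa using hx
        exact ⟨Complex.ofRealCLM.contDiff.comp hg,
          hc.mono' (subset_closure.trans hsub), fun h => hs (hsub h) rfl⟩
      have h2 : inner ℂ (testToL2 ⟨_, hg'⟩) f = 0 := hf _ (LinearMap.mem_range_self _ _)
      rw [inner_eq_zero_symm, inner_testToL2] at h2
      rw [← h2, pairing]
      congr 1
      funext x
      simp [mul_comm]
  rw [Lp.eq_zero_iff_ae_eq_zero]
  have h0 : ∀ᵐ x ∂(volume : Measure Plane), x ≠ 0 := by
    simp [ae_iff]
  filter_upwards [h1, h0] with x hx hx0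
  simpa using hx hx0

theorem testToL2_mem_domain (α : ℝ) (u : testSpace) : testToL2 u ∈ (minimalOperator α).domain :=
  LinearMap.mem_range_self _ u

theorem minimalOperator_apply (α : ℝ) (u : testSpace) (h : testToL2 u ∈ (minimalOperator α).domain) :
    minimalOperator α ⟨testToL2 u, h⟩ = testToL2 (magneticLaplacian α u) := by
  change testToL2 (magneticLaplacian α ((LinearEquiv.ofInjective testToL2 testToL2_injective).symm
    ⟨testToL2 u, h⟩)) = _
  congr 2
  rw [LinearEquiv.symm_apply_eq]
  rfl

/-- By definition of the adjoint, `H_α^* f = z f` is the weak equation against test functions. The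
conjugate of `z` appears because the inner product is conjugate linear in its first argument. -/
theorem mem_eigenspace_hamiltonian {α : ℝ} {C D : Matrix (Fin 2) (Fin 2) ℂ} {z : ℂ} {f : L2Plane} :
    f ∈ eigenspace (hamiltonian α C D) z ↔ f ∈ boundaryCondition α C D ∧
      ∀ u : testSpace, pairing f (magneticLaplacian α u : testSpace) = star z * pairing f u := by
  have hd := dense_domain α
  constructor
  · rintro ⟨⟨g, hg⟩, hk, rfl⟩
    refine ⟨hg.1, fun u => ?_⟩
    have h1 : (hamiltonian α C D) ⟨g, hg⟩ = z • g := by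
      simpa [sub_eq_zero] using hk
    have h2 : (minimalOperator α).adjoint ⟨g, hg.2⟩ = z • g := h1
    have h3 := LinearPMap.adjoint_isFormalAdjoint hd ⟨g, hg.2⟩
      ⟨testToL2 u, testToL2_mem_domain α u⟩
    rw [h2, minimalOperator_apply, inner_smul_left] at h3
    have e1 := inner_testToL2 g u
    have e2 := inner_testToL2 g (magneticLaplacian α u)
    exact e2.symm.trans (h3.symm.trans (by rw [e1]; rfl))
  · rintro ⟨hb, h⟩
    have h1 : ∀ x : (minimalOperator α).domain, inner ℂ (z • f) (x : L2Plane) =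
        inner ℂ f (minimalOperator α x) := by
      rintro ⟨x, hx⟩
      obtain ⟨u, rfl⟩ : ∃ u, testToL2 u = x := hx
      change inner ℂ (z • f) (testToL2 u) =
        inner ℂ f (minimalOperator α ⟨testToL2 u, testToL2_mem_domain α u⟩)
      rw [minimalOperator_apply, inner_smul_left, inner_testToL2, inner_testToL2]
      exact (h u).symm
    have h2 : f ∈ (minimalOperator α).adjoint.domain :=
      LinearPMap.mem_adjoint_domain_of_exists f ⟨z • f, h1⟩
    refine ⟨⟨f, hb, h2⟩, ?_, rfl⟩
    have h3 : (minimalOperator α).adjoint ⟨f, h2⟩ = z • f :=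
      LinearPMap.adjoint_apply_eq hd _ h1
    have h4 : (hamiltonian α C D) ⟨f, hb, h2⟩ = z • f := h3
    simpa [sub_eq_zero] using h4

/-! ### Solutions of one angular momentum -/

/-- Bootstrapping: the system expresses the derivatives of `u` and `v` through `u` and `v` with
smooth coefficients. -/
theorem RadialSolution.contDiff {ν : ℝ} {z : ℂ} {u v : ℝ → ℂ} (h : RadialSolution ν z u v) :
    ContDiff ℝ ∞ u ∧ ContDiff ℝ ∞ v := by
  have du : deriv u = v := funext fun t => (h.deriv_fst t).deriv
  have dv : deriv v = fun t => ((ν : ℂ) ^ 2 - z * (Real.exp (2 * t) : ℂ)) * u t :=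
    funext fun t => (h.deriv_snd t).deriv
  have hQ : ContDiff ℝ ∞ fun t : ℝ => ((ν : ℂ) ^ 2 - z * (Real.exp (2 * t) : ℂ)) :=
    contDiff_const.sub (contDiff_const.mul (Complex.ofRealCLM.contDiff.comp
      (Real.contDiff_exp.comp (contDiff_const.mul contDiff_id))))
  have key : ∀ n : ℕ, ContDiff ℝ n u ∧ ContDiff ℝ n v := by
    intro n
    induction n with
    | zero =>
      exact ⟨contDiff_zero.2 h.continuous_fst, contDiff_zero.2 h.continuous_snd⟩
    | succ n ih =>
      rw [show ((n + 1 : ℕ) : WithTop ℕ∞) = n + 1 by push_cast; rfl]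
      constructor
      · refine contDiff_succ_iff_deriv.2 ⟨fun t => (h.deriv_fst t).differentiableAt, by simp, ?_⟩
        rw [du]; exact ih.2
      · refine contDiff_succ_iff_deriv.2 ⟨fun t => (h.deriv_snd t).differentiableAt, by simp, ?_⟩
        rw [dv]; exact (hQ.of_le (by exact_mod_cast le_top)).mul ih.1
  exact ⟨contDiff_infty.2 fun n => (key n).1, contDiff_infty.2 fun n => (key n).2⟩

/-- Both factors of each squared momentum are moved onto the mode, smooth off the origin; there the
operator acts as the radial one, which the equation turns into multiplication by `z`. This is the
direction that produces eigenfunctions. -/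
theorem pairing_modeFun_magneticLaplacian {α ν : ℝ} {m : ℤ} (hν : ν ^ 2 = (m + α) ^ 2) {z : ℂ}
    {k k' : ℝ → ℂ} (h : RadialSolution ν z k k') (u : testSpace) :
    pairing (modeFun m k) (magneticLaplacian α u : testSpace) =
      star z * pairing (modeFun m k) u := by
  obtain ⟨hk, hk'⟩ := h.contDiff
  have hψ : ∀ x : Plane, x ≠ 0 → ContDiffAt ℝ ∞ (modeFun m k) x := fun x hx =>
    contDiffAt_modeFun m hk hx
  have hmψ : ∀ j, ∀ x : Plane, x ≠ 0 → ContDiffAt ℝ ∞ (momentumFun α j (modeFun m k)) x := by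
    intro j x hx
    refine (contDiffAt_modeMomentum (α := α) (m := m) hk hk' j hx).congr_of_eventuallyEq ?_
    filter_upwards [isOpen_ne.mem_nhds hx] with y hy
    exact momentumFun_modeFun hk h.deriv_fst j hy
  have hsum : pairing (modeFun m k) (magneticLaplacian α u : testSpace) =
      ∫ x, star (∑ j, momentumFun α j (momentumFun α j (modeFun m k)) x) *
        (u : Plane → ℂ) x := by
    have hmom : ∀ j, momentumFun α j (u : Plane → ℂ) ∈ testSpace :=
      fun j => momentumFun_mem α j u.2
    have hmom2 : ∀ j, momentumFun α j (momentumFun α j (u : Plane → ℂ)) ∈ testSpace :=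
      fun j => momentumFun_mem α j (hmom j)
    have hc2 : ∀ j, ∀ x : Plane, x ≠ 0 →
        ContinuousAt (fun x => star (momentumFun α j (momentumFun α j (modeFun m k)) x)) x := by
      intro j x hx
      have e1 : ContDiffAt ℝ ∞ (fun y => fderiv ℝ (momentumFun α j (modeFun m k)) y
          (EuclideanSpace.single j 1)) x :=
        ((hmψ j x hx).fderiv_right (m := ∞) (by simp)).clm_apply contDiffAt_const
      have e2 : ContDiffAt ℝ ∞ (fun y : Plane => (vectorPotential α y j : ℂ)) x :=
        Complex.ofRealCLM.contDiff.contDiffAt.comp x (contDiffAt_vectorPotential α j hx)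
      exact ((contDiffAt_const.mul e1).sub (e2.mul (hmψ j x hx))).continuousAt.star
    rw [pairing]
    simp only [magneticLaplacian_apply, Fin.sum_univ_two, mul_add, star_add, add_mul]
    rw [integral_add (integrable_mul_test (fun x hx => (hψ x hx).continuousAt.star) (hmom2 0))
      (integrable_mul_test (fun x hx => (hψ x hx).continuousAt.star) (hmom2 1)),
      integral_add (integrable_mul_test (hc2 0) u.2) (integrable_mul_test (hc2 1) u.2)]
    congr 1
    · rw [integral_star_mul_momentumFun α 0 hψ (hmom 0), integral_star_mul_momentumFun α 0 (hmψ 0) u.2]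
    · rw [integral_star_mul_momentumFun α 1 hψ (hmom 1), integral_star_mul_momentumFun α 1 (hmψ 1) u.2]
  rw [hsum, pairing, ← integral_const_mul]
  refine integral_congr_ae ?_
  have h0 : ∀ᵐ x ∂(volume : Measure Plane), x ≠ 0 := by simp [ae_iff]
  filter_upwards [h0] with x hx
  have hn : (‖x‖ : ℂ) ≠ 0 := by exact_mod_cast norm_ne_zero_iff.2 hx
  have hexp : (Real.exp (2 * Real.log ‖x‖) : ℂ) = (‖x‖ : ℂ) ^ 2 := by
    have : Real.exp (2 * Real.log ‖x‖) = ‖x‖ ^ 2 := by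
      rw [show (2 : ℝ) * Real.log ‖x‖ = ((2 : ℕ) : ℝ) * Real.log ‖x‖ by norm_num, Real.exp_nat_mul,
        Real.exp_log (norm_pos_iff.2 hx)]
    rw [this]; push_cast; rfl
  have hν' : (ν : ℂ) ^ 2 = ((m : ℂ) + α) ^ 2 := by exact_mod_cast hν
  rw [sum_momentumFun_modeFun hk hk' h.deriv_fst h.deriv_snd hx, modeFun_of_ne hx, hexp, hν']
  rw [← mul_assoc, ← star_mul']
  congr 2
  field_simp
  ring

/-! ### Logarithmic polar coordinates -/

/-- The point with polar coordinates `r = e^t` and `θ`. -/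
def logPolar (p : ℝ × ℝ) : Plane :=
  WithLp.toLp 2 ![Real.exp p.1 * Real.cos p.2, Real.exp p.1 * Real.sin p.2]

/-- The measure `e^{2t} dt`. -/
def radialMeasure : Measure ℝ := volume.withDensity fun t => ENNReal.ofReal (Real.exp (2 * t))

/-- The Lebesgue measure on `(-π, π]`. -/
def angleMeasure : Measure ℝ := volume.restrict (Ioc (-Real.pi) Real.pi)

instance : SigmaFinite radialMeasure :=
  SigmaFinite.withDensity_ofReal _

instance : IsFiniteMeasure angleMeasure := by unfold angleMeasure; infer_instance

theorem measurable_ofReal_exp : Measurable fun t : ℝ => ENNReal.ofReal (Real.exp (2 * t)) := by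
  fun_prop

theorem radialMeasure_absolutelyContinuous : radialMeasure ≪ volume :=
  withDensity_absolutelyContinuous _ _

theorem absolutelyContinuous_radialMeasure : volume ≪ radialMeasure :=
  withDensity_absolutelyContinuous' measurable_ofReal_exp.aemeasurable
    (ae_of_all _ fun t => by simp [Real.exp_pos])

theorem continuous_logPolar : Continuous logPolar := by
  unfold logPolar
  refine (PiLp.continuous_toLp 2 _).comp (continuous_pi fun i => ?_)
  fin_cases i
  · simpa using by fun_prop
  · simpa using by fun_prop

theorem lintegral_Ioi_eq (g : ℝ → ℝ≥0∞) :
    ∫⁻ r in Ioi (0 : ℝ), g r = ∫⁻ t, ENNReal.ofReal (Real.exp t) * g (Real.exp t) := by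
  have h := lintegral_image_eq_lintegral_abs_deriv_mul (s := univ) (f := Real.exp)
    (f' := Real.exp) MeasurableSet.univ (fun x _ => (Real.hasDerivAt_exp x).hasDerivWithinAt)
    Real.exp_injective.injOn g
  rw [image_univ, Real.range_exp] at h
  simpa [abs_of_pos, Real.exp_pos] using h

/-- Polar coordinates followed by `r = e^t`, under which `r dr` becomes `e^{2t} dt`. -/
theorem measurePreserving_logPolar :
    MeasurePreserving logPolar (radialMeasure.prod angleMeasure) volume := by
  refine ⟨continuous_logPolar.measurable, ?_⟩
  refine Measure.ext_of_lintegral _ fun g hg => ?_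
  rw [lintegral_map hg continuous_logPolar.measurable]
  let e : ℝ × ℝ → Plane := fun p => WithLp.toLp 2 ![p.1, p.2]
  have hcomp : MeasurePreserving e volume volume := by
    have h1 := (volume_preserving_finTwoArrow ℝ).symm
    have h2 := (PiLp.volume_preserving_toLp (Fin 2)).comp h1
    have he : e = WithLp.toLp 2 ∘ ⇑(MeasurableEquiv.finTwoArrow (α := ℝ)).symm := by
      funext p
      refine congrArg (WithLp.toLp 2) (funext fun i => ?_)
      fin_cases i <;> rfl
    rw [he]
    exact h2
  have hge : Measurable fun p => g (e p) := hg.comp hcomp.measurable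
  rw [← hcomp.lintegral_comp hg, ← lintegral_comp_polarCoord_symm]
  have hm : Measurable fun p : ℝ × ℝ =>
      ENNReal.ofReal p.1 • g (e (polarCoord.symm p)) :=
    (by fun_prop : Measurable fun p : ℝ × ℝ => ENNReal.ofReal p.1).smul
      (hge.comp continuous_polarCoord_symm.measurable)
  have ht : (volume : Measure (ℝ × ℝ)).restrict polarCoord.target =
      (volume.restrict (Ioi 0)).prod angleMeasure := by
    rw [polarCoord_target, Measure.volume_eq_prod, ← Measure.prod_restrict, angleMeasure,
      Measure.restrict_congr_set Ioo_ae_eq_Ioc]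
  rw [ht, lintegral_prod_symm' _ hm,
    lintegral_prod_symm' (fun p => g (logPolar p)) (hg.comp continuous_logPolar.measurable)]
  refine lintegral_congr fun θ => ?_
  rw [lintegral_Ioi_eq, radialMeasure, lintegral_withDensity_eq_lintegral_mul _
    measurable_ofReal_exp (by
      exact (hg.comp continuous_logPolar.measurable).comp (by fun_prop))]
  refine lintegral_congr fun t => ?_
  simp only [Pi.mul_apply, smul_eq_mul]
  rw [← mul_assoc, ← ENNReal.ofReal_mul (Real.exp_pos t).le, ← Real.exp_add, two_mul]
  rfl

theorem norm_logPolar (p : ℝ × ℝ) : ‖logPolar p‖ = Real.exp p.1 := by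
  rw [← sq_eq_sq₀ (norm_nonneg _) (Real.exp_pos _).le, norm_sq_eq]
  simp only [logPolar, Matrix.cons_val_zero, Matrix.cons_val_one]
  linear_combination (Real.exp p.1) ^ 2 * Real.sin_sq_add_cos_sq p.2

theorem logPolar_ne_zero (p : ℝ × ℝ) : logPolar p ≠ 0 := by
  rw [← norm_pos_iff, norm_logPolar]; exact Real.exp_pos _

theorem angular_logPolar (m : ℤ) (p : ℝ × ℝ) :
    angular m (logPolar p) = Complex.exp (m * (p.2 * Complex.I)) := by
  rw [angular, norm_logPolar, Complex.exp_int_mul, Complex.exp_mul_I]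
  congr 1
  have : (Real.exp p.1 : ℂ) ≠ 0 := by exact_mod_cast (Real.exp_pos _).ne'
  simp only [planeCoord, logPolar, Matrix.cons_val_zero, Matrix.cons_val_one]
  push_cast [-Complex.ofReal_exp]
  field_simp

theorem modeFun_logPolar (m : ℤ) (η : ℝ → ℂ) (p : ℝ × ℝ) :
    modeFun m η (logPolar p) = η p.1 * Complex.exp (m * (p.2 * Complex.I)) := by
  rw [modeFun_of_ne (logPolar_ne_zero p), norm_logPolar, Real.log_exp, angular_logPolar]

theorem integral_radialMeasure (g : ℝ → ℂ) :
    ∫ t, g t ∂radialMeasure = ∫ t, (Real.exp (2 * t) : ℂ) * g t := by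
  rw [radialMeasure, integral_withDensity_eq_integral_toReal_smul measurable_ofReal_exp (by simp)]
  refine integral_congr_ae (ae_of_all _ fun t => ?_)
  simp only [ENNReal.toReal_ofReal (Real.exp_pos _).le]
  rw [Complex.real_smul]

theorem integrable_radialMeasure_iff {g : ℝ → ℝ} :
    Integrable g radialMeasure ↔ Integrable fun t => g t * Real.exp (2 * t) := by
  rw [radialMeasure, integrable_withDensity_iff measurable_ofReal_exp (by simp)]
  simp [ENNReal.toReal_ofReal (Real.exp_pos _).le]

/-- A square integrable function on `(-π, π]` without Fourier coefficients vanishes. -/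
theorem ae_eq_zero_of_fourier {g : ℝ → ℂ} (hg : MemLp g 2 angleMeasure)
    (h : ∀ m : ℤ, ∫ θ, g θ * Complex.exp (m * (θ * Complex.I)) ∂angleMeasure = 0) :
    g =ᵐ[angleMeasure] 0 := by
  have : Fact (0 < 2 * Real.pi) := ⟨by positivity⟩
  have hI : Ioc (-Real.pi) (-Real.pi + 2 * Real.pi) = Ioc (-Real.pi) Real.pi := by
    congr 1; ring
  have hL : MemLp (AddCircle.liftIoc (2 * Real.pi) (-Real.pi) g) 2 AddCircle.haarAddCircle := by
    refine (MemLp.memLp_liftIoc ?_).haarAddCircle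
    rw [hI]; exact hg
  have hco : ∀ n, fourierCoeff (AddCircle.liftIoc (2 * Real.pi) (-Real.pi) g) n = 0 := by
    intro n
    have e : fourierCoeff (AddCircle.liftIoc (2 * Real.pi) (-Real.pi) g) n =
        (1 / (2 * Real.pi)) • ∫ θ in (-Real.pi)..(-Real.pi + 2 * Real.pi),
          g θ * Complex.exp ((-n : ℤ) * (θ * Complex.I)) := by
      rw [fourierCoeff_eq_intervalIntegral _ n (-Real.pi)]
      congr 1
      refine intervalIntegral.integral_congr_ae (ae_of_all _ fun x hx => ?_)
      rw [uIoc_of_le (by linarith [Real.pi_pos])] at hx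
      rw [AddCircle.liftIoc_coe_apply hx, fourier_coe_apply, smul_eq_mul, mul_comm]
      congr 2
      have : (Real.pi : ℂ) ≠ 0 := by exact_mod_cast Real.pi_ne_zero
      push_cast
      field_simp
    rw [e, intervalIntegral.integral_of_le (by linarith [Real.pi_pos]), hI]
    have := h (-n)
    rw [angleMeasure] at this
    rw [this, smul_zero]
  -- Completeness of the Fourier basis on the circle of length `2π`.
  have hz : hL.toLp _ = 0 := by
    apply (fourierBasis (T := 2 * Real.pi)).repr.injective
    ext n
    rw [fourierBasis_repr, fourierCoeff_congr_ae hL.coeFn_toLp, hco]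
    simp
  have hz' : AddCircle.liftIoc (2 * Real.pi) (-Real.pi) g =ᵐ[AddCircle.haarAddCircle] 0 :=
    hL.coeFn_toLp.symm.trans (by rw [hz]; exact Lp.coeFn_zero _ _ _)
  have hz2 : AddCircle.liftIoc (2 * Real.pi) (-Real.pi) g =ᵐ[volume] 0 := by
    rw [AddCircle.volume_eq_smul_haarAddCircle]
    exact Measure.ae_smul_measure hz' _
  have h3 := (AddCircle.measurePreserving_mk (2 * Real.pi) (-Real.pi)).quasiMeasurePreserving.ae hz2
  rw [hI] at h3
  rw [angleMeasure]
  filter_upwards [h3, ae_restrict_mem measurableSet_Ioc] with x hx hm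
  rw [AddCircle.liftIoc_coe_apply (by rw [hI]; exact hm)] at hx
  exact hx

/-! ### Angular decomposition of square integrable functions -/

/-- The conjugate of the Fourier coefficient of `f` on the circle of radius `e^t`. -/
def modeCoeff (m : ℤ) (f : Plane → ℂ) (t : ℝ) : ℂ :=
  ∫ θ, star (f (logPolar (t, θ))) * Complex.exp (m * (θ * Complex.I)) ∂angleMeasure

section

variable {f : Plane → ℂ}

theorem continuous_phase (m : ℤ) : Continuous fun p : ℝ × ℝ => Complex.exp (m * (p.2 * Complex.I)) := by
  fun_prop

theorem norm_phase (m : ℤ) (θ : ℝ) : ‖Complex.exp (m * (θ * Complex.I))‖ = 1 := by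
  rw [← mul_assoc, show (m : ℂ) * (θ : ℂ) * Complex.I = ((m * θ : ℝ) : ℂ) * Complex.I by push_cast; rfl]
  exact Complex.norm_exp_ofReal_mul_I _

theorem memLp_mode (hf : MemLp f 2 volume) (m : ℤ) :
    MemLp (fun p : ℝ × ℝ => star (f (logPolar p)) * Complex.exp (m * (p.2 * Complex.I))) 2
      (radialMeasure.prod angleMeasure) := by
  have h := (hf.comp_measurePreserving measurePreserving_logPolar).star
  refine h.of_le (h.1.mul (continuous_phase m).aestronglyMeasurable) (ae_of_all _ fun p => ?_)
  rw [norm_mul, norm_phase, mul_one]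
  exact le_rfl

theorem ae_memLp_slice (hf : MemLp f 2 volume) :
    ∀ᵐ t ∂radialMeasure, MemLp (fun θ => f (logPolar (t, θ))) 2 angleMeasure := by
  have h := hf.comp_measurePreserving measurePreserving_logPolar
  have h2 := (memLp_two_iff_integrable_sq_norm h.1).1 h
  filter_upwards [h2.prod_right_ae, h.1.prodMk_left] with t ht ht'
  exact (memLp_two_iff_integrable_sq_norm ht').2 ht

theorem aestronglyMeasurable_modeCoeff (hf : MemLp f 2 volume) (m : ℤ) :
    AEStronglyMeasurable (modeCoeff m f) radialMeasure :=
  (memLp_mode hf m).1.integral_prod_right'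

/-- Cauchy-Schwarz on a space of mass `2π`, from the nonnegativity of `∫ (2π‖g‖ - I)²`. -/
theorem sq_integral_norm_le {g : ℝ → ℂ} (hg : MemLp g 2 angleMeasure) :
    ‖∫ θ, g θ ∂angleMeasure‖ ^ 2 ≤ 2 * Real.pi * ∫ θ, ‖g θ‖ ^ 2 ∂angleMeasure := by
  have h1 : Integrable g angleMeasure := hg.integrable (by norm_num)
  have h2 := (memLp_two_iff_integrable_sq_norm hg.1).1 hg
  set I := ∫ θ, ‖g θ‖ ∂angleMeasure with hI
  have hI0 : 0 ≤ I := integral_nonneg fun _ => norm_nonneg _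
  have hle : ‖∫ θ, g θ ∂angleMeasure‖ ≤ I := norm_integral_le_integral_norm _
  have hmass : angleMeasure.real univ = 2 * Real.pi := by
    have : 0 ≤ Real.pi - -Real.pi := by linarith [Real.pi_pos]
    simp only [angleMeasure, measureReal_restrict_apply_univ, Real.volume_real_Ioc,
      max_eq_left this]
    ring
  have h3 : 0 ≤ ∫ θ, (2 * Real.pi * ‖g θ‖ - I) ^ 2 ∂angleMeasure :=
    integral_nonneg fun _ => sq_nonneg _
  have h4 : ∫ θ, (2 * Real.pi * ‖g θ‖ - I) ^ 2 ∂angleMeasure =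
      (2 * Real.pi) ^ 2 * (∫ θ, ‖g θ‖ ^ 2 ∂angleMeasure) - 2 * (2 * Real.pi) * I * I +
        I ^ 2 * (2 * Real.pi) := by
    have : (fun θ => (2 * Real.pi * ‖g θ‖ - I) ^ 2) = fun θ =>
        ((2 * Real.pi) ^ 2 * ‖g θ‖ ^ 2 - (2 * (2 * Real.pi) * I) * ‖g θ‖) + I ^ 2 := by
      funext θ; ring
    have i1 : Integrable (fun θ => (2 * Real.pi) ^ 2 * ‖g θ‖ ^ 2) angleMeasure := h2.const_mul _
    have i2 : Integrable (fun θ => (2 * (2 * Real.pi) * I) * ‖g θ‖) angleMeasure :=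
      h1.norm.const_mul _
    have i3 : Integrable (fun θ => (2 * Real.pi) ^ 2 * ‖g θ‖ ^ 2 -
      (2 * (2 * Real.pi) * I) * ‖g θ‖) angleMeasure := i1.sub i2
    rw [this, integral_add i3 (integrable_const _), integral_sub i1 i2, integral_const_mul, integral_const_mul,
      integral_const, hmass, ← hI]
    simp only [smul_eq_mul]
    ring
  rw [h4] at h3
  have h5 : I ^ 2 ≤ 2 * Real.pi * ∫ θ, ‖g θ‖ ^ 2 ∂angleMeasure := by
    have := Real.pi_pos
    nlinarith
  exact (pow_le_pow_left₀ (norm_nonneg _) hle 2).trans h5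

/-- Cauchy-Schwarz on each circle, then Fubini. -/
theorem radialL2_modeCoeff (hf : MemLp f 2 volume) (m : ℤ) :
    Integrable fun t => ‖modeCoeff m f t‖ ^ 2 * Real.exp (2 * t) := by
  rw [← integrable_radialMeasure_iff (g := fun t => ‖modeCoeff m f t‖ ^ 2)]
  have h := memLp_mode hf m
  have h2 := (memLp_two_iff_integrable_sq_norm h.1).1 h
  refine Integrable.mono' (h2.integral_prod_left.const_mul (2 * Real.pi))
    ((aestronglyMeasurable_modeCoeff hf m).norm.pow 2) ?_
  filter_upwards [h2.prod_right_ae, h.1.prodMk_left] with t ht ht'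
  rw [Real.norm_of_nonneg (sq_nonneg _)]
  exact sq_integral_norm_le ((memLp_two_iff_integrable_sq_norm ht').2 ht)

/-- The product with `e^t` lies in `L²(dt)`, and multiplication by the continuous function `e^{-t}`
undoes it. -/
theorem locallyIntegrable_modeCoeff (hf : MemLp f 2 volume) (m : ℤ) :
    LocallyIntegrable (modeCoeff m f) := by
  have hm : AEStronglyMeasurable (modeCoeff m f) volume :=
    (aestronglyMeasurable_modeCoeff hf m).mono_ac absolutelyContinuous_radialMeasure
  have hc : Continuous fun t : ℝ => (Real.exp t : ℂ) := by fun_prop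
  have h1 : MemLp (fun t => modeCoeff m f t * (Real.exp t : ℂ)) 2 volume := by
    have hmc : AEStronglyMeasurable (fun t => modeCoeff m f t * (Real.exp t : ℂ)) volume :=
      hm.mul hc.aestronglyMeasurable
    rw [memLp_two_iff_integrable_sq_norm hmc]
    refine (radialL2_modeCoeff hf m).congr (ae_of_all _ fun t => ?_)
    simp only [norm_mul, mul_pow, Complex.norm_real, Real.norm_of_nonneg (Real.exp_pos t).le]
    rw [two_mul, Real.exp_add, sq (Real.exp t)]
  have h2 : LocallyIntegrable (fun t => modeCoeff m f t * (Real.exp t : ℂ)) :=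
    h1.locallyIntegrable (by norm_num)
  have hc' : Continuous fun t : ℝ => (Real.exp (-t) : ℂ) := by fun_prop
  refine (LocallyIntegrable.mul_continuous hc' h2).congr (ae_of_all _ fun t => ?_)
  simp only [mul_assoc]
  rw [← Complex.ofReal_mul, ← Real.exp_add]
  simp

/-- Fubini in logarithmic polar coordinates; the conjugate in `modeCoeff` is the one of the inner
product. -/
theorem pairing_modeFun (hf : MemLp f 2 volume) (m : ℤ) {g : ℝ → ℂ} (hg : modeFun m g ∈ testSpace) :
    pairing f (modeFun m g) = ∫ t, (Real.exp (2 * t) : ℂ) * (g t * modeCoeff m f t) := by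
  have hL : MemLp (modeFun m g) 2 volume := memLp_of_mem_testSpace ⟨_, hg⟩
  have hint : Integrable (fun x => star (f x) * modeFun m g x) volume :=
    hf.star.integrable_mul hL
  rw [pairing, ← measurePreserving_logPolar.map_eq, integral_map
    continuous_logPolar.measurable.aemeasurable
    (by rw [measurePreserving_logPolar.map_eq]; exact hint.1)]
  have hint2 : Integrable (fun p => star (f (logPolar p)) * modeFun m g (logPolar p))
      (radialMeasure.prod angleMeasure) :=
    measurePreserving_logPolar.integrable_comp_of_integrable hint
  rw [integral_prod _ hint2, ← integral_radialMeasure]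
  refine integral_congr_ae (ae_of_all _ fun t => ?_)
  simp only [modeCoeff]
  rw [← integral_const_mul]
  refine integral_congr_ae (ae_of_all _ fun θ => ?_)
  simp only [modeFun_logPolar]
  ring

theorem ae_eq_of_ae_comp_logPolar {f g : Plane → ℂ} (hf : StronglyMeasurable f)
    (hg : StronglyMeasurable g)
    (h : ∀ᵐ p ∂(radialMeasure.prod angleMeasure), f (logPolar p) = g (logPolar p)) :
    f =ᵐ[volume] g := by
  rw [← measurePreserving_logPolar.map_eq]
  exact (ae_map_iff continuous_logPolar.measurable.aemeasurable
    (measurableSet_eq_fun hf.measurable hg.measurable)).2 h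

/-- Testing the weak equation with `η(log r) e^{imθ}` and integrating over the angle leaves the weak
radial equation. The energy is conjugated because the coefficient belongs to the conjugate of `f`.
-/
theorem exists_radialSolution_modeCoeff (hf : MemLp f 2 volume) {α : ℝ} {z : ℂ}
    (h : ∀ u : testSpace, pairing f (magneticLaplacian α u : testSpace) = star z * pairing f u)
    (m : ℤ) {ν : ℝ} (hν : ν ^ 2 = (m + α) ^ 2) :
    ∃ u v : ℝ → ℂ, RadialSolution ν (star z) u v ∧ RadialL2 u ∧ modeCoeff m f =ᵐ[volume] u := by
  obtain ⟨u, v, hs, hu⟩ := exists_radialSolution (ν := ν) (z := star z)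
    (locallyIntegrable_modeCoeff hf m) (by
    intro η η₁ η₂ hη hc h1 h2
    have hη₁ : ContDiff ℝ ∞ η₁ := by
      have : η₁ = deriv η := funext fun t => (h1 t).deriv.symm
      rw [this]; exact contDiff_infty_iff_deriv.1 hη |>.2
    have hη₂ : ContDiff ℝ ∞ η₂ := by
      have : η₂ = deriv η₁ := funext fun t => (h2 t).deriv.symm
      rw [this]; exact contDiff_infty_iff_deriv.1 hη₁ |>.2
    have hc₂ : HasCompactSupport η₂ := by
      have e1 : η₁ = deriv η := funext fun t => (h1 t).deriv.symm
      have e2 : η₂ = deriv η₁ := funext fun t => (h2 t).deriv.symm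
      rw [e2, e1]
      exact hc.deriv.deriv
    have cx : ∀ {g : ℝ → ℝ}, ContDiff ℝ ∞ g → ContDiff ℝ ∞ fun t => (g t : ℂ) := fun hg =>
      Complex.ofRealCLM.contDiff.comp hg
    have cc : ∀ {g : ℝ → ℝ}, HasCompactSupport g → HasCompactSupport fun t => (g t : ℂ) :=
      fun hg => hg.comp_left (g := fun x : ℝ => (x : ℂ)) Complex.ofReal_zero
    set w : testSpace := ⟨modeFun m fun t => (η t : ℂ), modeFun_mem_testSpace m (cx hη) (cc hc)⟩
    -- The radial profile of the magnetic Laplacian of `w`; its factor `e^{-2t}` cancels the density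
    -- `e^{2t}`.
    set g₂ : ℝ → ℂ := fun t => (Real.exp (-2 * t) : ℂ) * (-(η₂ t : ℂ) + ((m : ℂ) + α) ^ 2 * η t)
    have hg₂ : ContDiff ℝ ∞ g₂ :=
      (cx (Real.contDiff_exp.comp (contDiff_const.mul contDiff_id))).mul
        ((cx hη₂).neg.add (contDiff_const.mul (cx hη)))
    have hcg₂ : HasCompactSupport g₂ := by
      have : HasCompactSupport fun t => (-(η₂ t : ℂ) + ((m : ℂ) + α) ^ 2 * η t) :=
        (cc hc₂).neg.add ((cc hc).mul_left (f := fun _ => ((m : ℂ) + α) ^ 2))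
      exact this.mul_left (f := fun t : ℝ => (Real.exp (-2 * t) : ℂ))
    have hw : ((magneticLaplacian α w : testSpace) : Plane → ℂ) = modeFun m g₂ := by
      -- Both sides are continuous, so it suffices to compare them off the origin.
      have h0 : (((magneticLaplacian α w : testSpace) : Plane → ℂ)) =ᵐ[volume] modeFun m g₂ := by
        have h0 : ∀ᵐ x ∂(volume : Measure Plane), x ≠ 0 := by simp [ae_iff]
        filter_upwards [h0] with x hx
        have hp : 0 < ‖x‖ := norm_pos_iff.2 hx
        have hn : (‖x‖ : ℂ) ≠ 0 := by exact_mod_cast hp.ne'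
        have hexp : (Real.exp (-2 * Real.log ‖x‖) : ℂ) = ((‖x‖ : ℂ) ^ 2)⁻¹ := by
          have : Real.exp (-2 * Real.log ‖x‖) = (‖x‖ ^ 2)⁻¹ := by
            rw [neg_mul, Real.exp_neg, show (2 : ℝ) * Real.log ‖x‖ = ((2 : ℕ) : ℝ) * Real.log ‖x‖ by
              norm_num, Real.exp_nat_mul, Real.exp_log hp]
          rw [this]; push_cast; rfl
        rw [magneticLaplacian_apply, sum_momentumFun_modeFun (cx hη) (cx hη₁)
          (fun t => (h1 t).ofReal_comp) (fun t => (h2 t).ofReal_comp) hx, modeFun_of_ne hx]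
        simp only [g₂, hexp]
        rw [div_eq_mul_inv]
        ring
      exact ((magneticLaplacian α w).2.1.continuous.ae_eq_iff_eq volume
        (modeFun_mem_testSpace m hg₂ hcg₂).1.continuous).1 h0
    have key := h w
    rw [hw, pairing_modeFun hf m (modeFun_mem_testSpace m hg₂ hcg₂),
      pairing_modeFun hf m (modeFun_mem_testSpace m (cx hη) (cc hc))] at key
    have hF := locallyIntegrable_modeCoeff hf m
    have int : ∀ {g : ℝ → ℂ}, Continuous g → HasCompactSupport g →
        Integrable fun t => g t * modeCoeff m f t := fun hg hgc =>
      hF.integrable_smul_left_of_hasCompactSupport hg hgc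
    have e1 : ∀ t, (Real.exp (2 * t) : ℂ) * (g₂ t * modeCoeff m f t) =
        (ν : ℂ) ^ 2 * ((η t : ℂ) * modeCoeff m f t) - (η₂ t : ℂ) * modeCoeff m f t := by
      intro t
      have hν' : (ν : ℂ) ^ 2 = ((m : ℂ) + α) ^ 2 := by exact_mod_cast hν
      have he : (Real.exp (2 * t) : ℂ) * (Real.exp (-2 * t) : ℂ) = 1 := by
        rw [← Complex.ofReal_mul, ← Real.exp_add]; simp
      simp only [g₂]
      rw [hν']
      linear_combination ((-(η₂ t : ℂ) + ((m : ℂ) + α) ^ 2 * η t) * modeCoeff m f t) * he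
    have i1 : Integrable fun t => (η t : ℂ) * modeCoeff m f t := int (cx hη).continuous (cc hc)
    have i2 : Integrable fun t => (η₂ t : ℂ) * modeCoeff m f t := int (cx hη₂).continuous (cc hc₂)
    have i3 : Integrable fun t => (Real.exp (2 * t) : ℂ) * ((η t : ℂ) * modeCoeff m f t) := by
      have := int (g := fun t => (Real.exp (2 * t) : ℂ) * (η t : ℂ))
        ((by fun_prop : Continuous fun t : ℝ => (Real.exp (2 * t) : ℂ)).mul (cx hη).continuous)
        ((cc hc).mul_left (f := fun t : ℝ => (Real.exp (2 * t) : ℂ)))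
      simpa only [mul_assoc] using this
    simp only [e1] at key
    rw [integral_sub (i1.const_mul _) i2, integral_const_mul] at key
    have e2 : ∀ t, (η t : ℂ) * (((ν : ℂ) ^ 2 - star z * (Real.exp (2 * t) : ℂ)) * modeCoeff m f t) =
        (ν : ℂ) ^ 2 * ((η t : ℂ) * modeCoeff m f t) -
          star z * ((Real.exp (2 * t) : ℂ) * ((η t : ℂ) * modeCoeff m f t)) := fun t => by ring
    simp only [e2]
    rw [integral_sub (i1.const_mul _) (i3.const_mul _), integral_const_mul, integral_const_mul]
    linear_combination -key)
  refine ⟨u, v, hs, ?_, hu⟩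
  refine (radialL2_modeCoeff hf m).congr ?_
  filter_upwards [hu] with t ht
  rw [ht]

end

theorem RadialSolution.const_mul {ν : ℝ} {z : ℂ} {u v : ℝ → ℂ} (h : RadialSolution ν z u v) (c : ℂ) :
    RadialSolution ν z (fun t => c * u t) (fun t => c * v t) where
  deriv_fst t := (h.deriv_fst t).const_mul c
  deriv_snd t := ((h.deriv_snd t).const_mul c).congr_deriv (by ring)

theorem RadialL2.const_mul {u : ℝ → ℂ} (h : RadialL2 u) (c : ℂ) : RadialL2 fun t => c * u t := by
  refine (Integrable.const_mul h (‖c‖ ^ 2)).congr (ae_of_all _ fun t => ?_)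
  simp only [norm_mul]
  ring

theorem integral_phase (n : ℤ) :
    ∫ θ, Complex.exp (n * (θ * Complex.I)) ∂angleMeasure = if n = 0 then 2 * (Real.pi : ℂ) else 0 := by
  have hle : -Real.pi ≤ Real.pi := by linarith [Real.pi_pos]
  rw [angleMeasure, ← intervalIntegral.integral_of_le hle]
  by_cases hn : n = 0
  · simp [hn]
    ring
  · have hc : (n : ℂ) * Complex.I ≠ 0 := mul_ne_zero (by exact_mod_cast hn) Complex.I_ne_zero
    have e : ∀ θ : ℝ, Complex.exp (n * (θ * Complex.I)) = Complex.exp (n * Complex.I * θ) :=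
      fun θ => by congr 1; ring
    simp only [e]
    rw [integral_exp_mul_complex hc, if_neg hn]
    have : Complex.exp (n * Complex.I * (Real.pi : ℝ)) =
        Complex.exp (n * Complex.I * ((-Real.pi : ℝ) : ℂ)) :=
      Complex.exp_eq_exp_iff_exists_int.2 ⟨n, by push_cast; ring⟩
    rw [this, sub_self, zero_div]

theorem measurable_angular (m : ℤ) : Measurable (angular m) := by
  have h : Measurable fun x : Plane => planeCoord x / (‖x‖ : ℂ) :=
    contDiff_planeCoord.continuous.measurable.div
      (Complex.measurable_ofReal.comp measurable_norm)
  cases m with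
  | ofNat n =>
    have : angular (Int.ofNat n) = fun x => (planeCoord x / (‖x‖ : ℂ)) ^ n := by
      funext x; simp [angular]
    rw [this]; exact h.pow_const n
  | negSucc n =>
    have : angular (Int.negSucc n) = fun x => ((planeCoord x / (‖x‖ : ℂ)) ^ (n + 1))⁻¹ := by
      funext x; simp only [angular, zpow_negSucc]
    rw [this]; exact (h.pow_const _).inv

theorem measurable_modeFun (m : ℤ) {η : ℝ → ℂ} (hη : Continuous η) : Measurable (modeFun m η) := by
  refine Measurable.ite (measurableSet_singleton 0) measurable_const ?_
  exact (hη.measurable.comp (Real.measurable_log.comp measurable_norm)).mul (measurable_angular m)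

section

variable {α : ℝ} {z : ℂ} {f : Plane → ℂ}

/-- Subtracting the two possible modes from the conjugate of `g` leaves a function without Fourier
coefficients, hence zero. -/
theorem ae_slice_eq {g : ℝ → ℂ} (hg : MemLp g 2 angleMeasure) (c₀ c₁ : ℂ)
    (h : ∀ m : ℤ, ∫ θ, star (g θ) * Complex.exp (m * (θ * Complex.I)) ∂angleMeasure =
      if m = 0 then c₀ else if m = -1 then c₁ else 0) :
    ∀ᵐ θ ∂angleMeasure, g θ = 1 / (2 * (Real.pi : ℂ)) * star c₀ +
      1 / (2 * (Real.pi : ℂ)) * star c₁ * Complex.exp ((-1 : ℤ) * (θ * Complex.I)) := by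
  set k : ℂ := 1 / (2 * (Real.pi : ℂ)) with hk
  have hk' : k * (2 * (Real.pi : ℂ)) = 1 := by
    have : (Real.pi : ℂ) ≠ 0 := by exact_mod_cast Real.pi_ne_zero
    rw [hk]; field_simp
  have bnd : ∀ n : ℤ, MemLp (fun θ : ℝ => Complex.exp (n * (θ * Complex.I))) 2 angleMeasure :=
    fun n => MemLp.of_bound (by fun_prop) 1 (ae_of_all _ fun θ => (norm_phase n θ).le)
  have hd : MemLp (fun θ => star (g θ) - (k * c₀ * Complex.exp ((0 : ℤ) * (θ * Complex.I)) +
      k * c₁ * Complex.exp ((1 : ℤ) * (θ * Complex.I)))) 2 angleMeasure :=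
    hg.star.sub (((bnd 0).const_mul _).add ((bnd 1).const_mul _))
  have int : ∀ n : ℤ, Integrable (fun θ : ℝ => Complex.exp (n * (θ * Complex.I))) angleMeasure :=
    fun n => (bnd n).integrable (by norm_num)
  have h0 := ae_eq_zero_of_fourier hd (by
    intro m
    have i1 : Integrable (fun θ => star (g θ) * Complex.exp (m * (θ * Complex.I))) angleMeasure :=
      hg.star.integrable_mul (bnd m)
    have e : ∀ θ : ℝ, (star (g θ) - (k * c₀ * Complex.exp ((0 : ℤ) * (θ * Complex.I)) +
        k * c₁ * Complex.exp ((1 : ℤ) * (θ * Complex.I)))) * Complex.exp (m * (θ * Complex.I)) =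
        star (g θ) * Complex.exp (m * (θ * Complex.I)) -
          (k * c₀ * Complex.exp (m * (θ * Complex.I)) +
            k * c₁ * Complex.exp ((m + 1 : ℤ) * (θ * Complex.I))) := by
      intro θ
      have : Complex.exp ((m + 1 : ℤ) * (θ * Complex.I)) = Complex.exp ((1 : ℤ) * (θ * Complex.I)) *
          Complex.exp (m * (θ * Complex.I)) := by
        rw [← Complex.exp_add]; congr 1; push_cast; ring
      rw [this]
      simp
      ring
    simp only [e]
    have i2 : Integrable (fun θ : ℝ => k * c₀ * Complex.exp (m * (θ * Complex.I))) angleMeasure :=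
      (int m).const_mul _
    have i3 : Integrable (fun θ : ℝ => k * c₁ * Complex.exp ((m + 1 : ℤ) * (θ * Complex.I)))
      angleMeasure := (int (m + 1)).const_mul _
    have i4 : Integrable (fun θ : ℝ => k * c₀ * Complex.exp (m * (θ * Complex.I)) +
      k * c₁ * Complex.exp ((m + 1 : ℤ) * (θ * Complex.I))) angleMeasure := i2.add i3
    rw [integral_sub i1 i4, integral_add i2 i3, integral_const_mul, integral_const_mul,
      integral_phase, integral_phase, h m]
    by_cases hm0 : m = 0
    · simp [hm0]
      linear_combination -c₀ * hk'
    · by_cases hm1 : m = -1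
      · simp [hm1]
        linear_combination -c₁ * hk'
      · have : m + 1 ≠ 0 := by omega
        simp [hm0, hm1, this])
  filter_upwards [h0] with θ hθ
  have h1 : star (g θ) = k * c₀ * Complex.exp ((0 : ℤ) * (θ * Complex.I)) +
      k * c₁ * Complex.exp ((1 : ℤ) * (θ * Complex.I)) := sub_eq_zero.1 hθ
  have h2 := congrArg star h1
  rw [star_star] at h2
  have hks : star k = k := by rw [hk]; simp
  have he : star (Complex.exp ((1 : ℤ) * (θ * Complex.I))) =
      Complex.exp ((-1 : ℤ) * (θ * Complex.I)) := by
    rw [← starRingEnd_apply, ← Complex.exp_conj]; simp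
  rw [h2, star_add, star_mul', star_mul', star_mul', star_mul', hks, he]
  simp

/-- For `m` different from `0` and `-1` the index `|m + α|` exceeds `1`, so the coefficient solves a
radial equation without square integrable solutions. Almost every circle then carries just two
modes, recovered by conjugating and dividing by `2π`. -/
theorem exists_modes (h0 : 0 < α) (h1 : α < 1) (hf : MemLp f 2 volume) (hfm : StronglyMeasurable f)
    (h : ∀ u : testSpace, pairing f (magneticLaplacian α u : testSpace) = star z * pairing f u) :
    ∃ u v u' v' : ℝ → ℂ, RadialSolution α z u v ∧ RadialL2 u ∧ RadialSolution (1 - α) z u' v' ∧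
      RadialL2 u' ∧ f =ᵐ[volume] fun x => modeFun 0 u x + modeFun (-1) u' x := by
  obtain ⟨w, w₁, hw, hwL, hwe⟩ := exists_radialSolution_modeCoeff hf h 0 (ν := α) (by simp)
  obtain ⟨y, y₁, hy, hyL, hye⟩ := exists_radialSolution_modeCoeff hf h (-1) (ν := 1 - α)
    (by push_cast; ring)
  have hrest : ∀ m : ℤ, m ≠ 0 → m ≠ -1 → modeCoeff m f =ᵐ[volume] 0 := by
    intro m hm0 hm1
    obtain ⟨u, v, hu, huL, hue⟩ := exists_radialSolution_modeCoeff hf h m (ν := |(m : ℝ) + α|)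
      (sq_abs _)
    have : 1 < |(m : ℝ) + α| := by
      rcases lt_or_gt_of_ne hm0 with hm | hm
      · have : (m : ℝ) ≤ -2 := by exact_mod_cast (by omega : m ≤ -2)
        rw [abs_of_neg (by linarith)]
        linarith
      · have : (1 : ℝ) ≤ m := by exact_mod_cast hm
        rw [abs_of_pos (by linarith)]
        linarith
    rw [hu.eq_zero_of_one_lt this huL] at hue
    exact hue
  set k : ℂ := 1 / (2 * (Real.pi : ℂ)) with hk
  have sol : ∀ {ν : ℝ} {a b : ℝ → ℂ}, RadialSolution ν (star z) a b → RadialSolution ν z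
      (fun t => k * star (a t)) (fun t => k * star (b t)) := fun ha => by
    have := ha.conj.const_mul k
    rwa [star_star] at this
  refine ⟨_, _, _, _, sol hw, hwL.conj.const_mul k, sol hy, hyL.conj.const_mul k, ?_⟩
  have hmeas : Measurable fun x => modeFun 0 (fun t => k * star (w t)) x +
      modeFun (-1) (fun t => k * star (y t)) x :=
    (measurable_modeFun 0 (sol hw).continuous_fst).add (measurable_modeFun _ (sol hy).continuous_fst)
  refine ae_eq_of_ae_comp_logPolar hfm hmeas.stronglyMeasurable ?_
  refine (Measure.ae_prod_iff_ae_ae (measurableSet_eq_fun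
    (hfm.measurable.comp continuous_logPolar.measurable)
    (hmeas.comp continuous_logPolar.measurable))).2 ?_
  -- One null set of radii serves all the countably many modes.
  have hall : ∀ᵐ t ∂radialMeasure, ∀ m : ℤ, m ≠ 0 → m ≠ -1 → modeCoeff m f t = 0 := by
    rw [ae_all_iff]
    intro m
    by_cases hm0 : m = 0
    · simp [hm0]
    by_cases hm1 : m = -1
    · simp [hm1]
    filter_upwards [radialMeasure_absolutelyContinuous.ae_le (hrest m hm0 hm1)] with t ht _ _
    exact ht
  filter_upwards [ae_memLp_slice hf, hall, radialMeasure_absolutelyContinuous.ae_le hwe,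
    radialMeasure_absolutelyContinuous.ae_le hye] with t ht hz hwt hyt
  have := ae_slice_eq ht (w t) (y t) (by
    intro m
    change modeCoeff m f t = _
    by_cases hm0 : m = 0
    · simp [hm0, hwt]
    by_cases hm1 : m = -1
    · simp [hm1, hyt]
    simp [hm0, hm1, hz m hm0 hm1])
  filter_upwards [this] with θ hθ
  simp only [Function.comp_apply]
  rw [modeFun_logPolar, modeFun_logPolar]
  simp only [hθ, hk]
  simp

end

/-! ### Boundary values -/

/-- `u(t) = A e^{-νt} + B e^{νt} + O(e^t)` as `t → -∞`. -/
def HasExpansion (ν : ℝ) (u : ℝ → ℂ) (A B : ℂ) : Prop :=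
  (fun t => u t - (A * (Real.exp (-ν * t) : ℂ) + B * (Real.exp (ν * t) : ℂ)))
    =O[atBot] fun t => Real.exp t

theorem HasExpansion.const_mul {ν : ℝ} {u : ℝ → ℂ} {A B : ℂ} (h : HasExpansion ν u A B) (c : ℂ) :
    HasExpansion ν (fun t => c * u t) (c * A) (c * B) :=
  (h.const_mul_left c).congr_left fun t => by ring

theorem tendsto_exp_mul_atBot {a : ℝ} (ha : 0 < a) :
    Tendsto (fun t : ℝ => (Real.exp (a * t) : ℂ)) atBot (𝓝 0) := by
  have := Real.tendsto_exp_atBot.comp (tendsto_id.const_mul_atBot ha)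
  simpa [Function.comp_def, -Complex.ofReal_exp] using
    (Complex.continuous_ofReal.tendsto _).comp this

/-- The factor `e^{νt}` isolates `A`, after which `e^{-νt}` isolates `B`; the remainder `O(e^t)`
still tends to zero because `ν < 1`. -/
theorem HasExpansion.unique {ν : ℝ} (h0 : 0 < ν) (h1 : ν < 1) {u : ℝ → ℂ} {A B A' B' : ℂ}
    (h : HasExpansion ν u A B) (h' : HasExpansion ν u A' B') : A = A' ∧ B = B' := by
  have hd := h.sub h'
  have ex : ∀ a b t : ℝ, (Real.exp (a * t) : ℂ) * (Real.exp (b * t) : ℂ) =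
      (Real.exp ((a + b) * t) : ℂ) := fun a b t => by
    rw [← Complex.ofReal_mul, ← Real.exp_add]; ring_nf
  have key : ∀ s : ℝ, -1 < s → Tendsto (fun t => (A' - A) * (Real.exp ((s - ν) * t) : ℂ) +
      (B' - B) * (Real.exp ((s + ν) * t) : ℂ)) atBot (𝓝 0) := by
    intro s hs
    have e1 : (fun t => (A' - A) * (Real.exp ((s - ν) * t) : ℂ) +
      (B' - B) * (Real.exp ((s + ν) * t) : ℂ)) =O[atBot] fun t => Real.exp ((s + 1) * t) := by
      have e0 : (fun t : ℝ => (Real.exp (s * t) : ℂ)) =O[atBot] fun t => Real.exp (s * t) :=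
        Complex.isBigO_ofReal_left.2 (isBigO_refl _ _)
      refine (e0.mul hd).congr (fun t => ?_) (fun t => ?_)
      · have e1 := ex s (-ν) t
        have e2 := ex s ν t
        rw [← sub_eq_add_neg] at e1
        rw [← e1, ← e2]
        ring
      · rw [← Real.exp_add]; ring_nf
    refine e1.trans_tendsto ?_
    exact Real.tendsto_exp_atBot.comp (tendsto_id.const_mul_atBot (by linarith))
  have hA : A' - A = 0 := by
    have k1 := key ν (by linarith)
    simp only [sub_self, zero_mul, Real.exp_zero, Complex.ofReal_one, mul_one] at k1
    have k2 := (tendsto_exp_mul_atBot (a := ν + ν) (by linarith)).const_mul (B' - B)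
    have := (tendsto_const_nhds (x := A' - A) (f := atBot (α := ℝ))).add k2
    rw [mul_zero, add_zero] at this
    exact tendsto_nhds_unique this k1
  have hB : B' - B = 0 := by
    have k1 := key (-ν) (by linarith)
    simp only [hA, zero_mul, zero_add, neg_add_cancel, Real.exp_zero, Complex.ofReal_one,
      mul_one] at k1
    exact tendsto_nhds_unique tendsto_const_nhds k1
  exact ⟨(sub_eq_zero.1 hA).symm, (sub_eq_zero.1 hB).symm⟩

section

variable {α : ℝ} {f : L2Plane} {u u' : ℝ → ℂ} {Φ Ψ : Fin 2 → ℂ}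

theorem norm_rpow_eq {x : Plane} (hx : x ≠ 0) (a : ℝ) :
    ‖x‖ ^ a = Real.exp (a * Real.log ‖x‖) := by
  rw [Real.rpow_def_of_pos (norm_pos_iff.2 hx), mul_comm]

/-- The remainder of the expansion of a function in one channel. -/
def remainder (ν : ℝ) (u : ℝ → ℂ) (A B : ℂ) (t : ℝ) : ℂ :=
  2 * (Real.pi : ℂ) * u t - (A * (Real.exp (-ν * t) : ℂ) + B * (Real.exp (ν * t) : ℂ))

theorem sub_singularPart_eq (α : ℝ) (u u' : ℝ → ℂ) (Φ Ψ : Fin 2 → ℂ) {x : Plane} (hx : x ≠ 0) :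
    2 * (Real.pi : ℂ) * (modeFun 0 u x + modeFun (-1) u' x) - singularPart α Φ Ψ x =
      remainder α u (Φ 0) (Ψ 0) (Real.log ‖x‖) +
      remainder (1 - α) u' (Φ 1) (Ψ 1) (Real.log ‖x‖) * angular (-1) x := by
  rw [singularPart, modeFun_of_ne hx, modeFun_of_ne hx, expNegAngle_eq, norm_rpow_eq hx,
    norm_rpow_eq hx, norm_rpow_eq hx, norm_rpow_eq hx, remainder, remainder,
    show -(1 - α) = α - 1 by ring]
  have : angular 0 x = 1 := by simp [angular]
  rw [this]
  ring

theorem ae_inf_nhds_le : ae (volume : Measure Plane) ⊓ 𝓝 0 ≤ 𝓝[≠] 0 := by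
  rw [nhdsWithin, inf_comm]
  refine inf_le_inf_left _ ?_
  rw [le_principal_iff]
  exact (by simp [ae_iff] : ∀ᵐ x ∂(volume : Measure Plane), x ≠ 0)

theorem tendsto_log_norm : Tendsto (fun x : Plane => Real.log ‖x‖) (𝓝[≠] 0) atBot :=
  Real.tendsto_log_nhdsGT_zero.comp (tendsto_norm_nhdsNE_zero)

/-- The remainders are continuous off the origin, so an estimate almost everywhere holds at every
nearby point. At the angles `0` and `π` the factor `e^{-iθ}` is `1` and `-1`, and half the sum and
half the difference separate the channels. -/
theorem hasBoundaryValues_iff (hu : Continuous u) (hu' : Continuous u')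
    (hf : f =ᵐ[volume] fun x => modeFun 0 u x + modeFun (-1) u' x) :
    HasBoundaryValues α f Φ Ψ ↔
      HasExpansion α (fun t => 2 * (Real.pi : ℂ) * u t) (Φ 0) (Ψ 0) ∧
      HasExpansion (1 - α) (fun t => 2 * (Real.pi : ℂ) * u' t) (Φ 1) (Ψ 1) := by
  have hne : ∀ᶠ x in ae (volume : Measure Plane) ⊓ 𝓝 0, x ≠ 0 :=
    ae_inf_nhds_le self_mem_nhdsWithin
  constructor
  · intro h
    obtain ⟨c, hc⟩ := h.bound
    set a := remainder α u (Φ 0) (Ψ 0) with ha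
    set b := remainder (1 - α) u' (Φ 1) (Ψ 1) with hb
    have hac : Continuous a := by rw [ha]; unfold remainder; fun_prop
    have hbc : Continuous b := by rw [hb]; unfold remainder; fun_prop
    have hc2 : ∀ᶠ x in ae (volume : Measure Plane) ⊓ 𝓝 0,
        ‖a (Real.log ‖x‖) + b (Real.log ‖x‖) * angular (-1) x‖ ≤ c * ‖x‖ := by
      filter_upwards [hc, hf.filter_mono inf_le_left, hne] with x hx hfx hx0
      rw [hfx, sub_singularPart_eq α u u' Φ Ψ hx0] at hx
      simpa using hx
    rw [inf_comm, eventually_inf] at hc2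
    obtain ⟨s, hs, t, ht, hst⟩ := hc2
    obtain ⟨ε, hε, hball⟩ := Metric.mem_nhds_iff.1 hs
    have hall : ∀ x : Plane, x ≠ 0 → ‖x‖ < ε →
        ‖a (Real.log ‖x‖) + b (Real.log ‖x‖) * angular (-1) x‖ ≤ c * ‖x‖ := by
      set g : Plane → ℝ := fun x =>
        ‖a (Real.log ‖x‖) + b (Real.log ‖x‖) * angular (-1) x‖ - c * ‖x‖ with hg
      have hcont : ContinuousOn g (Metric.ball 0 ε ∩ {0}ᶜ) := by
        rintro x ⟨-, hx⟩
        have hl := (contDiffAt_log_norm (x := x) hx).continuousAt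
        exact (((hac.continuousAt.comp hl).add ((hbc.continuousAt.comp hl).mul
          (contDiffAt_angular (-1) hx).continuousAt)).norm.sub
          (continuousAt_const.mul continuous_norm.continuousAt)).continuousWithinAt
      -- The set where the estimate fails is open and null, hence empty.
      have hopen := hcont.isOpen_inter_preimage (Metric.isOpen_ball.inter isOpen_compl_singleton)
        (isOpen_Ioi (a := (0 : ℝ)))
      have hnull : volume ((Metric.ball (0 : Plane) ε ∩ {0}ᶜ) ∩ g ⁻¹' Ioi 0) = 0 := by
        refine measure_mono_null (fun x hx => ?_) (mem_ae_iff.1 ht)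
        intro hxt
        have := hst x ⟨hball hx.1.1, hxt⟩
        have h2 : 0 < g x := hx.2
        simp only [hg] at h2
        linarith
      rw [hopen.measure_eq_zero_iff (μ := volume)] at hnull
      intro x hx0 hx
      by_contra hcon
      have : x ∈ (Metric.ball (0 : Plane) ε ∩ {0}ᶜ) ∩ g ⁻¹' Ioi 0 := by
        refine ⟨⟨by simpa using hx, hx0⟩, ?_⟩
        simp only [mem_preimage, mem_Ioi, hg]
        linarith
      rw [hnull] at this
      exact this
    have hev : ∀ᶠ t in atBot, Real.exp t < ε :=
      Real.tendsto_exp_atBot.eventually (gt_mem_nhds hε)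
    have two : ∀ᶠ t in atBot, ‖a t + b t‖ ≤ c * Real.exp t ∧ ‖a t - b t‖ ≤ c * Real.exp t := by
      filter_upwards [hev] with t ht
      have e1 := hall (logPolar (t, 0)) (logPolar_ne_zero _) (by rwa [norm_logPolar])
      have e2 := hall (logPolar (t, Real.pi)) (logPolar_ne_zero _) (by rwa [norm_logPolar])
      rw [norm_logPolar, angular_logPolar, Real.log_exp] at e1 e2
      refine ⟨by simpa using e1, ?_⟩
      have : Complex.exp (((-1 : ℤ) : ℂ) * ((Real.pi : ℂ) * Complex.I)) = -1 := by
        push_cast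
        rw [neg_one_mul, Complex.exp_neg, Complex.exp_pi_mul_I]; norm_num
      simp only [this] at e2
      simpa [sub_eq_add_neg] using e2
    constructor
    · refine IsBigO.of_bound c ?_
      filter_upwards [two] with t ht
      rw [Real.norm_of_nonneg (Real.exp_pos t).le]
      change ‖a t‖ ≤ _
      have : a t = (1 / 2 : ℂ) * ((a t + b t) + (a t - b t)) := by ring
      rw [this, norm_mul]
      have := norm_add_le (a t + b t) (a t - b t)
      rw [show ‖(1 / 2 : ℂ)‖ = 1 / 2 by norm_num]
      linarith [ht.1, ht.2]
    · refine IsBigO.of_bound c ?_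
      filter_upwards [two] with t ht
      rw [Real.norm_of_nonneg (Real.exp_pos t).le]
      change ‖b t‖ ≤ _
      have : b t = (1 / 2 : ℂ) * ((a t + b t) - (a t - b t)) := by ring
      rw [this, norm_mul]
      have := norm_sub_le (a t + b t) (a t - b t)
      rw [show ‖(1 / 2 : ℂ)‖ = 1 / 2 by norm_num]
      linarith [ht.1, ht.2]
  · rintro ⟨h0, h1⟩
    have hl : Tendsto (fun x : Plane => Real.log ‖x‖) (ae (volume : Measure Plane) ⊓ 𝓝 0) atBot :=
      tendsto_log_norm.mono_left ae_inf_nhds_le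
    have k0 := h0.comp_tendsto hl
    have k1 := h1.comp_tendsto hl
    have hexp : (fun t => Real.exp t) ∘ (fun x : Plane => Real.log ‖x‖)
        =ᶠ[ae (volume : Measure Plane) ⊓ 𝓝 0] fun x => ‖x‖ := by
      filter_upwards [hne] with x hx
      exact Real.exp_log (norm_pos_iff.2 hx)
    have k1' : (fun x : Plane => remainder (1 - α) u' (Φ 1) (Ψ 1) (Real.log ‖x‖) * angular (-1) x)
        =O[ae (volume : Measure Plane) ⊓ 𝓝 0] fun x => ‖x‖ := by
      refine IsBigO.trans ?_ (k1.congr' EventuallyEq.rfl hexp)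
      refine IsBigO.of_bound 1 ?_
      filter_upwards [hne] with x hx
      rw [norm_mul, norm_angular hx, mul_one, one_mul]
      exact le_rfl
    refine IsBigO.congr' ((k0.congr' EventuallyEq.rfl hexp).add k1') ?_ EventuallyEq.rfl
    filter_upwards [hf.filter_mono inf_le_left, hne] with x hfx hx0
    rw [hfx, sub_singularPart_eq α u u' Φ Ψ hx0]
    rfl

end

/-! ### The boundary conditions are Lagrangian -/

/-- By the symmetry of `C D*`, the block matrix with rows `(C, -D)` and `(D, C)` times its adjoint
is block diagonal with blocks `N = CC* + DD*`. It is therefore invertible, and the inverse read as a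
left inverse parametrizes the kernel of `(C, -D)`. -/
theorem Admissible.exists_eq {C D : Matrix (Fin 2) (Fin 2) ℂ} (h : Admissible C D)
    {φ w : Fin 2 → ℂ} (hb : C *ᵥ φ = D *ᵥ w) : ∃ v, φ = Dᴴ *ᵥ v ∧ w = Cᴴ *ᵥ v := by
  set N := C * Cᴴ + D * Dᴴ with hN
  have hNu : IsUnit N.det := isUnit_iff_ne_zero.2 h.det_ne_zero
  have hsym : D * Cᴴ = C * Dᴴ := by
    have := h.isHermitian
    rwa [Matrix.IsHermitian, Matrix.conjTranspose_mul, Matrix.conjTranspose_conjTranspose] at this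
  have hW : Matrix.fromBlocks C (-D) D C * (Matrix.fromBlocks Cᴴ Dᴴ (-Dᴴ) Cᴴ *
      Matrix.fromBlocks N⁻¹ 0 0 N⁻¹) = 1 := by
    rw [← mul_assoc, Matrix.fromBlocks_multiply, Matrix.fromBlocks_multiply]
    have e1 : C * Cᴴ + -D * -Dᴴ = N := by rw [neg_mul_neg]
    have e2 : C * Dᴴ + -D * Cᴴ = 0 := by rw [neg_mul, hsym, add_neg_cancel]
    have e3 : D * Cᴴ + C * -Dᴴ = 0 := by rw [mul_neg, hsym, add_neg_cancel]
    have e4 : D * Dᴴ + C * Cᴴ = N := by rw [hN, add_comm]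
    rw [e1, e2, e3, e4]
    simp [Matrix.mul_nonsing_inv N hNu, Matrix.fromBlocks_one]
  rw [mul_eq_one_comm, Matrix.fromBlocks_multiply, Matrix.fromBlocks_multiply,
    ← Matrix.fromBlocks_one, Matrix.fromBlocks_inj] at hW
  obtain ⟨h11, -, h21, h22⟩ := hW
  simp only [mul_zero, zero_add, add_zero, mul_neg, neg_mul] at h11 h21 h22
  have k1 : ∀ X : Matrix (Fin 2) (Fin 2) ℂ, ∀ y, Cᴴ *ᵥ (N⁻¹ *ᵥ (X *ᵥ y)) = (Cᴴ * N⁻¹ * X) *ᵥ y :=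
    fun X y => by rw [Matrix.mulVec_mulVec, Matrix.mulVec_mulVec]
  have k2 : ∀ X : Matrix (Fin 2) (Fin 2) ℂ, ∀ y, Dᴴ *ᵥ (N⁻¹ *ᵥ (X *ᵥ y)) = (Dᴴ * N⁻¹ * X) *ᵥ y :=
    fun X y => by rw [Matrix.mulVec_mulVec, Matrix.mulVec_mulVec]
  have h21' : Dᴴ * N⁻¹ * C = Cᴴ * N⁻¹ * D := by
    rw [neg_add_eq_zero] at h21; exact h21
  refine ⟨N⁻¹ *ᵥ (C *ᵥ w + D *ᵥ φ), ?_, ?_⟩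
  · rw [Matrix.mulVec_add, Matrix.mulVec_add, k2 C, h21', ← k1 D, ← hb, k1 C, k2 D,
      ← Matrix.add_mulVec, h11, Matrix.one_mulVec]
  · rw [Matrix.mulVec_add, Matrix.mulVec_add, k1 D, ← h21', ← k2 C, hb, k1 C, k2 D,
      ← Matrix.add_mulVec, h11, Matrix.one_mulVec]

/-- With `φ = D* v` and `w = C* v` the product is `v* D C* v`, the value of a Hermitian form. This
is the vanishing of the flux at the origin. -/
theorem Admissible.im_dotProduct_eq_zero {C D : Matrix (Fin 2) (Fin 2) ℂ} (h : Admissible C D)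
    {φ w : Fin 2 → ℂ} (hb : C *ᵥ φ = D *ᵥ w) : (star φ ⬝ᵥ w).im = 0 := by
  obtain ⟨v, rfl, rfl⟩ := h.exists_eq hb
  have hsym : D * Cᴴ = C * Dᴴ := by
    have := h.isHermitian
    rwa [Matrix.IsHermitian, Matrix.conjTranspose_mul, Matrix.conjTranspose_conjTranspose] at this
  rw [Matrix.star_mulVec, Matrix.conjTranspose_conjTranspose, ← Matrix.dotProduct_mulVec,
    Matrix.mulVec_mulVec, hsym]
  exact h.isHermitian.im_star_dotProduct_mulVec_self v

/-! ### Modified Bessel functions of the second kind -/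

/-- The integral `∫₀^∞ e^{-s - A/s} s^{ν-1} ds`; it is `2 (κr/2)^ν K_ν(κr)` for `A = κ²r²/4`. -/
def besselIntegral (ν A : ℝ) : ℝ :=
  ∫ s in Ioi (0 : ℝ), Real.exp (-s) * s ^ (ν - 1) * Real.exp (-(A / s))

section

variable {ν A : ℝ}

theorem continuousOn_besselIntegrand (ν A : ℝ) :
    ContinuousOn (fun s : ℝ => Real.exp (-s) * s ^ (ν - 1) * Real.exp (-(A / s))) (Ioi 0) := by
  intro s hs
  have hs' : s ≠ 0 := (mem_Ioi.1 hs).ne'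
  have h1 : ContinuousAt (fun s : ℝ => s ^ (ν - 1)) s := Real.continuousAt_rpow_const _ _ (Or.inl hs')
  have h2 : ContinuousAt (fun s : ℝ => A / s) s := continuousAt_const.div continuousAt_id hs'
  exact (((Real.continuous_exp.comp continuous_neg).continuousAt.mul h1).mul
    (Real.continuous_exp.continuousAt.comp h2.neg)).continuousWithinAt

theorem aestronglyMeasurable_besselIntegrand (ν A : ℝ) :
    AEStronglyMeasurable (fun s : ℝ => Real.exp (-s) * s ^ (ν - 1) * Real.exp (-(A / s)))
      (volume.restrict (Ioi 0)) :=
  (continuousOn_besselIntegrand ν A).aestronglyMeasurable measurableSet_Ioi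

theorem besselIntegrand_le (hA : 0 ≤ A) {s : ℝ} (hs : 0 < s) :
    ‖Real.exp (-s) * s ^ (ν - 1) * Real.exp (-(A / s))‖ ≤ Real.exp (-s) * s ^ (ν - 1) := by
  have h1 : 0 ≤ Real.exp (-s) * s ^ (ν - 1) := by positivity
  rw [Real.norm_of_nonneg (by positivity)]
  have : Real.exp (-(A / s)) ≤ 1 := Real.exp_le_one_iff.2 (by
    have : 0 ≤ A / s := by positivity
    linarith)
  exact mul_le_of_le_one_right h1 this

theorem integrableOn_besselIntegrand (hν : 0 < ν) (hA : 0 ≤ A) :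
    IntegrableOn (fun s : ℝ => Real.exp (-s) * s ^ (ν - 1) * Real.exp (-(A / s))) (Ioi 0) := by
  refine Integrable.mono' (Real.GammaIntegral_convergent hν)
    (aestronglyMeasurable_besselIntegrand ν A) ?_
  filter_upwards [ae_restrict_mem measurableSet_Ioi] with s hs
  exact besselIntegrand_le hA hs

theorem besselIntegral_zero (hν : 0 < ν) : besselIntegral ν 0 = Real.Gamma ν := by
  rw [Real.Gamma_eq_integral hν]
  simp [besselIntegral]

theorem besselIntegral_le (hν : 0 < ν) (hA : 0 ≤ A) : besselIntegral ν A ≤ Real.Gamma ν := by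
  rw [Real.Gamma_eq_integral hν]
  refine setIntegral_mono_on (integrableOn_besselIntegrand hν hA)
    (Real.GammaIntegral_convergent hν) measurableSet_Ioi fun s hs => ?_
  exact (le_abs_self _).trans (besselIntegrand_le hA hs)

theorem besselIntegral_pos (hν : 0 < ν) (hA : 0 ≤ A) : 0 < besselIntegral ν A := by
  refine (setIntegral_pos_iff_support_of_nonneg_ae ?_ (integrableOn_besselIntegrand hν hA)).2 ?_
  · filter_upwards [ae_restrict_mem measurableSet_Ioi] with s hs
    have : 0 < s := hs
    simp only [Pi.zero_apply]
    positivity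
  · have : Ioi (0 : ℝ) ⊆ (Function.support fun s : ℝ =>
        Real.exp (-s) * s ^ (ν - 1) * Real.exp (-(A / s))) ∩ Ioi 0 := by
      intro s hs
      have : 0 < s := hs
      refine ⟨?_, hs⟩
      have : 0 < Real.exp (-s) * s ^ (ν - 1) * Real.exp (-(A / s)) := by positivity
      exact this.ne'
    exact lt_of_lt_of_le (by simp) (measure_mono this)

theorem exp_neg_div_le (hA : 0 < A) {s : ℝ} (hs : 0 < s) : Real.exp (-(A / s)) ≤ s / A := by
  have h := Real.add_one_le_exp (A / s)
  have h2 : 0 < A / s := by positivity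
  rw [Real.exp_neg, ← inv_div A s]
  exact inv_anti₀ h2 (by linarith)

/-- The bound `e^{-A/s} ≤ s/A` raises the index by one. Decay of order `1/A` is all that square
integrability at infinity requires. -/
theorem besselIntegral_le_div (hν : 0 < ν) (hA : 0 < A) :
    besselIntegral ν A ≤ Real.Gamma (ν + 1) / A := by
  rw [Real.Gamma_eq_integral (by linarith), div_eq_inv_mul, ← integral_const_mul]
  refine setIntegral_mono_on (integrableOn_besselIntegrand hν hA.le)
    ((Real.GammaIntegral_convergent (by linarith)).const_mul _) measurableSet_Ioi fun s hs => ?_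
  have hs' : 0 < s := hs
  have e : s ^ (ν + 1 - 1) = s ^ (ν - 1) * s := by
    rw [← Real.rpow_add_one hs'.ne']; ring_nf
  have := mul_le_mul_of_nonneg_left (exp_neg_div_le hA hs')
    (by positivity : 0 ≤ Real.exp (-s) * s ^ (ν - 1))
  rw [e]
  refine this.trans (le_of_eq ?_)
  field_simp

/-- The reflection `ν ↦ -ν`. -/
theorem besselIntegral_neg (hA : 0 < A) (μ : ℝ) :
    besselIntegral μ A = A ^ μ * besselIntegral (-μ) A := by
  have himg : (fun s : ℝ => A / s) '' Ioi 0 = Ioi 0 := by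
    ext s
    constructor
    · rintro ⟨r, hr, rfl⟩
      exact div_pos hA hr
    · intro hs
      have hs' : s ≠ 0 := (mem_Ioi.1 hs).ne'
      exact ⟨A / s, div_pos hA hs, by field_simp⟩
  -- The substitution `s ↦ A/s` exchanges the two exponentials and inverts the power.
  have h := integral_image_eq_integral_abs_deriv_smul (s := Ioi (0 : ℝ)) (f := fun s => A / s)
    (f' := fun s => -A / s ^ 2) measurableSet_Ioi (fun s hs => by
      have hs' : s ≠ 0 := (mem_Ioi.1 hs).ne'
      have : HasDerivAt (fun s => A / s) ((0 * s - A * 1) / s ^ 2) s :=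
        (hasDerivAt_const s A).div (hasDerivAt_id s) hs'
      exact (this.congr_deriv (by ring)).hasDerivWithinAt) (fun a ha b hb hab => by
      have ha' : a ≠ 0 := (mem_Ioi.1 ha).ne'
      have hb' : b ≠ 0 := (mem_Ioi.1 hb).ne'
      have : A / a = A / b := hab
      field_simp at this
      exact this.symm)
    (fun s => Real.exp (-s) * s ^ (μ - 1) * Real.exp (-(A / s)))
  rw [himg] at h
  rw [besselIntegral, h, besselIntegral, ← integral_const_mul]
  refine setIntegral_congr_fun measurableSet_Ioi fun s hs => ?_
  have hs' : 0 < s := hs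
  have e1 : A / (A / s) = s := by field_simp
  have e2 : |(-A / s ^ 2)| = A / s ^ 2 := by
    rw [neg_div, abs_neg, abs_of_pos (by positivity)]
  have e3 : (A / s) ^ (μ - 1) = A ^ μ / A * (s * s ^ (-μ)) := by
    rw [Real.div_rpow hA.le hs'.le, Real.rpow_sub_one hA.ne', Real.rpow_sub_one hs'.ne',
      Real.rpow_neg hs'.le]
    have : s ^ μ ≠ 0 := (Real.rpow_pos_of_pos hs' μ).ne'
    field_simp
  have e4 : s ^ (-μ - 1) = s ^ (-μ) / s := Real.rpow_sub_one hs'.ne' _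
  simp only [smul_eq_mul]
  rw [e1, e2, e3, e4]
  field_simp

/-- Differentiation under the integral lowers the index to `ν - 1`, and the reflection makes it `1 -
ν`. The indices `ν` and `1 - ν` are thus closed under differentiation, which replaces the
recurrences for Bessel functions. -/
theorem hasDerivAt_besselIntegral (hν : 0 < ν) (hA : 0 < A) :
    HasDerivAt (besselIntegral ν) (-(A ^ (ν - 1) * besselIntegral (1 - ν) A)) A := by
  -- On parameters above `A/2` one bound serves: the exponential is at most `2s/A`, which absorbs
  -- the extra `1/s`.
  have key := hasDerivAt_integral_of_dominated_loc_of_deriv_le (μ := volume.restrict (Ioi (0 : ℝ)))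
    (F := fun A s => Real.exp (-s) * s ^ (ν - 1) * Real.exp (-(A / s)))
    (F' := fun A s => -(Real.exp (-s) * s ^ (ν - 1 - 1) * Real.exp (-(A / s))))
    (x₀ := A) (s := Ioi (A / 2)) (bound := fun s => 2 / A * (Real.exp (-s) * s ^ (ν - 1)))
    (Ioi_mem_nhds (by linarith))
    (Eventually.of_forall fun A => aestronglyMeasurable_besselIntegrand ν A)
    (integrableOn_besselIntegrand hν hA.le)
    (aestronglyMeasurable_besselIntegrand (ν - 1) A).neg ?_
    ((Real.GammaIntegral_convergent hν).const_mul _) ?_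
  · refine key.2.congr_deriv ?_
    have h1 := besselIntegral_neg hA (ν - 1)
    rw [neg_sub] at h1
    rw [integral_neg, ← h1]
    rfl
  · filter_upwards [ae_restrict_mem measurableSet_Ioi] with s hs B hB
    have hs' : 0 < s := hs
    have hB' : A / 2 < B := hB
    rw [norm_neg, Real.norm_of_nonneg (by positivity)]
    have h1 : Real.exp (-(B / s)) ≤ s / (A / 2) := by
      refine le_trans (Real.exp_le_exp.2 (neg_le_neg ?_)) (exp_neg_div_le (by linarith) hs')
      exact div_le_div_of_nonneg_right hB'.le hs'.le
    have := mul_le_mul_of_nonneg_left h1 (by positivity : 0 ≤ Real.exp (-s) * s ^ (ν - 1 - 1))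
    refine this.trans (le_of_eq ?_)
    rw [Real.rpow_sub_one hs'.ne' (ν - 1)]
    field_simp
  · filter_upwards [ae_restrict_mem measurableSet_Ioi] with s hs B _
    have hs' : 0 < s := hs
    have h1 : HasDerivAt (fun B : ℝ => -(B / s)) (-(1 / s)) B :=
      ((hasDerivAt_id B).div_const s).neg
    refine (h1.exp.const_mul (Real.exp (-s) * s ^ (ν - 1))).congr_deriv ?_
    rw [Real.rpow_sub_one hs'.ne' (ν - 1)]
    field_simp

theorem continuousOn_besselIntegral (hν : 0 < ν) : ContinuousOn (besselIntegral ν) (Ici 0) := by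
  intro A hA
  refine continuousWithinAt_of_dominated (bound := fun s => Real.exp (-s) * s ^ (ν - 1)) ?_ ?_
    (Real.GammaIntegral_convergent hν) ?_
  · exact Eventually.of_forall fun B => aestronglyMeasurable_besselIntegrand ν B
  · filter_upwards [self_mem_nhdsWithin] with B hB
    filter_upwards [ae_restrict_mem measurableSet_Ioi] with s hs
    exact besselIntegrand_le hB hs
  · refine ae_of_all _ fun s => ?_
    have : Continuous fun B : ℝ => Real.exp (-s) * s ^ (ν - 1) * Real.exp (-(B / s)) := by fun_prop
    exact this.continuousWithinAt

/-- The expansion of the Bessel function at the origin is bounded below by its leading terms. -/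
theorem le_besselIntegral (hν : 0 < ν) (hν1 : ν < 1) (hA : 0 ≤ A) :
    Real.Gamma ν - A ^ ν * Real.Gamma (1 - ν) / ν ≤ besselIntegral ν A := by
  have hmono : MonotoneOn (fun A => besselIntegral ν A + A ^ ν * (Real.Gamma (1 - ν) / ν)) (Ici 0) := by
    refine monotoneOn_of_hasDerivWithinAt_nonneg (convex_Ici 0) ?_
      (f' := fun A => A ^ (ν - 1) * (Real.Gamma (1 - ν) - besselIntegral (1 - ν) A)) ?_ ?_
    · exact (continuousOn_besselIntegral hν).add
        ((Real.continuous_rpow_const hν.le).continuousOn.mul_const _)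
    · intro B hB
      rw [interior_Ici] at hB ⊢
      have hB' : 0 < B := hB
      refine (((hasDerivAt_besselIntegral hν hB').add ((Real.hasDerivAt_rpow_const
        (Or.inl hB'.ne')).mul_const _)).congr_deriv ?_).hasDerivWithinAt
      field_simp
      ring
    · intro B hB
      rw [interior_Ici] at hB
      have hB' : 0 < B := hB
      have := besselIntegral_le (ν := 1 - ν) (by linarith) hB'.le
      exact mul_nonneg (Real.rpow_nonneg hB'.le _) (by linarith)
  have := hmono self_mem_Ici hA hA
  simp only [besselIntegral_zero hν, Real.zero_rpow hν.ne'] at this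
  rw [mul_div_assoc]
  linarith

/-- The lower bound for the index `1 - ν` controls the derivative of the error for the index `ν`:
since `A^{ν-1} A^{1-ν} = 1`, that derivative is at most the constant `Γ(ν)/(1-ν)`. -/
theorem besselIntegral_expansion (hν : 0 < ν) (hν1 : ν < 1) (hA : 0 ≤ A) :
    |besselIntegral ν A - (Real.Gamma ν - A ^ ν * Real.Gamma (1 - ν) / ν)| ≤
      Real.Gamma ν / (1 - ν) * A := by
  have hlow := le_besselIntegral hν hν1 hA
  have hanti : AntitoneOn (fun A => besselIntegral ν A + A ^ ν * (Real.Gamma (1 - ν) / ν) -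
      Real.Gamma ν / (1 - ν) * A) (Ici 0) := by
    refine antitoneOn_of_hasDerivWithinAt_nonpos (convex_Ici 0) ?_
      (f' := fun A => A ^ (ν - 1) * (Real.Gamma (1 - ν) - besselIntegral (1 - ν) A) -
        Real.Gamma ν / (1 - ν)) ?_ ?_
    · exact ((continuousOn_besselIntegral hν).add
        ((Real.continuous_rpow_const hν.le).continuousOn.mul_const _)).sub (by fun_prop)
    · intro B hB
      rw [interior_Ici] at hB ⊢
      have hB' : 0 < B := hB
      refine ((((hasDerivAt_besselIntegral hν hB').add ((Real.hasDerivAt_rpow_const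
        (Or.inl hB'.ne')).mul_const _)).sub ((hasDerivAt_id B).const_mul _)).congr_deriv
        ?_).hasDerivWithinAt
      field_simp
      ring
    · intro B hB
      rw [interior_Ici] at hB
      have hB' : 0 < B := hB
      have h1 := le_besselIntegral (ν := 1 - ν) (by linarith) (by linarith) hB'.le
      rw [sub_sub_cancel] at h1
      have h2 : B ^ (ν - 1) * (B ^ (1 - ν) * Real.Gamma ν / (1 - ν)) = Real.Gamma ν / (1 - ν) := by
        rw [mul_div_assoc, ← mul_assoc, ← Real.rpow_add hB']
        simp
      have h3 := mul_le_mul_of_nonneg_left (show Real.Gamma (1 - ν) - besselIntegral (1 - ν) B ≤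
        B ^ (1 - ν) * Real.Gamma ν / (1 - ν) by linarith) (Real.rpow_nonneg hB'.le (ν - 1))
      rw [h2] at h3
      linarith
  have := hanti self_mem_Ici hA hA
  simp only [besselIntegral_zero hν, Real.zero_rpow hν.ne'] at this
  have e : A ^ ν * (Real.Gamma (1 - ν) / ν) = A ^ ν * Real.Gamma (1 - ν) / ν := by ring
  rw [e] at this
  rw [abs_of_nonneg (by linarith)]
  linarith

end

/-! ### The decaying radial solution. -/

/-- The decaying solution `e^{-νt} ∫₀^∞ exp(-s - c e^{2t}/s) s^{ν-1} ds` for `z = -4c`. -/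
def radialK (ν c t : ℝ) : ℝ := Real.exp (-ν * t) * besselIntegral ν (c * Real.exp (2 * t))

/-- The derivative of `radialK`. -/
def radialK' (ν c t : ℝ) : ℝ :=
  -ν * radialK ν c t - 2 * c ^ ν * Real.exp (ν * t) * besselIntegral (1 - ν) (c * Real.exp (2 * t))

section

variable {ν c : ℝ}

theorem hasDerivAt_exp_mul (a t : ℝ) :
    HasDerivAt (fun t => Real.exp (a * t)) (a * Real.exp (a * t)) t := by
  simpa [mul_comm] using ((hasDerivAt_id t).const_mul a).exp

theorem hasDerivAt_besselIntegral_exp (hν : 0 < ν) (hc : 0 < c) (t : ℝ) :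
    HasDerivAt (fun t => besselIntegral ν (c * Real.exp (2 * t)))
      (-2 * c ^ ν * Real.exp (2 * ν * t) * besselIntegral (1 - ν) (c * Real.exp (2 * t))) t := by
  have hp : 0 < c * Real.exp (2 * t) := by positivity
  refine ((hasDerivAt_besselIntegral hν hp).comp t
    ((hasDerivAt_exp_mul 2 t).const_mul c)).congr_deriv ?_
  have e : (c * Real.exp (2 * t)) ^ (ν - 1) * (c * Real.exp (2 * t)) = c ^ ν * Real.exp (2 * ν * t) := by
    rw [← Real.rpow_add_one hp.ne', sub_add_cancel, Real.mul_rpow hc.le (Real.exp_pos _).le,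
      ← Real.exp_mul]
    ring_nf
  linear_combination (-2 * besselIntegral (1 - ν) (c * Real.exp (2 * t))) * e

theorem hasDerivAt_radialK (hν : 0 < ν) (hc : 0 < c) (t : ℝ) :
    HasDerivAt (radialK ν c) (radialK' ν c t) t := by
  refine ((hasDerivAt_exp_mul (-ν) t).mul (hasDerivAt_besselIntegral_exp hν hc t)).congr_deriv ?_
  have e : Real.exp (ν * t) = Real.exp (-ν * t) * Real.exp (2 * ν * t) := by
    rw [← Real.exp_add]; ring_nf
  rw [radialK', radialK, e]
  ring

/-- Differentiating the integral of index `1 - ν` leads back to index `ν`, so the second derivative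
closes up to the radial equation. -/
theorem hasDerivAt_radialK' (hν : 0 < ν) (hν1 : ν < 1) (hc : 0 < c) (t : ℝ) :
    HasDerivAt (radialK' ν c) ((ν ^ 2 + 4 * c * Real.exp (2 * t)) * radialK ν c t) t := by
  have h1 := hasDerivAt_besselIntegral_exp (ν := 1 - ν) (by linarith) hc t
  rw [sub_sub_cancel] at h1
  refine (((hasDerivAt_radialK hν hc t).const_mul (-ν)).sub
    (((hasDerivAt_exp_mul ν t).const_mul (2 * c ^ ν)).mul h1)).congr_deriv ?_
  have e1 : Real.exp (ν * t) * Real.exp (2 * (1 - ν) * t) = Real.exp (-ν * t) * Real.exp (2 * t) := by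
    rw [← Real.exp_add, ← Real.exp_add]; ring_nf
  have e2 : c ^ ν * c ^ (1 - ν) = c := by
    rw [← Real.rpow_add hc]; simp
  rw [radialK', radialK]
  set I := besselIntegral ν (c * Real.exp (2 * t))
  linear_combination (4 * c ^ ν * c ^ (1 - ν) * I) * e1 +
    (4 * Real.exp (-ν * t) * Real.exp (2 * t) * I) * e2

theorem radialSolution_radialK (hν : 0 < ν) (hν1 : ν < 1) (hc : 0 < c) :
    RadialSolution ν (-4 * c) (fun t => (radialK ν c t : ℂ)) (fun t => (radialK' ν c t : ℂ)) where
  deriv_fst t := (hasDerivAt_radialK hν hc t).ofReal_comp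
  deriv_snd t := by
    refine (hasDerivAt_radialK' hν hν1 hc t).ofReal_comp.congr_deriv ?_
    push_cast
    ring

theorem radialK_pos (hν : 0 < ν) (hc : 0 < c) (t : ℝ) : 0 < radialK ν c t :=
  mul_pos (Real.exp_pos _) (besselIntegral_pos hν (by positivity))

theorem continuous_radialK (hν : 0 < ν) (hc : 0 < c) : Continuous (radialK ν c) :=
  continuous_iff_continuousAt.2 fun t => (hasDerivAt_radialK hν hc t).continuousAt

/-- Near the origin the integral is bounded and `e^{(2-2ν)t}` is integrable since `ν < 1`; at
infinity the integral is `O(e^{-2t})`. -/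
theorem radialL2_radialK (hν : 0 < ν) (hν1 : ν < 1) (hc : 0 < c) :
    RadialL2 fun t => (radialK ν c t : ℂ) := by
  have hcont : Continuous fun t => ‖(radialK ν c t : ℂ)‖ ^ 2 * Real.exp (2 * t) := by
    have := continuous_radialK hν hc
    fun_prop
  have hB : ∀ t, ‖(radialK ν c t : ℂ)‖ ^ 2 * Real.exp (2 * t) =
      besselIntegral ν (c * Real.exp (2 * t)) ^ 2 * Real.exp ((2 - 2 * ν) * t) := by
    intro t
    have e : Real.exp ((2 - 2 * ν) * t) = Real.exp (-ν * t) ^ 2 * Real.exp (2 * t) := by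
      rw [← Real.exp_nat_mul, ← Real.exp_add]; push_cast; ring_nf
    rw [Complex.norm_real, Real.norm_of_nonneg (radialK_pos hν hc t).le, radialK, e]
    ring
  have hpos : ∀ t, 0 ≤ besselIntegral ν (c * Real.exp (2 * t)) := fun t =>
    (besselIntegral_pos hν (by positivity)).le
  rw [RadialL2, ← integrableOn_univ, ← Iic_union_Ioi (a := (0 : ℝ)), integrableOn_union]
  constructor
  · refine Integrable.mono' (((integrableOn_exp_mul_Iic (a := 2 - 2 * ν) (by linarith) 0)).const_mul
      (Real.Gamma ν ^ 2)) hcont.aestronglyMeasurable (ae_of_all _ fun t => ?_)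
    rw [Real.norm_of_nonneg (by positivity), hB]
    have := pow_le_pow_left₀ (hpos t) (besselIntegral_le hν (by positivity :
      0 ≤ c * Real.exp (2 * t))) 2
    exact mul_le_mul_of_nonneg_right this (Real.exp_pos _).le
  · refine Integrable.mono' (((integrableOn_exp_mul_Ioi (a := -2 - 2 * ν) (by linarith) 0)).const_mul
      ((Real.Gamma (ν + 1) / c) ^ 2)) hcont.aestronglyMeasurable (ae_of_all _ fun t => ?_)
    rw [Real.norm_of_nonneg (by positivity), hB]
    have := pow_le_pow_left₀ (hpos t) (besselIntegral_le_div hν (by positivity :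
      0 < c * Real.exp (2 * t))) 2
    refine (mul_le_mul_of_nonneg_right this (Real.exp_pos _).le).trans (le_of_eq ?_)
    have e : Real.exp ((2 - 2 * ν) * t) = Real.exp ((-2 - 2 * ν) * t) * Real.exp (2 * t) ^ 2 := by
      rw [← Real.exp_nat_mul, ← Real.exp_add]; push_cast; ring_nf
    rw [e]
    have := (Real.exp_pos (2 * t)).ne'
    field_simp

/-- The error of the expansion of the integral contributes `O(e^{(2-ν)t})`, which is `O(e^t)` at
`-∞` because `ν < 1`. -/
theorem hasExpansion_radialK (hν : 0 < ν) (hν1 : ν < 1) (hc : 0 < c) :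
    HasExpansion ν (fun t => (radialK ν c t : ℂ)) (Real.Gamma ν : ℂ)
      ((-(c ^ ν * Real.Gamma (1 - ν) / ν) : ℝ) : ℂ) := by
  refine IsBigO.of_bound (Real.Gamma ν / (1 - ν) * c) ?_
  filter_upwards [eventually_le_atBot 0] with t ht
  have hA : 0 ≤ c * Real.exp (2 * t) := by positivity
  have e1 : (c * Real.exp (2 * t)) ^ ν = c ^ ν * Real.exp (2 * ν * t) := by
    rw [Real.mul_rpow hc.le (Real.exp_pos _).le, ← Real.exp_mul]; ring_nf
  have e2 : Real.exp (ν * t) = Real.exp (-ν * t) * Real.exp (2 * ν * t) := by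
    rw [← Real.exp_add]; ring_nf
  have h : radialK ν c t - (Real.Gamma ν * Real.exp (-ν * t) +
      -(c ^ ν * Real.Gamma (1 - ν) / ν) * Real.exp (ν * t)) =
      Real.exp (-ν * t) * (besselIntegral ν (c * Real.exp (2 * t)) - (Real.Gamma ν -
        (c * Real.exp (2 * t)) ^ ν * Real.Gamma (1 - ν) / ν)) := by
    rw [radialK, e1, e2]; ring
  rw [← Complex.ofReal_mul, ← Complex.ofReal_mul, ← Complex.ofReal_add, ← Complex.ofReal_sub, h,
    Complex.norm_real, norm_mul, Real.norm_of_nonneg (Real.exp_pos _).le,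
    Real.norm_of_nonneg (Real.exp_pos _).le, Real.norm_eq_abs]
  refine (mul_le_mul_of_nonneg_left (besselIntegral_expansion hν hν1 hA)
    (Real.exp_pos _).le).trans ?_
  have h3 : Real.exp (-ν * t) * Real.exp (2 * t) ≤ Real.exp t := by
    rw [← Real.exp_add]
    refine Real.exp_le_exp.2 ?_
    nlinarith
  have hG : 0 ≤ Real.Gamma ν / (1 - ν) * c := by
    have := Real.Gamma_pos_of_pos hν
    have : 0 < 1 - ν := by linarith
    positivity
  have := mul_le_mul_of_nonneg_left h3 hG
  linarith

/-- A square integrable solution is a multiple of `radialK`. -/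
theorem RadialSolution.eq_const_mul_radialK (hν : 0 < ν) (hν1 : ν < 1) (hc : 0 < c) {u v : ℝ → ℂ}
    (h : RadialSolution ν (-4 * c) u v) (hL : RadialL2 u) :
    ∃ a : ℂ, u = fun t => a * (radialK ν c t : ℂ) := by
  have hK := radialSolution_radialK hν hν1 hc
  have hne : ∀ t, (radialK ν c t : ℂ) ≠ 0 := fun t => by exact_mod_cast (radialK_pos hν hc t).ne'
  -- The Wronskian of two square integrable solutions vanishes, so the quotient by the positive
  -- solution is constant.
  have hd : ∀ t, HasDerivAt (fun t => u t / (radialK ν c t : ℂ)) 0 t := by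
    intro t
    refine ((h.deriv_fst t).div (hK.deriv_fst t) (hne t)).congr_deriv ?_
    rw [h.wronskian_eq_zero hK hL (radialL2_radialK hν hν1 hc) t]
    ring
  refine ⟨u 0 / (radialK ν c 0 : ℂ), funext fun t => ?_⟩
  have := is_const_of_deriv_eq_zero (fun s => (hd s).differentiableAt) (fun s => (hd s).deriv) t 0
  rw [← this]
  exact (div_mul_cancel₀ _ (hne t)).symm

end

/-! ### The eigenspaces -/

section

variable {α : ℝ} {C D : Matrix (Fin 2) (Fin 2) ℂ} {z : ℂ}

theorem modeFun_zero (m : ℤ) : modeFun m 0 = 0 := by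
  funext x
  by_cases hx : x = 0
  · simp [modeFun, hx]
  · simp [modeFun_of_ne hx]

theorem exists_modes_of_mem_eigenspace (h0 : 0 < α) (h1 : α < 1) {f : L2Plane}
    (hf : f ∈ eigenspace (hamiltonian α C D) z) :
    ∃ u v u' v' : ℝ → ℂ, RadialSolution α z u v ∧ RadialL2 u ∧ RadialSolution (1 - α) z u' v' ∧
      RadialL2 u' ∧ f =ᵐ[volume] (fun x => modeFun 0 u x + modeFun (-1) u' x) ∧
      ∃ Φ Ψ : Fin 2 → ℂ, HasExpansion α (fun t => 2 * (Real.pi : ℂ) * u t) (Φ 0) (Ψ 0) ∧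
        HasExpansion (1 - α) (fun t => 2 * (Real.pi : ℂ) * u' t) (Φ 1) (Ψ 1) ∧
        C *ᵥ Φ = (2 : ℂ) • (D *ᵥ ![(α : ℂ) * Ψ 0, (1 - (α : ℂ)) * Ψ 1]) := by
  obtain ⟨⟨Φ, Ψ, hbv, hbc⟩, hw⟩ := mem_eigenspace_hamiltonian.1 hf
  obtain ⟨u, v, u', v', hu, huL, hu', hu'L, hfe⟩ :=
    exists_modes h0 h1 (Lp.memLp f) (Lp.stronglyMeasurable f) hw
  obtain ⟨e0, e1⟩ := (hasBoundaryValues_iff hu.continuous_fst hu'.continuous_fst hfe).1 hbv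
  exact ⟨u, v, u', v', hu, huL, hu', hu'L, hfe, Φ, Ψ, e0, e1, hbc⟩

/-- For real `z ≥ 0` each channel alone admits no square integrable solution. For non-real `z` the
fluxes of the two channels at the origin add up to the imaginary part of the boundary form, which is
zero for an admissible pair. -/
theorem eigenspace_eq_bot (h0 : 0 < α) (h1 : α < 1) (hCD : Admissible C D)
    (hz : z.im ≠ 0 ∨ 0 ≤ z.re) : eigenspace (hamiltonian α C D) z = ⊥ := by
  rw [Submodule.eq_bot_iff]
  intro f hf
  obtain ⟨u, v, u', v', hu, huL, hu', hu'L, hfe, Φ, Ψ, e0, e1, hbc⟩ :=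
    exists_modes_of_mem_eigenspace h0 h1 hf
  have hzero : u = 0 ∧ u' = 0 := by
    by_cases him : z.im = 0
    · have hre : 0 ≤ z.re := hz.resolve_left (not_not.2 him)
      have e : z = (z.re : ℂ) := Complex.ext (by simp) (by simp [him])
      rw [e] at hu hu'
      rcases hre.lt_or_eq with hp | hp
      · exact ⟨hu.eq_zero_of_pos hp huL, hu'.eq_zero_of_pos hp hu'L⟩
      · rw [← hp, Complex.ofReal_zero] at hu hu'
        exact ⟨RadialSolution.eq_zero_of_zero h0 h1 hu huL,
          RadialSolution.eq_zero_of_zero (by linarith) (by linarith) hu' hu'L⟩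
    · have t0 := RadialSolution.tendsto_im_atBot h0 h1 (hu.const_mul (2 * (Real.pi : ℂ))) e0
      have t1 := RadialSolution.tendsto_im_atBot (by linarith) (by linarith)
        (hu'.const_mul (2 * (Real.pi : ℂ))) e1
      have ht := t0.add t1
      have hL := hCD.im_dotProduct_eq_zero (φ := Φ)
        (w := (2 : ℂ) • ![(α : ℂ) * Ψ 0, (1 - (α : ℂ)) * Ψ 1]) (by rw [hbc, Matrix.mulVec_smul])
      have hs : 2 * α * (star (Φ 0) * Ψ 0).im + 2 * (1 - α) * (star (Φ 1) * Ψ 1).im = 0 := by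
        rw [← hL]
        simp [dotProduct, Fin.sum_univ_two]
        ring
      rw [hs] at ht
      obtain ⟨k0, k1⟩ := RadialSolution.eq_zero_of_im_ne_zero him (hu.const_mul (2 * (Real.pi : ℂ)))
        (huL.const_mul _) (hu'.const_mul (2 * (Real.pi : ℂ))) (hu'L.const_mul _) ht
      have hpi : 2 * (Real.pi : ℂ) ≠ 0 := by exact_mod_cast Real.two_pi_pos.ne'
      constructor
      · funext t
        simpa [hpi] using congrFun k0 t
      · funext t
        simpa [hpi] using congrFun k1 t
  rw [hzero.1, hzero.2, modeFun_zero, modeFun_zero] at hfe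
  rw [Lp.eq_zero_iff_ae_eq_zero]
  filter_upwards [hfe] with x hx
  rw [hx]
  simp

theorem memLp_modeFun (m : ℤ) {u : ℝ → ℂ} (hu : Continuous u) (hL : RadialL2 u) :
    MemLp (modeFun m u) 2 volume := by
  have hm := measurable_modeFun m hu
  rw [← measurePreserving_logPolar.map_eq, memLp_map_measure_iff hm.aestronglyMeasurable
    continuous_logPolar.measurable.aemeasurable, memLp_two_iff_integrable_sq_norm
    (hm.comp continuous_logPolar.measurable).aestronglyMeasurable]
  have h1 : Integrable (fun t => ‖u t‖ ^ 2) radialMeasure := integrable_radialMeasure_iff.2 hL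
  refine (h1.comp_fst angleMeasure).congr (ae_of_all _ fun p => ?_)
  simp only [Function.comp_apply, modeFun_logPolar, norm_mul, norm_phase, mul_one]

/-- The decaying solution, with leading coefficient one at the origin. -/
def decaying (ν c t : ℝ) : ℂ := (Real.Gamma ν : ℂ)⁻¹ * (radialK ν c t : ℂ)

theorem continuous_decaying {ν c : ℝ} (hν : 0 < ν) (hc : 0 < c) : Continuous (decaying ν c) := by
  have := continuous_radialK hν hc
  unfold decaying
  fun_prop

/-- The ratio, up to a constant, of the coefficients of the decaying solution. -/
def weylFactor (ν c : ℝ) : ℝ := 2 * c ^ ν * Real.Gamma (1 - ν) / Real.Gamma ν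

theorem hasExpansion_decaying {ν c : ℝ} (hν : 0 < ν) (hν1 : ν < 1) (hc : 0 < c) (a : ℂ) :
    HasExpansion ν (fun t => a * decaying ν c t) a ((-(weylFactor ν c) / (2 * ν) : ℝ) * a) := by
  have h := ((hasExpansion_radialK hν hν1 hc).const_mul (Real.Gamma ν : ℂ)⁻¹).const_mul a
  have hG : (Real.Gamma ν : ℂ) ≠ 0 := by exact_mod_cast (Real.Gamma_pos_of_pos hν).ne'
  have hν' : (ν : ℂ) ≠ 0 := by exact_mod_cast hν.ne'
  convert h using 1
  · rfl
  · field_simp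
  · rw [weylFactor]
    push_cast
    field_simp

/-- The eigenfunction candidates at the energy `-4c`. -/
def decayingFun (α c : ℝ) (a : Fin 2 → ℂ) (x : Plane) : ℂ :=
  a 0 * modeFun 0 (decaying α c) x + a 1 * modeFun (-1) (decaying (1 - α) c) x

theorem decayingFun_eq (α c : ℝ) (a : Fin 2 → ℂ) : decayingFun α c a = fun x =>
    modeFun 0 (fun t => a 0 * decaying α c t) x +
      modeFun (-1) (fun t => a 1 * decaying (1 - α) c t) x := by
  funext x
  by_cases hx : x = 0
  · simp [decayingFun, modeFun, hx]
  · simp only [decayingFun, modeFun_of_ne hx]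
    ring

variable {c : ℝ}

theorem memLp_decayingFun (h0 : 0 < α) (h1 : α < 1) (hc : 0 < c) (a : Fin 2 → ℂ) :
    MemLp (decayingFun α c a) 2 volume := by
  have k0 := memLp_modeFun 0 (continuous_decaying h0 hc) ((radialL2_radialK h0 h1 hc).const_mul _)
  have k1 := memLp_modeFun (-1) (continuous_decaying (ν := 1 - α) (by linarith) hc)
    ((radialL2_radialK (by linarith) (by linarith) hc).const_mul _)
  exact (k0.const_mul (a 0)).add (k1.const_mul (a 1))

/-- `decayingFun` as a linear map. -/
def decayingMap (h0 : 0 < α) (h1 : α < 1) (hc : 0 < c) : (Fin 2 → ℂ) →ₗ[ℂ] L2Plane where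
  toFun a := (memLp_decayingFun h0 h1 hc a).toLp _
  map_add' a b := by
    rw [← MemLp.toLp_add]
    congr 1
    funext x
    simp only [decayingFun, Pi.add_apply]
    ring
  map_smul' k a := by
    rw [RingHom.id_apply, ← MemLp.toLp_const_smul]
    congr 1
    funext x
    simp only [decayingFun, Pi.smul_apply, smul_eq_mul]
    ring

theorem decayingMap_ae_eq (h0 : 0 < α) (h1 : α < 1) (hc : 0 < c) (a : Fin 2 → ℂ) :
    decayingMap h0 h1 hc a =ᵐ[volume] fun x => modeFun 0 (fun t => a 0 * decaying α c t) x +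
      modeFun (-1) (fun t => a 1 * decaying (1 - α) c t) x := by
  rw [← decayingFun_eq]
  exact (memLp_decayingFun h0 h1 hc a).coeFn_toLp

theorem hasBoundaryValues_decayingMap (h0 : 0 < α) (h1 : α < 1) (hc : 0 < c) (a : Fin 2 → ℂ) :
    HasBoundaryValues α (decayingMap h0 h1 hc a) (fun j => 2 * (Real.pi : ℂ) * a j)
      ![(-(weylFactor α c) / (2 * α) : ℝ) * (2 * (Real.pi : ℂ) * a 0),
        (-(weylFactor (1 - α) c) / (2 * (1 - α)) : ℝ) * (2 * (Real.pi : ℂ) * a 1)] := by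
  refine (hasBoundaryValues_iff (continuous_const.mul (continuous_decaying h0 hc))
    (continuous_const.mul (continuous_decaying (by linarith) hc))
    (decayingMap_ae_eq h0 h1 hc a)).2 ⟨?_, ?_⟩
  · simpa [mul_assoc] using hasExpansion_decaying h0 h1 hc (2 * (Real.pi : ℂ) * a 0)
  · simpa [mul_assoc] using hasExpansion_decaying (ν := 1 - α) (by linarith) (by linarith) hc
      (2 * (Real.pi : ℂ) * a 1)

theorem hasBoundaryValues_unique_of_decayingMap (h0 : 0 < α) (h1 : α < 1) (hc : 0 < c)
    {a : Fin 2 → ℂ} {Φ Ψ : Fin 2 → ℂ} (h : HasBoundaryValues α (decayingMap h0 h1 hc a) Φ Ψ) :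
    Φ = (fun j => 2 * (Real.pi : ℂ) * a j) ∧
    Ψ = ![(-(weylFactor α c) / (2 * α) : ℝ) * (2 * (Real.pi : ℂ) * a 0),
        (-(weylFactor (1 - α) c) / (2 * (1 - α)) : ℝ) * (2 * (Real.pi : ℂ) * a 1)] := by
  have key := hasBoundaryValues_iff (α := α) (u := fun t => a 0 * decaying α c t)
    (u' := fun t => a 1 * decaying (1 - α) c t) (continuous_const.mul (continuous_decaying h0 hc))
    (continuous_const.mul (continuous_decaying (by linarith) hc))
    (decayingMap_ae_eq h0 h1 hc a) (Φ := Φ) (Ψ := Ψ)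
  have key' := hasBoundaryValues_iff (α := α) (u := fun t => a 0 * decaying α c t)
    (u' := fun t => a 1 * decaying (1 - α) c t) (continuous_const.mul (continuous_decaying h0 hc))
    (continuous_const.mul (continuous_decaying (by linarith) hc))
    (decayingMap_ae_eq h0 h1 hc a) |>.1 (hasBoundaryValues_decayingMap h0 h1 hc a)
  obtain ⟨k0, k1⟩ := key.1 h
  obtain ⟨p0, q0⟩ := k0.unique h0 h1 key'.1
  obtain ⟨p1, q1⟩ := k1.unique (by linarith) (by linarith) key'.2
  constructor
  · funext j
    fin_cases j
    · exact p0
    · exact p1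
  · funext j
    fin_cases j
    · exact q0
    · exact q1

/-- The coefficients `Φ` of the expansion recover `a`, and boundary values are unique. -/
theorem decayingMap_injective (h0 : 0 < α) (h1 : α < 1) (hc : 0 < c) :
    Function.Injective (decayingMap h0 h1 hc) := by
  rw [← LinearMap.ker_eq_bot, LinearMap.ker_eq_bot']
  intro a ha
  have hz : HasBoundaryValues α (decayingMap h0 h1 hc a) 0 0 := by
    rw [ha]
    have h : (fun x : Plane => 2 * (Real.pi : ℂ) * (0 : L2Plane) x - singularPart α 0 0 x)
        =ᶠ[ae (volume : Measure Plane) ⊓ 𝓝 0] fun _ => 0 := by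
      filter_upwards [(Lp.coeFn_zero ℂ 2 (volume : Measure Plane)).filter_mono inf_le_left] with x hx
      rw [hx]
      simp [singularPart]
    exact h.trans_isBigO (isBigO_zero _ _)
  have := (hasBoundaryValues_unique_of_decayingMap h0 h1 hc hz).1
  funext j
  have h2 := congrFun this j
  have hpi : (Real.pi : ℂ) ≠ 0 := by exact_mod_cast Real.pi_ne_zero
  simpa [hpi] using h2.symm

/-- The matrix whose kernel is the eigenspace of the energy `-4c`. -/
def bornMatrix (α : ℝ) (C D : Matrix (Fin 2) (Fin 2) ℂ) (c : ℝ) : Matrix (Fin 2) (Fin 2) ℂ :=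
  C + D * Matrix.diagonal ![(weylFactor α c : ℂ), (weylFactor (1 - α) c : ℂ)]

/-- On decaying solutions `2αΨ₀` and `2(1-α)Ψ₋₁` are minus the Weyl factors times `Φ₀` and `Φ₋₁`. -/
theorem boundaryCondition_decaying_iff (h0 : 0 < α) (h1 : α < 1) (a : Fin 2 → ℂ) :
    C *ᵥ (fun j => 2 * (Real.pi : ℂ) * a j) = (2 : ℂ) • (D *ᵥ ![(α : ℂ) *
      ((-(weylFactor α c) / (2 * α) : ℝ) * (2 * (Real.pi : ℂ) * a 0)), (1 - (α : ℂ)) *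
        ((-(weylFactor (1 - α) c) / (2 * (1 - α)) : ℝ) * (2 * (Real.pi : ℂ) * a 1))]) ↔
      bornMatrix α C D c *ᵥ a = 0 := by
  have hpi : 2 * (Real.pi : ℂ) ≠ 0 := by exact_mod_cast Real.two_pi_pos.ne'
  have hα : (α : ℂ) ≠ 0 := by exact_mod_cast h0.ne'
  have hα1 : 1 - (α : ℂ) ≠ 0 := by
    have : 1 - α ≠ 0 := by linarith
    exact_mod_cast this
  have e1 : (fun j => 2 * (Real.pi : ℂ) * a j) = (2 * (Real.pi : ℂ)) • a := rfl
  have e2 : ![(α : ℂ) * ((-(weylFactor α c) / (2 * α) : ℝ) * (2 * (Real.pi : ℂ) * a 0)),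
      (1 - (α : ℂ)) * ((-(weylFactor (1 - α) c) / (2 * (1 - α)) : ℝ) *
        (2 * (Real.pi : ℂ) * a 1))] = (-(Real.pi : ℂ)) •
      (Matrix.diagonal ![(weylFactor α c : ℂ), (weylFactor (1 - α) c : ℂ)] *ᵥ a) := by
    funext j
    fin_cases j
    · simp
      field_simp
    · simp
      field_simp
  rw [e1, e2, Matrix.mulVec_smul, Matrix.mulVec_smul, bornMatrix, Matrix.add_mulVec,
    ← Matrix.mulVec_mulVec, smul_smul, show (2 : ℂ) * -(Real.pi : ℂ) = -(2 * (Real.pi : ℂ)) by ring,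
    neg_smul, ← smul_neg, smul_right_inj hpi, eq_neg_iff_add_eq_zero]

/-- Square integrability determines each of the two modes up to a scalar, and the boundary condition
is a linear condition on the two scalars. Conversely the decaying modes satisfy the weak equation.
-/
theorem eigenspace_eq_map (h0 : 0 < α) (h1 : α < 1) (hc : 0 < c) :
    eigenspace (hamiltonian α C D) (-4 * c) =
      (LinearMap.ker (bornMatrix α C D c).mulVecLin).map (decayingMap h0 h1 hc) := by
  ext f
  rw [Submodule.mem_map]
  constructor
  · intro hf
    obtain ⟨u, v, u', v', hu, huL, hu', hu'L, hfe, -⟩ := exists_modes_of_mem_eigenspace h0 h1 hf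
    obtain ⟨a₀, ha₀⟩ := hu.eq_const_mul_radialK h0 h1 hc huL
    obtain ⟨a₁, ha₁⟩ := hu'.eq_const_mul_radialK (by linarith) (by linarith) hc hu'L
    have hG0 : (Real.Gamma α : ℂ) ≠ 0 := by exact_mod_cast (Real.Gamma_pos_of_pos h0).ne'
    have hG1 : (Real.Gamma (1 - α) : ℂ) ≠ 0 := by
      exact_mod_cast (Real.Gamma_pos_of_pos (by linarith)).ne'
    set a : Fin 2 → ℂ := ![a₀ * (Real.Gamma α : ℂ), a₁ * (Real.Gamma (1 - α) : ℂ)]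
    have hfa : decayingMap h0 h1 hc a = f := by
      refine Lp.ext ((decayingMap_ae_eq h0 h1 hc a).trans (EventuallyEq.trans ?_ hfe.symm))
      have e0 : (fun t => a 0 * decaying α c t) = u := by
        rw [ha₀]; funext t; simp only [a, decaying, Matrix.cons_val_zero]; field_simp
      have e1 : (fun t => a 1 * decaying (1 - α) c t) = u' := by
        rw [ha₁]; funext t; simp only [a, decaying, Matrix.cons_val_one, Matrix.cons_val_fin_one]
        field_simp
      rw [e0, e1]
    refine ⟨a, ?_, hfa⟩
    obtain ⟨⟨Φ, Ψ, hbv, hbc⟩, -⟩ := mem_eigenspace_hamiltonian.1 hf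
    rw [← hfa] at hbv
    obtain ⟨rfl, rfl⟩ := hasBoundaryValues_unique_of_decayingMap h0 h1 hc hbv
    exact (boundaryCondition_decaying_iff h0 h1 a).1 hbc
  · rintro ⟨a, ha, rfl⟩
    refine mem_eigenspace_hamiltonian.2 ⟨⟨_, _, hasBoundaryValues_decayingMap h0 h1 hc a,
      (boundaryCondition_decaying_iff h0 h1 a).2 ha⟩, fun w => ?_⟩
    have s0 := ((radialSolution_radialK h0 h1 hc).const_mul (Real.Gamma α : ℂ)⁻¹).const_mul (a 0)
    have s1 := ((radialSolution_radialK (ν := 1 - α) (by linarith) (by linarith) hc).const_mul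
      (Real.Gamma (1 - α) : ℂ)⁻¹).const_mul (a 1)
    have p0 := pairing_modeFun_magneticLaplacian (α := α) (m := 0) (by simp) s0 w
    have p1 := pairing_modeFun_magneticLaplacian (α := α) (m := -1) (by push_cast; ring) s1 w
    have hadd : ∀ w : testSpace, pairing (decayingMap h0 h1 hc a) w =
        pairing (modeFun 0 fun t => a 0 * decaying α c t) w +
        pairing (modeFun (-1) fun t => a 1 * decaying (1 - α) c t) w := by
      intro w
      rw [pairing_congr (decayingMap_ae_eq h0 h1 hc a), pairing, pairing, pairing, ← integral_add]
      · congr 1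
        funext x
        rw [star_add, add_mul]
      · exact integrable_mul_test (fun x hx => (contDiffAt_modeFun 0 s0.contDiff.1 hx).continuousAt.star) w.2
      · exact integrable_mul_test (fun x hx => (contDiffAt_modeFun (-1) s1.contDiff.1 hx).continuousAt.star) w.2
    rw [hadd, hadd, mul_add]
    exact congrArg₂ (· + ·) p0 p1

theorem toENat_rank_eigenspace (h0 : 0 < α) (h1 : α < 1) (hc : 0 < c) :
    Cardinal.toENat (Module.rank ℂ (eigenspace (hamiltonian α C D) (-4 * c))) =
      (Module.finrank ℂ (LinearMap.ker (bornMatrix α C D c).mulVecLin) : ℕ∞) := by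
  rw [eigenspace_eq_map h0 h1 hc, ← (Submodule.equivMapOfInjective _
    (decayingMap_injective h0 h1 hc) _).rank_eq, ← Module.finrank_eq_rank]
  simp

/-- Eigenvalues are negative reals, that is of the form `-4c` with `c > 0`. Off the finite set the
matrix is injective, so the sum over the complex plane is finite. -/
theorem eigenvalueCount_eq_sum (h0 : 0 < α) (h1 : α < 1) (hCD : Admissible C D) (s : Finset ℝ)
    (hs : ∀ c ∈ s, 0 < c) (h : ∀ c, 0 < c → c ∉ s → (bornMatrix α C D c).det ≠ 0) :
    eigenvalueCount (hamiltonian α C D) = ((∑ c ∈ s,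
      Module.finrank ℂ (LinearMap.ker (bornMatrix α C D c).mulVecLin) : ℕ) : ℕ∞) := by
  classical
  have hinj : Function.Injective fun c : ℝ => (-4 * c : ℂ) := by
    intro a b hab
    have : (a : ℂ) = b := by
      have h4 : (-4 : ℂ) ≠ 0 := by norm_num
      exact mul_left_cancel₀ h4 hab
    exact_mod_cast this
  rw [eigenvalueCount, tsum_eq_sum (s := s.image fun c : ℝ => (-4 * c : ℂ)), Finset.sum_image
    (fun a _ b _ hab => hinj hab)]
  · push_cast
    exact Finset.sum_congr rfl fun c hc => toENat_rank_eigenspace h0 h1 (hs c hc)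
  · intro z hz
    by_cases hneg : z.im ≠ 0 ∨ 0 ≤ z.re
    · rw [eigenspace_eq_bot h0 h1 hCD hneg]
      simp
    · rw [not_or, not_not, not_le] at hneg
      have e : z = -4 * ((-z.re / 4 : ℝ) : ℂ) := by
        apply Complex.ext
        · simp
          ring
        · simp [hneg.1]
      have hc : 0 < -z.re / 4 := by linarith [hneg.2]
      have hns : -z.re / 4 ∉ s := fun hmem => hz (Finset.mem_image.2 ⟨_, hmem, e.symm⟩)
      rw [e, toENat_rank_eigenspace h0 h1 hc]
      have hk : LinearMap.ker (bornMatrix α C D (-z.re / 4)).mulVecLin = ⊥ := by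
        rw [LinearMap.ker_eq_bot']
        intro a ha
        exact Matrix.eq_zero_of_mulVec_eq_zero (h _ hc hns) ha
      rw [hk]
      simp

end

/-! ### Coordinates of admissible pairs -/

/-- The coordinates of a pair `(C, D)`: up to a phase `u`, the matrix `adj(C) D` is Hermitian and
the determinants of `C` and `D` are real. -/
structure PairCoordinates (C D : Matrix (Fin 2) (Fin 2) ℂ) (u : ℂ) (c a b d : ℝ) (e : ℂ) : Prop where
  norm_eq_one : ‖u‖ = 1
  det_fst : C.det = u * c
  det_snd : D.det = u * d
  adjugate_mul : C.adjugate * D = u • !![(a : ℂ), e; star e, (b : ℂ)]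
  ne_zero : c - d ≠ 0 ∨ a + b ≠ 0

/-- `U(2) = U(1) · SU(2)`: divide by a square root of the determinant. -/
theorem exists_eq_smul_of_unitary {V : Matrix (Fin 2) (Fin 2) ℂ} (hV : V * Vᴴ = 1) :
    ∃ v P Q : ℂ, ‖v‖ = 1 ∧ V = v • !![P, Q; -star Q, star P] ∧ P * star P + Q * star Q = 1 := by
  obtain ⟨v, hv⟩ := IsAlgClosed.exists_pow_nat_eq V.det (n := 2) two_pos
  have hd : V.det * star V.det = 1 := by
    rw [← Matrix.det_conjTranspose, ← Matrix.det_mul, hV, Matrix.det_one]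
  have hn : ‖v‖ = 1 := by
    have h1 : ‖V.det‖ * ‖V.det‖ = 1 := by
      have := congrArg norm hd
      simpa using this
    have h2 : ‖V.det‖ = 1 := by nlinarith [norm_nonneg V.det]
    rw [← hv, norm_pow] at h2
    nlinarith [norm_nonneg v]
  have hvv : v * star v = 1 := by
    have := Complex.mul_conj v
    rw [Complex.normSq_eq_norm_sq, hn] at this
    simpa using this
  have hadj : V.adjugate = V.det • Vᴴ := by
    have h1 : V.adjugate * (V * Vᴴ) = V.adjugate := by rw [hV, mul_one]
    rw [← h1, ← mul_assoc, Matrix.adjugate_mul, smul_mul_assoc, one_mul]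
  have h00 := congrFun (congrFun hadj 0) 0
  have h10 := congrFun (congrFun hadj 1) 0
  simp [Matrix.adjugate_fin_two, ← hv] at h00 h10
  refine ⟨v, star v * V 0 0, star v * V 0 1, hn, ?_, ?_⟩
  · ext i j
    fin_cases i <;> fin_cases j
    · simp at hvv ⊢
      linear_combination -V 0 0 * hvv
    · simp at hvv ⊢
      linear_combination -V 0 1 * hvv
    · simp
      linear_combination -h10
    · simp
      linear_combination h00
  · have h := congrFun (congrFun hV 0) 0
    simp [Matrix.mul_apply, Fin.sum_univ_two] at h
    simp at hvv ⊢
    linear_combination h + (V 0 0 * (starRingEnd ℂ) (V 0 0) + V 0 1 * (starRingEnd ℂ) (V 0 1)) * hvv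

/-- Cayley transform: `A = C + iD` satisfies `AA* = CC* + DD*`, so it is invertible, and `V = A⁻¹(C
- iD)` is unitary. Then `C = A(1 + V)/2` and `D = A(1 - V)/(2i)`, and the coordinates are read off
from `det A` and the decomposition of `V` into a phase and an element of `SU(2)`. -/
theorem Admissible.exists_pairCoordinates {C D : Matrix (Fin 2) (Fin 2) ℂ} (h : Admissible C D) :
    ∃ u c a b d e, PairCoordinates C D u c a b d e := by
  have hsym : D * Cᴴ = C * Dᴴ := by
    have := h.isHermitian
    rwa [Matrix.IsHermitian, Matrix.conjTranspose_mul, Matrix.conjTranspose_conjTranspose] at this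
  set A := C + Complex.I • D with hA
  set B := C - Complex.I • D with hB
  have hII : Complex.I * Complex.I = -1 := Complex.I_mul_I
  have hAA : A * Aᴴ = C * Cᴴ + D * Dᴴ := by
    rw [hA, Matrix.conjTranspose_add, Matrix.conjTranspose_smul, add_mul, mul_add, mul_add]
    simp only [Matrix.smul_mul, Matrix.mul_smul, smul_smul, hsym]
    simp
  have hBB : B * Bᴴ = C * Cᴴ + D * Dᴴ := by
    rw [hB, Matrix.conjTranspose_sub, Matrix.conjTranspose_smul, sub_mul, mul_sub, mul_sub]
    simp only [Matrix.smul_mul, Matrix.mul_smul, smul_smul, hsym]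
    simp
    abel
  have hdA : A.det ≠ 0 := by
    intro h0
    apply h.det_ne_zero
    rw [← hAA, Matrix.det_mul, h0, zero_mul]
  have hu : IsUnit A.det := isUnit_iff_ne_zero.2 hdA
  set V := A⁻¹ * B with hVdef
  have hAV : A * V = B := by rw [hVdef, ← mul_assoc, Matrix.mul_nonsing_inv A hu, one_mul]
  have hV : V * Vᴴ = 1 := by
    rw [hVdef, Matrix.conjTranspose_mul, ← mul_assoc, mul_assoc A⁻¹ B, hBB, ← hAA, ← mul_assoc,
      Matrix.nonsing_inv_mul A hu, one_mul, ← Matrix.conjTranspose_mul,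
      Matrix.nonsing_inv_mul A hu, Matrix.conjTranspose_one]
  obtain ⟨v, P, Q, hv, hVe, hPQ⟩ := exists_eq_smul_of_unitary hV
  have hvv : v * star v = 1 := by
    have := Complex.mul_conj v
    rw [Complex.normSq_eq_norm_sq, hv] at this
    simpa using this
  set X : Matrix (Fin 2) (Fin 2) ℂ :=
    (1 / 2 : ℂ) • !![1 + v * P, v * Q; -(v * star Q), 1 + v * star P] with hX
  set Y : Matrix (Fin 2) (Fin 2) ℂ :=
    (-Complex.I / 2) • !![1 - v * P, -(v * Q); v * star Q, 1 - v * star P] with hY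
  have hVX : X = (1 / 2 : ℂ) • (1 + V) := by
    rw [hX, hVe]
    ext i j
    fin_cases i <;> fin_cases j <;> simp
  have hVY : Y = (-Complex.I / 2) • (1 - V) := by
    rw [hY, hVe]
    ext i j
    fin_cases i <;> fin_cases j <;> simp
  have hC : C = A * X := by
    rw [hVX, Matrix.mul_smul, mul_add, hAV, mul_one, hA, hB, add_add_sub_cancel, ← two_smul ℂ,
      smul_smul]
    norm_num
  have hD : D = A * Y := by
    rw [hVY, Matrix.mul_smul, mul_sub, hAV, mul_one, hA, hB, add_sub_sub_cancel, ← two_smul ℂ,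
      smul_smul, smul_smul]
    have : -Complex.I / 2 * 2 * Complex.I = 1 := by linear_combination -hII
    rw [this, one_smul]
  set ρ : ℝ := ‖A.det‖ with hρ
  have hρ0 : ρ ≠ 0 := norm_ne_zero_iff.2 hdA
  set w : ℂ := A.det / ρ with hw
  have hdw : A.det = w * ρ := by
    rw [hw, div_mul_cancel₀]
    exact_mod_cast hρ0
  have hwn : ‖w‖ = 1 := by
    rw [hw, norm_div, Complex.norm_real, Real.norm_of_nonneg (norm_nonneg _), ← hρ, div_self hρ0]
  have re2 : ∀ z : ℂ, ((z.re : ℝ) : ℂ) = (z + star z) / 2 := fun z => by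
    rw [← starRingEnd_apply, Complex.re_eq_add_conj]
  have im2 : ∀ z : ℂ, ((z.im : ℝ) : ℂ) = -Complex.I * (z - star z) / 2 := fun z => by
    rw [← starRingEnd_apply, Complex.im_eq_sub_conj]
    rw [div_eq_div_iff (mul_ne_zero two_ne_zero Complex.I_ne_zero) two_ne_zero]
    linear_combination (2 * (z - (starRingEnd ℂ) z)) * hII
  -- The common phase is that of `det A` times `v`. With these choices `c - d = ρ Re v` and `a + b =
  -- -ρ Im v`, which cannot both vanish.
  refine ⟨w * v, ρ * (v.re + P.re) / 2, -ρ * (v.im + P.im) / 2, -ρ * (v.im - P.im) / 2,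
    -ρ * (v.re - P.re) / 2, ρ * Complex.I * Q / 2, ⟨by simp [hwn, hv], ?_, ?_, ?_, ?_⟩⟩
  · rw [hC, Matrix.det_mul, hdw, hX, Matrix.det_smul, Matrix.det_fin_two_of]
    push_cast
    rw [re2 v, re2 P]
    simp only [Fintype.card_fin]
    linear_combination (w * ρ * v ^ 2 / 4) * hPQ - (w * ρ / 4) * hvv
  · rw [hD, Matrix.det_mul, hdw, hY, Matrix.det_smul, Matrix.det_fin_two_of]
    push_cast
    rw [re2 v, re2 P]
    simp only [Fintype.card_fin]
    linear_combination (w * ρ / 4 * ((1 - v * P) * (1 - v * star P) + v * Q * (v * star Q))) * hII -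
      (w * ρ * v ^ 2 / 4) * hPQ + (w * ρ / 4) * hvv
  · have hKK : C.adjugate * D = A.det • (X.adjugate * Y) := by
      rw [hC, Matrix.adjugate_mul_distrib, hD, mul_assoc, ← mul_assoc A.adjugate,
        Matrix.adjugate_mul, smul_mul_assoc, one_mul, Matrix.mul_smul]
    rw [hKK, hdw, hX, hY, Matrix.adjugate_fin_two]
    ext i j
    fin_cases i <;> fin_cases j
    · simp
      rw [im2 v, im2 P]
      simp at hPQ hvv ⊢
      linear_combination (Complex.I * w * ρ * v ^ 2 / 4) * hPQ + (Complex.I * w * ρ / 4) * hvv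
    · simp
      ring
    · simp
      ring
    · simp
      rw [im2 v, im2 P]
      simp at hPQ hvv ⊢
      linear_combination (Complex.I * w * ρ * v ^ 2 / 4) * hPQ + (Complex.I * w * ρ / 4) * hvv
  · by_contra! hcon
    have e1 : ρ * v.re = 0 := by linarith [hcon.1]
    have e2 : ρ * v.im = 0 := by linarith [hcon.2]
    have hr : v.re = 0 := (mul_eq_zero.1 e1).resolve_left hρ0
    have hi : v.im = 0 := (mul_eq_zero.1 e2).resolve_left hρ0
    have : v = 0 := Complex.ext hr hi
    rw [this] at hv
    simp at hv

namespace PairCoordinates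

variable {C D : Matrix (Fin 2) (Fin 2) ℂ} {u : ℂ} {c a b d : ℝ} {e : ℂ}

theorem neg (h : PairCoordinates C D u c a b d e) :
    PairCoordinates C D (-u) (-c) (-a) (-b) (-d) (-e) where
  norm_eq_one := by rw [norm_neg]; exact h.norm_eq_one
  det_fst := by rw [h.det_fst]; push_cast; ring
  det_snd := by rw [h.det_snd]; push_cast; ring
  adjugate_mul := by
    rw [h.adjugate_mul]
    ext i j
    fin_cases i <;> fin_cases j <;> simp
  ne_zero := by
    rcases h.ne_zero with h | h
    · left; intro h2; apply h; linarith
    · right; intro h2; apply h; linarith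

theorem ne_zero' (h : PairCoordinates C D u c a b d e) : u ≠ 0 := by
  intro h0
  have := h.norm_eq_one
  simp [h0] at this

theorem mul_star (h : PairCoordinates C D u c a b d e) : u * star u = 1 := by
  have := Complex.mul_conj u
  rw [Complex.normSq_eq_norm_sq, h.norm_eq_one] at this
  simpa using this

/-- The determinant of `adj(C) D`, computed from the factors and from the Hermitian form; in size
two `adj(C)` and `C` have the same determinant. -/
theorem mul_sub_mul (h : PairCoordinates C D u c a b d e) : a * b - c * d = Complex.normSq e := by
  have h1 := congrArg Matrix.det h.adjugate_mul
  rw [Matrix.det_mul, Matrix.det_adjugate, h.det_fst, h.det_snd, Matrix.det_smul,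
    Matrix.det_fin_two_of] at h1
  simp only [Fintype.card_fin, Nat.add_one_sub_one, pow_one] at h1
  have h2 : (c : ℂ) * d = a * b - e * star e := by
    have hu : u ^ 2 ≠ 0 := pow_ne_zero 2 h.ne_zero'
    apply mul_left_cancel₀ hu
    linear_combination h1
  have h3 : ((a * b - c * d : ℝ) : ℂ) = (Complex.normSq e : ℂ) := by
    push_cast
    rw [h2, ← Complex.mul_conj, starRingEnd_apply]
    ring
  exact_mod_cast h3

theorem det_mul_conjTranspose (h : PairCoordinates C D u c a b d e) :
    (C * Dᴴ).det = ((c * d : ℝ) : ℂ) := by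
  rw [Matrix.det_mul, Matrix.det_conjTranspose, h.det_fst, h.det_snd, star_mul']
  have := h.mul_star
  simp at this ⊢
  linear_combination (c * d : ℂ) * this

theorem mul_hermitian (h : PairCoordinates C D u c a b d e) :
    C * !![(a : ℂ), e; star e, (b : ℂ)] = (c : ℂ) • D := by
  have h1 : C * (C.adjugate * D) = C.det • D := by
    rw [← mul_assoc, Matrix.mul_adjugate, smul_mul_assoc, one_mul]
  rw [h.adjugate_mul, h.det_fst, Matrix.mul_smul, mul_smul] at h1
  exact smul_right_injective _ h.ne_zero' h1

theorem mul_adjugate_hermitian (h : PairCoordinates C D u c a b d e) :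
    D * !![(b : ℂ), -e; -star e, (a : ℂ)] = (d : ℂ) • C := by
  have h0 : (C.adjugate * D).adjugate = D.adjugate * C := by
    rw [Matrix.adjugate_mul_distrib, Matrix.adjugate_adjugate C (by simp)]
    simp
  have h1 : D * (C.adjugate * D).adjugate = D.det • C := by
    rw [h0, ← mul_assoc, Matrix.mul_adjugate, smul_mul_assoc, one_mul]
  have h2 : (u • !![(a : ℂ), e; star e, (b : ℂ)]).adjugate =
      u • !![(b : ℂ), -e; -star e, (a : ℂ)] := by
    rw [Matrix.adjugate_smul, Matrix.adjugate_fin_two_of]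
    simp
  rw [h.adjugate_mul, h2, h.det_snd, Matrix.mul_smul, mul_smul] at h1
  exact smul_right_injective _ h.ne_zero' h1

/-- A matrix of size two and its adjugate add up to the trace. As `CC*` and `DD*` are nonnegative,
the sign of the trace of `C D*` can be read off from `c`, `d` and `a + b`. -/
theorem smul_mul_conjTranspose (h : PairCoordinates C D u c a b d e) :
    ((a + b : ℝ) : ℂ) • (C * Dᴴ) = (c : ℂ) • (D * Dᴴ) + (d : ℂ) • (C * Cᴴ) := by
  have h1 : C * !![(a : ℂ), e; star e, (b : ℂ)] * Dᴴ = (c : ℂ) • (D * Dᴴ) := by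
    rw [h.mul_hermitian, Matrix.smul_mul]
  have h2 : C * !![(b : ℂ), -e; -star e, (a : ℂ)] * Dᴴ = (d : ℂ) • (C * Cᴴ) := by
    have := congrArg Matrix.conjTranspose h.mul_adjugate_hermitian
    rw [Matrix.conjTranspose_mul, Matrix.conjTranspose_smul] at this
    have hh : (!![(b : ℂ), -e; -star e, (a : ℂ)])ᴴ = !![(b : ℂ), -e; -star e, (a : ℂ)] := by
      ext i j
      fin_cases i <;> fin_cases j <;> simp
    rw [hh] at this
    rw [mul_assoc, this, Matrix.mul_smul]
    simp
  rw [← h1, ← h2, ← add_mul, ← mul_add]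
  have : !![(a : ℂ), e; star e, (b : ℂ)] + !![(b : ℂ), -e; -star e, (a : ℂ)] =
      ((a + b : ℝ) : ℂ) • (1 : Matrix (Fin 2) (Fin 2) ℂ) := by
    ext i j
    fin_cases i <;> fin_cases j <;> simp [add_comm]
  rw [this, Matrix.mul_smul, mul_one, Matrix.smul_mul]

end PairCoordinates

/-! ### Counting negative eigenvalues -/

theorem negEigenvalueCount_eq {A : Matrix (Fin 2) (Fin 2) ℂ} (hA : A.IsHermitian) :
    ∃ x y : ℝ, A.det = ((x * y : ℝ) : ℂ) ∧ A.trace = ((x + y : ℝ) : ℂ) ∧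
      negEigenvalueCount hA = (if x < 0 then 1 else 0) + (if y < 0 then 1 else 0) := by
  refine ⟨hA.eigenvalues 0, hA.eigenvalues 1, ?_, ?_, ?_⟩
  · rw [hA.det_eq_prod_eigenvalues, Fin.prod_univ_two]; push_cast; rfl
  · rw [hA.trace_eq_sum_eigenvalues, Fin.sum_univ_two]; push_cast; rfl
  · rw [negEigenvalueCount, Finset.card_filter, Fin.sum_univ_two]

theorem trace_mul_conjTranspose (A : Matrix (Fin 2) (Fin 2) ℂ) :
    ∃ t : ℝ, (A * Aᴴ).trace = (t : ℂ) ∧ 0 ≤ t ∧ (t = 0 → A = 0) := by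
  refine ⟨∑ i, ∑ j, Complex.normSq (A i j), ?_, ?_, ?_⟩
  · simp [Matrix.trace, Matrix.mul_apply, Fin.sum_univ_two, Complex.mul_conj]
  · exact Finset.sum_nonneg fun i _ => Finset.sum_nonneg fun j _ => Complex.normSq_nonneg _
  · intro h
    have h := (Finset.sum_eq_zero_iff_of_nonneg fun i _ =>
      Finset.sum_nonneg fun j _ => Complex.normSq_nonneg (A i j)).1 h
    ext i j
    have := (Finset.sum_eq_zero_iff_of_nonneg fun j _ => Complex.normSq_nonneg _).1
      (h i (Finset.mem_univ i)) j (Finset.mem_univ j)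
    simpa using this

namespace PairCoordinates

variable {C D : Matrix (Fin 2) (Fin 2) ℂ} {u : ℂ} {c a b d : ℝ} {e : ℂ}

theorem exists_trace (h : PairCoordinates C D u c a b d e) {T : ℝ} (hT : (C * Dᴴ).trace = (T : ℂ)) :
    ∃ s t : ℝ, 0 ≤ s ∧ 0 ≤ t ∧ (s = 0 → D = 0) ∧ (t = 0 → C = 0) ∧ (a + b) * T = c * s + d * t := by
  obtain ⟨s, hs, hs0, hs1⟩ := trace_mul_conjTranspose D
  obtain ⟨t, ht, ht0, ht1⟩ := trace_mul_conjTranspose C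
  refine ⟨s, t, hs0, ht0, hs1, ht1, ?_⟩
  have := congrArg Matrix.trace h.smul_mul_conjTranspose
  rw [Matrix.trace_smul, Matrix.trace_add, Matrix.trace_smul, Matrix.trace_smul, hs, ht, hT] at this
  simp only [smul_eq_mul] at this
  exact_mod_cast this

theorem fst_ne_zero (h : PairCoordinates C D u c a b d e) (hab : a + b ≠ 0) : C ≠ 0 ∧ D ≠ 0 := by
  have key : C.adjugate * D ≠ 0 := by
    intro h0
    have h1 := h.adjugate_mul
    rw [h0] at h1
    have ha := congrFun (congrFun h1 0) 0
    have hb := congrFun (congrFun h1 1) 1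
    simp [h.ne_zero'] at ha hb
    exact hab (by rw [ha, hb, add_zero])
  refine ⟨fun h0 => key ?_, fun h0 => key ?_⟩
  · rw [h0, Matrix.adjugate_zero, zero_mul]
  · rw [h0, mul_zero]

/-- The number of negative eigenvalues when `a + b > 0`. -/
theorem negEigenvalueCount_of_pos (h : PairCoordinates C D u c a b d e) (hab : 0 < a + b)
    (hA : (C * Dᴴ).IsHermitian) :
    negEigenvalueCount hA = (if c < 0 then 1 else 0) + (if d < 0 then 1 else 0) := by
  -- The eigenvalues `x, y` of `C D*` satisfy `xy = cd` and `(a + b)(x + y) = cs + dt` with `s, t >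
  -- 0`. Product and sum together force as many negative signs among `x, y` as among `c, d`.
  obtain ⟨x, y, hdet, htr, hN⟩ := negEigenvalueCount_eq hA
  rw [hN]
  have hxy : x * y = c * d := by
    rw [h.det_mul_conjTranspose] at hdet
    exact_mod_cast hdet.symm
  obtain ⟨s, t, hs, ht, hs1, ht1, hst⟩ := h.exists_trace htr
  obtain ⟨hC, hD⟩ := h.fst_ne_zero hab.ne'
  have hs' : 0 < s := lt_of_le_of_ne hs fun h0 => hD (hs1 h0.symm)
  have ht' : 0 < t := lt_of_le_of_ne ht fun h0 => hC (ht1 h0.symm)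
  by_cases hc : c < 0 <;> by_cases hd : d < 0
  · have h1 : 0 < x * y := hxy ▸ mul_pos_of_neg_of_neg hc hd
    have h2 : (a + b) * (x + y) < 0 := by rw [hst]; nlinarith
    have h3 : x + y < 0 := by nlinarith
    have hx : x < 0 := by nlinarith
    have hy : y < 0 := by nlinarith
    simp [hc, hd, hx, hy]
  · rw [not_lt] at hd
    have h1 : x * y ≤ 0 := hxy ▸ mul_nonpos_of_nonpos_of_nonneg hc.le hd
    rcases lt_trichotomy x 0 with hx | hx | hx
    · have hy : ¬ y < 0 := by rw [not_lt]; nlinarith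
      simp [hc, not_lt.2 hd, hx, hy]
    · subst hx
      have hd0 : d = 0 := by
        rw [zero_mul] at hxy
        exact (mul_eq_zero.1 hxy.symm).resolve_left hc.ne
      have hy : y < 0 := by
        rw [hd0] at hst
        have : (a + b) * y < 0 := by nlinarith
        nlinarith
      simp [hc, not_lt.2 hd, hy]
    · have hy : y < 0 := by
        rcases hd.lt_or_eq with hd' | hd'
        · have : x * y < 0 := hxy ▸ mul_neg_of_neg_of_pos hc hd'
          nlinarith
        · rw [← hd'] at hxy hst
          have h4 : y = 0 := by
            rw [mul_zero] at hxy
            exact (mul_eq_zero.1 hxy).resolve_left hx.ne'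
          rw [h4] at hst
          nlinarith
      simp [hc, not_lt.2 hd, not_lt.2 hx.le, hy]
  · rw [not_lt] at hc
    have h1 : x * y ≤ 0 := hxy ▸ mul_nonpos_of_nonneg_of_nonpos hc hd.le
    rcases lt_trichotomy x 0 with hx | hx | hx
    · have hy : ¬ y < 0 := by rw [not_lt]; nlinarith
      simp [hd, not_lt.2 hc, hx, hy]
    · subst hx
      have hc0 : c = 0 := by
        rw [zero_mul] at hxy
        exact (mul_eq_zero.1 hxy.symm).resolve_right hd.ne
      have hy : y < 0 := by
        rw [hc0] at hst
        have : (a + b) * y < 0 := by nlinarith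
        nlinarith
      simp [hd, not_lt.2 hc, hy]
    · have hy : y < 0 := by
        rcases hc.lt_or_eq with hc' | hc'
        · have : x * y < 0 := hxy ▸ mul_neg_of_pos_of_neg hc' hd
          nlinarith
        · rw [← hc'] at hxy hst
          have h4 : y = 0 := by
            rw [zero_mul] at hxy
            exact (mul_eq_zero.1 hxy).resolve_left hx.ne'
          rw [h4] at hst
          nlinarith
      simp [hd, not_lt.2 hc, not_lt.2 hx.le, hy]
  · rw [not_lt] at hc hd
    have h1 : 0 ≤ x * y := hxy ▸ mul_nonneg hc hd
    have h2 : 0 ≤ (a + b) * (x + y) := by rw [hst]; positivity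
    have h3 : 0 ≤ x + y := nonneg_of_mul_nonneg_right h2 hab
    have hx : ¬ x < 0 := by rw [not_lt]; by_contra! hx; nlinarith
    have hy : ¬ y < 0 := by rw [not_lt]; by_contra! hy; nlinarith
    simp [not_lt.2 hc, not_lt.2 hd, hx, hy]

theorem negEigenvalueCount_of_neg (h : PairCoordinates C D u c a b d e) (hcd : c * d < 0)
    (hA : (C * Dᴴ).IsHermitian) : negEigenvalueCount hA = 1 := by
  obtain ⟨x, y, hdet, -, hN⟩ := negEigenvalueCount_eq hA
  rw [hN]
  have hxy : x * y < 0 := by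
    rw [h.det_mul_conjTranspose] at hdet
    have : c * d = x * y := by exact_mod_cast hdet
    rwa [← this]
  rcases mul_neg_iff.1 hxy with ⟨h1, h2⟩ | ⟨h1, h2⟩
  · simp [h2, not_lt.2 h1.le]
  · simp [h1, not_lt.2 h2.le]

/-- Here `e = 0` too, so `cD = 0` and `dC = 0`. Since `c ≠ d`, one of the two matrices vanishes. -/
theorem negEigenvalueCount_of_zero (h : PairCoordinates C D u c a b d e) (ha : a = 0) (hb : b = 0)
    (hcd : c * d = 0) (hA : (C * Dᴴ).IsHermitian) : negEigenvalueCount hA = 0 := by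
  have he : e = 0 := by
    have := h.mul_sub_mul
    rw [ha, hcd] at this
    simpa using this.symm
  have hne : c - d ≠ 0 := h.ne_zero.resolve_right (by simp [ha, hb])
  have h1 := h.mul_hermitian
  have h2 := h.mul_adjugate_hermitian
  have z1 : !![(a : ℂ), e; star e, (b : ℂ)] = 0 := by
    ext i j
    fin_cases i <;> fin_cases j <;> simp [ha, hb, he]
  have z2 : !![(b : ℂ), -e; -star e, (a : ℂ)] = 0 := by
    ext i j
    fin_cases i <;> fin_cases j <;> simp [ha, hb, he]
  rw [z1, mul_zero] at h1
  rw [z2, mul_zero] at h2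
  have hz : C * Dᴴ = 0 := by
    rcases mul_eq_zero.1 hcd with h0 | h0
    · have hd : (d : ℂ) ≠ 0 := by
        intro hd
        apply hne
        rw [h0, Complex.ofReal_eq_zero.1 hd, sub_zero]
      rw [(smul_eq_zero.1 h2.symm).resolve_left hd, zero_mul]
    · have hc : (c : ℂ) ≠ 0 := by
        intro hc
        apply hne
        rw [h0, Complex.ofReal_eq_zero.1 hc, sub_zero]
      rw [(smul_eq_zero.1 h1.symm).resolve_left hc, Matrix.conjTranspose_zero, mul_zero]
  obtain ⟨x, y, hdet, htr, hN⟩ := negEigenvalueCount_eq hA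
  rw [hz, Matrix.det_zero] at hdet
  rw [hz, Matrix.trace_zero] at htr
  have h3 : x * y = 0 := by exact_mod_cast hdet.symm
  have h4 : x + y = 0 := by exact_mod_cast htr.symm
  have hx : x = 0 := by nlinarith
  have hy : y = 0 := by linarith
  rw [hN, hx, hy]
  simp

end PairCoordinates

/-! ### Roots of the secular equation -/

/-- Increasing bijections of `(0, ∞)`. -/
structure IsScale (x : ℝ → ℝ) : Prop where
  pos : ∀ t, 0 < t → 0 < x t
  strictMono : ∀ s t, 0 < s → s < t → x s < x t
  continuousOn : ContinuousOn x (Ioi 0)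
  tendsto_zero : Tendsto x (𝓝[>] 0) (𝓝 0)
  tendsto_atTop : Tendsto x atTop atTop

theorem isScale_weylFactor {ν : ℝ} (hν : 0 < ν) (hν1 : ν < 1) : IsScale (weylFactor ν) := by
  have h0 := Real.Gamma_pos_of_pos hν
  have h1 : 0 < Real.Gamma (1 - ν) := Real.Gamma_pos_of_pos (by linarith)
  have hc : Continuous (weylFactor ν) := by
    unfold weylFactor
    exact ((continuous_const.mul (Real.continuous_rpow_const hν.le)).mul_const _).div_const _
  refine ⟨fun t ht => ?_, fun s t hs hst => ?_, hc.continuousOn, ?_, ?_⟩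
  · unfold weylFactor; positivity
  · have := Real.rpow_lt_rpow hs.le hst hν
    unfold weylFactor
    refine div_lt_div_of_pos_right (mul_lt_mul_of_pos_right ?_ h1) h0
    linarith
  · have := (hc.tendsto 0).mono_left (nhdsWithin_le_nhds (s := Ioi 0))
    simpa [weylFactor, Real.zero_rpow hν.ne'] using this
  · unfold weylFactor
    exact (((tendsto_rpow_atTop hν).const_mul_atTop two_pos).atTop_mul_const h1).atTop_div_const h0

theorem exists_root {g : ℝ → ℝ} (hg : ContinuousOn g (Ioi 0)) {s t : ℝ} (hs : 0 < s) (ht : 0 < t)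
    (h1 : g s ≤ 0) (h2 : 0 ≤ g t) : ∃ r, 0 < r ∧ g r = 0 :=
  (isPreconnected_Ioi (a := (0 : ℝ))).intermediate_value hs ht hg ⟨h1, h2⟩

namespace IsScale

variable {x y : ℝ → ℝ} (hx : IsScale x) (hy : IsScale y) {a b c d E : ℝ}

include hx in
theorem injective {s t : ℝ} (hs : 0 < s) (ht : 0 < t) (h : x s = x t) : s = t := by
  rcases lt_trichotomy s t with hst | hst | hst
  · exact absurd h (hx.strictMono s t hs hst).ne
  · exact hst
  · exact absurd h (hx.strictMono t s ht hst).ne'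

include hx in
theorem exists_eq {k : ℝ} (hk : 0 < k) : ∃ t, 0 < t ∧ x t = k := by
  obtain ⟨s, hs, hs0⟩ := ((hx.tendsto_zero.eventually (gt_mem_nhds hk)).and self_mem_nhdsWithin).exists
  obtain ⟨t, ht, ht0⟩ := ((hx.tendsto_atTop.eventually_ge_atTop k).and (eventually_gt_atTop 0)).exists
  obtain ⟨r, hr, hr0⟩ := exists_root (g := fun t => x t - k) (hx.continuousOn.sub continuousOn_const)
    hs0 ht0 (by linarith) (by linarith)
  exact ⟨r, hr, by linarith⟩

include hx hy

/-- Where both factors are negative their product runs from `0` to infinity. Clipping the factors at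
zero extends it continuously to all `t > 0`, and a positive value of the clipped product certifies
the region. The sign condition on `a` or `b` makes it start at zero. -/
theorem exists_root_pos (hd : d < 0) (hE : 0 < E) (hab : 0 ≤ a ∨ 0 ≤ b) :
    ∃ t, 0 < t ∧ d * x t + b < 0 ∧ d * y t + a < 0 ∧ (d * x t + b) * (d * y t + a) = E := by
  set g : ℝ → ℝ := fun t => max (-(d * x t + b)) 0 * max (-(d * y t + a)) 0 - E with hg
  have hgc : ContinuousOn g (Ioi 0) :=
    ((((continuousOn_const.mul hx.continuousOn).add continuousOn_const).neg.sup
      continuousOn_const).mul (((continuousOn_const.mul hy.continuousOn).add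
        continuousOn_const).neg.sup continuousOn_const)).sub continuousOn_const
  have lim : Tendsto g (𝓝[>] 0) (𝓝 (-E)) := by
    have h1 := (((hx.tendsto_zero.const_mul d).add_const b).neg.max
      (tendsto_const_nhds (x := (0 : ℝ)))).mul (((hy.tendsto_zero.const_mul d).add_const a).neg.max
      (tendsto_const_nhds (x := (0 : ℝ))))
    have h2 := h1.sub_const E
    have : max (-(d * 0 + b)) 0 * max (-(d * 0 + a)) 0 = 0 := by
      rcases hab with h | h
      · rw [max_eq_right (by linarith : -(d * 0 + a) ≤ 0), mul_zero]
      · rw [max_eq_right (by linarith : -(d * 0 + b) ≤ 0), zero_mul]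
    rwa [this, zero_sub] at h2
  obtain ⟨s, hs, hs0⟩ := ((lim.eventually (gt_mem_nhds (by linarith : -E < 0))).and
    self_mem_nhdsWithin).exists
  have tx : Tendsto (fun t => -(d * x t + b)) atTop atTop := by
    have := (hx.tendsto_atTop.const_mul_atTop (by linarith : 0 < -d)).atTop_add
      (tendsto_const_nhds (x := -b))
    exact this.congr fun t => by ring
  have ty : Tendsto (fun t => -(d * y t + a)) atTop atTop := by
    have := (hy.tendsto_atTop.const_mul_atTop (by linarith : 0 < -d)).atTop_add
      (tendsto_const_nhds (x := -a))
    exact this.congr fun t => by ring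
  obtain ⟨t, ⟨ht, ht'⟩, ht0⟩ := (((tx.eventually_ge_atTop 1).and (ty.eventually_ge_atTop E)).and
    (eventually_gt_atTop 0)).exists
  obtain ⟨r, hr, hr0⟩ := exists_root hgc hs0 ht0 hs.le (by
    simp only [hg]
    rw [max_eq_left (by linarith : 0 ≤ -(d * x t + b)), max_eq_left (by linarith)]
    nlinarith)
  simp only [hg] at hr0
  have hp : 0 < -(d * x r + b) := by
    by_contra! hcon
    rw [max_eq_right hcon, zero_mul] at hr0
    linarith
  have hq : 0 < -(d * y r + a) := by
    by_contra! hcon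
    rw [max_eq_right hcon, mul_zero] at hr0
    linarith
  rw [max_eq_left hp.le, max_eq_left hq.le] at hr0
  exact ⟨r, hr, by linarith, by linarith, by linarith⟩

/-- Where both factors are positive their product falls from `ab > E` to `0`; the same clipping
applies. -/
theorem exists_root_neg (hd : d < 0) (hE : 0 < E) (ha : 0 < a) (hb : 0 < b) (hab : E < a * b) :
    ∃ t, 0 < t ∧ 0 < d * x t + b ∧ 0 < d * y t + a ∧ (d * x t + b) * (d * y t + a) = E := by
  set g : ℝ → ℝ := fun t => E - max (d * x t + b) 0 * max (d * y t + a) 0 with hg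
  have hgc : ContinuousOn g (Ioi 0) :=
    continuousOn_const.sub ((((continuousOn_const.mul hx.continuousOn).add continuousOn_const).sup
      continuousOn_const).mul (((continuousOn_const.mul hy.continuousOn).add
        continuousOn_const).sup continuousOn_const))
  have lim : Tendsto g (𝓝[>] 0) (𝓝 (E - b * a)) := by
    have h1 := (((hx.tendsto_zero.const_mul d).add_const b).max
      (tendsto_const_nhds (x := (0 : ℝ)))).mul (((hy.tendsto_zero.const_mul d).add_const a).max
      (tendsto_const_nhds (x := (0 : ℝ))))
    have h2 := h1.const_sub E
    rwa [mul_zero, zero_add, zero_add, max_eq_left ha.le, max_eq_left hb.le] at h2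
  obtain ⟨s, hs, hs0⟩ := ((lim.eventually (gt_mem_nhds (by linarith : E - b * a < 0))).and
    self_mem_nhdsWithin).exists
  obtain ⟨t, ht, ht0⟩ := ((hx.tendsto_atTop.eventually_ge_atTop (b / -d)).and
    (eventually_gt_atTop 0)).exists
  obtain ⟨r, hr, hr0⟩ := exists_root hgc hs0 ht0 hs.le (by
    simp only [hg]
    rw [div_le_iff₀ (by linarith)] at ht
    rw [max_eq_right (by linarith : d * x t + b ≤ 0), zero_mul]
    linarith)
  simp only [hg] at hr0
  have hp : 0 < d * x r + b := by
    by_contra! hcon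
    rw [max_eq_right hcon, zero_mul] at hr0
    linarith
  have hq : 0 < d * y r + a := by
    by_contra! hcon
    rw [max_eq_right hcon, mul_zero] at hr0
    linarith
  rw [max_eq_left hp.le, max_eq_left hq.le] at hr0
  exact ⟨r, hr, hp, hq, by linarith⟩

/-- Both factors decrease strictly since `d < 0`; being negative, they have a strictly increasing
product. -/
theorem unique_root_of_neg {s t : ℝ} (hd : d < 0) (hs : 0 < s) (ht : 0 < t)
    (hps : d * x s + b < 0) (hqs : d * y s + a < 0) (hpt : d * x t + b < 0) (hqt : d * y t + a < 0)
    (h : (d * x s + b) * (d * y s + a) = (d * x t + b) * (d * y t + a)) : s = t := by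
  have key : ∀ s t, 0 < s → s < t → d * x s + b < 0 → d * y s + a < 0 →
      (d * x s + b) * (d * y s + a) < (d * x t + b) * (d * y t + a) := by
    intro s t hs hst hp hq
    have h1 := mul_lt_mul_of_neg_left (hx.strictMono s t hs hst) hd
    have h2 := mul_lt_mul_of_neg_left (hy.strictMono s t hs hst) hd
    nlinarith
  rcases lt_trichotomy s t with hst | hst | hst
  · exact absurd h (key s t hs hst hps hqs).ne
  · exact hst
  · exact absurd h (key t s ht hst hpt hqt).ne'

theorem unique_root_of_pos {s t : ℝ} (hd : d < 0) (hs : 0 < s) (ht : 0 < t)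
    (hps : 0 < d * x s + b) (hqs : 0 < d * y s + a) (hpt : 0 < d * x t + b) (hqt : 0 < d * y t + a)
    (h : (d * x s + b) * (d * y s + a) = (d * x t + b) * (d * y t + a)) : s = t := by
  have key : ∀ s t, 0 < s → s < t → 0 < d * x t + b → 0 < d * y t + a →
      (d * x t + b) * (d * y t + a) < (d * x s + b) * (d * y s + a) := by
    intro s t hs hst hp hq
    have h1 := mul_lt_mul_of_neg_left (hx.strictMono s t hs hst) hd
    have h2 := mul_lt_mul_of_neg_left (hy.strictMono s t hs hst) hd
    nlinarith
  rcases lt_trichotomy s t with hst | hst | hst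
  · exact absurd h (key s t hs hst hpt hqt).ne'
  · exact hst
  · exact absurd h (key t s ht hst hps hqs).ne

/-- The value starts at `c < 0`; the term in `d` is nondecreasing, and `ax + by` is strictly
increasing and unbounded. -/
theorem exists_unique_root (ha : 0 ≤ a) (hb : 0 ≤ b) (hab : 0 < a + b) (hc : c < 0) (hd : 0 ≤ d) :
    ∃ t, 0 < t ∧ c + a * x t + b * y t + d * (x t * y t) = 0 ∧
      ∀ s, 0 < s → c + a * x s + b * y s + d * (x s * y s) = 0 → s = t := by
  set g : ℝ → ℝ := fun t => c + a * x t + b * y t + d * (x t * y t) with hg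
  have hgc : ContinuousOn g (Ioi 0) :=
    (((continuousOn_const.add (continuousOn_const.mul hx.continuousOn)).add
      (continuousOn_const.mul hy.continuousOn)).add
      (continuousOn_const.mul (hx.continuousOn.mul hy.continuousOn)))
  have lim : Tendsto g (𝓝[>] 0) (𝓝 c) := by
    have := ((((hx.tendsto_zero.const_mul a).const_add c).add (hy.tendsto_zero.const_mul b))).add
      ((hx.tendsto_zero.mul hy.tendsto_zero).const_mul d)
    simpa using this
  obtain ⟨s, hs, hs0⟩ := ((lim.eventually (gt_mem_nhds hc)).and self_mem_nhdsWithin).exists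
  -- At this height `ax + by ≥ (a + b) · (-c / (a + b)) = -c`, whichever of `a`, `b` is nonzero.
  obtain ⟨t, ⟨ht, ht'⟩, ht0⟩ := (((hx.tendsto_atTop.eventually_ge_atTop (-c / (a + b))).and
    (hy.tendsto_atTop.eventually_ge_atTop (-c / (a + b)))).and (eventually_gt_atTop 0)).exists
  have mono : ∀ s t, 0 < s → s < t → g s < g t := by
    intro s t hs hst
    have h1 := hx.strictMono s t hs hst
    have h2 := hy.strictMono s t hs hst
    have h3 := hx.pos s hs
    have h4 := hy.pos s hs
    have h5 : x s * y s ≤ x t * y t := by nlinarith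
    have h6 := mul_le_mul_of_nonneg_left h5 hd
    have h7 : a * x s + b * y s < a * x t + b * y t := by
      rcases ha.lt_or_eq with ha' | ha'
      · have := mul_lt_mul_of_pos_left h1 ha'
        have := mul_le_mul_of_nonneg_left h2.le hb
        linarith
      · have hb' : 0 < b := by linarith
        have := mul_lt_mul_of_pos_left h2 hb'
        rw [← ha']
        linarith
    simp only [hg]
    linarith
  obtain ⟨r, hr, hr0⟩ := exists_root hgc hs0 ht0 hs.le (by
    simp only [hg]
    rw [div_le_iff₀ hab] at ht ht'
    have h1 : 0 ≤ d * (x t * y t) := mul_nonneg hd (mul_pos (hx.pos t ht0) (hy.pos t ht0)).le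
    have h2 : -c ≤ a * x t + b * y t := by
      have e1 := mul_le_mul_of_nonneg_left ht ha
      have e2 := mul_le_mul_of_nonneg_left ht' hb
      have e3 : (a + b) * -c ≤ (a + b) * (a * x t + b * y t) := by linarith
      exact le_of_mul_le_mul_left e3 hab
    linarith)
  refine ⟨r, hr, hr0, fun s hs hs0 => ?_⟩
  rcases lt_trichotomy s r with hst | hst | hst
  · have := mono s r hs hst
    rw [hr0] at this
    exact absurd hs0 this.ne
  · exact hst
  · have := mono r s hr hst
    rw [hr0] at this
    exact absurd hs0 this.ne'

end IsScale

theorem finrank_ker_eq_one {M : Matrix (Fin 2) (Fin 2) ℂ} (h0 : M.det = 0) (hM : M ≠ 0) :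
    Module.finrank ℂ (LinearMap.ker M.mulVecLin) = 1 := by
  have h1 : LinearMap.ker M.mulVecLin ≠ ⊥ := by
    intro h
    obtain ⟨v, hv, hv0⟩ := Matrix.exists_mulVec_eq_zero_iff.2 h0
    exact hv ((LinearMap.ker_eq_bot'.1 h) v hv0)
  have h2 : LinearMap.ker M.mulVecLin ≠ ⊤ := by
    intro h
    apply hM
    rw [LinearMap.ker_eq_top] at h
    ext i j
    have := congrFun (LinearMap.congr_fun h (Pi.single j 1)) i
    simpa using this
  have h3 := Submodule.finrank_lt h2
  rw [Module.finrank_fin_fun] at h3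
  have h4 := Submodule.one_le_finrank_iff.2 h1
  omega

theorem finrank_ker_zero : Module.finrank ℂ
    (LinearMap.ker (0 : Matrix (Fin 2) (Fin 2) ℂ).mulVecLin) = 2 := by
  rw [Matrix.mulVecLin_zero, LinearMap.ker_zero, finrank_top, Module.finrank_fin_fun]

/-! ### Determinant and kernel of `C + D diag(X, Y)`. -/

namespace PairCoordinates

variable {C D : Matrix (Fin 2) (Fin 2) ℂ} {u : ℂ} {c a b d : ℝ} {e : ℂ}

/-- The determinant is affine in `X` and in `Y`; the linear coefficients are the diagonal entries of
`adj(C) D`. -/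
theorem det_add_mul_diagonal (h : PairCoordinates C D u c a b d e) (X Y : ℂ) :
    (C + D * Matrix.diagonal ![X, Y]).det = u * (c + a * X + b * Y + d * (X * Y)) := by
  have h0 := h.det_fst
  have h1 := h.det_snd
  have h2 := congrFun (congrFun h.adjugate_mul 0) 0
  have h3 := congrFun (congrFun h.adjugate_mul 1) 1
  rw [Matrix.det_fin_two] at h0 h1
  simp [Matrix.adjugate_fin_two, Matrix.mul_apply, Fin.sum_univ_two] at h2 h3
  rw [Matrix.det_fin_two]
  simp [Matrix.mul_apply, Matrix.diagonal_apply]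
  linear_combination h0 + X * h2 + Y * h3 + X * Y * h1

theorem adjugate_snd_mul (h : PairCoordinates C D u c a b d e) :
    D.adjugate * C = u • !![(b : ℂ), -e; -star e, (a : ℂ)] := by
  have h0 : (C.adjugate * D).adjugate = D.adjugate * C := by
    rw [Matrix.adjugate_mul_distrib, Matrix.adjugate_adjugate C (by simp)]
    simp
  rw [← h0, h.adjugate_mul, Matrix.adjugate_smul, Matrix.adjugate_fin_two_of]
  simp

/-- The determinant of the right side is the factorized form `(dX + b)(dY + a) - |e|²` of the
secular equation, up to `u²`. -/
theorem adjugate_snd_mul_add (h : PairCoordinates C D u c a b d e) (X Y : ℂ) :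
    D.adjugate * (C + D * Matrix.diagonal ![X, Y]) =
      u • !![d * X + b, -e; -star e, d * Y + a] := by
  rw [mul_add, h.adjugate_snd_mul, ← mul_assoc, Matrix.adjugate_mul, h.det_snd, smul_mul_assoc,
    one_mul]
  ext i j
  fin_cases i <;> fin_cases j <;> simp <;> ring

/-- Multiplication by `adj(D)` loses nothing when `D` is invertible. A two-dimensional kernel thus
occurs exactly if the channels decouple and have a common root. -/
theorem add_mul_diagonal_eq_zero_iff (h : PairCoordinates C D u c a b d e) (hd : d ≠ 0) (X Y : ℂ) :
    C + D * Matrix.diagonal ![X, Y] = 0 ↔ d * X + b = 0 ∧ d * Y + a = 0 ∧ e = 0 := by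
  have key := h.adjugate_snd_mul_add X Y
  have hu := h.ne_zero'
  constructor
  · intro h0
    rw [h0, mul_zero] at key
    have h1 := congrFun (congrFun key 0) 0
    have h2 := congrFun (congrFun key 1) 1
    have h3 := congrFun (congrFun key 0) 1
    simp [hu] at h1 h2 h3
    exact ⟨h1, h2, h3⟩
  · rintro ⟨h1, h2, h3⟩
    have hz : (u • !![d * X + b, -e; -star e, d * Y + a] : Matrix (Fin 2) (Fin 2) ℂ) = 0 := by
      rw [h1, h2, h3]
      ext i j
      fin_cases i <;> fin_cases j <;> simp
    rw [hz] at key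
    have h4 := congrArg (D * ·) key
    simp only [mul_zero] at h4
    rw [← mul_assoc, Matrix.mul_adjugate, smul_mul_assoc, one_mul, h.det_snd] at h4
    exact (smul_eq_zero.1 h4).resolve_left (mul_ne_zero hu (by exact_mod_cast hd))

end PairCoordinates

/-! ### Sign patterns and the dimension count. -/

/-- The sign normalization of pair coordinates. -/
inductive IsNormalized (c a b d : ℝ) : Prop
  | definite (ha : 0 ≤ a) (hb : 0 ≤ b) (hab : 0 < a + b) : IsNormalized c a b d
  | indefinite (hab : a * b < 0) (hc : 0 < c) (hd : d < 0) : IsNormalized c a b d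
  | null (ha : a = 0) (hb : b = 0) (hc : 0 ≤ c) (hd : d ≤ 0) (hcd : 0 < c - d) : IsNormalized c a b d

namespace PairCoordinates

variable {C D : Matrix (Fin 2) (Fin 2) ℂ} {u : ℂ} {c a b d : ℝ} {e : ℂ}

/-- The relation `ab - cd ≥ 0` leaves few patterns: `ab < 0` forces `cd < 0`, while `ab ≥ 0` with `a
+ b = 0` forces `a = b = 0`, `cd ≤ 0` and `c ≠ d`. A global sign can be moved into `u`. -/
theorem isNormalized (h : PairCoordinates C D u c a b d e) :
    IsNormalized c a b d ∨ IsNormalized (-c) (-a) (-b) (-d) := by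
  have hE : 0 ≤ a * b - c * d := h.mul_sub_mul ▸ Complex.normSq_nonneg e
  rcases lt_or_ge (a * b) 0 with hab | hab
  · have hcd : c * d < 0 := by linarith
    rcases mul_neg_iff.1 hcd with ⟨h1, h2⟩ | ⟨h1, h2⟩
    · exact Or.inl (.indefinite hab h1 h2)
    · exact Or.inr (.indefinite (by linarith) (by linarith) (by linarith))
  · by_cases h0 : a + b = 0
    · have ha : a = 0 := by
        have : b = -a := by linarith
        subst this
        nlinarith
      have hb : b = 0 := by linarith
      have hcd : c * d ≤ 0 := by rw [ha] at hE; linarith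
      have hne : c - d ≠ 0 := h.ne_zero.resolve_right (not_not.2 h0)
      rcases hne.lt_or_gt with hlt | hlt
      · refine Or.inr (.null (by simp [ha]) (by simp [hb]) ?_ ?_ (by linarith))
        · by_contra! hc
          nlinarith
        · by_contra! hc
          nlinarith
      · refine Or.inl (.null ha hb ?_ ?_ hlt)
        · by_contra! hc
          nlinarith
        · by_contra! hc
          nlinarith
    · rcases lt_or_gt_of_ne h0 with hlt | hlt
      · refine Or.inr (.definite ?_ ?_ (by linarith))
        · by_contra! hc
          nlinarith
        · by_contra! hc
          nlinarith
      · refine Or.inl (.definite ?_ ?_ hlt)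
        · by_contra! hc
          nlinarith
        · by_contra! hc
          nlinarith

end PairCoordinates

theorem Admissible.exists_isNormalized {C D : Matrix (Fin 2) (Fin 2) ℂ} (h : Admissible C D) :
    ∃ u c a b d e, PairCoordinates C D u c a b d e ∧ IsNormalized c a b d := by
  obtain ⟨u, c, a, b, d, e, hp⟩ := h.exists_pairCoordinates
  rcases hp.isNormalized with hn | hn
  · exact ⟨u, c, a, b, d, e, hp, hn⟩
  · exact ⟨_, _, _, _, _, _, hp.neg, hn⟩

/-- The matrices `M t`, `t > 0`, have kernels of total dimension `N`. -/
def HasKernelCount (M : ℝ → Matrix (Fin 2) (Fin 2) ℂ) (N : ℕ) : Prop :=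
  ∃ s : Finset ℝ, (∀ t ∈ s, 0 < t) ∧ (∀ t, 0 < t → t ∉ s → (M t).det ≠ 0) ∧
    ∑ t ∈ s, Module.finrank ℂ (LinearMap.ker (M t).mulVecLin) = N

theorem HasKernelCount.zero {M : ℝ → Matrix (Fin 2) (Fin 2) ℂ} (h : ∀ t, 0 < t → (M t).det ≠ 0) :
    HasKernelCount M 0 :=
  ⟨∅, by simp, fun t ht _ => h t ht, by simp⟩

theorem HasKernelCount.single {M : ℝ → Matrix (Fin 2) (Fin 2) ℂ} {r : ℝ} (hr : 0 < r)
    (h : ∀ t, 0 < t → (M t).det = 0 → t = r) :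
    HasKernelCount M (Module.finrank ℂ (LinearMap.ker (M r).mulVecLin)) :=
  ⟨{r}, by simpa, fun t ht htr h0 => htr (by simp [h t ht h0]), by simp⟩

theorem HasKernelCount.pair {M : ℝ → Matrix (Fin 2) (Fin 2) ℂ} {r s : ℝ} (hr : 0 < r) (hs : 0 < s)
    (hrs : r ≠ s) (h : ∀ t, 0 < t → (M t).det = 0 → t = r ∨ t = s) (hr0 : (M r).det = 0)
    (hr1 : M r ≠ 0) (hs0 : (M s).det = 0) (hs1 : M s ≠ 0) :
    HasKernelCount M 2 :=
  ⟨{r, s}, by simp [hr, hs], fun t ht htr h0 => htr (by simpa using h t ht h0), by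
    rw [Finset.sum_pair hrs, finrank_ker_eq_one hr0 hr1, finrank_ker_eq_one hs0 hs1]⟩

theorem HasKernelCount.one {M : ℝ → Matrix (Fin 2) (Fin 2) ℂ} {r : ℝ} (hr : 0 < r)
    (h : ∀ t, 0 < t → (M t).det = 0 → t = r) (hr0 : (M r).det = 0) (hr1 : M r ≠ 0) :
    HasKernelCount M 1 := by
  have := HasKernelCount.single hr h
  rwa [finrank_ker_eq_one hr0 hr1] at this

namespace PairCoordinates

variable {C D : Matrix (Fin 2) (Fin 2) ℂ} {u : ℂ} {c a b d : ℝ} {e : ℂ} {x y : ℝ → ℝ}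

theorem det_eq_zero_iff (h : PairCoordinates C D u c a b d e) (x y : ℝ) :
    (C + D * Matrix.diagonal ![(x : ℂ), (y : ℂ)]).det = 0 ↔ c + a * x + b * y + d * (x * y) = 0 := by
  rw [h.det_add_mul_diagonal, mul_eq_zero, or_iff_right h.ne_zero']
  norm_cast

/-- Completing the product: `d` times the secular polynomial is `(dx + b)(dy + a) - (ab - cd)`. -/
theorem det_eq_zero_iff_mul (h : PairCoordinates C D u c a b d e) (hd : d < 0) (x y : ℝ) :
    (C + D * Matrix.diagonal ![(x : ℂ), (y : ℂ)]).det = 0 ↔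
      (d * x + b) * (d * y + a) = Complex.normSq e := by
  rw [h.det_eq_zero_iff, ← h.mul_sub_mul]
  constructor
  · intro h0
    linear_combination d * h0
  · intro h0
    apply mul_left_cancel₀ hd.ne
    linear_combination h0

theorem ne_zero_of_offDiag (h : PairCoordinates C D u c a b d e) (hd : d < 0)
    (he : 0 < Complex.normSq e) (x y : ℝ) :
    C + D * Matrix.diagonal ![(x : ℂ), (y : ℂ)] ≠ 0 := by
  rw [Ne, h.add_mul_diagonal_eq_zero_iff hd.ne]
  rintro ⟨-, -, h3⟩
  simp [h3] at he

theorem ne_zero_of_fst (h : PairCoordinates C D u c a b d e) (hd : d < 0) {x : ℝ} (y : ℝ)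
    (hx : d * x + b ≠ 0) : C + D * Matrix.diagonal ![(x : ℂ), (y : ℂ)] ≠ 0 := by
  rw [Ne, h.add_mul_diagonal_eq_zero_iff hd.ne]
  rintro ⟨h1, -, -⟩
  exact hx (by exact_mod_cast h1)

theorem ne_zero_of_snd (h : PairCoordinates C D u c a b d e) (hd : d < 0) (x : ℝ) {y : ℝ}
    (hy : d * y + a ≠ 0) : C + D * Matrix.diagonal ![(x : ℂ), (y : ℂ)] ≠ 0 := by
  rw [Ne, h.add_mul_diagonal_eq_zero_iff hd.ne]
  rintro ⟨-, h2, -⟩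
  exact hy (by exact_mod_cast h2)

/-- One negative eigenvalue, `det D < 0 ≤ det C`. -/
theorem hasKernelCount_one (h : PairCoordinates C D u c a b d e) (hx : IsScale x) (hy : IsScale y)
    (hd : d < 0) (hc : 0 ≤ c) (hab : 0 ≤ a ∨ 0 ≤ b)
    (hE : Complex.normSq e = 0 → 0 < a ∧ b ≤ 0 ∨ a ≤ 0 ∧ 0 < b) :
    HasKernelCount (fun t => C + D * Matrix.diagonal ![(x t : ℂ), (y t : ℂ)]) 1 := by
  have key := h.mul_sub_mul
  have hcd : c * d ≤ 0 := mul_nonpos_of_nonneg_of_nonpos hc hd.le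
  have hneg : ∀ t, 0 < t → d * x t < 0 ∧ d * y t < 0 := fun t ht =>
    ⟨mul_neg_of_neg_of_pos hd (hx.pos t ht), mul_neg_of_neg_of_pos hd (hy.pos t ht)⟩
  rcases (Complex.normSq_nonneg e).lt_or_eq with he | he
  · obtain ⟨r, hr, hr1, hr2, hr3⟩ := hx.exists_root_pos hy (d := d) (a := a) (b := b) hd he hab
    refine HasKernelCount.one hr (fun t ht h0 => ?_) ((h.det_eq_zero_iff_mul hd _ _).2 hr3)
      (h.ne_zero_of_offDiag hd he _ _)
    rw [h.det_eq_zero_iff_mul hd] at h0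
    have hn := hneg t ht
    -- Two positive factors would have a product below `ab ≤ |e|²`.
    have hsig : d * x t + b < 0 ∧ d * y t + a < 0 := by
      rcases mul_pos_iff.1 (h0 ▸ he) with ⟨h1, h2⟩ | h1
      · exfalso
        have := mul_lt_mul'' (show d * x t + b < b by linarith) (show d * y t + a < a by linarith)
          h1.le h2.le
        linarith
      · exact h1
    exact hx.unique_root_of_neg hy hd ht hr hsig.1 hsig.2 hr1 hr2 (h0.trans hr3.symm)
  -- For `e = 0` the equation splits into two scalar ones, exactly one of which has a positive root.
  · rcases hE he.symm with ⟨ha, hb⟩ | ⟨ha, hb⟩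
    · obtain ⟨r, hr, hr1⟩ := hy.exists_eq (k := a / -d) (div_pos ha (by linarith))
      have hr2 : d * y r + a = 0 := by
        rw [hr1, div_neg, mul_neg, mul_div_cancel₀ _ hd.ne, neg_add_cancel]
      refine HasKernelCount.one hr (fun t ht h0 => ?_)
        ((h.det_eq_zero_iff_mul hd _ _).2 (by rw [hr2, ← he, mul_zero]))
        (h.ne_zero_of_fst hd _ (by linarith [hneg r hr]))
      rw [h.det_eq_zero_iff_mul hd, ← he, mul_eq_zero,
        or_iff_right (by linarith [hneg t ht])] at h0
      exact hy.injective ht hr (mul_left_cancel₀ hd.ne (by linarith))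
    · obtain ⟨r, hr, hr1⟩ := hx.exists_eq (k := b / -d) (div_pos hb (by linarith))
      have hr2 : d * x r + b = 0 := by
        rw [hr1, div_neg, mul_neg, mul_div_cancel₀ _ hd.ne, neg_add_cancel]
      refine HasKernelCount.one hr (fun t ht h0 => ?_)
        ((h.det_eq_zero_iff_mul hd _ _).2 (by rw [hr2, ← he, zero_mul]))
        (h.ne_zero_of_snd hd _ (by linarith [hneg r hr]))
      rw [h.det_eq_zero_iff_mul hd, ← he, mul_eq_zero,
        or_iff_left (by linarith [hneg t ht])] at h0
      exact hx.injective ht hr (mul_left_cancel₀ hd.ne (by linarith))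

/-- Two negative eigenvalues. -/
theorem hasKernelCount_two (h : PairCoordinates C D u c a b d e) (hx : IsScale x) (hy : IsScale y)
    (hd : d < 0) (hc : c < 0) (ha : 0 < a) (hb : 0 < b) :
    HasKernelCount (fun t => C + D * Matrix.diagonal ![(x t : ℂ), (y t : ℂ)]) 2 := by
  have key := h.mul_sub_mul
  have hcd : 0 < c * d := mul_pos_of_neg_of_neg hc hd
  rcases (Complex.normSq_nonneg e).lt_or_eq with he | he
  -- One root has both factors negative, the other both positive; the second exists because `cd > 0`
  -- gives `|e|² < ab`.
  · obtain ⟨r, hr, hr1, hr2, hr3⟩ := hx.exists_root_pos hy (d := d) (a := a) (b := b) hd he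
      (Or.inl ha.le)
    obtain ⟨s, hs, hs1, hs2, hs3⟩ := hx.exists_root_neg hy (d := d) (a := a) (b := b) hd he ha hb
      (by linarith)
    refine HasKernelCount.pair hr hs (fun hrs => ?_) (fun t ht h0 => ?_)
      ((h.det_eq_zero_iff_mul hd _ _).2 hr3) (h.ne_zero_of_offDiag hd he _ _)
      ((h.det_eq_zero_iff_mul hd _ _).2 hs3) (h.ne_zero_of_offDiag hd he _ _)
    · rw [hrs] at hr1
      linarith
    · rw [h.det_eq_zero_iff_mul hd] at h0
      rcases mul_pos_iff.1 (h0 ▸ he) with h1 | h1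
      · exact Or.inr (hx.unique_root_of_pos hy hd ht hs h1.1 h1.2 hs1 hs2 (h0.trans hs3.symm))
      · exact Or.inl (hx.unique_root_of_neg hy hd ht hr h1.1 h1.2 hr1 hr2 (h0.trans hr3.symm))
  · have he0 : e = 0 := Complex.normSq_eq_zero.1 he.symm
    obtain ⟨r, hr, hr1⟩ := hy.exists_eq (k := a / -d) (div_pos ha (by linarith))
    obtain ⟨s, hs, hs1⟩ := hx.exists_eq (k := b / -d) (div_pos hb (by linarith))
    have hr2 : d * y r + a = 0 := by
        rw [hr1, div_neg, mul_neg, mul_div_cancel₀ _ hd.ne, neg_add_cancel]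
    have hs2 : d * x s + b = 0 := by
      rw [hs1, div_neg, mul_neg, mul_div_cancel₀ _ hd.ne, neg_add_cancel]
    have huniq : ∀ t, 0 < t → (C + D * Matrix.diagonal ![(x t : ℂ), (y t : ℂ)]).det = 0 →
        t = r ∨ t = s := by
      intro t ht h0
      rw [h.det_eq_zero_iff_mul hd, ← he, mul_eq_zero] at h0
      rcases h0 with h0 | h0
      · exact Or.inr (hx.injective ht hs (mul_left_cancel₀ hd.ne (by linarith)))
      · exact Or.inl (hy.injective ht hr (mul_left_cancel₀ hd.ne (by linarith)))
    -- Coinciding roots make the matrix zero, so one energy carries both dimensions.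
    by_cases hrs : r = s
    · subst hrs
      have h0 : C + D * Matrix.diagonal ![(x r : ℂ), (y r : ℂ)] = 0 :=
        (h.add_mul_diagonal_eq_zero_iff hd.ne _ _).2
          ⟨by exact_mod_cast hs2, by exact_mod_cast hr2, he0⟩
      have := HasKernelCount.single (M := fun t => C + D * Matrix.diagonal ![(x t : ℂ), (y t : ℂ)])
        hr (fun t ht h0 => by simpa using huniq t ht h0)
      rwa [h0, finrank_ker_zero] at this
    · refine HasKernelCount.pair hr hs hrs huniq
        ((h.det_eq_zero_iff_mul hd _ _).2 (by rw [hr2, ← he, mul_zero]))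
        (h.ne_zero_of_fst hd _ fun h0 => hrs ?_)
        ((h.det_eq_zero_iff_mul hd _ _).2 (by rw [hs2, ← he, zero_mul]))
        (h.ne_zero_of_snd hd _ fun h0 => hrs ?_)
      · exact hx.injective hr hs (mul_left_cancel₀ hd.ne (by linarith))
      · exact hy.injective hr hs (mul_left_cancel₀ hd.ne (by linarith))

/-- The secular polynomial is increasing and has one root. The matrix does not vanish there:
otherwise `c + ax = c + by = 0` and `e = 0`, so `a, b > 0` and `ab = cd ≤ 0`. -/
theorem hasKernelCount_one' (h : PairCoordinates C D u c a b d e) (hx : IsScale x) (hy : IsScale y)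
    (hd : 0 ≤ d) (hc : c < 0) (ha : 0 ≤ a) (hb : 0 ≤ b) (hab : 0 < a + b) :
    HasKernelCount (fun t => C + D * Matrix.diagonal ![(x t : ℂ), (y t : ℂ)]) 1 := by
  obtain ⟨r, hr, hr1, hr2⟩ := hx.exists_unique_root hy ha hb hab hc hd
  refine HasKernelCount.one hr (fun t ht h0 => hr2 t ht ((h.det_eq_zero_iff _ _).1 h0))
    ((h.det_eq_zero_iff _ _).2 hr1) fun h0 => ?_
  have h1 : C.adjugate * (C + D * Matrix.diagonal ![(x r : ℂ), (y r : ℂ)]) = 0 := by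
    rw [h0, mul_zero]
  rw [mul_add, ← mul_assoc, Matrix.adjugate_mul, h.adjugate_mul, h.det_fst] at h1
  have e0 := congrFun (congrFun h1 0) 0
  have e1 := congrFun (congrFun h1 1) 1
  have e2 := congrFun (congrFun h1 0) 1
  simp [Matrix.vecMul_diagonal] at e0 e1 e2
  have f0 : c + a * x r = 0 := by
    have : u * ((c + a * x r : ℝ) : ℂ) = 0 := by push_cast; linear_combination e0
    exact_mod_cast (mul_eq_zero.1 this).resolve_left h.ne_zero'
  have f1 : c + b * y r = 0 := by
    have : u * ((c + b * y r : ℝ) : ℂ) = 0 := by push_cast; linear_combination e1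
    exact_mod_cast (mul_eq_zero.1 this).resolve_left h.ne_zero'
  have f2 : e = 0 := by
    have := (hy.pos r hr).ne'
    simpa [h.ne_zero', this] using e2
  have key := h.mul_sub_mul
  rw [f2, map_zero] at key
  have g0 : a ≠ 0 := by rintro rfl; linarith
  have g1 : b ≠ 0 := by rintro rfl; linarith
  have := mul_pos (ha.lt_of_ne' g0) (hb.lt_of_ne' g1)
  have := mul_nonpos_of_nonpos_of_nonneg hc.le hd
  linarith

/-- Each sign pattern is evaluated twice, by the roots of the secular equation and by the signature
of `C D*`. -/
theorem hasKernelCount (h : PairCoordinates C D u c a b d e) (hn : IsNormalized c a b d)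
    (hx : IsScale x) (hy : IsScale y) (hA : (C * Dᴴ).IsHermitian) :
    HasKernelCount (fun t => C + D * Matrix.diagonal ![(x t : ℂ), (y t : ℂ)])
      (negEigenvalueCount hA) := by
  have key := h.mul_sub_mul
  have hE := Complex.normSq_nonneg e
  rcases hn with ⟨ha, hb, hab⟩ | ⟨hab, hc, hd⟩ | ⟨ha, hb, hc, hd, hcd⟩
  · rw [h.negEigenvalueCount_of_pos hab]
    rcases lt_or_ge c 0 with hc | hc <;> rcases lt_or_ge d 0 with hd | hd
    · rw [if_pos hc, if_pos hd]
      have : 0 < a * b := by linarith [mul_pos_of_neg_of_neg hc hd]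
      exact h.hasKernelCount_two hx hy hd hc (ha.lt_of_ne' fun h0 => by simp [h0] at this)
        (hb.lt_of_ne' fun h0 => by simp [h0] at this)
    · rw [if_pos hc, if_neg hd.not_gt]
      exact h.hasKernelCount_one' hx hy hd hc ha hb hab
    · rw [if_neg hc.not_gt, if_pos hd]
      refine h.hasKernelCount_one hx hy hd hc (Or.inl ha) fun h0 => ?_
      rw [h0] at key
      have h1 : a * b ≤ 0 := by linarith [mul_nonpos_of_nonneg_of_nonpos hc hd.le]
      rcases mul_eq_zero.1 (le_antisymm h1 (mul_nonneg ha hb)) with h2 | h2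
      · exact Or.inr ⟨h2.le, by linarith⟩
      · exact Or.inl ⟨by linarith, h2.le⟩
    · rw [if_neg hc.not_gt, if_neg hd.not_gt]
      refine HasKernelCount.zero fun t ht h0 => ?_
      rw [h.det_eq_zero_iff] at h0
      have h1 := hx.pos t ht
      have h2 := hy.pos t ht
      have h3 := mul_nonneg hd (mul_pos h1 h2).le
      rcases ha.lt_or_eq with h4 | h4
      · linarith [mul_pos h4 h1, mul_nonneg hb h2.le]
      · have : 0 < b := by linarith
        linarith [mul_nonneg ha h1.le, mul_pos this h2]
  · rw [h.negEigenvalueCount_of_neg (mul_neg_of_pos_of_neg hc hd)]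
    have h0 : 0 < a ∧ b ≤ 0 ∨ a ≤ 0 ∧ 0 < b := by
      rcases mul_neg_iff.1 hab with h1 | h1
      · exact Or.inl ⟨h1.1, h1.2.le⟩
      · exact Or.inr ⟨h1.1.le, h1.2⟩
    exact h.hasKernelCount_one hx hy hd hc.le (h0.imp (·.1.le) (·.2.le)) fun _ => h0
  · by_cases h0 : c * d = 0
    · rw [h.negEigenvalueCount_of_zero ha hb h0]
      refine HasKernelCount.zero fun t ht h1 => ?_
      rw [h.det_eq_zero_iff, ha, hb] at h1
      have h2 := mul_pos (hx.pos t ht) (hy.pos t ht)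
      rcases mul_eq_zero.1 h0 with h3 | h3
      · have : d < 0 := by linarith
        linarith [mul_neg_of_neg_of_pos this h2]
      · rw [h3] at h1
        linarith
    · have hc' : 0 < c := hc.lt_of_ne' fun h1 => h0 (by simp [h1])
      have hd' : d < 0 := hd.lt_of_ne fun h1 => h0 (by simp [h1])
      have hcd' := mul_neg_of_pos_of_neg hc' hd'
      rw [h.negEigenvalueCount_of_neg hcd']
      refine h.hasKernelCount_one hx hy hd' hc (Or.inl ha.ge) fun h1 => ?_
      rw [h1, ha] at key
      linarith

end PairCoordinates

/-- The number of eigenvalues of `H_α^{CD}` is the number of negative eigenvalues of `C D*`. -/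
theorem eigenvalueCount_hamiltonian {α : ℝ} (h0 : 0 < α) (h1 : α < 1)
    {C D : Matrix (Fin 2) (Fin 2) ℂ} (hCD : Admissible C D) :
    eigenvalueCount (hamiltonian α C D) = (negEigenvalueCount hCD.isHermitian : ℕ∞) := by
  obtain ⟨u, c, a, b, d, e, h, hn⟩ := hCD.exists_isNormalized
  obtain ⟨s, hs0, hs1, hs2⟩ := h.hasKernelCount hn (isScale_weylFactor h0 h1)
    (isScale_weylFactor (ν := 1 - α) (by linarith) (by linarith)) hCD.isHermitian
  rw [eigenvalueCount_eq_sum h0 h1 hCD s hs0 hs1, ← hs2]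
  rfl

/-! ### The phase of a quotient of Gamma functions -/

/-- For `y > 0` the argument of `v + iy` is `π/2 - arctan(v/y)`, whatever the sign of `v`. -/
theorem div_conj_eq_exp_arctan (v : ℝ) {y : ℝ} (hy : 0 < y) :
    ((v : ℂ) + Complex.I * y) / (v - Complex.I * y) =
      -Complex.exp (-(2 * Complex.I * (Real.arctan (v / y) : ℝ))) := by
  set θ := Real.arctan (v / y) with hθ
  have hc : 0 < Real.cos θ := Real.cos_arctan_pos _
  have hv : v = y * (Real.sin θ / Real.cos θ) := by
    rw [← Real.tan_eq_sin_div_cos, hθ, Real.tan_arctan]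
    field_simp
  have e2 : Complex.exp (-(2 * Complex.I * (θ : ℝ))) =
      ((Real.cos θ : ℂ) - Complex.I * (Real.sin θ : ℂ)) ^ 2 := by
    rw [show -(2 * Complex.I * (θ : ℂ)) = (2 : ℕ) * (((-θ : ℝ) : ℂ) * Complex.I) by push_cast; ring,
      Complex.exp_nat_mul, Complex.exp_mul_I, ← Complex.ofReal_cos, ← Complex.ofReal_sin,
      Real.cos_neg, Real.sin_neg]
    push_cast
    ring
  have h1 : (Real.sin θ : ℂ) ^ 2 + (Real.cos θ : ℂ) ^ 2 = 1 := by
    exact_mod_cast Real.sin_sq_add_cos_sq θ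
  have hne : (v : ℂ) - Complex.I * y ≠ 0 := by
    intro h0
    have := congrArg Complex.im h0
    simp at this
    exact hy.ne' this
  have hv' : (Real.cos θ : ℂ) * v = y * (Real.sin θ : ℂ) := by
    rw [hv]
    push_cast
    have hc' : Complex.cos θ ≠ 0 := by exact_mod_cast hc.ne'
    field_simp
  have hc' : (Real.cos θ : ℂ) ≠ 0 := by exact_mod_cast hc.ne'
  rw [e2, div_eq_iff hne]
  apply mul_left_cancel₀ hc'
  generalize (Real.cos θ : ℂ) = k at *
  generalize (Real.sin θ : ℂ) = l at *
  have hI := Complex.I_sq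
  linear_combination (1 + (k - Complex.I * l) ^ 2) * hv' - y * (Complex.I * k + l) * h1 +
    y * l * (2 * k ^ 2 + l ^ 2 - Complex.I * k * l) * hI

theorem hasDerivAt_arctan_div {y : ℝ} (hy : 0 < y) (u : ℝ) :
    HasDerivAt (fun u : ℝ => Real.arctan (u / y)) (y / (u ^ 2 + y ^ 2)) u := by
  refine ((hasDerivAt_id u).div_const y).arctan.congr_deriv ?_
  simp only [id]
  field_simp
  ring

theorem concaveOn_arctan_div {y : ℝ} (hy : 0 < y) :
    ConcaveOn ℝ (Ici 0) fun u : ℝ => Real.arctan (u / y) := by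
  refine AntitoneOn.concaveOn_of_deriv (convex_Ici 0) (by fun_prop)
    (fun u _ => (hasDerivAt_arctan_div hy u).differentiableAt.differentiableWithinAt) ?_
  intro u hu v hv huv
  rw [interior_Ici, mem_Ioi] at hu hv
  rw [(hasDerivAt_arctan_div hy u).deriv, (hasDerivAt_arctan_div hy v).deriv]
  gcongr

theorem arctan_div_sub_le {y : ℝ} (hy : 0 < y) (u : ℝ) {β : ℝ} (hβ : 0 ≤ β) :
    Real.arctan ((u + β) / y) - Real.arctan (u / y) ≤ β / y := by
  have h := image_sub_le_mul_sub_of_deriv_le (f := fun u : ℝ => Real.arctan (u / y)) (C := 1 / y)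
    (fun u => (hasDerivAt_arctan_div hy u).differentiableAt) (fun u => by
      rw [(hasDerivAt_arctan_div hy u).deriv, div_le_div_iff₀ (by positivity) hy]
      nlinarith [sq_nonneg u]) (show u ≤ u + β by linarith)
  convert h using 1
  ring

/-- By concavity a step of length `β ≤ 1` gains at least `β` times the gain of the unit step, and
unit steps telescope. -/
theorem le_sum_arctan {y σ β : ℝ} (hy : 0 < y) (hσ : 0 < σ) (hβ : 0 < β) (hβ1 : β ≤ 1) (n : ℕ) :
    β * (Real.arctan ((σ + n) / y) - Real.arctan (σ / y)) ≤
      ∑ j ∈ Finset.range n, (Real.arctan ((σ + j + β) / y) - Real.arctan ((σ + j) / y)) := by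
  have key : ∀ j : ℕ, β * (Real.arctan ((σ + (j + 1 : ℕ)) / y) - Real.arctan ((σ + j) / y)) ≤
      Real.arctan ((σ + j + β) / y) - Real.arctan ((σ + j) / y) := by
    intro j
    have m : ∀ k : ℕ, σ + k ∈ Ici (0 : ℝ) := fun k => by rw [mem_Ici]; positivity
    have h := (concaveOn_arctan_div hy).2 (m j) (m (j + 1)) (sub_nonneg.2 hβ1) hβ.le (by ring)
    simp only [smul_eq_mul] at h
    rw [show (1 - β) * (σ + j) + β * (σ + (j + 1 : ℕ)) = σ + j + β by push_cast; ring] at h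
    linarith
  have := Finset.sum_le_sum fun j (_ : j ∈ Finset.range n) => key j
  rw [← Finset.mul_sum, Finset.sum_range_sub (fun j : ℕ => Real.arctan ((σ + j) / y))] at this
  simpa using this

/-- By concavity a step of length `β` gains at most `β` times the gain of the preceding unit step.
The first term has no predecessor and costs `β/y`. -/
theorem sum_arctan_le {y σ β : ℝ} (hy : 0 < y) (hσ : 0 < σ) (hβ : 0 < β) (n : ℕ) :
    ∑ j ∈ Finset.range (n + 1), (Real.arctan ((σ + j + β) / y) - Real.arctan ((σ + j) / y)) ≤
      β * (Real.arctan ((σ + n) / y) - Real.arctan (σ / y)) + β / y := by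
  rw [Finset.sum_range_succ']
  have key : ∀ j : ℕ, Real.arctan ((σ + (j + 1 : ℕ) + β) / y) - Real.arctan ((σ + (j + 1 : ℕ)) / y) ≤
      β * (Real.arctan ((σ + (j + 1 : ℕ)) / y) - Real.arctan ((σ + j) / y)) := by
    intro j
    have h := (concaveOn_arctan_div hy).slope_anti_adjacent (x := σ + j) (y := σ + (j + 1 : ℕ))
      (z := σ + (j + 1 : ℕ) + β) (by rw [mem_Ici]; positivity) (by rw [mem_Ici]; positivity)
      (by push_cast; linarith) (by linarith)
    rw [show σ + (j + 1 : ℕ) + β - (σ + (j + 1 : ℕ)) = β by ring,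
      show σ + (j + 1 : ℕ) - (σ + j) = 1 by push_cast; ring, div_one, div_le_iff₀ hβ] at h
    linarith
  have h1 := Finset.sum_le_sum fun j (_ : j ∈ Finset.range n) => key j
  rw [← Finset.mul_sum, Finset.sum_range_sub (fun j : ℕ => Real.arctan ((σ + j) / y))] at h1
  have h2 := arctan_div_sub_le hy (σ + (0 : ℕ)) hβ.le
  simp only [Nat.cast_zero, add_zero] at h1 h2 ⊢
  linarith

/-- The square of the phase of `Γ(σ + β + iy) / Γ(σ + iy)`. -/
def gammaPhase (σ β y : ℝ) : ℂ :=
  Complex.Gamma (σ + β + Complex.I * y) / Complex.Gamma (σ + β - Complex.I * y) *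
    (Complex.Gamma (σ - Complex.I * y) / Complex.Gamma (σ + Complex.I * y))

/-- In Euler's product the powers of `n` and the factorials cancel from this quotient; each
remaining factor contributes twice a difference of arctangents. -/
theorem gammaSeq_phase {σ β y : ℝ} (hy : 0 < y) {n : ℕ} (hn : n ≠ 0) :
    Complex.GammaSeq (σ + β + Complex.I * y) n / Complex.GammaSeq (σ + β - Complex.I * y) n *
      (Complex.GammaSeq (σ - Complex.I * y) n / Complex.GammaSeq (σ + Complex.I * y) n) =
    Complex.exp (2 * Complex.I * ((∑ j ∈ Finset.range (n + 1),
      (Real.arctan ((σ + j + β) / y) - Real.arctan ((σ + j) / y)) : ℝ) : ℂ)) := by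
  have hn' : (n : ℂ) ≠ 0 := by exact_mod_cast hn
  have hf : (Nat.factorial n : ℂ) ≠ 0 := by exact_mod_cast Nat.factorial_ne_zero n
  have him : ∀ v : ℝ, (v : ℂ) + Complex.I * y ≠ 0 ∧ (v : ℂ) - Complex.I * y ≠ 0 := by
    intro v
    constructor <;> intro h0 <;> have := congrArg Complex.im h0 <;> simp at this <;>
      exact hy.ne' this
  have hprod : ∀ j : ℕ, Complex.exp (2 * Complex.I *
      ((Real.arctan ((σ + j + β) / y) - Real.arctan ((σ + j) / y) : ℝ) : ℂ)) =
      ((σ + β - Complex.I * y + j) * (σ + Complex.I * y + j)) /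
        ((σ + β + Complex.I * y + j) * (σ - Complex.I * y + j)) := by
    intro j
    have e1 := div_conj_eq_exp_arctan (σ + j + β) hy
    have e2 := div_conj_eq_exp_arctan (σ + j) hy
    rw [Complex.ofReal_sub, mul_sub, sub_eq_add_neg, Complex.exp_add]
    have e3 : Complex.exp (2 * Complex.I * (Real.arctan ((σ + j + β) / y) : ℝ)) =
        -(((σ + j + β : ℝ) - Complex.I * y) / ((σ + j + β : ℝ) + Complex.I * y)) := by
      rw [← inv_div ((σ + j + β : ℝ) + Complex.I * y : ℂ), e1, ← inv_neg, neg_neg, ← Complex.exp_neg, neg_neg]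
    have e4 : Complex.exp (-(2 * Complex.I * (Real.arctan ((σ + j) / y) : ℝ))) =
        -(((σ + j : ℝ) + Complex.I * y) / ((σ + j : ℝ) - Complex.I * y)) := by
      rw [e2, neg_neg]
    rw [e3, e4, neg_mul_neg, div_mul_div_comm]
    push_cast
    congr 2 <;> ring
  rw [Complex.ofReal_sum, Finset.mul_sum, Complex.exp_sum, Finset.prod_congr rfl fun j _ => hprod j,
    Finset.prod_div_distrib, Finset.prod_mul_distrib, Finset.prod_mul_distrib]
  have hp : ∀ v : ℝ, ∏ j ∈ Finset.range (n + 1), ((v : ℂ) + Complex.I * y + j) ≠ 0 ∧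
      ∏ j ∈ Finset.range (n + 1), ((v : ℂ) - Complex.I * y + j) ≠ 0 := by
    intro v
    constructor <;> refine Finset.prod_ne_zero_iff.2 fun j _ => ?_
    · have := (him (v + j)).1
      push_cast at this
      rwa [add_right_comm] at this
    · have := (him (v + j)).2
      push_cast at this
      rwa [add_sub_right_comm] at this
  have p1 := hp (σ + β)
  have p2 := hp σ
  push_cast at p1
  have hpow : ∀ z : ℂ, (n : ℂ) ^ z ≠ 0 := fun z => by
    rw [Ne, Complex.cpow_eq_zero_iff]
    exact fun h => hn' h.1
  have hexp : (n : ℂ) ^ (σ + β + Complex.I * y) * (n : ℂ) ^ (σ - Complex.I * y) =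
      (n : ℂ) ^ (σ + β - Complex.I * y) * (n : ℂ) ^ (σ + Complex.I * y) := by
    rw [← Complex.cpow_add _ _ hn', ← Complex.cpow_add _ _ hn']
    congr 1
    ring
  unfold Complex.GammaSeq
  have h1 := hpow (σ + β - Complex.I * y)
  have h2 := hpow (σ + Complex.I * y)
  obtain ⟨p1, p3⟩ := p1
  obtain ⟨p2, p4⟩ := p2
  generalize (n : ℂ) ^ (σ + β + Complex.I * y) = k1 at *
  generalize (n : ℂ) ^ (σ + β - Complex.I * y) = k2 at *
  generalize (n : ℂ) ^ (σ - Complex.I * y) = k3 at *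
  generalize (n : ℂ) ^ (σ + Complex.I * y) = k4 at *
  generalize ∏ j ∈ Finset.range (n + 1), ((σ : ℂ) + β + Complex.I * y + j) = q1 at *
  generalize ∏ j ∈ Finset.range (n + 1), ((σ : ℂ) + β - Complex.I * y + j) = q2 at *
  generalize ∏ j ∈ Finset.range (n + 1), ((σ : ℂ) - Complex.I * y + j) = q3 at *
  generalize ∏ j ∈ Finset.range (n + 1), ((σ : ℂ) + Complex.I * y + j) = q4 at *
  field_simp
  linear_combination hexp

theorem Gamma_ne_zero' {v y : ℝ} (hv : 0 < v) :
    Complex.Gamma (v + Complex.I * y) ≠ 0 ∧ Complex.Gamma (v - Complex.I * y) ≠ 0 := by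
  constructor <;> refine Complex.Gamma_ne_zero_of_re_pos ?_ <;> simpa

theorem norm_exp_two_mul_sub_le (s t : ℝ) :
    ‖Complex.exp (2 * Complex.I * s) - Complex.exp (2 * Complex.I * t)‖ ≤ 2 * |s - t| := by
  have h := Real.norm_exp_I_mul_ofReal_sub_one_le (x := 2 * (s - t))
  have e : Complex.exp (2 * Complex.I * s) - Complex.exp (2 * Complex.I * t) =
      Complex.exp ((2 * t : ℝ) * Complex.I) * (Complex.exp (Complex.I * (2 * (s - t) : ℝ)) - 1) := by
    rw [mul_sub, ← Complex.exp_add]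
    push_cast
    ring_nf
  rw [e, norm_mul, Complex.norm_exp_ofReal_mul_I, one_mul]
  refine h.trans ?_
  rw [Real.norm_eq_abs, abs_mul, abs_two]

/-- The two arctangent bounds pin down the phase of Euler's product up to `β/y` and an error that
vanishes as `n → ∞`. This takes the place of Stirling's formula. -/
theorem norm_gammaPhase_sub_le {σ β y : ℝ} (hy : 0 < y) (hσ : 0 < σ) (hβ : 0 < β) (hβ1 : β ≤ 1) :
    ‖gammaPhase σ β y - Complex.exp (2 * Complex.I *
      ((β * (Real.pi / 2 - Real.arctan (σ / y)) : ℝ) : ℂ))‖ ≤ 2 * (β / y) := by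
  have hG := Gamma_ne_zero' (v := σ + β) (y := y) (by linarith)
  have hG' := Gamma_ne_zero' (v := σ) (y := y) hσ
  push_cast at hG
  have lim := ((Complex.GammaSeq_tendsto_Gamma (σ + β + Complex.I * y)).div
    (Complex.GammaSeq_tendsto_Gamma (σ + β - Complex.I * y)) hG.2).mul
    ((Complex.GammaSeq_tendsto_Gamma (σ - Complex.I * y)).div
    (Complex.GammaSeq_tendsto_Gamma (σ + Complex.I * y)) hG'.1)
  set A := β * (Real.pi / 2 - Real.arctan (σ / y)) with hA
  have lim' : Tendsto (fun n : ℕ => 2 * (β / y + β * (Real.pi / 2 - Real.arctan ((σ + n) / y)))) atTop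
      (𝓝 (2 * (β / y))) := by
    have h1 : Tendsto (fun n : ℕ => (σ + n) / y) atTop atTop :=
      (tendsto_atTop_add_const_left _ σ tendsto_natCast_atTop_atTop).atTop_div_const hy
    have h2 := (Real.tendsto_arctan_atTop.comp h1).mono_right nhdsWithin_le_nhds
    have h3 := (((h2.const_sub (Real.pi / 2)).const_mul β).const_add (β / y)).const_mul 2
    simpa using h3
  refine le_of_tendsto_of_tendsto (lim.sub_const _).norm lim' ?_
  filter_upwards [eventually_ne_atTop 0] with n hn
  simp only [Pi.div_apply]
  rw [gammaSeq_phase hy hn]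
  refine (norm_exp_two_mul_sub_le _ _).trans ?_
  have h1 := le_sum_arctan hy hσ hβ hβ1 (n + 1)
  have h2 := sum_arctan_le hy hσ hβ n
  have h3 : Real.arctan ((σ + n) / y) ≤ Real.arctan ((σ + (n + 1 : ℕ)) / y) := by
    refine Real.arctan_strictMono.monotone (div_le_div_of_nonneg_right ?_ hy.le)
    push_cast
    linarith
  have h4 := (Real.arctan_lt_pi_div_two ((σ + n) / y)).le
  have h5 := mul_le_mul_of_nonneg_left h3 hβ.le
  have h6 := mul_le_mul_of_nonneg_left h4 hβ.le
  have h7 : 0 ≤ β / y := by positivity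
  refine mul_le_mul_of_nonneg_left ?_ zero_le_two
  rw [abs_le]
  constructor <;> rw [hA] <;> nlinarith

theorem tendsto_gammaPhase_atTop {σ β : ℝ} (hσ : 0 < σ) (hβ : 0 < β) (hβ1 : β ≤ 1) :
    Tendsto (gammaPhase σ β) atTop (𝓝 (Complex.exp (Complex.I * (Real.pi * β)))) := by
  have h1 : Tendsto (fun y : ℝ => β / y) atTop (𝓝 0) := tendsto_const_nhds.div_atTop tendsto_id
  have h2 : Tendsto (fun y : ℝ => σ / y) atTop (𝓝 0) := tendsto_const_nhds.div_atTop tendsto_id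
  have h3 : Tendsto (fun y : ℝ => β * (Real.pi / 2 - Real.arctan (σ / y))) atTop
      (𝓝 (β * (Real.pi / 2 - Real.arctan 0))) :=
    (((Real.continuous_arctan.tendsto 0).comp h2).const_sub _).const_mul β
  have h4 : Tendsto (fun y : ℝ => Complex.exp (2 * Complex.I *
      ((β * (Real.pi / 2 - Real.arctan (σ / y)) : ℝ) : ℂ))) atTop
      (𝓝 (Complex.exp (Complex.I * (Real.pi * β)))) := by
    have hc : Continuous fun s : ℝ => Complex.exp (2 * Complex.I * (s : ℂ)) := by fun_prop
    have h := (hc.tendsto _).comp h3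
    have e : (2 * Complex.I * ((β * (Real.pi / 2 - Real.arctan 0) : ℝ) : ℂ)) =
        Complex.I * (Real.pi * β) := by
      rw [Real.arctan_zero]
      push_cast
      ring
    rw [e] at h
    exact h
  have h5 : Tendsto (fun y : ℝ => gammaPhase σ β y - Complex.exp (2 * Complex.I *
      ((β * (Real.pi / 2 - Real.arctan (σ / y)) : ℝ) : ℂ))) atTop (𝓝 0) := by
    refine squeeze_zero_norm' ?_ (by simpa using h1.const_mul 2)
    filter_upwards [eventually_gt_atTop 0] with y hy
    exact norm_gammaPhase_sub_le hy hσ hβ hβ1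
  simpa using h5.add h4

theorem conj_gammaPhase (σ β y : ℝ) :
    (starRingEnd ℂ) (gammaPhase σ β y) = gammaPhase σ β (-y) := by
  simp only [gammaPhase, map_mul, map_div₀, ← Complex.Gamma_conj]
  simp [sub_eq_add_neg]

theorem tendsto_gammaPhase_atBot {σ β : ℝ} (hσ : 0 < σ) (hβ : 0 < β) (hβ1 : β ≤ 1) :
    Tendsto (gammaPhase σ β) atBot (𝓝 (Complex.exp (-(Complex.I * (Real.pi * β))))) := by
  have h := (Complex.continuous_conj.tendsto _).comp
    ((tendsto_gammaPhase_atTop hσ hβ hβ1).comp tendsto_neg_atBot_atTop)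
  rw [← Complex.exp_conj] at h
  convert h using 2
  · funext y
    simp [conj_gammaPhase]
  · simp

theorem continuous_gammaPhase {σ β : ℝ} (hσ : 0 < σ) (hβ : 0 < β) : Continuous (gammaPhase σ β) := by
  have key : ∀ v : ℝ, 0 < v → Continuous (fun y : ℝ => Complex.Gamma (v + Complex.I * y)) ∧
      Continuous (fun y : ℝ => Complex.Gamma (v - Complex.I * y)) := by
    intro v hv
    constructor <;> rw [continuous_iff_continuousAt] <;> intro y <;>
      refine ContinuousAt.comp (g := Complex.Gamma) (Complex.differentiableAt_Gamma _ ?_).continuousAt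
        (by fun_prop)
    all_goals
      intro m h0
      have := congrArg Complex.re h0
      simp at this
      have hm : (0 : ℝ) ≤ m := m.cast_nonneg
      linarith
  have k1 := key (σ + β) (by linarith)
  have k2 := key σ hσ
  have hG := fun y => Gamma_ne_zero' (v := σ + β) (y := y) (by linarith)
  have hG' := fun y => Gamma_ne_zero' (v := σ) (y := y) hσ
  push_cast at k1 hG
  exact (k1.1.div k1.2 fun y => (hG y).2).mul (k2.2.div k2.1 fun y => (hG' y).1)

theorem norm_gammaPhase {σ β : ℝ} (hσ : 0 < σ) (hβ : 0 < β) (y : ℝ) : ‖gammaPhase σ β y‖ = 1 := by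
  have hG := Gamma_ne_zero' (v := σ + β) (y := y) (by linarith)
  have hG' := Gamma_ne_zero' (v := σ) (y := y) hσ
  push_cast at hG
  have h : gammaPhase σ β y * (starRingEnd ℂ) (gammaPhase σ β y) = 1 := by
    rw [conj_gammaPhase]
    simp only [gammaPhase, Complex.ofReal_neg, mul_neg, sub_neg_eq_add, ← sub_eq_add_neg]
    have h1 := hG.1
    have h2 := hG.2
    have h3 := hG'.1
    have h4 := hG'.2
    field_simp
  rw [Complex.mul_conj, Complex.normSq_eq_norm_sq] at h
  have h' : ‖gammaPhase σ β y‖ ^ 2 = 1 := by exact_mod_cast h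
  nlinarith [norm_nonneg (gammaPhase σ β y)]

/-! ### The wave operator functions -/

/-- `e^{iπα}`. -/
def rotor (α : ℝ) : ℂ := Complex.exp (Complex.I * (Real.pi : ℂ) * (α : ℂ))

theorem rotor_eq (α : ℝ) : rotor α =
    (Real.cos (Real.pi * α) : ℂ) + (Real.sin (Real.pi * α) : ℂ) * Complex.I := by
  rw [rotor, mul_assoc, mul_comm, ← Complex.ofReal_mul, Complex.exp_mul_I, Complex.ofReal_cos,
    Complex.ofReal_sin]

theorem rotor_re (α : ℝ) : (rotor α).re = Real.cos (Real.pi * α) := by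
  simp [rotor_eq, -Complex.ofReal_cos, -Complex.ofReal_sin]

theorem rotor_im (α : ℝ) : (rotor α).im = Real.sin (Real.pi * α) := by
  simp [rotor_eq, -Complex.ofReal_cos, -Complex.ofReal_sin]

theorem star_rotor (α : ℝ) :
    star (rotor α) = Complex.exp (-Complex.I * (Real.pi : ℂ) * (α : ℂ)) := by
  rw [rotor, Complex.star_def, ← Complex.exp_conj]
  simp

theorem rotor_mul_star (α : ℝ) : rotor α * star (rotor α) = 1 := by
  rw [star_rotor, rotor, ← Complex.exp_add]
  simp

theorem norm_rotor (α : ℝ) : ‖rotor α‖ = 1 := by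
  rw [rotor, mul_assoc, mul_comm, ← Complex.ofReal_mul, Complex.norm_exp_ofReal_mul_I]

theorem sin_pi_mul_pos {α : ℝ} (h0 : 0 < α) (h1 : α < 1) : 0 < Real.sin (Real.pi * α) :=
  Real.sin_pos_of_pos_of_lt_pi (by positivity) (by nlinarith [Real.pi_pos])

theorem rotor_sub_star (α : ℝ) :
    rotor α - star (rotor α) = 2 * Complex.I * (Real.sin (Real.pi * α) : ℂ) := by
  rw [Complex.star_def, Complex.sub_conj, rotor_im, Complex.ofReal_mul, Complex.ofReal_ofNat]
  ring

/-- `e^{-πx}`. -/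
def boost (x : ℝ) : ℝ := Real.exp (-(Real.pi * x))

theorem boost_pos (x : ℝ) : 0 < boost x := Real.exp_pos _

theorem add_star_rotor_ne_zero {α : ℝ} (h0 : 0 < α) (h1 : α < 1) (t : ℝ) :
    (t : ℂ) + star (rotor α) ≠ 0 := by
  intro h
  have := congrArg Complex.im h
  simp [rotor_im] at this
  exact (sin_pi_mul_pos h0 h1).ne' this

theorem sub_rotor_ne_zero {α : ℝ} (h0 : 0 < α) (h1 : α < 1) (t : ℝ) :
    (t : ℂ) - rotor α ≠ 0 := by
  intro h
  have := congrArg Complex.im h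
  simp [rotor_im] at this
  exact (sin_pi_mul_pos h0 h1).ne' this

theorem phaseShift_zero {α : ℝ} (h0 : 0 < α) : phaseShift α 0 = -(Real.pi / 2 * α) := by
  simp [phaseShift, abs_of_pos h0]

theorem abs_neg_one_add {α : ℝ} (h1 : α < 1) : |((-1 : ℤ) : ℝ) + α| = 1 - α := by
  rw [abs_of_neg (by push_cast; linarith)]
  push_cast
  ring

theorem phaseShift_neg_one {α : ℝ} (h1 : α < 1) : phaseShift α (-1) = Real.pi / 2 * α := by
  rw [phaseShift, abs_neg_one_add h1]
  simp

theorem phiMinus_zero {α : ℝ} (h0 : 0 < α) (x : ℝ) :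
    phiMinus α 0 x = Complex.exp (-(Complex.I * (Real.pi / 2 * α))) *
      gammaPhase (1 / 2) (α / 2) (-(x / 2)) := by
  rw [phiMinus, phaseShift_zero h0, gammaPhase, Int.cast_zero, zero_add, abs_of_pos h0, abs_zero]
  push_cast
  rw [mul_assoc, mul_comm (Complex.Gamma _ / _) (Complex.Gamma _ / _)]
  congr 1
  · congr 1; ring
  · congr 2 <;> congr 1 <;> ring

theorem phiMinus_neg_one {α : ℝ} (h1 : α < 1) (x : ℝ) :
    phiMinus α (-1) x = Complex.exp (Complex.I * (Real.pi / 2 * α)) *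
      gammaPhase (1 - α / 2) (α / 2) (x / 2) := by
  rw [phiMinus, phaseShift_neg_one h1, abs_neg_one_add h1, gammaPhase]
  push_cast
  rw [mul_assoc]
  congr 1
  congr 2 <;> congr 1 <;> simp <;> ring

theorem I_mul_exp (z : ℂ) :
    Complex.I * Complex.exp z = Complex.exp (Real.pi / 2 * Complex.I + z) := by
  rw [Complex.exp_add, Complex.exp_pi_div_two_mul_I]

theorem two_mul_sin_eq (ν x : ℝ) :
    2 * Complex.sin (Real.pi * (1 / 2 * (1 + ν + Complex.I * x))) =
      Complex.exp (Real.pi * x / 2) * Complex.exp (Complex.I * (Real.pi / 2 * ν)) *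
        ((boost x : ℂ) + Complex.exp (-(Complex.I * (Real.pi * ν)))) := by
  have e1 : Complex.exp (-(Real.pi * (1 / 2 * (1 + ν + Complex.I * x))) * Complex.I) =
      -Complex.I * (Complex.exp (Real.pi * x / 2) * Complex.exp (Complex.I * (Real.pi / 2 * ν)) *
        Complex.exp (-(Complex.I * (Real.pi * ν)))) := by
    have hI : ∀ z, -Complex.I * Complex.exp z = Complex.exp (-Real.pi / 2 * Complex.I + z) :=
      fun z => by rw [Complex.exp_add, Complex.exp_neg_pi_div_two_mul_I]
    rw [← Complex.exp_add, ← Complex.exp_add, hI]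
    congr 1
    linear_combination (-(Real.pi : ℂ) * x / 2) * Complex.I_sq
  have e2 : Complex.exp (Real.pi * (1 / 2 * (1 + ν + Complex.I * x)) * Complex.I) =
      Complex.I * (Complex.exp (Real.pi * x / 2) * Complex.exp (Complex.I * (Real.pi / 2 * ν)) *
        (boost x : ℂ)) := by
    rw [boost, Complex.ofReal_exp, ← Complex.exp_add, ← Complex.exp_add]
    rw [I_mul_exp]
    congr 1
    push_cast
    linear_combination ((Real.pi : ℂ) * x / 2) * Complex.I_sq
  rw [Complex.sin, e1, e2]
  linear_combination (-(Complex.exp (Real.pi * x / 2) * Complex.exp (Complex.I * (Real.pi / 2 * ν)) *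
    ((boost x : ℂ) + Complex.exp (-(Complex.I * (Real.pi * ν)))))) * Complex.I_sq

/-- Euler's reflection formula at `(1 + ν + ix)/2`, with the sine expressed through `boost`. -/
theorem Gamma_mul_Gamma_eq {ν x : ℝ}
    (hne : (boost x : ℂ) + Complex.exp (-(Complex.I * (Real.pi * ν))) ≠ 0) :
    1 / (2 * (Real.pi : ℂ)) * Complex.exp (Real.pi * x / 2) *
      (Complex.Gamma (1 / 2 * (1 + ν + Complex.I * x)) *
        Complex.Gamma (1 / 2 * (1 - ν - Complex.I * x))) *
      ((boost x : ℂ) + Complex.exp (-(Complex.I * (Real.pi * ν)))) =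
      Complex.exp (-(Complex.I * (Real.pi / 2 * ν))) := by
  have h := Complex.Gamma_mul_Gamma_one_sub (1 / 2 * (1 + ν + Complex.I * x))
  rw [show (1 : ℂ) - 1 / 2 * (1 + ν + Complex.I * x) = 1 / 2 * (1 - ν - Complex.I * x) by ring] at h
  have h2 := two_mul_sin_eq ν x
  have hpi : (Real.pi : ℂ) ≠ 0 := by exact_mod_cast Real.pi_ne_zero
  rw [h, Complex.exp_neg (Complex.I * (Real.pi / 2 * ν))]
  have h3 : Complex.sin (Real.pi * (1 / 2 * (1 + ν + Complex.I * x))) ≠ 0 := by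
    intro h0
    rw [h0, mul_zero] at h2
    exact mul_ne_zero (mul_ne_zero (Complex.exp_ne_zero _) (Complex.exp_ne_zero _)) hne h2.symm
  have h4 := Complex.exp_ne_zero (Complex.I * (Real.pi / 2 * ν))
  generalize Complex.sin (Real.pi * (1 / 2 * (1 + ν + Complex.I * x))) = S at *
  generalize Complex.exp (Complex.I * (Real.pi / 2 * ν)) = T at *
  generalize (boost x : ℂ) + Complex.exp (-(Complex.I * (Real.pi * ν))) = Q at *
  field_simp
  linear_combination -h2

/-- The reflection formula trades the last Gamma factor of `φ̃_0` for the denominator of `φ_0^-`, so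
the two functions differ by an elementary factor. -/
theorem phiTilde_zero {α : ℝ} (h0 : 0 < α) (h1 : α < 1) (x : ℝ) :
    phiTilde α 0 x = phiMinus α 0 x / ((boost x : ℂ) + star (rotor α)) := by
  have e : star (rotor α) = Complex.exp (-(Complex.I * (Real.pi * α))) := by
    rw [star_rotor]; congr 1; ring
  have hne := add_star_rotor_ne_zero h0 h1 (boost x)
  rw [e] at hne ⊢
  have h := Gamma_mul_Gamma_eq hne
  have hG : Complex.Gamma (1 / 2 * ((α : ℂ) + 1 + Complex.I * x)) ≠ 0 :=
    Complex.Gamma_ne_zero_of_re_pos (by simp; linarith)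
  rw [eq_div_iff hne, phiMinus, phiTilde, phaseShift_zero h0, Int.cast_zero, zero_add, abs_of_pos h0,
    abs_zero]
  rw [show Complex.exp (Complex.I * ((-(Real.pi / 2 * α) : ℝ) : ℂ)) =
    Complex.exp (-(Complex.I * (Real.pi / 2 * α))) by push_cast; congr 1; ring, ← h,
    show (1 : ℂ) + α + Complex.I * x = α + 1 + Complex.I * x by ring,
    show (1 : ℂ) + α - Complex.I * x = α + 1 - Complex.I * x by ring]
  simp only [Complex.ofReal_zero, mul_zero, zero_div, Complex.exp_zero, mul_one]
  generalize Complex.Gamma (1 / 2 * ((α : ℂ) + 1 + Complex.I * x)) = G at *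
  field_simp

theorem phiTilde_neg_one {α : ℝ} (h0 : 0 < α) (h1 : α < 1) (x : ℝ) :
    phiTilde α (-1) x = -(phiMinus α (-1) x / ((boost x : ℂ) - rotor α)) := by
  have e : -rotor α = Complex.exp (-(Complex.I * (Real.pi * (1 - α : ℝ)))) := by
    rw [rotor, ← neg_one_mul, ← Complex.exp_neg_pi_mul_I, ← Complex.exp_add]
    congr 1
    push_cast
    ring
  have hne := sub_rotor_ne_zero h0 h1 (boost x)
  rw [sub_eq_add_neg, e] at hne ⊢
  have h := Gamma_mul_Gamma_eq hne
  have hG : Complex.Gamma (1 / 2 * (((1 - α : ℝ) : ℂ) + 1 + Complex.I * x)) ≠ 0 :=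
    Complex.Gamma_ne_zero_of_re_pos (by simp; linarith)
  rw [eq_comm, neg_eq_iff_eq_neg, div_eq_iff hne, phiMinus, phiTilde, phaseShift_neg_one h1,
    abs_neg_one_add h1]
  have e2 : Complex.exp (Complex.I * ((Real.pi / 2 * α : ℝ) : ℂ)) =
      Complex.I * Complex.exp (-(Complex.I * (Real.pi / 2 * (1 - α : ℝ)))) := by
    rw [I_mul_exp]
    congr 1
    push_cast
    ring
  have e3 : Complex.exp (-Complex.I * (Real.pi : ℂ) * ((|((-1 : ℤ) : ℝ)| : ℝ) : ℂ) / 2) =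
      -Complex.I := by
    rw [← Complex.exp_neg_pi_div_two_mul_I]
    congr 1
    simp
    ring
  rw [e2, e3, ← h,
    show (1 : ℂ) + (1 - α : ℝ) + Complex.I * x = (1 - α : ℝ) + 1 + Complex.I * x by ring,
    show (1 : ℂ) + (1 - α : ℝ) - Complex.I * x = (1 - α : ℝ) + 1 - Complex.I * x by ring]
  generalize Complex.Gamma (1 / 2 * (((1 - α : ℝ) : ℂ) + 1 + Complex.I * x)) = G at *
  field_simp

theorem norm_phiMinus_zero {α : ℝ} (h0 : 0 < α) (x : ℝ) : ‖phiMinus α 0 x‖ = 1 := by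
  rw [phiMinus_zero h0, norm_mul, norm_gammaPhase (by norm_num) (by linarith), mul_one,
    show -(Complex.I * (Real.pi / 2 * α : ℂ)) = ((-(Real.pi / 2 * α) : ℝ) : ℂ) * Complex.I by
      push_cast; ring, Complex.norm_exp_ofReal_mul_I]

theorem norm_phiMinus_neg_one {α : ℝ} (h0 : 0 < α) (h1 : α < 1) (x : ℝ) :
    ‖phiMinus α (-1) x‖ = 1 := by
  rw [phiMinus_neg_one h1, norm_mul, norm_gammaPhase (by linarith) (by linarith), mul_one,
    show Complex.I * (Real.pi / 2 * α : ℂ) = ((Real.pi / 2 * α : ℝ) : ℂ) * Complex.I by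
      push_cast; ring, Complex.norm_exp_ofReal_mul_I]

theorem continuous_phiMinus_zero {α : ℝ} (h0 : 0 < α) : Continuous (phiMinus α 0) := by
  rw [funext (phiMinus_zero h0)]
  have := continuous_gammaPhase (σ := 1 / 2) (β := α / 2) (by norm_num) (by linarith)
  fun_prop

theorem continuous_phiMinus_neg_one {α : ℝ} (h0 : 0 < α) (h1 : α < 1) :
    Continuous (phiMinus α (-1)) := by
  rw [funext (phiMinus_neg_one h1)]
  have := continuous_gammaPhase (σ := 1 - α / 2) (β := α / 2) (by linarith) (by linarith)
  fun_prop

/-- The constant phase and the Gamma quotient contribute `-πα/2` each; at the other end they cancel.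
-/
theorem tendsto_phiMinus_zero_atTop {α : ℝ} (h0 : 0 < α) (h1 : α < 1) :
    Tendsto (phiMinus α 0) atTop (𝓝 (star (rotor α))) := by
  rw [funext (phiMinus_zero h0)]
  have h2 : Tendsto (fun x : ℝ => -(x / 2)) atTop atBot :=
    tendsto_neg_atTop_atBot.comp (tendsto_id.atTop_div_const two_pos)
  have h := ((tendsto_gammaPhase_atBot (σ := 1 / 2) (β := α / 2) (by norm_num) (by linarith)
    (by linarith)).comp h2).const_mul (Complex.exp (-(Complex.I * (Real.pi / 2 * α))))
  rw [← Complex.exp_add] at h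
  convert h using 2
  · rfl
  rw [star_rotor]
  congr 1
  push_cast
  ring

theorem tendsto_phiMinus_zero_atBot {α : ℝ} (h0 : 0 < α) (h1 : α < 1) :
    Tendsto (phiMinus α 0) atBot (𝓝 1) := by
  rw [funext (phiMinus_zero h0)]
  have h2 : Tendsto (fun x : ℝ => -(x / 2)) atBot atTop :=
    tendsto_neg_atBot_atTop.comp (tendsto_id.atBot_div_const two_pos)
  have h := ((tendsto_gammaPhase_atTop (σ := 1 / 2) (β := α / 2) (by norm_num) (by linarith)
    (by linarith)).comp h2).const_mul (Complex.exp (-(Complex.I * (Real.pi / 2 * α))))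
  rw [← Complex.exp_add] at h
  convert h using 2
  · rfl
  rw [← Complex.exp_zero]
  congr 1
  push_cast
  ring

theorem tendsto_phiMinus_neg_one_atTop {α : ℝ} (h0 : 0 < α) (h1 : α < 1) :
    Tendsto (phiMinus α (-1)) atTop (𝓝 (rotor α)) := by
  rw [funext (phiMinus_neg_one h1)]
  have h2 : Tendsto (fun x : ℝ => x / 2) atTop atTop := tendsto_id.atTop_div_const two_pos
  have h := ((tendsto_gammaPhase_atTop (σ := 1 - α / 2) (β := α / 2) (by linarith) (by linarith)
    (by linarith)).comp h2).const_mul (Complex.exp (Complex.I * (Real.pi / 2 * α)))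
  rw [← Complex.exp_add] at h
  convert h using 2
  · rfl
  rw [show rotor α = _ from rfl, rotor]
  congr 1
  push_cast
  ring

theorem tendsto_phiMinus_neg_one_atBot {α : ℝ} (h0 : 0 < α) (h1 : α < 1) :
    Tendsto (phiMinus α (-1)) atBot (𝓝 1) := by
  rw [funext (phiMinus_neg_one h1)]
  have h2 : Tendsto (fun x : ℝ => x / 2) atBot atBot := tendsto_id.atBot_div_const two_pos
  have h := ((tendsto_gammaPhase_atBot (σ := 1 - α / 2) (β := α / 2) (by linarith) (by linarith)
    (by linarith)).comp h2).const_mul (Complex.exp (Complex.I * (Real.pi / 2 * α)))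
  rw [← Complex.exp_add] at h
  convert h using 2
  · rfl
  rw [← Complex.exp_zero]
  congr 1
  push_cast
  ring

/-! ### The scattering matrix in pair coordinates -/

/-- `det (C + D diag(X, Y)) / u` at the energy `κ²`, where `X = e^{-iπα} x` and `Y = -e^{iπα} y`. -/
def secular (α c a b d x y : ℝ) : ℂ :=
  c + a * (x * star (rotor α)) - b * (y * rotor α) - d * (x * y)

/-- The numerator of the first entry of the scattering matrix. -/
def secularNum (α c a b d x y : ℝ) : ℂ :=
  c * star (rotor α) + a * x - b * y - d * (x * y) * rotor α

/-- The boundary value of `weylFactor` at the energy `κ²`. -/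
def weylScale (ν κ : ℝ) : ℝ := weylFactor ν (κ ^ 2 / 4)

theorem weylScale_eq (ν : ℝ) {κ : ℝ} (hκ : 0 < κ) :
    weylScale ν κ = 2 * ((κ / 2) ^ ν) ^ 2 * Real.Gamma (1 - ν) / Real.Gamma ν := by
  rw [weylScale, weylFactor, show κ ^ 2 / 4 = (κ / 2) ^ 2 by ring, ← Real.rpow_natCast,
    ← Real.rpow_natCast, ← Real.rpow_mul (by positivity), ← Real.rpow_mul (by positivity), mul_comm ν]

theorem rpow_half_mul {α κ : ℝ} (hκ : 0 < κ) : (κ / 2) ^ α * (κ / 2) ^ (1 - α) = κ / 2 := by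
  rw [← Real.rpow_add (by positivity), add_sub_cancel, Real.rpow_one]

theorem weylScale_mul {α κ : ℝ} (h0 : 0 < α) (h1 : α < 1) (hκ : 0 < κ) :
    weylScale α κ * weylScale (1 - α) κ = κ ^ 2 := by
  have g0 := (Real.Gamma_pos_of_pos h0).ne'
  have g1 := (Real.Gamma_pos_of_pos (sub_pos.2 h1)).ne'
  have h := rpow_half_mul (α := α) hκ
  rw [weylScale_eq α hκ, weylScale_eq (1 - α) hκ, sub_sub_cancel]
  generalize (κ / 2) ^ α = p at *
  generalize (κ / 2) ^ (1 - α) = q at *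
  field_simp
  linear_combination 4 * (p * q + κ / 2) * h

theorem pi_div_sin {α : ℝ} :
    Real.pi / (2 * Real.sin (Real.pi * α)) = Real.Gamma α * Real.Gamma (1 - α) / 2 := by
  rw [Real.Gamma_mul_Gamma_one_sub, div_div, mul_comm]

theorem channelZero_eq {α κ : ℝ} (hκ : 0 < κ) : channelZero α κ =
    ((Real.Gamma (1 - α) * (κ / 2) ^ α : ℝ) : ℂ) *
      Complex.exp (-Complex.I * (Real.pi : ℂ) * (α : ℂ) / 2) := by
  rw [channelZero, Real.div_rpow hκ.le zero_le_two]
  congr 2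
  ring

theorem channelNegOne_eq {α κ : ℝ} (hκ : 0 < κ) : channelNegOne α κ =
    ((Real.Gamma α * (κ / 2) ^ (1 - α) : ℝ) : ℂ) *
      Complex.exp (-Complex.I * (Real.pi : ℂ) * (1 - (α : ℂ)) / 2) := by
  rw [channelNegOne, Real.div_rpow hκ.le zero_le_two]
  congr 2
  ring

/-- Up to the constant `π/(2 sin πα)` this is the Weyl factor continued to the energy `κ²`. The
matrix inverted in `S̃` is therefore the one whose kernel yields bound states, at the other sign of
the energy. -/
theorem channelZero_sq {α κ : ℝ} (h0 : 0 < α) (hκ : 0 < κ) : channelZero α κ ^ 2 =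
    ((Real.pi / (2 * Real.sin (Real.pi * α)) : ℝ) : ℂ) * (weylScale α κ * star (rotor α)) := by
  have g0 := (Real.Gamma_pos_of_pos h0).ne'
  rw [channelZero_eq hκ, mul_pow, ← Complex.exp_nat_mul, pi_div_sin, weylScale_eq α hκ, star_rotor,
    ← mul_assoc, ← Complex.ofReal_mul, ← Complex.ofReal_pow]
  congr 2
  · field_simp
  · push_cast; ring

theorem channelNegOne_sq {α κ : ℝ} (h1 : α < 1) (hκ : 0 < κ) : channelNegOne α κ ^ 2 =
    ((Real.pi / (2 * Real.sin (Real.pi * α)) : ℝ) : ℂ) * -(weylScale (1 - α) κ * rotor α) := by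
  have g0 := (Real.Gamma_pos_of_pos (sub_pos.2 h1)).ne'
  have e : -rotor α = Complex.exp (2 * (-Complex.I * Real.pi * (1 - α) / 2)) := by
    rw [rotor, ← neg_one_mul, ← Complex.exp_neg_pi_mul_I, ← Complex.exp_add]
    congr 1
    ring
  rw [channelNegOne_eq hκ, mul_pow, ← Complex.exp_nat_mul, pi_div_sin, weylScale_eq (1 - α) hκ,
    ← mul_neg, e, ← mul_assoc, ← Complex.ofReal_mul, ← Complex.ofReal_pow, sub_sub_cancel]
  congr 2
  field_simp

theorem channelZero_mul {α κ : ℝ} (hκ : 0 < κ) : channelZero α κ * channelNegOne α κ =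
    ((Real.pi / (2 * Real.sin (Real.pi * α)) : ℝ) : ℂ) * (-Complex.I * κ) := by
  rw [channelZero_eq hκ, channelNegOne_eq hκ, mul_mul_mul_comm, ← Complex.exp_add, pi_div_sin,
    ← Complex.ofReal_mul, mul_mul_mul_comm, rpow_half_mul hκ,
    show -Complex.I * Real.pi * α / 2 + -Complex.I * Real.pi * (1 - α) / 2 = -Real.pi / 2 * Complex.I
      by ring, Complex.exp_neg_pi_div_two_mul_I]
  push_cast
  ring

namespace PairCoordinates

variable {C D : Matrix (Fin 2) (Fin 2) ℂ} {u : ℂ} {c a b d : ℝ} {e : ℂ} {α κ : ℝ}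

theorem adjugate_add_mul (h : PairCoordinates C D u c a b d e) (X Y : ℂ) :
    (C + D * Matrix.diagonal ![X, Y]).adjugate * D =
      u • !![a + d * Y, e; -(-star e), b + d * X] := by
  have h1 := h.adjugate_mul
  have h2 : D.adjugate * D = D.det • 1 := Matrix.adjugate_mul D
  rw [h.det_snd] at h2
  have h3 : (C + D * Matrix.diagonal ![X, Y]).adjugate =
      C.adjugate + Matrix.diagonal ![Y, X] * D.adjugate := by
    ext i j
    fin_cases i <;> fin_cases j <;> simp [Matrix.adjugate_fin_two, Matrix.mul_apply,
      Matrix.diagonal_apply] <;> ring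
  rw [h3, add_mul, mul_assoc, h1, h2]
  ext i j
  fin_cases i <;> fin_cases j <;> simp <;> ring

/-- Cramer's rule: the determinant is `u` times the secular function, and `adj(M) D` is `u` times an
explicit matrix, so the phase `u` cancels. -/
theorem sTilde_eq (h : PairCoordinates C D u c a b d e) (h0 : 0 < α) (h1 : α < 1) (hκ : 0 < κ)
    (hF : secular α c a b d (weylScale α κ) (weylScale (1 - α) κ) ≠ 0) :
    sTilde α C D κ = ((rotor α - star (rotor α)) /
      secular α c a b d (weylScale α κ) (weylScale (1 - α) κ)) •
      !![a * (weylScale α κ * star (rotor α)) - d * (weylScale α κ * weylScale (1 - α) κ),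
          Complex.I * κ * e; -(Complex.I * κ * star e),
          b * (weylScale (1 - α) κ * rotor α) + d * (weylScale α κ * weylScale (1 - α) κ)] := by
  have e1 := channelZero_sq h0 hκ
  have e2 := channelNegOne_sq h1 hκ
  have e3 := channelZero_mul (α := α) hκ
  have hk : ((Real.pi / (2 * Real.sin (Real.pi * α)) : ℝ) : ℂ) ≠ 0 := by
    have := sin_pi_mul_pos h0 h1
    exact_mod_cast (by positivity : (0 : ℝ) < Real.pi / (2 * Real.sin (Real.pi * α))).ne'
  have hω := rotor_mul_star α
  have hu := h.ne_zero'
  rw [sTilde, ← rotor_sub_star]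
  generalize ((Real.pi / (2 * Real.sin (Real.pi * α)) : ℝ) : ℂ) = k at *
  generalize channelZero α κ = b1 at *
  generalize channelNegOne α κ = b2 at *
  generalize weylScale α κ = x at *
  generalize weylScale (1 - α) κ = y at *
  set M := C + D * Matrix.diagonal ![(x * star (rotor α) : ℂ), -(y * rotor α)] with hM
  have hdet : M.det = u * secular α c a b d x y := by
    rw [hM, h.det_add_mul_diagonal, secular]
    linear_combination (-(u * d * x * y)) * hω
  have hadj := h.adjugate_add_mul (x * star (rotor α)) (-(y * rotor α))
  rw [← hM] at hadj
  have hN : D * Matrix.diagonal ![b1 ^ 2, b2 ^ 2] + k • C = k • M := by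
    rw [hM, e1, e2]
    ext i j
    fin_cases i <;> fin_cases j <;> simp [Matrix.mul_apply, Matrix.diagonal_apply] <;> ring
  have hinv : (k • M)⁻¹ * D = (k * secular α c a b d x y)⁻¹ •
      !![a + d * -(y * rotor α), e; -(-star e), b + d * (x * star (rotor α))] := by
    rw [Matrix.inv_def, Matrix.adjugate_smul, Matrix.det_smul, hdet, smul_mul_assoc, smul_mul_assoc,
      hadj, Ring.inverse_eq_inv', smul_smul, smul_smul]
    congr 1
    simp only [Fintype.card_fin, Nat.add_one_sub_one, pow_one]
    field_simp
  rw [hN, mul_assoc (Matrix.diagonal _), hinv]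
  generalize secular α c a b d x y = F at *
  generalize rotor α - star (rotor α) = s at *
  simp only [Complex.star_def] at *
  ext i j
  fin_cases i <;> fin_cases j <;> simp <;> field_simp
  · linear_combination s * (a - d * (y * rotor α)) * e1 - s * k * d * x * y * hω
  · linear_combination (-s * e) * e3
  · linear_combination (s * (starRingEnd ℂ) e) * e3
  · linear_combination (-s * (b + d * (x * (starRingEnd ℂ) (rotor α)))) * e2 +
      s * k * d * x * y * hω

/-- Adding `diag(ω̄, ω)` turns the diagonal entries into complex conjugates of each other. What
multiplies the inverse of the secular function has the shape of a multiple of an element of `SU(2)`.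
-/
theorem scatteringMatrix_eq (h : PairCoordinates C D u c a b d e) (h0 : 0 < α) (h1 : α < 1)
    (hκ : 0 < κ) (hF : secular α c a b d (weylScale α κ) (weylScale (1 - α) κ) ≠ 0) :
    scatteringMatrix α C D κ =
      (secular α c a b d (weylScale α κ) (weylScale (1 - α) κ))⁻¹ •
      !![secularNum α c a b d (weylScale α κ) (weylScale (1 - α) κ),
        -(2 * Real.sin (Real.pi * α) * κ * e); 2 * Real.sin (Real.pi * α) * κ * star e,
        star (secularNum α c a b d (weylScale α κ) (weylScale (1 - α) κ))] := by
  have hω := rotor_mul_star α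
  have hs := rotor_sub_star α
  have hI := Complex.I_sq
  rw [scatteringMatrix, h.sTilde_eq h0 h1 hκ hF, ← star_rotor, ← rotor]
  generalize Real.sin (Real.pi * α) = S at *
  ext i j
  fin_cases i <;> fin_cases j <;> simp [-Complex.ofReal_sin] <;> field_simp
  · simp only [Complex.star_def] at *
    simp only [secular, secularNum, Complex.star_def]
    linear_combination (a * weylScale α κ - b * weylScale (1 - α) κ) * hω
  · simp only [Complex.star_def] at *
    linear_combination (Complex.I * κ * e) * hs + 2 * S * κ * e * hI
  · simp only [Complex.star_def] at *
    linear_combination (-(Complex.I * κ * (starRingEnd ℂ) e)) * hs -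
      2 * S * κ * (starRingEnd ℂ) e * hI
  · simp only [secular, secularNum, Complex.star_def] at *
    simp
    linear_combination (a * weylScale α κ - b * weylScale (1 - α) κ) * hω

/-- Follows from `xy = κ²`, `|e|² = ab - cd` and `4 sin² πα = -(ω - ω̄)²`. It contains both the
unitarity of `S` and the formula for its determinant. -/
theorem secular_mul_star (h : PairCoordinates C D u c a b d e) (h0 : 0 < α) (h1 : α < 1)
    (hκ : 0 < κ) :
    secularNum α c a b d (weylScale α κ) (weylScale (1 - α) κ) *
        star (secularNum α c a b d (weylScale α κ) (weylScale (1 - α) κ)) +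
      (2 * Real.sin (Real.pi * α) * κ * e) * (2 * Real.sin (Real.pi * α) * κ * star e) =
    secular α c a b d (weylScale α κ) (weylScale (1 - α) κ) *
      star (secular α c a b d (weylScale α κ) (weylScale (1 - α) κ)) := by
  have hω := rotor_mul_star α
  have hs := rotor_sub_star α
  have hI := Complex.I_sq
  have hxy : (weylScale α κ : ℂ) * weylScale (1 - α) κ = κ ^ 2 := by
    exact_mod_cast weylScale_mul h0 h1 hκ
  have he : e * star e = a * b - c * d := by
    have := Complex.mul_conj e
    rw [← h.mul_sub_mul] at this
    push_cast at this
    exact this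
  have hs2 : (2 * (Real.sin (Real.pi * α) : ℂ)) ^ 2 = -(rotor α - star (rotor α)) ^ 2 := by
    rw [hs]
    linear_combination (4 * (Real.sin (Real.pi * α) : ℂ) ^ 2) * hI
  have hw : (2 * Real.sin (Real.pi * α) * κ * e) * (2 * Real.sin (Real.pi * α) * κ * star e) =
      -(rotor α - star (rotor α)) ^ 2 * (weylScale α κ * weylScale (1 - α) κ) * (a * b - c * d) := by
    rw [hxy, ← he, ← hs2]
    ring
  rw [hw, secular, secularNum]
  simp only [star_add, star_sub, star_mul', star_star]
  simp only [Complex.star_def, Complex.conj_ofReal] at *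
  generalize (starRingEnd ℂ) (rotor α) = w at *
  generalize (weylScale α κ : ℂ) = x at *
  generalize (weylScale (1 - α) κ : ℂ) = y at *
  linear_combination (c ^ 2 + d ^ 2 * x ^ 2 * y ^ 2 + 2 * x * y * (a * b - c * d) - a ^ 2 * x ^ 2 -
    b ^ 2 * y ^ 2 : ℂ) * hω

theorem scatteringMatrix_mul (h : PairCoordinates C D u c a b d e) (h0 : 0 < α) (h1 : α < 1)
    (hκ : 0 < κ) (hF : secular α c a b d (weylScale α κ) (weylScale (1 - α) κ) ≠ 0) :
    scatteringMatrix α C D κ ∈ Matrix.unitaryGroup (Fin 2) ℂ ∧ (scatteringMatrix α C D κ).det =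
      star (secular α c a b d (weylScale α κ) (weylScale (1 - α) κ)) /
        secular α c a b d (weylScale α κ) (weylScale (1 - α) κ) := by
  have key := h.secular_mul_star h0 h1 hκ
  rw [h.scatteringMatrix_eq h0 h1 hκ hF, Matrix.mem_unitaryGroup_iff]
  have hs : star (2 * (Real.sin (Real.pi * α) : ℂ)) = 2 * Real.sin (Real.pi * α) := by
    simp [-Complex.ofReal_sin]
  have hk : star (κ : ℂ) = κ := Complex.conj_ofReal _
  generalize 2 * (Real.sin (Real.pi * α) : ℂ) = s at *
  generalize (κ : ℂ) = k at *
  generalize secularNum α c a b d (weylScale α κ) (weylScale (1 - α) κ) = n at *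
  generalize secular α c a b d (weylScale α κ) (weylScale (1 - α) κ) = F at *
  simp only [Complex.star_def] at *
  have hF' : (starRingEnd ℂ) F ≠ 0 := by simpa
  constructor
  · ext i j
    fin_cases i <;> fin_cases j <;>
      simp [Matrix.mul_apply, Fin.sum_univ_two, Matrix.star_apply, hs, hk] <;> field_simp
    · linear_combination key
    · ring
    · ring
    · linear_combination key
  · rw [Matrix.det_fin_two]
    simp
    field_simp
    linear_combination key

end PairCoordinates

/-! ### The vertical sides of the square -/

/-- Extension by continuity from `ℝ` to `[-∞, ∞]`. -/
theorem exists_continuous_extension_EReal {Y : Type*} [TopologicalSpace Y] {f : ℝ → Y} {A B : Y}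
    (hf : Continuous f) (hA : Tendsto f atBot (𝓝 A)) (hB : Tendsto f atTop (𝓝 B)) :
    ∃ g : EReal → Y, Continuous g ∧ g ⊥ = A ∧ g ⊤ = B ∧ ∀ x : ℝ, g x = f x := by
  set g : EReal → Y := fun x => EReal.rec A f B x with hg
  have h1 : g ⊥ = A := rfl
  have h2 : g ⊤ = B := rfl
  have h3 : ∀ x : ℝ, g x = f x := fun _ => rfl
  refine ⟨g, ?_, h1, h2, h3⟩
  rw [continuous_iff_continuousAt]
  intro x
  induction x with
  | bot =>
    rw [ContinuousAt, h1]
    intro U hU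
    obtain ⟨a, ha⟩ := eventually_atBot.1 (hA.eventually hU)
    refine (EReal.nhds_bot_basis.mem_iff).2 ⟨a, trivial, fun y hy => ?_⟩
    induction y with
    | bot => exact show g ⊥ ∈ U from h1 ▸ mem_of_mem_nhds hU
    | coe y => exact ha y (EReal.coe_lt_coe_iff.1 hy).le
    | top => exact absurd (mem_Iio.1 hy) not_top_lt
  | coe x =>
    rw [← EReal.isOpenEmbedding_coe.continuousAt_iff]
    exact hf.continuousAt
  | top =>
    rw [ContinuousAt, h2]
    intro U hU
    obtain ⟨a, ha⟩ := eventually_atTop.1 (hB.eventually hU)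
    refine (EReal.nhds_top_basis.mem_iff).2 ⟨a, trivial, fun y hy => ?_⟩
    induction y with
    | bot => exact absurd (mem_Ioi.1 hy) not_lt_bot
    | coe y => exact ha y (EReal.coe_lt_coe_iff.1 hy).le
    | top => exact show g ⊤ ∈ U from h2 ▸ mem_of_mem_nhds hU

theorem continuous_boost : Continuous boost := by
  unfold boost
  fun_prop

theorem tendsto_boost_atTop : Tendsto boost atTop (𝓝 0) :=
  Real.tendsto_exp_neg_atTop_nhds_zero.comp (tendsto_id.const_mul_atTop Real.pi_pos)

theorem tendsto_boost_atBot : Tendsto boost atBot atTop :=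
  Real.tendsto_exp_atTop.comp
    (tendsto_neg_atBot_atTop.comp (tendsto_id.const_mul_atBot Real.pi_pos))

theorem rotor_one_sub (α : ℝ) : rotor (1 - α) = -star (rotor α) := by
  rw [star_rotor, rotor, ← neg_one_mul, ← Complex.exp_pi_mul_I, ← Complex.exp_add]
  congr 1
  push_cast
  ring

/-- The restriction of the wave operator to one channel, relative to `φ_m^-`. -/
def channelPhase (ν x : ℝ) : ℂ := ((boost x : ℂ) + rotor ν) / ((boost x : ℂ) + star (rotor ν))

/-- A quotient of the form `z / z̄` has twice the argument of `z`. -/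
theorem channelPhase_eq_exp {ν : ℝ} (h0 : 0 < ν) (h1 : ν < 1) (x : ℝ) :
    channelPhase ν x = Complex.exp (Complex.I * ((2 * ((boost x : ℂ) + rotor ν).arg : ℝ) : ℂ)) := by
  have hs : star ((boost x : ℂ) + rotor ν) = boost x + star (rotor ν) := by simp
  have hne := add_star_rotor_ne_zero h0 h1 (boost x)
  rw [channelPhase]
  rw [← hs] at hne ⊢
  generalize (boost x : ℂ) + rotor ν = z at *
  rw [div_eq_iff hne]
  have h := Complex.norm_mul_exp_arg_mul_I z
  have h' := congrArg star h
  simp only [Complex.star_def, map_mul, Complex.conj_ofReal, ← Complex.exp_conj, Complex.conj_I]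
    at h' ⊢
  rw [← h', mul_left_comm, ← Complex.exp_add]
  conv_lhs => rw [← h]
  congr 2
  push_cast
  ring

theorem norm_channelPhase {ν : ℝ} (h0 : 0 < ν) (h1 : ν < 1) (x : ℝ) : ‖channelPhase ν x‖ = 1 := by
  rw [channelPhase_eq_exp h0 h1, mul_comm, Complex.norm_exp_ofReal_mul_I]

theorem channelPhase_sub_one {ν : ℝ} (h0 : 0 < ν) (h1 : ν < 1) (x : ℝ) :
    channelPhase ν x - 1 = (rotor ν - star (rotor ν)) / ((boost x : ℂ) + star (rotor ν)) := by
  rw [channelPhase, div_sub_one (add_star_rotor_ne_zero h0 h1 _)]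
  congr 1
  ring

theorem continuous_channelPhase {ν : ℝ} (h0 : 0 < ν) (h1 : ν < 1) : Continuous (channelPhase ν) := by
  have := continuous_boost
  unfold channelPhase
  exact Continuous.div (by fun_prop) (by fun_prop) fun x => add_star_rotor_ne_zero h0 h1 _

theorem tendsto_channelPhase_atTop (ν : ℝ) :
    Tendsto (channelPhase ν) atTop (𝓝 (rotor ν ^ 2)) := by
  have h : Tendsto (fun x => (boost x : ℂ)) atTop (𝓝 ((0 : ℝ) : ℂ)) :=
    (Complex.continuous_ofReal.tendsto 0).comp tendsto_boost_atTop
  have hne : star (rotor ν) ≠ 0 := by simp [← norm_ne_zero_iff, norm_rotor]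
  have h2 := (h.add_const (rotor ν)).div (h.add_const (star (rotor ν))) (by simpa using hne)
  have e : rotor ν ^ 2 = (((0 : ℝ) : ℂ) + rotor ν) / (((0 : ℝ) : ℂ) + star (rotor ν)) := by
    rw [Complex.ofReal_zero, zero_add, zero_add, eq_div_iff hne, sq, mul_assoc, rotor_mul_star,
      mul_one]
  rw [e]
  exact h2

theorem tendsto_channelPhase_atBot (ν : ℝ) : Tendsto (channelPhase ν) atBot (𝓝 1) := by
  have h : Tendsto (fun x => (((boost x)⁻¹ : ℝ) : ℂ)) atBot (𝓝 ((0 : ℝ) : ℂ)) :=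
    (Complex.continuous_ofReal.tendsto 0).comp (tendsto_inv_atTop_zero.comp tendsto_boost_atBot)
  have h2 := ((h.mul_const (rotor ν)).const_add 1).div ((h.mul_const (star (rotor ν))).const_add 1)
    (by simp)
  simp only [Complex.ofReal_zero, zero_mul, add_zero, div_one] at h2
  refine h2.congr fun x => ?_
  have hb : (boost x : ℂ) ≠ 0 := by exact_mod_cast (boost_pos x).ne'
  rw [channelPhase, Pi.div_apply, ← mul_div_mul_left _ _ hb]
  push_cast
  rw [mul_add, mul_add, mul_inv_cancel_left₀ hb, mul_inv_cancel_left₀ hb, mul_one]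

theorem add_rotor_mem_slitPlane {ν : ℝ} (h0 : 0 < ν) (h1 : ν < 1) (t : ℝ) :
    (t : ℂ) + rotor ν ∈ Complex.slitPlane := by
  right
  simp [rotor_im, (sin_pi_mul_pos h0 h1).ne']

theorem arg_rotor {ν : ℝ} (h0 : -1 < ν) (h1 : ν < 1) : (rotor ν).arg = Real.pi * ν := by
  rw [rotor_eq, Complex.ofReal_cos, Complex.ofReal_sin, Complex.arg_cos_add_sin_mul_I]
  constructor <;> nlinarith [Real.pi_pos]

/-- The continuous argument of `channelPhase` on `[-∞, ∞]`. -/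
theorem exists_channelPhase_lift {ν : ℝ} (h0 : 0 < ν) (h1 : ν < 1) :
    ∃ χ : EReal → ℝ, Continuous χ ∧ χ ⊥ = 0 ∧ χ ⊤ = 2 * (Real.pi * ν) ∧
      ∀ x : ℝ, channelPhase ν x = Complex.exp (Complex.I * (χ x : ℂ)) := by
  -- The number `e^{-πx} + e^{iπν}` stays in the upper half plane, so the principal argument is
  -- continuous; it runs from `0` to `πν`.
  have hc : Continuous fun x : ℝ => 2 * ((boost x : ℂ) + rotor ν).arg := by
    rw [continuous_iff_continuousAt]
    intro x
    have h := Complex.continuousAt_arg (add_rotor_mem_slitPlane h0 h1 (boost x))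
    have hb : ContinuousAt (fun x : ℝ => (boost x : ℂ) + rotor ν) x := by
      have := continuous_boost
      fun_prop
    exact continuousAt_const.mul (ContinuousAt.comp (g := Complex.arg) h hb)
  have htop : Tendsto (fun x : ℝ => 2 * ((boost x : ℂ) + rotor ν).arg) atTop
      (𝓝 (2 * (Real.pi * ν))) := by
    have h : Tendsto (fun x => (boost x : ℂ) + rotor ν) atTop (𝓝 (((0 : ℝ) : ℂ) + rotor ν)) :=
      ((Complex.continuous_ofReal.tendsto 0).comp tendsto_boost_atTop).add_const _
    have h2 := ((Complex.continuousAt_arg (add_rotor_mem_slitPlane h0 h1 0)).tendsto.comp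
      h).const_mul 2
    rw [Complex.ofReal_zero, zero_add, arg_rotor (by linarith) h1] at h2
    exact h2
  have hbot : Tendsto (fun x : ℝ => 2 * ((boost x : ℂ) + rotor ν).arg) atBot (𝓝 0) := by
    -- Dividing by `boost x > 0` does not change the argument and gives a finite limit.
    have h : Tendsto (fun x => 1 + (((boost x)⁻¹ : ℝ) : ℂ) * rotor ν) atBot
        (𝓝 (1 + ((0 : ℝ) : ℂ) * rotor ν)) :=
      (((Complex.continuous_ofReal.tendsto 0).comp
        (tendsto_inv_atTop_zero.comp tendsto_boost_atBot)).mul_const _).const_add 1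
    rw [Complex.ofReal_zero, zero_mul, add_zero] at h
    have h2 := ((Complex.continuousAt_arg Complex.one_mem_slitPlane).tendsto.comp h).const_mul 2
    rw [Complex.arg_one, mul_zero] at h2
    refine h2.congr fun x => ?_
    have hb : (boost x : ℂ) ≠ 0 := by exact_mod_cast (boost_pos x).ne'
    rw [Function.comp_apply, ← Complex.arg_real_mul _ (boost_pos x)]
    congr 2
    push_cast
    rw [mul_add, mul_one, mul_inv_cancel_left₀ hb]
  obtain ⟨χ, h2, h3, h4, h5⟩ := exists_continuous_extension_EReal hc hbot htop
  refine ⟨χ, h2, h3, h4, fun x => ?_⟩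
  rw [h5, channelPhase_eq_exp h0 h1]

/-- The scattering of the two channels, relative to `diag(φ_0^-, φ_{-1}^-)`, when both are coupled. -/
def phaseMatrix (α x : ℝ) : Matrix (Fin 2) (Fin 2) ℂ :=
  Matrix.diagonal ![channelPhase α x, channelPhase (1 - α) x]

theorem diagonal_mem_unitaryGroup {z w : ℂ} (hz : ‖z‖ = 1) (hw : ‖w‖ = 1) :
    Matrix.diagonal ![z, w] ∈ Matrix.unitaryGroup (Fin 2) ℂ := by
  have h : ∀ z : ℂ, ‖z‖ = 1 → z * (starRingEnd ℂ) z = 1 := fun z hz => by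
    rw [Complex.mul_conj, Complex.normSq_eq_norm_sq, hz]
    simp
  rw [Matrix.mem_unitaryGroup_iff]
  ext i j
  fin_cases i <;> fin_cases j <;>
    simp [Matrix.mul_apply, Matrix.star_apply, Matrix.diagonal_apply, h, hz, hw]

/-- The matrix acts as `V` on the range of `P` and as the identity on the orthogonal complement, and
`V` preserves both. -/
theorem one_add_mul_mem_unitaryGroup {V P : Matrix (Fin 2) (Fin 2) ℂ}
    (hV : V ∈ Matrix.unitaryGroup (Fin 2) ℂ) (hP : P.IsHermitian) (hPP : P * P = P)
    (hVP : V * P = P * V) : 1 + (V - 1) * P ∈ Matrix.unitaryGroup (Fin 2) ℂ := by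
  rw [Matrix.mem_unitaryGroup_iff] at hV ⊢
  have hs : star (1 + (V - 1) * P) = 1 + P * (star V - 1) := by
    rw [star_add, star_mul, star_sub, star_one, show star P = P from hP]
  rw [hs]
  have e : (V - 1) * P * (P * (star V - 1)) = P - P * star V - V * P + P := by
    rw [← mul_assoc, mul_assoc (V - 1), hPP, sub_mul, hVP, one_mul, sub_mul, mul_sub, mul_sub, mul_assoc,
      hV]
    rw [← hVP]
    noncomm_ring
  have e2 : (1 + (V - 1) * P) * (1 + P * (star V - 1)) =
      1 + (V - 1) * P + P * (star V - 1) + (V - 1) * P * (P * (star V - 1)) := by noncomm_ring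
  rw [e2, e]
  noncomm_ring

/-- The projection `P` describes an energy at which `S̃ = 2i sin(πα) diag(1, -1) P`; the continuous
argument of the determinant of the corresponding side of the square is that of `φ_0^- φ_{-1}^-` plus a
function with increment `δ`. -/
structure IsEndProjection (α : ℝ) (P : Matrix (Fin 2) (Fin 2) ℂ) (δ : ℝ) : Prop where
  isHermitian : P.IsHermitian
  mul_self : P * P = P
  comm : ∀ x, phaseMatrix α x * P = P * phaseMatrix α x
  lift : ∃ χ : EReal → ℝ, Continuous χ ∧ χ ⊥ = 0 ∧ χ ⊤ = δ ∧
    ∀ x : ℝ, (1 + (phaseMatrix α x - 1) * P).det = Complex.exp (Complex.I * (χ x : ℂ))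

namespace IsEndProjection

variable {α : ℝ}

theorem zero (α : ℝ) : IsEndProjection α 0 0 where
  isHermitian := Matrix.isHermitian_zero
  mul_self := mul_zero _
  comm x := by simp
  lift := ⟨0, continuous_const, rfl, rfl, fun x => by simp⟩

theorem one (h0 : 0 < α) (h1 : α < 1) : IsEndProjection α 1 (2 * Real.pi) where
  isHermitian := Matrix.isHermitian_one
  mul_self := mul_one _
  comm x := by simp
  lift := by
    obtain ⟨χ, a1, a2, a3, a4⟩ := exists_channelPhase_lift h0 h1
    obtain ⟨ψ, b1, b2, b3, b4⟩ := exists_channelPhase_lift (sub_pos.2 h1) (sub_lt_self 1 h0)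
    refine ⟨fun x => χ x + ψ x, a1.add b1, by simp [a2, b2], by simp only [a3, b3]; ring, fun x => ?_⟩
    rw [mul_one, add_sub_cancel, phaseMatrix, Matrix.det_diagonal, Fin.prod_univ_two]
    simp only [Matrix.cons_val_zero, Matrix.cons_val_one]
    rw [a4, b4, ← Complex.exp_add]
    push_cast
    ring_nf

theorem fst (h0 : 0 < α) (h1 : α < 1) :
    IsEndProjection α (Matrix.diagonal ![1, 0]) (2 * (Real.pi * α)) where
  isHermitian := by
    ext i j
    fin_cases i <;> fin_cases j <;> simp
  mul_self := by
    ext i j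
    fin_cases i <;> fin_cases j <;> simp
  comm x := by rw [phaseMatrix, Matrix.diagonal_mul_diagonal, Matrix.diagonal_mul_diagonal]; simp only [mul_comm]
  lift := by
    obtain ⟨χ, a1, a2, a3, a4⟩ := exists_channelPhase_lift h0 h1
    refine ⟨χ, a1, a2, a3, fun x => ?_⟩
    rw [← a4, Matrix.det_fin_two, phaseMatrix]
    simp

theorem snd (h0 : 0 < α) (h1 : α < 1) :
    IsEndProjection α (Matrix.diagonal ![0, 1]) (2 * (Real.pi * (1 - α))) where
  isHermitian := by
    ext i j
    fin_cases i <;> fin_cases j <;> simp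
  mul_self := by
    ext i j
    fin_cases i <;> fin_cases j <;> simp
  comm x := by rw [phaseMatrix, Matrix.diagonal_mul_diagonal, Matrix.diagonal_mul_diagonal]; simp only [mul_comm]
  lift := by
    obtain ⟨χ, a1, a2, a3, a4⟩ := exists_channelPhase_lift (sub_pos.2 h1) (sub_lt_self 1 h0)
    refine ⟨χ, a1, a2, a3, fun x => ?_⟩
    rw [← a4, Matrix.det_fin_two, phaseMatrix]
    simp

/-- At `α = 1/2` the two channel phases agree, so they commute with every projection. A projection
of rank one picks up a single phase, with increment `2π · 1/2`. -/
theorem half {a b : ℝ} {e : ℂ} (hab : 0 < a + b) (he : a * b = Complex.normSq e) :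
    IsEndProjection (1 / 2) (((a + b : ℝ) : ℂ)⁻¹ • !![(a : ℂ), -e; -star e, (b : ℂ)]) Real.pi := by
  have hab' : (a : ℂ) + b ≠ 0 := by exact_mod_cast hab.ne'
  have he' : e * (starRingEnd ℂ) e = a * b := by
    rw [Complex.mul_conj, ← he]
    push_cast
    rfl
  have hV : ∀ x, phaseMatrix (1 / 2) x = channelPhase (1 / 2) x • 1 := by
    intro x
    rw [phaseMatrix, show (1 : ℝ) - 1 / 2 = 1 / 2 by norm_num]
    ext i j
    fin_cases i <;> fin_cases j <;> simp
  refine ⟨?_, ?_, fun x => by rw [hV]; simp, ?_⟩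
  · ext i j
    fin_cases i <;> fin_cases j <;> simp
  · ext i j
    fin_cases i <;> fin_cases j <;> simp [Matrix.mul_apply, Fin.sum_univ_two] <;> field_simp
    · linear_combination he'
    · ring
    · ring
    · linear_combination he'
  · obtain ⟨χ, a1, a2, a3, a4⟩ := exists_channelPhase_lift (ν := 1 / 2) (by norm_num) (by norm_num)
    refine ⟨χ, a1, a2, by rw [a3]; ring, fun x => ?_⟩
    rw [← a4, hV]
    generalize channelPhase (1 / 2) x = w
    rw [show w • (1 : Matrix (Fin 2) (Fin 2) ℂ) - 1 = (w - 1) • 1 by rw [sub_smul, one_smul],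
      smul_mul_assoc, one_mul, Matrix.det_fin_two]
    simp
    field_simp
    linear_combination (-(w - 1) ^ 2) * he'

end IsEndProjection

/-- In each channel `(ω - ω̄) φ̃_m` is `φ_m^-` times the channel phase minus one, up to a sign that
`diag(1, -1)` absorbs. -/
theorem waveRestriction_eq {α : ℝ} (h0 : 0 < α) (h1 : α < 1) (P : Matrix (Fin 2) (Fin 2) ℂ) (x : ℝ) :
    waveRestriction α ((rotor α - star (rotor α)) • (Matrix.diagonal ![1, -1] * P)) x =
      Matrix.diagonal ![phiMinus α 0 x, phiMinus α (-1) x] * (1 + (phaseMatrix α x - 1) * P) := by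
  have e0 := channelPhase_sub_one h0 h1 x
  have e1 := channelPhase_sub_one (sub_pos.2 h1) (sub_lt_self 1 h0) x
  have hr : star (rotor (1 - α)) = -rotor α := by rw [rotor_one_sub, star_neg, star_star]
  rw [hr, rotor_one_sub] at e1
  have hw : phaseMatrix α x - 1 = Matrix.diagonal ![channelPhase α x - 1, channelPhase (1 - α) x - 1] := by
    rw [phaseMatrix]
    ext i j
    fin_cases i <;> fin_cases j <;> simp
  rw [waveRestriction, phiTilde_zero h0 h1, phiTilde_neg_one h0 h1, hw, e0, e1]
  simp only [Complex.star_def] at *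
  ext i j
  fin_cases i <;> fin_cases j <;> simp <;> ring

/-! ### The limits at zero and at infinite energy -/

section Secular

variable {α c a b d x y : ℝ}

theorem secular_re : (secular α c a b d x y).re =
    c - d * (x * y) + (a * x - b * y) * Real.cos (Real.pi * α) := by
  simp [secular, rotor_re]
  ring

theorem secular_im : (secular α c a b d x y).im =
    -((a * x + b * y) * Real.sin (Real.pi * α)) := by
  simp [secular, rotor_im]
  ring

/-- The imaginary part of the secular function is `-(ax + by) sin πα`, which is negative. -/
theorem I_mul_secular_mem_slitPlane (h0 : 0 < α) (h1 : α < 1) (ha : 0 ≤ a) (hb : 0 ≤ b)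
    (hab : 0 < a + b) (hx : 0 < x) (hy : 0 < y) :
    Complex.I * secular α c a b d x y ∈ Complex.slitPlane := by
  left
  have hs := sin_pi_mul_pos h0 h1
  have : 0 < a * x + b * y := by
    rcases ha.lt_or_eq with h | h
    · linarith [mul_pos h hx, mul_nonneg hb hy.le]
    · have : 0 < b := by linarith
      linarith [mul_nonneg ha hx.le, mul_pos this hy]
  simp [secular_im]
  positivity

/-- The imaginary part vanishes only where `by = -ax`. There `(ax)² = -ab·xy ≤ c(-d)xy`, and the
inequality of arithmetic and geometric means gives `c - dxy > 2|ax cos πα|`, so the real part is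
positive. -/
theorem secular_mem_slitPlane (h0 : 0 < α) (h1 : α < 1) (hab : a * b < 0) (hc : 0 < c) (hd : d < 0)
    (hE : 0 ≤ a * b - c * d) (hx : 0 < x) (hy : 0 < y) :
    secular α c a b d x y ∈ Complex.slitPlane := by
  have hs := sin_pi_mul_pos h0 h1
  by_cases h : a * x + b * y = 0
  · left
    rw [secular_re]
    have hxy := mul_pos hx hy
    have e1 : a * x - b * y = 2 * (a * x) := by linarith
    have e2 : (a * x) ^ 2 = -(a * b) * (x * y) := by
      have : b * y = -(a * x) := by linarith
      linear_combination (a * x) * this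
    have e3 : 0 < (a * x) ^ 2 := by rw [e2]; exact mul_pos (by linarith) hxy
    have e4 : (a * x) ^ 2 ≤ -(c * d) * (x * y) := by
      rw [e2]
      exact mul_le_mul_of_nonneg_right (by linarith) hxy.le
    have e5 : Real.cos (Real.pi * α) ^ 2 < 1 := by
      nlinarith [Real.sin_sq_add_cos_sq (Real.pi * α)]
    have e6 : 0 < -d * (x * y) := mul_pos (by linarith) hxy
    have e7 : (2 * (a * x) * Real.cos (Real.pi * α)) ^ 2 < (c + -d * (x * y)) ^ 2 := by
      have f1 : (2 * (a * x) * Real.cos (Real.pi * α)) ^ 2 =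
        4 * (a * x) ^ 2 * Real.cos (Real.pi * α) ^ 2 := by ring
      have f2 : 4 * (a * x) ^ 2 * Real.cos (Real.pi * α) ^ 2 < 4 * (a * x) ^ 2 * 1 :=
        mul_lt_mul_of_pos_left e5 (by linarith)
      nlinarith [sq_nonneg (c - -d * (x * y))]
    have e8 := (abs_lt_of_sq_lt_sq' e7 (by linarith)).1
    rw [e1]
    linarith
  · right
    rw [secular_im, neg_ne_zero]
    exact mul_ne_zero h hs.ne'

theorem secular_mem_slitPlane_of_null (hc : 0 ≤ c) (hd : d ≤ 0) (hcd : 0 < c - d) (hx : 0 < x)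
    (hy : 0 < y) : secular α c 0 0 d x y ∈ Complex.slitPlane := by
  left
  rw [secular_re]
  have hxy := mul_pos hx hy
  rcases hc.lt_or_eq with h | h
  · have := mul_nonneg (neg_nonneg.2 hd) hxy.le
    linarith
  · have := mul_pos (show 0 < -d by linarith) hxy
    linarith

end Secular

/-! #### The scales -/

theorem isScale_weylScale {ν : ℝ} (h0 : 0 < ν) (h1 : ν < 1) : IsScale (weylScale ν) := by
  have h := isScale_weylFactor h0 h1
  have hq : ∀ t : ℝ, 0 < t → 0 < t ^ 2 / 4 := fun t ht => by positivity
  have hc : Continuous fun t : ℝ => t ^ 2 / 4 := by fun_prop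
  refine ⟨fun t ht => h.pos _ (hq t ht), fun s t hs hst => h.strictMono _ _ (hq s hs) (by gcongr),
    h.continuousOn.comp hc.continuousOn fun t ht => hq t ht, h.tendsto_zero.comp ?_,
    h.tendsto_atTop.comp ?_⟩
  · refine tendsto_nhdsWithin_iff.2 ⟨?_, ?_⟩
    · have := (hc.tendsto 0).mono_left (nhdsWithin_le_nhds (s := Ioi 0))
      simpa using this
    · filter_upwards [self_mem_nhdsWithin] with t ht
      exact hq t ht
  · exact (tendsto_pow_atTop two_ne_zero).atTop_div_const (by norm_num)

theorem weylScale_half {κ : ℝ} (hκ : 0 < κ) : weylScale (1 / 2) κ = κ := by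
  have hG := (Real.Gamma_pos_of_pos (one_half_pos (α := ℝ))).ne'
  rw [weylScale_eq _ hκ, show (1 : ℝ) - 1 / 2 = 1 / 2 by norm_num, mul_div_cancel_right₀ _ hG,
    ← Real.sqrt_eq_rpow, Real.sq_sqrt (by positivity)]
  ring

/-- The exponent `1 - 2ν` decides which channel dominates at low and at high energy; at `ν = 1/2`
neither does. -/
theorem weylScale_div {ν κ : ℝ} (hκ : 0 < κ) : weylScale (1 - ν) κ / weylScale ν κ =
    (Real.Gamma ν / Real.Gamma (1 - ν)) ^ 2 * ((κ / 2) ^ (1 - 2 * ν)) ^ 2 := by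
  have e : (κ / 2) ^ (1 - 2 * ν) = (κ / 2) ^ (1 - ν) / (κ / 2) ^ ν := by
    rw [← Real.rpow_sub (by positivity)]
    ring_nf
  rw [weylScale_eq _ hκ, weylScale_eq _ hκ, sub_sub_cancel, e]
  have := (Real.rpow_pos_of_pos (half_pos hκ) ν).ne'
  field_simp

theorem tendsto_weylScale_div_zero {ν : ℝ} (h : ν < 1 / 2) :
    Tendsto (fun κ => weylScale (1 - ν) κ / weylScale ν κ) (𝓝[>] 0) (𝓝 0) := by
  have hc : Continuous fun κ : ℝ =>
      (Real.Gamma ν / Real.Gamma (1 - ν)) ^ 2 * ((κ / 2) ^ (1 - 2 * ν)) ^ 2 := by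
    have := Real.continuous_rpow_const (q := 1 - 2 * ν) (by linarith)
    fun_prop
  have h1 := (hc.tendsto 0).mono_left (nhdsWithin_le_nhds (s := Ioi 0))
  rw [zero_div, Real.zero_rpow (by linarith)] at h1
  simp only [ne_eq, OfNat.ofNat_ne_zero, not_false_eq_true, zero_pow, mul_zero] at h1
  refine h1.congr' ?_
  filter_upwards [self_mem_nhdsWithin] with κ hκ
  exact (weylScale_div hκ).symm

theorem tendsto_weylScale_div_atTop {ν : ℝ} (h : 1 / 2 < ν) :
    Tendsto (fun κ => weylScale (1 - ν) κ / weylScale ν κ) atTop (𝓝 0) := by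
  have h1 : Tendsto (fun κ : ℝ => (κ / 2) ^ (1 - 2 * ν)) atTop (𝓝 0) := by
    have := (tendsto_rpow_neg_atTop (y := 2 * ν - 1) (by linarith)).comp
      (tendsto_id.atTop_div_const (two_pos (α := ℝ)))
    rwa [neg_sub] at this
  have h2 := (h1.pow 2).const_mul ((Real.Gamma ν / Real.Gamma (1 - ν)) ^ 2)
  simp only [ne_eq, OfNat.ofNat_ne_zero, not_false_eq_true, zero_pow, mul_zero] at h2
  refine h2.congr' ?_
  filter_upwards [eventually_gt_atTop 0] with κ hκ
  exact (weylScale_div hκ).symm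

/-! #### The limits of `S̃` -/

/-- Along the filter `l` the matrix `S̃` tends to `2i sin(πα) diag(1, -1) P`; the number `g` is the
increment of the argument of the corresponding vertical side plus twice the limit of `f`. -/
def HasEnd (α : ℝ) (C D : Matrix (Fin 2) (Fin 2) ℂ) (f : ℝ → ℝ) (l : Filter ℝ) (g : ℝ) : Prop :=
  ∃ (P : Matrix (Fin 2) (Fin 2) ℂ) (δ A : ℝ), IsEndProjection α P δ ∧
    Tendsto (sTilde α C D) l (𝓝 ((rotor α - star (rotor α)) • (Matrix.diagonal ![1, -1] * P))) ∧
    Tendsto f l (𝓝 A) ∧ δ + 2 * A = g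

/-- The secular function at the energy `κ²`. -/
def secularAt (α c a b d κ : ℝ) : ℂ := secular α c a b d (weylScale α κ) (weylScale (1 - α) κ)

namespace PairCoordinates

variable {C D : Matrix (Fin 2) (Fin 2) ℂ} {u : ℂ} {c a b d : ℝ} {e : ℂ} {α : ℝ} {σ : ℂ}
  {P : Matrix (Fin 2) (Fin 2) ℂ} {δ : ℝ} {l : Filter ℝ} {N : ℝ → ℝ} {c' a' b' d' : ℝ}

/-- `N` has the size of the leading monomials of the secular function. Dividing by it changes
neither the argument nor the entries of `S̃`, which are quotients by the secular function, so the
limit `L ≠ 0` determines both. -/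
theorem hasEnd_of_tendsto (h : PairCoordinates C D u c a b d e) (h0 : 0 < α) (h1 : α < 1)
    (hF : ∀ κ, 0 < κ → secularAt α c a b d κ ≠ 0) (hP : IsEndProjection α P δ)
    (hl : ∀ᶠ κ in l, 0 < κ) (hN : ∀ᶠ κ in l, 0 < N κ)
    (tc : Tendsto (fun κ => c / N κ) l (𝓝 c'))
    (ta : Tendsto (fun κ => a * weylScale α κ / N κ) l (𝓝 a'))
    (tb : Tendsto (fun κ => b * weylScale (1 - α) κ / N κ) l (𝓝 b'))
    (td : Tendsto (fun κ => d * (weylScale α κ * weylScale (1 - α) κ) / N κ) l (𝓝 d'))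
    {L z : ℂ} (hL : c' + a' * star (rotor α) - b' * rotor α - d' = L)
    (hσ : σ * L ∈ Complex.slitPlane)
    (tz : Tendsto (fun κ : ℝ => (κ : ℂ) * e / N κ) l (𝓝 z))
    (h00 : a' * star (rotor α) - d' = L * P 0 0) (h11 : -(b' * rotor α + d') = L * P 1 1)
    (h01 : Complex.I * z = L * P 0 1) (h10 : Complex.I * star z = L * P 1 0) :
    HasEnd α C D (fun κ => (σ * secularAt α c a b d κ).arg) l (δ + 2 * (σ * L).arg) := by
  have hL0 : L ≠ 0 := by
    rintro rfl
    simp at hσ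
  have ofR : ∀ {f : ℝ → ℝ} {r : ℝ}, Tendsto f l (𝓝 r) →
      Tendsto (fun κ => (f κ : ℂ)) l (𝓝 (r : ℂ)) := fun hf =>
    (Complex.continuous_ofReal.tendsto _).comp hf
  have tF : Tendsto (fun κ => secularAt α c a b d κ / N κ) l (𝓝 L) := by
    rw [← hL]
    refine ((((ofR tc).add ((ofR ta).mul_const (star (rotor α)))).sub
      ((ofR tb).mul_const (rotor α))).sub (ofR td)).congr fun κ => ?_
    rw [secularAt, secular]
    push_cast
    ring
  refine ⟨P, δ, (σ * L).arg, hP, ?_, ?_, rfl⟩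
  · have t00 : Tendsto (fun κ => (a * (weylScale α κ * star (rotor α)) -
        d * (weylScale α κ * weylScale (1 - α) κ)) / secularAt α c a b d κ) l (𝓝 (P 0 0)) := by
      have := (((ofR ta).mul_const (star (rotor α))).sub (ofR td)).div tF hL0
      rw [h00, mul_div_cancel_left₀ _ hL0] at this
      refine this.congr' ?_
      filter_upwards [hN, hl] with κ hκ hκ'
      have hNκ : (N κ : ℂ) ≠ 0 := by exact_mod_cast hκ.ne'
      have hFκ := hF κ hκ'
      simp only [Pi.div_apply]
      push_cast
      field_simp
    have t11 : Tendsto (fun κ => -((b * (weylScale (1 - α) κ * rotor α) +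
        d * (weylScale α κ * weylScale (1 - α) κ)) / secularAt α c a b d κ)) l (𝓝 (P 1 1)) := by
      have := (((ofR tb).mul_const (rotor α)).add (ofR td)).neg.div tF hL0
      rw [h11, mul_div_cancel_left₀ _ hL0] at this
      refine this.congr' ?_
      filter_upwards [hN, hl] with κ hκ hκ'
      have hNκ : (N κ : ℂ) ≠ 0 := by exact_mod_cast hκ.ne'
      have hFκ := hF κ hκ'
      simp only [Pi.div_apply]
      push_cast
      field_simp
    have t01 : Tendsto (fun κ : ℝ => Complex.I * κ * e / secularAt α c a b d κ) l (𝓝 (P 0 1)) := by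
      have := (tz.const_mul Complex.I).div tF hL0
      rw [h01, mul_div_cancel_left₀ _ hL0] at this
      refine this.congr' ?_
      filter_upwards [hN, hl] with κ hκ hκ'
      have hNκ : (N κ : ℂ) ≠ 0 := by exact_mod_cast hκ.ne'
      have hFκ := hF κ hκ'
      simp only [Pi.div_apply]
      field_simp
    have t10 : Tendsto (fun κ : ℝ => Complex.I * κ * star e / secularAt α c a b d κ) l
        (𝓝 (P 1 0)) := by
      have := (((continuous_star.tendsto z).comp tz).const_mul Complex.I).div tF hL0
      rw [h10, mul_div_cancel_left₀ _ hL0] at this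
      refine this.congr' ?_
      filter_upwards [hN, hl] with κ hκ hκ'
      have hNκ : (N κ : ℂ) ≠ 0 := by exact_mod_cast hκ.ne'
      have hFκ := hF κ hκ'
      simp only [Pi.div_apply, Function.comp_apply, star_div₀, star_mul']
      simp only [Complex.star_def, Complex.conj_ofReal]
      field_simp
    have key : ∀ᶠ κ in l, (rotor α - star (rotor α)) •
        !![(a * (weylScale α κ * star (rotor α)) -
          d * (weylScale α κ * weylScale (1 - α) κ)) / secularAt α c a b d κ,
          Complex.I * κ * e / secularAt α c a b d κ;
          -(Complex.I * κ * star e / secularAt α c a b d κ),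
          -(-((b * (weylScale (1 - α) κ * rotor α) +
          d * (weylScale α κ * weylScale (1 - α) κ)) / secularAt α c a b d κ))] =
        sTilde α C D κ := by
      filter_upwards [hl] with κ hκ
      rw [h.sTilde_eq h0 h1 hκ (hF κ hκ), ← secularAt]
      ext i j
      fin_cases i <;> fin_cases j <;> simp <;> ring
    refine Tendsto.congr' key (Tendsto.const_smul ?_ _)
    refine tendsto_pi_nhds.2 fun i => tendsto_pi_nhds.2 fun j => ?_
    fin_cases i <;> fin_cases j
    · simpa using t00
    · simpa using t01
    · simpa using t10.neg
    · simpa using t11.neg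
  · refine ((Complex.continuousAt_arg hσ).tendsto.comp (tF.const_mul σ)).congr' ?_
    filter_upwards [hN] with κ hκ
    have : (N κ : ℂ) ≠ 0 := by exact_mod_cast hκ.ne'
    rw [Function.comp_apply, ← Complex.arg_real_mul (σ * (_ / _)) hκ]
    congr 1
    field_simp

/-- The off-diagonal terms need no separate hypothesis: `|κe|² = xy(ab - cd)`, whose normalized
limit is `a'b' - c'd' = 0`. -/
theorem hasEnd_of_tendsto_diagonal (h : PairCoordinates C D u c a b d e) (h0 : 0 < α) (h1 : α < 1)
    (hF : ∀ κ, 0 < κ → secularAt α c a b d κ ≠ 0) {p q : ℂ}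
    (hP : IsEndProjection α (Matrix.diagonal ![p, q]) δ)
    (hl : ∀ᶠ κ in l, 0 < κ) (hN : ∀ᶠ κ in l, 0 < N κ)
    (tc : Tendsto (fun κ => c / N κ) l (𝓝 c'))
    (ta : Tendsto (fun κ => a * weylScale α κ / N κ) l (𝓝 a'))
    (tb : Tendsto (fun κ => b * weylScale (1 - α) κ / N κ) l (𝓝 b'))
    (td : Tendsto (fun κ => d * (weylScale α κ * weylScale (1 - α) κ) / N κ) l (𝓝 d'))
    {L : ℂ} (hL : c' + a' * star (rotor α) - b' * rotor α - d' = L)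
    (hσ : σ * L ∈ Complex.slitPlane) (hz : a' * b' - c' * d' = 0)
    (h00 : a' * star (rotor α) - d' = L * p) (h11 : -(b' * rotor α + d') = L * q) :
    HasEnd α C D (fun κ => (σ * secularAt α c a b d κ).arg) l (δ + 2 * (σ * L).arg) := by
  refine h.hasEnd_of_tendsto h0 h1 hF hP hl hN tc ta tb td hL hσ (z := 0) ?_ (by simpa using h00)
    (by simpa using h11) (by simp) (by simp)
  have key := (ta.mul tb).sub (tc.mul td)
  rw [hz] at key
  have key2 : Tendsto (fun κ : ℝ => ‖(κ : ℂ) * e / N κ‖ ^ 2) l (𝓝 0) := by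
    refine key.congr' ?_
    filter_upwards [hl, hN] with κ hκ hκN
    rw [norm_div, norm_mul, Complex.norm_real, Complex.norm_real, div_pow, mul_pow, ← Complex.normSq_eq_norm_sq e,
      ← h.mul_sub_mul, Real.norm_eq_abs, Real.norm_eq_abs, sq_abs, sq_abs, ← weylScale_mul h0 h1 hκ]
    field_simp
  have key3 := (Real.continuous_sqrt.tendsto 0).comp key2
  rw [Real.sqrt_zero] at key3
  exact tendsto_zero_iff_norm_tendsto_zero.2 (key3.congr fun κ => Real.sqrt_sq (norm_nonneg _))

end PairCoordinates

theorem I_mul_star_rotor (α : ℝ) : Complex.I * star (rotor α) = rotor (1 / 2 - α) := by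
  rw [star_rotor, rotor, I_mul_exp]
  congr 1
  push_cast
  ring

theorem neg_I_mul_rotor (α : ℝ) : -(Complex.I * rotor α) = rotor (α - 1 / 2) := by
  have h := congrArg star (I_mul_star_rotor α)
  rw [star_mul', star_star] at h
  have h2 : star (rotor (1 / 2 - α)) = rotor (α - 1 / 2) := by
    rw [star_rotor, rotor]
    congr 1
    push_cast
    ring
  rw [← h2, ← h]
  simp

theorem rotor_half : rotor (1 / 2) = Complex.I := by
  refine Eq.trans (congrArg Complex.exp ?_) Complex.exp_pi_div_two_mul_I
  push_cast
  ring

theorem arg_I_mul_of_pos {r : ℝ} (hr : 0 < r) : (Complex.I * r).arg = Real.pi / 2 := by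
  rw [mul_comm, Complex.arg_real_mul _ hr, Complex.arg_I]

theorem arg_I_mul_of_neg {r : ℝ} (hr : r < 0) : (Complex.I * r).arg = -(Real.pi / 2) := by
  rw [show Complex.I * (r : ℂ) = ((-r : ℝ) : ℂ) * -Complex.I by push_cast; ring,
    Complex.arg_real_mul _ (neg_pos.2 hr), Complex.arg_neg_I]

theorem I_mul_mem_slitPlane {r : ℝ} (hr : r ≠ 0) : Complex.I * r ∈ Complex.slitPlane := by
  right
  simpa

/-! ### Coupling patterns at the two ends of the energy axis. -/

namespace PairCoordinates

variable {C D : Matrix (Fin 2) (Fin 2) ℂ} {u : ℂ} {c a b d : ℝ} {e : ℂ} {α : ℝ} {σ : ℂ}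
  {l : Filter ℝ}

/-- No channel is coupled at the end `l`. -/
theorem hasEnd_none (h : PairCoordinates C D u c a b d e) (h0 : 0 < α) (h1 : α < 1)
    (hF : ∀ κ, 0 < κ → secularAt α c a b d κ ≠ 0) (hl : ∀ᶠ κ in l, 0 < κ)
    (ta : Tendsto (fun κ => a * weylScale α κ) l (𝓝 0))
    (tb : Tendsto (fun κ => b * weylScale (1 - α) κ) l (𝓝 0))
    (td : Tendsto (fun κ => d * (weylScale α κ * weylScale (1 - α) κ)) l (𝓝 0))
    (hσ : σ * c ∈ Complex.slitPlane) :
    HasEnd α C D (fun κ => (σ * secularAt α c a b d κ).arg) l (0 + 2 * (σ * c).arg) := by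
  have hP : IsEndProjection α (Matrix.diagonal ![(0 : ℂ), 0]) 0 := by
    have e : Matrix.diagonal ![(0 : ℂ), 0] = 0 := by
      ext i j
      fin_cases i <;> fin_cases j <;> simp
    rw [e]
    exact IsEndProjection.zero α
  refine h.hasEnd_of_tendsto_diagonal h0 h1 hF hP hl (N := fun _ => 1) (by simp)
    (c' := c) (a' := 0) (b' := 0) (d' := 0) (by simpa using tendsto_const_nhds) (by simpa using ta) (by simpa using tb)
    (by simpa using td) (L := c) (by simp) hσ (by simp) (by simp) (by simp)

/-- Both channels are coupled at the end `l`. -/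
theorem hasEnd_both (h : PairCoordinates C D u c a b d e) (h0 : 0 < α) (h1 : α < 1)
    (hF : ∀ κ, 0 < κ → secularAt α c a b d κ ≠ 0) (hl : ∀ᶠ κ in l, 0 < κ)
    (tc : Tendsto (fun κ => c / (weylScale α κ * weylScale (1 - α) κ)) l (𝓝 0))
    (ta : Tendsto (fun κ => a / weylScale (1 - α) κ) l (𝓝 0))
    (tb : Tendsto (fun κ => b / weylScale α κ) l (𝓝 0))
    (hσ : σ * (-d : ℝ) ∈ Complex.slitPlane) :
    HasEnd α C D (fun κ => (σ * secularAt α c a b d κ).arg) l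
      (2 * Real.pi + 2 * (σ * (-d : ℝ)).arg) := by
  have hP : IsEndProjection α (Matrix.diagonal ![(1 : ℂ), 1]) (2 * Real.pi) := by
    have e : Matrix.diagonal ![(1 : ℂ), 1] = 1 := by
      ext i j
      fin_cases i <;> fin_cases j <;> simp
    rw [e]
    exact IsEndProjection.one h0 h1
  have hx := isScale_weylScale h0 h1
  have hy := isScale_weylScale (sub_pos.2 h1) (sub_lt_self 1 h0)
  refine h.hasEnd_of_tendsto_diagonal h0 h1 hF hP hl
    (N := fun κ => weylScale α κ * weylScale (1 - α) κ) ?_ (c' := 0) (a' := 0) (b' := 0) (d' := d)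
    tc (ta.congr' ?_) (tb.congr' ?_) (tendsto_const_nhds.congr' ?_) (L := (-d : ℝ)) (by simp) hσ
    (by simp) (by simp) (by simp)
  all_goals filter_upwards [hl] with κ hκ
  all_goals have h2 := hx.pos κ hκ
  all_goals have h3 := hy.pos κ hκ
  · positivity
  all_goals field_simp

/-- Only the channel `0` is coupled at the end `l`. -/
theorem hasEnd_fst (h : PairCoordinates C D u c a b d e) (h0 : 0 < α) (h1 : α < 1)
    (hF : ∀ κ, 0 < κ → secularAt α c a b d κ ≠ 0) (hl : ∀ᶠ κ in l, 0 < κ) (ha : 0 < a)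
    (tc : Tendsto (fun κ => c / weylScale α κ) l (𝓝 0))
    (tb : Tendsto (fun κ => b * (weylScale (1 - α) κ / weylScale α κ)) l (𝓝 0))
    (td : Tendsto (fun κ => d * weylScale (1 - α) κ) l (𝓝 0)) :
    HasEnd α C D (fun κ => (Complex.I * secularAt α c a b d κ).arg) l Real.pi := by
  have hx := isScale_weylScale h0 h1
  -- Twice this argument plus the increment `2πα` of the side is `π`, independently of `α`.
  have harg : (Complex.I * (a * star (rotor α))).arg = Real.pi * (1 / 2 - α) := by
    rw [mul_left_comm, Complex.arg_real_mul _ ha, I_mul_star_rotor, arg_rotor] <;> linarith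
  have key := h.hasEnd_of_tendsto_diagonal h0 h1 hF (IsEndProjection.fst h0 h1) hl
    (N := weylScale α) (σ := Complex.I) (hl.mono hx.pos) (c' := 0) (a' := a) (b' := 0) (d' := 0)
    tc (tendsto_const_nhds.congr' ?_) (tb.congr' ?_) (td.congr' ?_) (L := a * star (rotor α))
    (by simp) ?_ (by simp) (by simp) (by simp)
  · rw [harg] at key
    convert key using 1
    ring
  · filter_upwards [hl] with κ hκ
    have h2 := hx.pos κ hκ
    field_simp
  · filter_upwards [hl] with κ hκ
    ring
  · filter_upwards [hl] with κ hκ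
    have h2 := hx.pos κ hκ
    field_simp
  · left
    rw [mul_left_comm, I_mul_star_rotor, Complex.re_ofReal_mul, rotor_re]
    refine mul_pos ha (Real.cos_pos_of_mem_Ioo ⟨?_, ?_⟩) <;> nlinarith [Real.pi_pos]

/-- Only the channel `-1` is coupled at the end `l`. -/
theorem hasEnd_snd (h : PairCoordinates C D u c a b d e) (h0 : 0 < α) (h1 : α < 1)
    (hF : ∀ κ, 0 < κ → secularAt α c a b d κ ≠ 0) (hl : ∀ᶠ κ in l, 0 < κ) (hb : 0 < b)
    (tc : Tendsto (fun κ => c / weylScale (1 - α) κ) l (𝓝 0))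
    (ta : Tendsto (fun κ => a * (weylScale α κ / weylScale (1 - α) κ)) l (𝓝 0))
    (td : Tendsto (fun κ => d * weylScale α κ) l (𝓝 0)) :
    HasEnd α C D (fun κ => (Complex.I * secularAt α c a b d κ).arg) l Real.pi := by
  have hy := isScale_weylScale (sub_pos.2 h1) (sub_lt_self 1 h0)
  have hL : Complex.I * -(b * rotor α) = b * rotor (α - 1 / 2) := by
    rw [← neg_I_mul_rotor]
    ring
  -- Likewise `2π(1 - α) + 2π(α - 1/2) = π`.
  have harg : (Complex.I * -(b * rotor α)).arg = Real.pi * (α - 1 / 2) := by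
    rw [hL, Complex.arg_real_mul _ hb, arg_rotor] <;> linarith
  have key := h.hasEnd_of_tendsto_diagonal h0 h1 hF (IsEndProjection.snd h0 h1) hl
    (N := weylScale (1 - α)) (σ := Complex.I) (hl.mono hy.pos) (c' := 0) (a' := 0) (b' := b)
    (d' := 0) tc (ta.congr' ?_) (tendsto_const_nhds.congr' ?_) (td.congr' ?_) (L := -(b * rotor α))
    (by simp) ?_ (by simp) (by simp) (by simp)
  · rw [harg] at key
    convert key using 1
    ring
  · filter_upwards [hl] with κ hκ
    ring
  · filter_upwards [hl] with κ hκ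
    have h2 := hy.pos κ hκ
    field_simp
  · filter_upwards [hl] with κ hκ
    have h2 := hy.pos κ hκ
    field_simp
  · left
    rw [hL, Complex.re_ofReal_mul, rotor_re]
    refine mul_pos hb (Real.cos_pos_of_mem_Ioo ⟨?_, ?_⟩) <;> nlinarith [Real.pi_pos]

/-- The mixed case `α = 1/2`. -/
theorem hasEnd_half (h : PairCoordinates C D u c a b d e)
    (hF : ∀ κ, 0 < κ → secularAt (1 / 2) c a b d κ ≠ 0) (hl : ∀ᶠ κ in l, 0 < κ) (hab : 0 < a + b)
    (hcd : c * d = 0) (tc : Tendsto (fun κ => c / κ) l (𝓝 0))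
    (td : Tendsto (fun κ => d * κ) l (𝓝 0)) :
    HasEnd (1 / 2) C D (fun κ => (Complex.I * secularAt (1 / 2) c a b d κ).arg) l Real.pi := by
  have he : a * b = Complex.normSq e := by rw [← h.mul_sub_mul, hcd, sub_zero]
  have hab' : (a : ℂ) + b ≠ 0 := by exact_mod_cast hab.ne'
  -- The rotated limit is `a + b > 0`, with argument zero; the value `π` comes from the projection
  -- of rank one alone.
  have hL : Complex.I * (-(Complex.I * (a + b : ℝ))) = (a + b : ℝ) := by
    linear_combination (-((a + b : ℝ) : ℂ)) * Complex.I_sq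
  have hw : ∀ κ : ℝ, 0 < κ → weylScale (1 - 1 / 2) κ = κ ∧ weylScale (1 / 2) κ = κ := by
    intro κ hκ
    rw [show (1 : ℝ) - 1 / 2 = 1 / 2 by norm_num]
    exact ⟨weylScale_half hκ, weylScale_half hκ⟩
  have key := h.hasEnd_of_tendsto (by norm_num) (by norm_num) hF (IsEndProjection.half hab he) hl
    (N := fun κ => κ) (σ := Complex.I) hl (c' := 0) (a' := a) (b' := b) (d' := 0) tc
    (tendsto_const_nhds.congr' ?_) (tendsto_const_nhds.congr' ?_) (td.congr' ?_)
    (L := -(Complex.I * (a + b : ℝ))) (z := e)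
    (by rw [rotor_half]; simp; ring) (by rw [hL]; exact Or.inl hab)
    (tendsto_const_nhds.congr' ?_) ?_ ?_ ?_ ?_
  · rw [hL, Complex.arg_ofReal_of_nonneg hab.le] at key
    simpa using key
  · filter_upwards [hl] with κ hκ
    rw [(hw κ hκ).2]
    field_simp
  · filter_upwards [hl] with κ hκ
    rw [(hw κ hκ).1]
    field_simp
  · filter_upwards [hl] with κ hκ
    rw [(hw κ hκ).1, (hw κ hκ).2]
    field_simp
  · filter_upwards [hl] with κ hκ
    have : (κ : ℂ) ≠ 0 := by exact_mod_cast hκ.ne'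
    field_simp
  all_goals
    try rw [rotor_half]
    simp
    try field_simp

/-- If `c ≠ 0` the constant term dominates, no channel is coupled, and the value is twice the
argument of `ic`. If `c = 0` the leading term is `ax` or `by`, depending on `α` and on which
coefficient vanishes, or their combination at `α = 1/2`; each alternative gives `π`. -/
theorem hasEnd_zero_definite (h : PairCoordinates C D u c a b d e) (h0 : 0 < α) (h1 : α < 1)
    (hF : ∀ κ, 0 < κ → secularAt α c a b d κ ≠ 0) (ha : 0 ≤ a) (hb : 0 ≤ b) (hab : 0 < a + b) :
    HasEnd α C D (fun κ => (Complex.I * secularAt α c a b d κ).arg) (𝓝[>] 0)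
      (if c < 0 then -Real.pi else Real.pi) := by
  have hx := (isScale_weylScale h0 h1).tendsto_zero
  have hy := (isScale_weylScale (sub_pos.2 h1) (sub_lt_self 1 h0)).tendsto_zero
  have hl : ∀ᶠ κ in 𝓝[>] (0 : ℝ), 0 < κ := self_mem_nhdsWithin
  by_cases hc : c = 0
  · rw [if_neg (by simp [hc])]
    have tc : ∀ f : ℝ → ℝ, Tendsto (fun κ => c / f κ) (𝓝[>] 0) (𝓝 0) := fun f => by simp [hc]
    have fst : 0 < a → Tendsto (fun κ => b * (weylScale (1 - α) κ / weylScale α κ)) (𝓝[>] 0) (𝓝 0) →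
        HasEnd α C D (fun κ => (Complex.I * secularAt α c a b d κ).arg) (𝓝[>] 0) Real.pi :=
      fun ha tb => h.hasEnd_fst h0 h1 hF hl ha (tc _) tb (by simpa using hy.const_mul d)
    have snd : 0 < b → Tendsto (fun κ => a * (weylScale α κ / weylScale (1 - α) κ)) (𝓝[>] 0) (𝓝 0) →
        HasEnd α C D (fun κ => (Complex.I * secularAt α c a b d κ).arg) (𝓝[>] 0) Real.pi :=
      fun hb ta => h.hasEnd_snd h0 h1 hF hl hb (tc _) ta (by simpa using hx.const_mul d)
    rcases lt_trichotomy α (1 / 2) with hα | hα | hα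
    · rcases ha.lt_or_eq with ha | ha
      · exact fst ha (by simpa using (tendsto_weylScale_div_zero hα).const_mul b)
      · exact snd (by linarith) (by simp [← ha])
    · subst hα
      refine h.hasEnd_half hF hl hab (by simp [hc]) (tc _) ?_
      have : Tendsto (fun κ : ℝ => d * κ) (𝓝[>] 0) (𝓝 (d * 0)) :=
        (tendsto_id.mono_left nhdsWithin_le_nhds).const_mul d
      simpa using this
    · rcases hb.lt_or_eq with hb | hb
      · have := (tendsto_weylScale_div_zero (ν := 1 - α) (by linarith)).const_mul a
        rw [sub_sub_cancel, mul_zero] at this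
        exact snd hb this
      · exact fst (by linarith) (by simp [← hb])
  · have key := h.hasEnd_none h0 h1 hF hl (by simpa using hx.const_mul a)
      (by simpa using hy.const_mul b) (by simpa using (hx.mul hy).const_mul d) (I_mul_mem_slitPlane hc)
    rcases lt_or_gt_of_ne hc with hc | hc
    · rw [arg_I_mul_of_neg hc] at key
      rw [if_pos hc]
      convert key using 1
      ring
    · rw [arg_I_mul_of_pos hc] at key
      rw [if_neg hc.not_gt]
      convert key using 1
      ring

/-- If `d ≠ 0` the term in `xy` dominates, both channels are coupled, and the value is `2π` plus
twice the argument of `-id`. If `d = 0` the discussion is that of low energy with the dominant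
channels exchanged. -/
theorem hasEnd_atTop_definite (h : PairCoordinates C D u c a b d e) (h0 : 0 < α) (h1 : α < 1)
    (hF : ∀ κ, 0 < κ → secularAt α c a b d κ ≠ 0) (ha : 0 ≤ a) (hb : 0 ≤ b) (hab : 0 < a + b) :
    HasEnd α C D (fun κ => (Complex.I * secularAt α c a b d κ).arg) atTop
      (if d < 0 then 3 * Real.pi else Real.pi) := by
  have hx := (isScale_weylScale h0 h1).tendsto_atTop
  have hy := (isScale_weylScale (sub_pos.2 h1) (sub_lt_self 1 h0)).tendsto_atTop
  have hl : ∀ᶠ κ in (atTop : Filter ℝ), 0 < κ := eventually_gt_atTop 0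
  by_cases hd : d = 0
  · rw [if_neg (by simp [hd])]
    have td : ∀ f : ℝ → ℝ, Tendsto (fun κ => d * f κ) atTop (𝓝 0) := fun f => by simp [hd]
    have fst : 0 < a → Tendsto (fun κ => b * (weylScale (1 - α) κ / weylScale α κ)) atTop (𝓝 0) →
        HasEnd α C D (fun κ => (Complex.I * secularAt α c a b d κ).arg) atTop Real.pi :=
      fun ha tb => h.hasEnd_fst h0 h1 hF hl ha (tendsto_const_nhds.div_atTop hx) tb (td _)
    have snd : 0 < b → Tendsto (fun κ => a * (weylScale α κ / weylScale (1 - α) κ)) atTop (𝓝 0) →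
        HasEnd α C D (fun κ => (Complex.I * secularAt α c a b d κ).arg) atTop Real.pi :=
      fun hb ta => h.hasEnd_snd h0 h1 hF hl hb (tendsto_const_nhds.div_atTop hy) ta (td _)
    rcases lt_trichotomy α (1 / 2) with hα | hα | hα
    · rcases hb.lt_or_eq with hb | hb
      · have := (tendsto_weylScale_div_atTop (ν := 1 - α) (by linarith)).const_mul a
        rw [sub_sub_cancel, mul_zero] at this
        exact snd hb this
      · exact fst (by linarith) (by simp [← hb])
    · subst hα
      exact h.hasEnd_half hF hl hab (by simp [hd]) (tendsto_const_nhds.div_atTop tendsto_id) (td _)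
    · rcases ha.lt_or_eq with ha | ha
      · exact fst ha (by simpa using (tendsto_weylScale_div_atTop hα).const_mul b)
      · exact snd (by linarith) (by simp [← ha])
  · have key := h.hasEnd_both h0 h1 hF hl (tendsto_const_nhds.div_atTop (hx.atTop_mul_atTop₀ hy))
      (tendsto_const_nhds.div_atTop hy) (tendsto_const_nhds.div_atTop hx)
      (I_mul_mem_slitPlane (neg_ne_zero.2 hd))
    rcases lt_or_gt_of_ne hd with hd | hd
    · rw [arg_I_mul_of_pos (neg_pos.2 hd)] at key
      rw [if_pos hd]
      convert key using 1
      ring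
    · rw [arg_I_mul_of_neg (neg_lt_zero.2 hd)] at key
      rw [if_neg hd.not_gt]
      convert key using 1
      ring

theorem hasEnd_zero_of_pos (h : PairCoordinates C D u c a b d e) (h0 : 0 < α) (h1 : α < 1)
    (hF : ∀ κ, 0 < κ → secularAt α c a b d κ ≠ 0) (hc : 0 < c) :
    HasEnd α C D (fun κ => (1 * secularAt α c a b d κ).arg) (𝓝[>] 0) 0 := by
  have hx := (isScale_weylScale h0 h1).tendsto_zero
  have hy := (isScale_weylScale (sub_pos.2 h1) (sub_lt_self 1 h0)).tendsto_zero
  have key := h.hasEnd_none h0 h1 hF (l := 𝓝[>] 0) self_mem_nhdsWithin (by simpa using hx.const_mul a)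
    (by simpa using hy.const_mul b) (by simpa using (hx.mul hy).const_mul d) (σ := 1)
    (by rw [one_mul]; exact Or.inl hc)
  rwa [one_mul, Complex.arg_ofReal_of_nonneg hc.le, mul_zero, add_zero] at key

theorem hasEnd_atTop_of_neg (h : PairCoordinates C D u c a b d e) (h0 : 0 < α) (h1 : α < 1)
    (hF : ∀ κ, 0 < κ → secularAt α c a b d κ ≠ 0) (hd : d < 0) :
    HasEnd α C D (fun κ => (1 * secularAt α c a b d κ).arg) atTop (2 * Real.pi) := by
  have hx := (isScale_weylScale h0 h1).tendsto_atTop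
  have hy := (isScale_weylScale (sub_pos.2 h1) (sub_lt_self 1 h0)).tendsto_atTop
  have hd' : 0 < -d := neg_pos.2 hd
  have key := h.hasEnd_both h0 h1 hF (eventually_gt_atTop 0)
    (tendsto_const_nhds.div_atTop (hx.atTop_mul_atTop₀ hy))
    (tendsto_const_nhds.div_atTop hy) (tendsto_const_nhds.div_atTop hx) (σ := 1)
    (by rw [one_mul]; exact Or.inl hd')
  rwa [one_mul, Complex.arg_ofReal_of_nonneg hd'.le, mul_zero, add_zero] at key

/-- The behaviour of the scattering matrix at the two ends of the energy axis. -/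
theorem exists_hasEnd (h : PairCoordinates C D u c a b d e) (hn : IsNormalized c a b d) (h0 : 0 < α)
    (h1 : α < 1) (hA : (C * Dᴴ).IsHermitian) :
    ∃ (σ : ℂ) (g₀ g₁ : ℝ), ‖σ‖ = 1 ∧
      (∀ κ, 0 < κ → σ * secularAt α c a b d κ ∈ Complex.slitPlane) ∧
      HasEnd α C D (fun κ => (σ * secularAt α c a b d κ).arg) (𝓝[>] 0) g₀ ∧
      HasEnd α C D (fun κ => (σ * secularAt α c a b d κ).arg) atTop g₁ ∧
      g₀ - g₁ = -(2 * Real.pi * negEigenvalueCount hA) := by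
  have hx := (isScale_weylScale h0 h1).pos
  have hy := (isScale_weylScale (sub_pos.2 h1) (sub_lt_self 1 h0)).pos
  have key := h.mul_sub_mul
  have hE := Complex.normSq_nonneg e
  have nz : ∀ σ : ℂ, (∀ κ, 0 < κ → σ * secularAt α c a b d κ ∈ Complex.slitPlane) →
      ∀ κ, 0 < κ → secularAt α c a b d κ ≠ 0 := by
    intro σ hσ κ hκ h0
    have := hσ κ hκ
    simp [h0] at this
  rcases hn with ⟨ha, hb, hab⟩ | ⟨hab, hc, hd⟩ | ⟨ha, hb, hc, hd, hcd⟩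
  · have hs : ∀ κ, 0 < κ → Complex.I * secularAt α c a b d κ ∈ Complex.slitPlane := fun κ hκ =>
      I_mul_secular_mem_slitPlane h0 h1 ha hb hab (hx κ hκ) (hy κ hκ)
    -- Each of the conditions `c < 0` and `d < 0` changes `g₀ - g₁` by `-2π`.
    refine ⟨Complex.I, _, _, Complex.norm_I, hs, h.hasEnd_zero_definite h0 h1 (nz _ hs) ha hb hab,
      h.hasEnd_atTop_definite h0 h1 (nz _ hs) ha hb hab, ?_⟩
    rw [h.negEigenvalueCount_of_pos hab]
    split_ifs <;> push_cast <;> ring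
  · have hs : ∀ κ, 0 < κ → 1 * secularAt α c a b d κ ∈ Complex.slitPlane := fun κ hκ => by
      rw [one_mul]
      exact secular_mem_slitPlane h0 h1 hab hc hd (by linarith) (hx κ hκ) (hy κ hκ)
    refine ⟨1, _, _, norm_one, hs, h.hasEnd_zero_of_pos h0 h1 (nz _ hs) hc,
      h.hasEnd_atTop_of_neg h0 h1 (nz _ hs) hd, ?_⟩
    rw [h.negEigenvalueCount_of_neg (mul_neg_of_pos_of_neg hc hd)]
    push_cast
    ring
  · subst ha hb
    have hs : ∀ κ, 0 < κ → 1 * secularAt α c 0 0 d κ ∈ Complex.slitPlane := fun κ hκ => by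
      rw [one_mul]
      exact secular_mem_slitPlane_of_null hc hd hcd (hx κ hκ) (hy κ hκ)
    rcases hc.lt_or_eq with hc | hc
    · rcases hd.lt_or_eq with hd | hd
      · refine ⟨1, _, _, norm_one, hs, h.hasEnd_zero_of_pos h0 h1 (nz _ hs) hc,
          h.hasEnd_atTop_of_neg h0 h1 (nz _ hs) hd, ?_⟩
        rw [h.negEigenvalueCount_of_neg (mul_neg_of_pos_of_neg hc hd)]
        push_cast
        ring
      · subst hd
        refine ⟨1, _, _, norm_one, hs, h.hasEnd_zero_of_pos h0 h1 (nz _ hs) hc,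
          h.hasEnd_none h0 h1 (nz _ hs) (eventually_gt_atTop 0) (by simp) (by simp) (by simp)
            (by rw [one_mul]; exact Or.inl hc), ?_⟩
        rw [h.negEigenvalueCount_of_zero rfl rfl (by simp), one_mul,
          Complex.arg_ofReal_of_nonneg hc.le]
        simp
    -- Only `d` is left: both channels are coupled at both ends, and the two sides cancel.
    · subst hc
      have hd' : 0 < -d := by linarith
      have hsl : 1 * ((-d : ℝ) : ℂ) ∈ Complex.slitPlane := by rw [one_mul]; exact Or.inl hd'
      refine ⟨1, _, _, norm_one, hs,
        h.hasEnd_both h0 h1 (nz _ hs) self_mem_nhdsWithin (by simp) (by simp) (by simp) hsl,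
        h.hasEnd_both h0 h1 (nz _ hs) (eventually_gt_atTop 0) (by simp) (by simp) (by simp) hsl, ?_⟩
      rw [h.negEigenvalueCount_of_zero rfl rfl (by simp)]
      simp

end PairCoordinates

/-! ### The loop -/

theorem denseRange_coe_EReal : DenseRange ((↑) : ℝ → EReal) :=
  dense_of_exists_between fun a b hab => by
    obtain ⟨x, hx⟩ := EReal.lt_iff_exists_real_btwn.1 hab
    exact ⟨x, mem_range_self x, hx⟩

theorem eq_of_eq_on_real {Y : Type*} [TopologicalSpace Y] [T2Space Y] {f g : EReal → Y}
    (hf : Continuous f) (hg : Continuous g) (h : ∀ x : ℝ, f x = g x) (x : EReal) : f x = g x :=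
  congrFun (denseRange_coe_EReal.equalizer hf hg (funext h)) x

/-- A continuous function from `[-∞, ∞]` to the circle has a continuous argument. -/
theorem exists_lift_EReal {f : EReal → Circle} (hf : Continuous f) :
    ∃ θ : EReal → ℝ, Continuous θ ∧ ∀ x, (f x : ℂ) = Complex.exp (Complex.I * θ x) := by
  -- `[-∞, ∞]` is homeomorphic to the unit interval, where paths lift through the covering of the
  -- circle by the line.
  let φ : EReal ≃ₜ unitInterval :=
    ENNReal.logHomeomorph.symm.trans ENNReal.orderIsoUnitIntervalBirational.toHomeomorph
  let γ : C(unitInterval, Circle) := ⟨f ∘ φ.symm, hf.comp φ.symm.continuous⟩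
  obtain ⟨t, ht⟩ := Circle.exp_surjective (γ 0)
  have h := Circle.isCoveringMap_exp.liftPath_lifts γ t ht.symm
  refine ⟨fun x => Circle.isCoveringMap_exp.liftPath γ t ht.symm (φ x),
    (ContinuousMap.continuous _).comp φ.continuous, fun x => ?_⟩
  have h2 := congrFun h (φ x)
  have h3 : γ (φ x) = f x := by
    show f (φ.symm (φ x)) = f x
    rw [φ.symm_apply_apply]
  rw [h3, Function.comp_apply] at h2
  rw [← h2, Circle.coe_exp, mul_comm]

/-- The increment of this argument is never computed: the factor is common to the two vertical
sides, which are traversed in opposite directions. Only the existence of the limits at `±∞` matters.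
-/
theorem exists_phiMinus_lift {α : ℝ} (h0 : 0 < α) (h1 : α < 1) :
    ∃ θ : EReal → ℝ, Continuous θ ∧
      ∀ x : ℝ, phiMinus α 0 x * phiMinus α (-1) x = Complex.exp (Complex.I * θ x) := by
  have hn : ∀ x, phiMinus α 0 x * phiMinus α (-1) x ∈ Submonoid.unitSphere ℂ := fun x => by
    rw [← SetLike.mem_coe, Submonoid.coe_unitSphere, mem_sphere_zero_iff_norm, norm_mul, norm_phiMinus_zero h0, norm_phiMinus_neg_one h0 h1, one_mul]
  obtain ⟨g, hg, -, -, hgf⟩ := exists_continuous_extension_EReal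
    (f := fun x => (⟨phiMinus α 0 x * phiMinus α (-1) x, hn x⟩ : Circle))
    (A := ⟨1 * 1, by simp⟩) (B := ⟨star (rotor α) * rotor α, by
      rw [mul_comm, rotor_mul_star]
      exact one_mem _⟩)
    (Continuous.subtype_mk ((continuous_phiMinus_zero h0).mul (continuous_phiMinus_neg_one h0 h1)) hn)
    (tendsto_subtype_rng.2
      ((tendsto_phiMinus_zero_atBot h0 h1).mul (tendsto_phiMinus_neg_one_atBot h0 h1)))
    (tendsto_subtype_rng.2
      ((tendsto_phiMinus_zero_atTop h0 h1).mul (tendsto_phiMinus_neg_one_atTop h0 h1)))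
  obtain ⟨θ, hθ, h⟩ := exists_lift_EReal hg
  refine ⟨θ, hθ, fun x => ?_⟩
  rw [← h, hgf]

theorem tendsto_diagonal {l : Filter ℝ} {f g : ℝ → ℂ} {z w : ℂ} (hf : Tendsto f l (𝓝 z))
    (hg : Tendsto g l (𝓝 w)) :
    Tendsto (fun x => Matrix.diagonal ![f x, g x]) l (𝓝 (Matrix.diagonal ![z, w])) := by
  refine tendsto_pi_nhds.2 fun i => tendsto_pi_nhds.2 fun j => ?_
  fin_cases i <;> fin_cases j
  · simpa using hf
  · simpa using tendsto_const_nhds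
  · simpa using tendsto_const_nhds
  · simpa using hg

theorem continuous_diagonal {f g : ℝ → ℂ} (hf : Continuous f) (hg : Continuous g) :
    Continuous fun x => Matrix.diagonal ![f x, g x] :=
  continuous_iff_continuousAt.2 fun _ => tendsto_diagonal hf.continuousAt hg.continuousAt

/-- A vertical side of the loop. -/
theorem IsEndProjection.exists_side {α δ : ℝ} {P : Matrix (Fin 2) (Fin 2) ℂ} (h0 : 0 < α) (h1 : α < 1)
    (hP : IsEndProjection α P δ) {Θ : EReal → ℝ} (hΘ : Continuous Θ)
    (hΘφ : ∀ x : ℝ, phiMinus α 0 x * phiMinus α (-1) x = Complex.exp (Complex.I * Θ x)) :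
    ∃ (G : EReal → Matrix (Fin 2) (Fin 2) ℂ) (θ : EReal → ℝ), Continuous G ∧ Continuous θ ∧
      (∀ x, G x ∈ Matrix.unitaryGroup (Fin 2) ℂ) ∧
      (∀ x : ℝ, G x = waveRestriction α
        ((rotor α - star (rotor α)) • (Matrix.diagonal ![1, -1] * P)) x) ∧
      G ⊥ = 1 ∧ G ⊤ = Matrix.diagonal ![star (rotor α), rotor α] +
        (rotor α - star (rotor α)) • (Matrix.diagonal ![1, -1] * P) ∧
      (∀ x, (G x).det = Complex.exp (Complex.I * θ x)) ∧ θ ⊤ - θ ⊥ = Θ ⊤ - Θ ⊥ + δ := by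
  have h2 : 0 < 1 - α := sub_pos.2 h1
  have h3 : 1 - α < 1 := sub_lt_self 1 h0
  set F : ℝ → Matrix (Fin 2) (Fin 2) ℂ := fun x =>
    Matrix.diagonal ![phiMinus α 0 x, phiMinus α (-1) x] * (1 + (phaseMatrix α x - 1) * P) with hF
  have hFc : Continuous F :=
    (continuous_diagonal (continuous_phiMinus_zero h0) (continuous_phiMinus_neg_one h0 h1)).mul
      (continuous_const.add (((continuous_diagonal (continuous_channelPhase h0 h1)
        (continuous_channelPhase h2 h3)).sub continuous_const).mul continuous_const))
  have hbot : Tendsto F atBot (𝓝 (Matrix.diagonal ![1, 1] *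
      (1 + (Matrix.diagonal ![1, 1] - 1) * P))) :=
    (tendsto_diagonal (tendsto_phiMinus_zero_atBot h0 h1) (tendsto_phiMinus_neg_one_atBot h0 h1)).mul
      ((((tendsto_diagonal (tendsto_channelPhase_atBot α)
        (tendsto_channelPhase_atBot (1 - α))).sub_const 1).mul_const P).const_add 1)
  have htop : Tendsto F atTop (𝓝 (Matrix.diagonal ![star (rotor α), rotor α] *
      (1 + (Matrix.diagonal ![rotor α ^ 2, rotor (1 - α) ^ 2] - 1) * P))) :=
    (tendsto_diagonal (tendsto_phiMinus_zero_atTop h0 h1) (tendsto_phiMinus_neg_one_atTop h0 h1)).mul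
      ((((tendsto_diagonal (tendsto_channelPhase_atTop α)
        (tendsto_channelPhase_atTop (1 - α))).sub_const 1).mul_const P).const_add 1)
  obtain ⟨G, hG, hGbot, hGtop, hGF⟩ := exists_continuous_extension_EReal hFc hbot htop
  obtain ⟨χ, hχ, hχbot, hχtop, hχdet⟩ := hP.lift
  have hone : Matrix.diagonal ![(1 : ℂ), 1] = 1 := by
    ext i j
    fin_cases i <;> fin_cases j <;> simp
  refine ⟨G, fun x => Θ x + χ x, hG, hΘ.add hχ, fun x => ?_, fun x => ?_, ?_, ?_, fun x => ?_, ?_⟩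
  -- Unitarity is a closed condition known on the dense subset `ℝ`, so it extends to the corners.
  · rw [Matrix.mem_unitaryGroup_iff]
    refine eq_of_eq_on_real (f := fun x => G x * star (G x)) (hG.mul hG.star)
      continuous_const (fun x => ?_) x
    rw [hGF, ← Matrix.mem_unitaryGroup_iff]
    exact mul_mem
      (diagonal_mem_unitaryGroup (norm_phiMinus_zero h0 x) (norm_phiMinus_neg_one h0 h1 x))
      (one_add_mul_mem_unitaryGroup
        (diagonal_mem_unitaryGroup (norm_channelPhase h0 h1 x) (norm_channelPhase h2 h3 x))
        hP.isHermitian hP.mul_self (hP.comm x))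
  · rw [hGF, waveRestriction_eq h0 h1]
  · rw [hGbot, hone]
    simp
  -- At `+∞` the channel phases are `ω²` and `ω̄²`; from `ω̄(ω² - 1) = ω - ω̄` and its conjugate,
  -- the corner value is the limit of the scattering matrix.
  · rw [hGtop, mul_add, mul_one, ← mul_assoc, ← smul_mul_assoc]
    congr 2
    have hω := rotor_mul_star α
    rw [rotor_one_sub]
    simp only [Complex.star_def] at *
    ext i j
    fin_cases i <;> fin_cases j <;> simp [Matrix.mul_apply, Matrix.one_apply]
    · linear_combination (rotor α) * hω
    · linear_combination ((starRingEnd ℂ) (rotor α)) * hω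
  · refine eq_of_eq_on_real (f := fun x => (G x).det)
      (g := fun x => Complex.exp (Complex.I * ((Θ x + χ x : ℝ) : ℂ))) hG.matrix_det
      (by fun_prop) (fun x => ?_) x
    rw [hGF, Matrix.det_mul, Matrix.det_diagonal, Fin.prod_univ_two, hχdet]
    simp only [Matrix.cons_val_zero, Matrix.cons_val_one]
    rw [hΘφ, ← Complex.exp_add]
    push_cast
    ring_nf
  · simp only [hχbot, hχtop]
    ring

/-- The energies `κ ∈ [0, ∞]` as a transform of `[-∞, ∞]`. -/
theorem exists_continuous_extension_ENNReal {Y : Type*} [TopologicalSpace Y] {f : ℝ → Y} {A B : Y}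
    (hf : ContinuousOn f (Ioi 0)) (hA : Tendsto f (𝓝[>] 0) (𝓝 A)) (hB : Tendsto f atTop (𝓝 B)) :
    ∃ g : ℝ≥0∞ → Y, Continuous g ∧ g 0 = A ∧ g ⊤ = B ∧
      ∀ κ : ℝ, 0 < κ → g (ENNReal.ofReal κ) = f κ := by
  have hc : Continuous fun s => f (Real.exp s) :=
    hf.comp_continuous Real.continuous_exp fun s => Real.exp_pos s
  obtain ⟨g, hg, hgA, hgB, hgf⟩ := exists_continuous_extension_EReal hc
    (hA.comp Real.tendsto_exp_atBot_nhdsGT) (hB.comp Real.tendsto_exp_atTop)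
  refine ⟨fun κ => g (ENNReal.log κ), hg.comp ENNReal.logHomeomorph.continuous, by simpa using hgA,
    by simpa using hgB, fun κ hκ => ?_⟩
  simp only [ENNReal.log_ofReal_of_pos hκ]
  rw [hgf, Real.exp_log hκ]

theorem eq_of_eq_on_pos {Y : Type*} [TopologicalSpace Y] [T2Space Y] {f g : ℝ≥0∞ → Y}
    (hf : Continuous f) (hg : Continuous g)
    (h : ∀ κ : ℝ, 0 < κ → f (ENNReal.ofReal κ) = g (ENNReal.ofReal κ)) (κ : ℝ≥0∞) : f κ = g κ := by
  have key := eq_of_eq_on_real (hf.comp ENNReal.logHomeomorph.symm.continuous)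
    (hg.comp ENNReal.logHomeomorph.symm.continuous) (fun x => ?_) (ENNReal.log κ)
  · simpa using key
  · have h2 : ENNReal.logHomeomorph.symm (x : EReal) = ENNReal.ofReal (Real.exp x) := by
      simp [EReal.exp_coe]
    simp only [Function.comp_apply, h2]
    exact h _ (Real.exp_pos x)

/-- Modulo `2π` the argument of `F̄/F` is `-2 arg F = 2 arg σ - 2 arg (σF)`; the rotation `σ` is
chosen so that `arg (σF)` is continuous. -/
theorem star_div_eq_exp {F σ : ℂ} (hF : F ≠ 0) (hσ : ‖σ‖ = 1) :
    star F / F = Complex.exp (Complex.I * ((2 * σ.arg - 2 * (σ * F).arg : ℝ) : ℂ)) := by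
  have key : ∀ z : ℂ, z = ‖z‖ * Complex.exp (z.arg * Complex.I) := fun z =>
    (Complex.norm_mul_exp_arg_mul_I z).symm
  have hF' : star (σ * F) * σ = star F := by
    have hs : σ * star σ = 1 := by
      rw [Complex.star_def, Complex.mul_conj, Complex.normSq_eq_norm_sq, hσ]
      simp
    rw [star_mul']
    linear_combination (star F) * hs
  have hσ0 : σ ≠ 0 := by
    rintro rfl
    simp at hσ
  have e1 : star (σ * F) = σ * F * Complex.exp (-(2 * (σ * F).arg * Complex.I)) := by
    conv_lhs => rw [key (σ * F)]
    conv_rhs => rw [key (σ * F)]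
    rw [star_mul', mul_assoc, ← Complex.exp_add]
    simp only [Complex.star_def, Complex.conj_ofReal, ← Complex.exp_conj, map_mul, Complex.conj_I]
    rw [← key]
    ring_nf
  have e2 : σ * σ = Complex.exp (2 * σ.arg * Complex.I) := by
    conv_lhs => rw [key σ, hσ]
    rw [Complex.ofReal_one, one_mul, ← Complex.exp_add]
    ring_nf
  rw [div_eq_iff hF, ← hF', e1, mul_comm (Complex.I)]
  push_cast
  rw [sub_mul, sub_eq_add_neg, Complex.exp_add, ← e2]
  ring

namespace PairCoordinates

variable {C D : Matrix (Fin 2) (Fin 2) ℂ} {u : ℂ} {c a b d : ℝ} {e : ℂ} {α : ℝ} {σ : ℂ}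

/-- The upper side of the loop. -/
theorem exists_topSide (h : PairCoordinates C D u c a b d e) (h0 : 0 < α) (h1 : α < 1)
    (hσ : ‖σ‖ = 1) (hs : ∀ κ, 0 < κ → σ * secularAt α c a b d κ ∈ Complex.slitPlane)
    {S₀ S₁ : Matrix (Fin 2) (Fin 2) ℂ} {A₀ A₁ : ℝ} (hS₀ : Tendsto (sTilde α C D) (𝓝[>] 0) (𝓝 S₀))
    (hS₁ : Tendsto (sTilde α C D) atTop (𝓝 S₁))
    (hA₀ : Tendsto (fun κ => (σ * secularAt α c a b d κ).arg) (𝓝[>] 0) (𝓝 A₀))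
    (hA₁ : Tendsto (fun κ => (σ * secularAt α c a b d κ).arg) atTop (𝓝 A₁)) :
    ∃ (G : ℝ≥0∞ → Matrix (Fin 2) (Fin 2) ℂ) (θ : ℝ≥0∞ → ℝ), Continuous G ∧ Continuous θ ∧
      (∀ κ, G κ ∈ Matrix.unitaryGroup (Fin 2) ℂ) ∧
      (∀ κ : ℝ, 0 < κ → G (ENNReal.ofReal κ) = scatteringMatrix α C D κ) ∧
      G 0 = Matrix.diagonal ![star (rotor α), rotor α] + S₀ ∧
      G ⊤ = Matrix.diagonal ![star (rotor α), rotor α] + S₁ ∧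
      (∀ κ, (G κ).det = Complex.exp (Complex.I * θ κ)) ∧ θ ⊤ - θ 0 = 2 * A₀ - 2 * A₁ := by
  have hx := isScale_weylScale h0 h1
  have hy := isScale_weylScale (sub_pos.2 h1) (sub_lt_self 1 h0)
  have hF : ∀ κ, 0 < κ → secularAt α c a b d κ ≠ 0 := by
    intro κ hκ h0
    have := hs κ hκ
    simp [h0] at this
  have hxc : ContinuousOn (fun κ => (weylScale α κ : ℂ)) (Ioi 0) :=
    Complex.continuous_ofReal.comp_continuousOn hx.continuousOn
  have hyc : ContinuousOn (fun κ => (weylScale (1 - α) κ : ℂ)) (Ioi 0) :=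
    Complex.continuous_ofReal.comp_continuousOn hy.continuousOn
  have hFc : ContinuousOn (secularAt α c a b d) (Ioi 0) := by
    unfold secularAt secular
    fun_prop
  have hnc : ContinuousOn
      (fun κ => secularNum α c a b d (weylScale α κ) (weylScale (1 - α) κ)) (Ioi 0) := by
    unfold secularNum
    fun_prop
  have hSc : ContinuousOn (scatteringMatrix α C D) (Ioi 0) := by
    refine ContinuousOn.congr ?_ fun κ hκ => h.scatteringMatrix_eq h0 h1 hκ (hF κ hκ)
    refine ContinuousOn.smul (hFc.inv₀ hF) ?_
    refine continuousOn_pi.2 fun i => continuousOn_pi.2 fun j => ?_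
    fin_cases i <;> fin_cases j <;> simp [-Complex.ofReal_sin]
    · exact hnc
    · fun_prop
    · fun_prop
    · exact Complex.continuous_conj.comp_continuousOn hnc
  have hS : scatteringMatrix α C D = fun κ =>
      Matrix.diagonal ![star (rotor α), rotor α] + sTilde α C D κ := by
    funext κ
    rw [scatteringMatrix, star_rotor, rotor]
  have hθc : ContinuousOn (fun κ => 2 * σ.arg - 2 * (σ * secularAt α c a b d κ).arg) (Ioi 0) := by
    refine continuousOn_const.sub (continuousOn_const.mul fun κ hκ => ?_)
    have hm : ContinuousOn (fun κ => σ * secularAt α c a b d κ) (Ioi 0) := continuousOn_const.mul hFc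
    exact ContinuousAt.comp_continuousWithinAt (g := Complex.arg) (Complex.continuousAt_arg (hs κ hκ))
      (hm κ hκ)
  obtain ⟨G, hG, hG0, hGtop, hGS⟩ := exists_continuous_extension_ENNReal hSc
    (A := Matrix.diagonal ![star (rotor α), rotor α] + S₀)
    (B := Matrix.diagonal ![star (rotor α), rotor α] + S₁)
    (by rw [hS]; exact hS₀.const_add _) (by rw [hS]; exact hS₁.const_add _)
  obtain ⟨θ, hθ, hθ0, hθtop, hθarg⟩ := exists_continuous_extension_ENNReal hθc
    ((hA₀.const_mul 2).const_sub _) ((hA₁.const_mul 2).const_sub _)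
  refine ⟨G, θ, hG, hθ, fun κ => ?_, hGS, hG0, hGtop, fun κ => ?_, by rw [hθ0, hθtop]; ring⟩
  · rw [Matrix.mem_unitaryGroup_iff]
    refine eq_of_eq_on_pos (f := fun κ => G κ * star (G κ)) (hG.mul hG.star)
      continuous_const (fun κ hκ => ?_) κ
    rw [hGS κ hκ, ← Matrix.mem_unitaryGroup_iff]
    exact (h.scatteringMatrix_mul h0 h1 hκ (hF κ hκ)).1
  · refine eq_of_eq_on_pos (f := fun κ => (G κ).det)
      (g := fun κ => Complex.exp (Complex.I * (θ κ : ℂ))) hG.matrix_det (by fun_prop)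
      (fun κ hκ => ?_) κ
    rw [hGS κ hκ, hθarg κ hκ, (h.scatteringMatrix_mul h0 h1 hκ (hF κ hκ)).2]
    exact star_div_eq_exp (hF κ hκ) hσ

end PairCoordinates

/-- Continuous functions on the four sides that agree at the corners. -/
theorem exists_continuousMap_squareBoundary {L R : EReal → Matrix (Fin 2) (Fin 2) ℂ}
    {T : ℝ≥0∞ → Matrix (Fin 2) (Fin 2) ℂ} (hL : Continuous L) (hR : Continuous R) (hT : Continuous T)
    (uL : ∀ x, L x ∈ Matrix.unitaryGroup (Fin 2) ℂ) (uR : ∀ x, R x ∈ Matrix.unitaryGroup (Fin 2) ℂ)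
    (uT : ∀ κ, T κ ∈ Matrix.unitaryGroup (Fin 2) ℂ) (hLbot : L ⊥ = 1) (hRbot : R ⊥ = 1)
    (hLtop : L ⊤ = T 0) (hRtop : R ⊤ = T ⊤) :
    ∃ G : C(squareBoundary, Matrix.unitaryGroup (Fin 2) ℂ),
      (∀ x, (G (leftSide x) : Matrix (Fin 2) (Fin 2) ℂ) = L x) ∧
      (∀ κ, (G (topSide κ) : Matrix (Fin 2) (Fin 2) ℂ) = T κ) ∧
      (∀ x, (G (rightSide x) : Matrix (Fin 2) (Fin 2) ℂ) = R x) ∧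
      (∀ κ, (G (bottomSide κ) : Matrix (Fin 2) (Fin 2) ℂ) = 1) := by
  classical
  -- Agreement at the corners makes each closed side obey its own formula regardless of the order of
  -- the cases; continuity is then glued over four closed sets.
  set g : ℝ≥0∞ × EReal → Matrix (Fin 2) (Fin 2) ℂ := fun p =>
    if p.1 = 0 then L p.2 else if p.1 = ⊤ then R p.2 else if p.2 = ⊤ then T p.1 else 1 with hg
  have e1 : ∀ p : ℝ≥0∞ × EReal, p.1 = 0 → g p = L p.2 := fun p hp => by simp [hg, hp]
  have e2 : ∀ p : ℝ≥0∞ × EReal, p.1 = ⊤ → g p = R p.2 := fun p hp => by simp [hg, hp]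
  have e3 : ∀ p : ℝ≥0∞ × EReal, p.2 = ⊤ → g p = T p.1 := fun p hp => by
    by_cases h0 : p.1 = 0
    · rw [e1 p h0, hp, h0, hLtop]
    by_cases h1 : p.1 = ⊤
    · rw [e2 p h1, hp, h1, hRtop]
    simp [hg, h0, h1, hp]
  have e4 : ∀ p : ℝ≥0∞ × EReal, p.2 = ⊥ → g p = 1 := fun p hp => by
    by_cases h0 : p.1 = 0
    · rw [e1 p h0, hp, hLbot]
    by_cases h1 : p.1 = ⊤
    · rw [e2 p h1, hp, hRbot]
    simp [hg, h0, h1, hp]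
  have c1 : IsClosed {p : ℝ≥0∞ × EReal | p.1 = 0} := isClosed_eq continuous_fst continuous_const
  have c2 : IsClosed {p : ℝ≥0∞ × EReal | p.1 = ⊤} := isClosed_eq continuous_fst continuous_const
  have c3 : IsClosed {p : ℝ≥0∞ × EReal | p.2 = ⊥} := isClosed_eq continuous_snd continuous_const
  have c4 : IsClosed {p : ℝ≥0∞ × EReal | p.2 = ⊤} := isClosed_eq continuous_snd continuous_const
  have g1 : ContinuousOn g {p : ℝ≥0∞ × EReal | p.1 = 0} :=
    (hL.comp continuous_snd).continuousOn.congr fun p hp => e1 p hp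
  have g2 : ContinuousOn g {p : ℝ≥0∞ × EReal | p.1 = ⊤} :=
    (hR.comp continuous_snd).continuousOn.congr fun p hp => e2 p hp
  have g3 : ContinuousOn g {p : ℝ≥0∞ × EReal | p.2 = ⊥} :=
    continuousOn_const.congr fun p hp => e4 p hp
  have g4 : ContinuousOn g {p : ℝ≥0∞ × EReal | p.2 = ⊤} :=
    (hT.comp continuous_fst).continuousOn.congr fun p hp => e3 p hp
  have hgc : ContinuousOn g squareBoundary :=
    g1.union_of_isClosed (g2.union_of_isClosed (g3.union_of_isClosed g4 c3 c4) c2 (c3.union c4)) c1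
      (c2.union (c3.union c4))
  have hgu : ∀ p ∈ squareBoundary, g p ∈ Matrix.unitaryGroup (Fin 2) ℂ := by
    rintro p (hp | hp | hp | hp)
    · rw [e1 p hp]; exact uL _
    · rw [e2 p hp]; exact uR _
    · rw [e4 p hp]; exact one_mem _
    · rw [e3 p hp]; exact uT _
  refine ⟨⟨fun p => ⟨g p, hgu p p.2⟩, Continuous.subtype_mk hgc.domRestrict _⟩, fun x => e1 _ rfl,
    fun κ => e3 _ rfl, fun x => e2 (⊤, x) rfl, fun κ => e4 _ rfl⟩

/-- The loop of an admissible pair exists and its winding number is minus the number of negative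
eigenvalues of `C D*`. -/
theorem exists_isLevinsonLoop {α : ℝ} (h0 : 0 < α) (h1 : α < 1) {C D : Matrix (Fin 2) (Fin 2) ℂ}
    (hCD : Admissible C D) :
    ∃ G : C(squareBoundary, Matrix.unitaryGroup (Fin 2) ℂ), IsLevinsonLoop α C D G ∧
      HasWindingNumber (fun p => (G p : Matrix (Fin 2) (Fin 2) ℂ).det)
        (-(negEigenvalueCount hCD.isHermitian : ℤ)) := by
  obtain ⟨u, c, a, b, d, e, h, hn⟩ := hCD.exists_isNormalized
  obtain ⟨σ, g₀, g₁, hσ, hs, ⟨P₀, δ₀, A₀, hP₀, hS₀, hA₀, hg₀⟩, ⟨P₁, δ₁, A₁, hP₁, hS₁, hA₁, hg₁⟩, hg⟩ :=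
    h.exists_hasEnd hn h0 h1 hCD.isHermitian
  obtain ⟨Θ, hΘ, hΘφ⟩ := exists_phiMinus_lift h0 h1
  obtain ⟨L, θL, hL, hθL, uL, hLw, hLbot, hLtop, hLdet, hLθ⟩ := hP₀.exists_side h0 h1 hΘ hΘφ
  obtain ⟨R, θR, hR, hθR, uR, hRw, hRbot, hRtop, hRdet, hRθ⟩ := hP₁.exists_side h0 h1 hΘ hΘφ
  obtain ⟨T, θT, hT, hθT, uT, hTS, hT0, hTtop, hTdet, hTθ⟩ :=
    h.exists_topSide h0 h1 hσ hs hS₀ hS₁ hA₀ hA₁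
  obtain ⟨G, G1, G2, G3, G4⟩ := exists_continuousMap_squareBoundary hL hR hT uL uR uT hLbot hRbot
    (hLtop.trans hT0.symm) (hRtop.trans hTtop.symm)
  refine ⟨G, ⟨⟨_, hS₀, fun x => by rw [G1, hLw]⟩, fun κ hκ => by rw [G2, hTS κ hκ],
    ⟨_, hS₁, fun x => by rw [G3, hRw]⟩, fun κ _ => G4 _⟩, θL, θT, θR, fun _ => 0, hθL, hθT, hθR,
    continuous_const, fun x => ?_, fun κ => ?_, fun x => ?_, fun κ => ?_, ?_⟩
  · simp only [G1]
    exact hLdet x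
  · simp only [G2]
    exact hTdet κ
  · simp only [G3]
    exact hRdet x
  · simp [G4]
  -- The increments of `Θ` cancel, and what remains is `δ₀ + 2A₀ - 2A₁ - δ₁ = g₀ - g₁`.
  · push_cast
    linarith

end AharonovBohm

end

open AharonovBohm in
/-- Levinson's theorem for the Aharonov-Bohm operators: the function `Γ(C, D, α, ·)` is well defined
on the boundary of the square, the winding number of its determinant is minus the number of
eigenvalues of `H_α^{CD}`, and this number is that of the negative eigenvalues of `C D*`. -/
theorem theorem3p1 (α : ℝ) (hα : α ∈ Set.Ioo (0 : ℝ) 1) (C D : Matrix (Fin 2) (Fin 2) ℂ)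
    (hCD : Admissible C D) :
    ∃ G : C(squareBoundary, Matrix.unitaryGroup (Fin 2) ℂ), IsLevinsonLoop α C D G ∧
      HasWindingNumber (fun p => (G p : Matrix (Fin 2) (Fin 2) ℂ).det)
        (-(negEigenvalueCount hCD.isHermitian : ℤ)) ∧
      eigenvalueCount (hamiltonian α C D) = (negEigenvalueCount hCD.isHermitian : ℕ∞) := by
  obtain ⟨G, hG, hw⟩ := exists_isLevinsonLoop hα.1 hα.2 hCD
  exact ⟨G, hG, hw, eigenvalueCount_hamiltonian hα.1 hα.2 hCD⟩
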